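/- Let $n,m\ge 0$ be integers, and let $\mathcal A^1,\dots,\mathcal A^n:\mathbb R^m\to\mathbb R^{m\times m}$ be smooth matrix valued functions. **Littlewood–Paley notation.** Fix a smooth radial $\chi:\mathbb R^n\to[0,1]$ with $\chi(\xi)=1$ for $|\xi|\le \frac12$ and $\chi(\xi)=0$ for $|\xi|\ge 1$. For $k\in\mathbb Z$ let $f_{<k}=P_{<k}f$ be the Fourier multiplier with symbol $\chi(2^{-k}\xi)$ applied to $f$, and let $f_k=P_kf=f_{<k+1}-f_{<k}$. Define the low-high paraproduct and the high-high interactions of two functions by $$T_f g=\sum_{k\in\mathbb Z} f_{<k-8}\,g_k,\qquad \Pi(f,g)=\sum_{k\in\mathbb Z}\ \sum_{|i-k|\le 8} f_i\,g_k ,$$ and extend both bilinearly to vector and matrix valued functions. For $\sigma\ge0$ let $\|\cdot\|_{H^\sigma}$ be the usual inhomogeneous Sobolev norm on $\mathbb R^n$. For $u\in L^2(\mathbb R^n;\mathbb R^m)\cap W^{1,\infty}(\mathbb R^n;\mathbb R^m)$ set (with summation over $j=1,\dots,n$) $$F(u)=\Pi(\mathcal A^j(u),\partial_j u)+T_{\partial_j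 u}\mathcal A^j(u)-T_{D\mathcal A^j(u)\partial_j u}\,u ,$$ where $D\mathcal A^j(u)\partial_j u$ denotes the matrix valued function of the linear map $h\mapsto (D\mathcal A^j(u)h)\,\partial_j u$, and $T_{\partial_j u}\mathcal A^j(u)$ is the paraproduct with low frequency factor $\partial_ju$ for the matrix-vector product $\mathcal A^j(u)\,\partial_j u$. Then all the series in this formula converge absolutely, uniformly on $\mathbb R^n$, and the following bounds hold. i) *Sobolev bounds.* For every $\sigma\ge 0$ and $M\ge0$ there is a constant $C$, depending only on $n,m,\chi,\mathcal A^1,\dots,\mathcal A^n,\sigma,M$, such that for all $u\in L^2\cap W^{1,\infty}$ with $\|u\|_{L^\infty}\le M$ $$\|F(u)\|_{H^\sigma}\le C\,\|\nabla u\|_{L^\infty}\,\|u\|_{H^\sigma}.$$ ii) *Difference bounds.* For every $\sigma\ge0$ and $M\ge 0$ there is a constant $C$, with the same dependence, such that for all $u,v\in L^2\cap W^{1,\infty}$ with $A:=\|u\|_{L^\infty}+\|v\|_{L^\infty}\le M$, and with $B:=\|\nabla u\|_{L^\infty}+\|\nabla v\|_{L^\infty}$, $$\|F(u)-F(v)\|_{H^\sigma}\le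 C\,B\left[\|u-v\|_{H^\sigma}+\|u-v\|_{L^\infty}\left(\|u\|_{H^\sigma}+\|v\|_{H^\sigma}\right)\right].$$ Moreover, for every $M\ge0$ there is a constant $C$, depending only on $n,m,\chi,\mathcal A^1,\dots,\mathcal A^n,M$, such that for all such $u,v$ $$\|F(u)-F(v)\|_{L^2}\le C\,B\,\|u-v\|_{L^2}.$$ (A Sobolev norm equals $+\infty$ for functions outside $H^\sigma$; when the right hand side is finite, the function on the left belongs to $H^\sigma$, respectively $L^2$.) -/

import Mathlib

open MeasureTheory FourierTransform
open scoped ENNReal NNReal ContDiff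

noncomputable section

namespace Paradiff

/-- A radial smooth cutoff on `ℝⁿ`: equal to `1` for `|ξ| ≤ 1/2`, to `0` for `|ξ| ≥ 1`, with values
in `[0, 1]`. It generates a Littlewood-Paley decomposition. -/
structure IsLPCutoff {n : ℕ} (χ : EuclideanSpace ℝ (Fin n) → ℝ) : Prop where
  smooth : ContDiff ℝ ∞ χ
  radial : ∀ ξ η, ‖ξ‖ = ‖η‖ → χ ξ = χ η
  nonneg : ∀ ξ, 0 ≤ χ ξ
  le_one : ∀ ξ, χ ξ ≤ 1
  eq_one : ∀ ξ, ‖ξ‖ ≤ 1 / 2 → χ ξ = 1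
  eq_zero : ∀ ξ, 1 ≤ ‖ξ‖ → χ ξ = 0

/-- The convolution kernel of the Fourier multiplier with symbol `χ (2⁻ᵏ ξ)`: the inverse Fourier
transform of the symbol (it is real since `χ` is radial). -/
def lowKernel {n : ℕ} (χ : EuclideanSpace ℝ (Fin n) → ℝ) (k : ℤ)
    (x : EuclideanSpace ℝ (Fin n)) : ℝ :=
  (𝓕⁻ (fun ξ : EuclideanSpace ℝ (Fin n) => ((χ ((2 : ℝ) ^ (-k) • ξ) : ℝ) : ℂ)) x).re

/-- The Littlewood-Paley projection `P_{<k} f = f_{<k}` onto the frequencies `|ξ| < 2ᵏ`. -/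
def lowFreq {n : ℕ} (χ : EuclideanSpace ℝ (Fin n) → ℝ) (k : ℤ)
    (f : EuclideanSpace ℝ (Fin n) → ℝ) (x : EuclideanSpace ℝ (Fin n)) : ℝ :=
  ∫ y, lowKernel χ k (x - y) * f y

/-- The Littlewood-Paley projection `P_k f = f_k = f_{<k+1} - f_{<k}` onto the frequencies
`|ξ| ≈ 2ᵏ`, for `k ∈ ℤ`. -/
def dyadic {n : ℕ} (χ : EuclideanSpace ℝ (Fin n) → ℝ) (k : ℤ)
    (f : EuclideanSpace ℝ (Fin n) → ℝ) (x : EuclideanSpace ℝ (Fin n)) : ℝ :=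
  lowFreq χ (k + 1) f x - lowFreq χ k f x

/-- The `k`-th term `f_{<k-8} g_k` of the low-high paraproduct. -/
def paraTerm {n : ℕ} (χ : EuclideanSpace ℝ (Fin n) → ℝ)
    (f g : EuclideanSpace ℝ (Fin n) → ℝ) (k : ℤ) (x : EuclideanSpace ℝ (Fin n)) : ℝ :=
  lowFreq χ (k - 8) f x * dyadic χ k g x

/-- The `k`-th term `∑_{|i-k| ≤ 8} f_i g_k` of the high-high interactions. -/
def highTerm {n : ℕ} (χ : EuclideanSpace ℝ (Fin n) → ℝ)
    (f g : EuclideanSpace ℝ (Fin n) → ℝ) (k : ℤ) (x : EuclideanSpace ℝ (Fin n)) : ℝ :=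
  ∑ i ∈ Finset.Icc (k - 8) (k + 8), dyadic χ i f x * dyadic χ k g x

/-- Bony's paraproduct `T_f g = ∑_k f_{<k-8} g_k`. -/
def para {n : ℕ} (χ : EuclideanSpace ℝ (Fin n) → ℝ)
    (f g : EuclideanSpace ℝ (Fin n) → ℝ) (x : EuclideanSpace ℝ (Fin n)) : ℝ :=
  ∑' k : ℤ, paraTerm χ f g k x

/-- The high-high part `Π(f, g) = ∑_{|i-k| ≤ 8} f_i g_k` of the product `f g`. -/
def highHigh {n : ℕ} (χ : EuclideanSpace ℝ (Fin n) → ℝ)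
    (f g : EuclideanSpace ℝ (Fin n) → ℝ) (x : EuclideanSpace ℝ (Fin n)) : ℝ :=
  ∑' k : ℤ, highTerm χ f g k x

/-- Uniform absolute convergence of a series of functions indexed by `ℤ`. -/
def ConvergesUniformly {n : ℕ} (t : ℤ → EuclideanSpace ℝ (Fin n) → ℝ) : Prop :=
  ∃ b : ℤ → ℝ, Summable b ∧ ∀ k x, |t k x| ≤ b k

/-- The component `∂_j u_β` of the gradient of `u : ℝⁿ → ℝᵐ`. -/
def pd {n m : ℕ} (u : EuclideanSpace ℝ (Fin n) → EuclideanSpace ℝ (Fin m)) (j : Fin n) (β : Fin m)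
    (x : EuclideanSpace ℝ (Fin n)) : ℝ :=
  (fderiv ℝ u x (EuclideanSpace.single j 1)) β

/-- The entry `(A^j(u))_{αβ}`, as a function on `ℝⁿ`. -/
def coeff {n m : ℕ} (A : Fin n → EuclideanSpace ℝ (Fin m) → Matrix (Fin m) (Fin m) ℝ)
    (u : EuclideanSpace ℝ (Fin n) → EuclideanSpace ℝ (Fin m)) (j : Fin n) (α β : Fin m)
    (x : EuclideanSpace ℝ (Fin n)) : ℝ :=
  A j (u x) α β

/-- The `(α, γ)` entry of the matrix `DA^j(u) ∂_j u`, that is, of the linear map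
`h ↦ (DA^j(u) h) ∂_j u` on `ℝᵐ` (no summation over `j`). -/
def dCoeff {n m : ℕ} (A : Fin n → EuclideanSpace ℝ (Fin m) → Matrix (Fin m) (Fin m) ℝ)
    (u : EuclideanSpace ℝ (Fin n) → EuclideanSpace ℝ (Fin m)) (j : Fin n) (α γ : Fin m)
    (x : EuclideanSpace ℝ (Fin n)) : ℝ :=
  ∑ β, fderiv ℝ (fun z => A j z α β) (u x) (EuclideanSpace.single γ 1) * pd u j β x

/-- The paradifferential remainder
`F(u) = Π(A^j(u), ∂_j u) + T_{∂_j u} A^j(u) - T_{DA^j(u) ∂_j u} u` (summation over `j`). -/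
def remainder {n m : ℕ} (χ : EuclideanSpace ℝ (Fin n) → ℝ)
    (A : Fin n → EuclideanSpace ℝ (Fin m) → Matrix (Fin m) (Fin m) ℝ)
    (u : EuclideanSpace ℝ (Fin n) → EuclideanSpace ℝ (Fin m))
    (x : EuclideanSpace ℝ (Fin n)) : EuclideanSpace ℝ (Fin m) :=
  WithLp.toLp 2 fun α => ∑ j,
    ((∑ β, highHigh χ (coeff A u j α β) (pd u j β) x)
      + (∑ β, para χ (pd u j β) (coeff A u j α β) x)
      - ∑ γ, para χ (dCoeff A u j α γ) (fun y => u y γ) x)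

/-- All the series that enter `F(u)` converge absolutely, uniformly on `ℝⁿ`. -/
def RemainderConverges {n m : ℕ} (χ : EuclideanSpace ℝ (Fin n) → ℝ)
    (A : Fin n → EuclideanSpace ℝ (Fin m) → Matrix (Fin m) (Fin m) ℝ)
    (u : EuclideanSpace ℝ (Fin n) → EuclideanSpace ℝ (Fin m)) : Prop :=
  ∀ (j : Fin n) (α β : Fin m),
    ConvergesUniformly (highTerm χ (coeff A u j α β) (pd u j β)) ∧
    ConvergesUniformly (paraTerm χ (pd u j β) (coeff A u j α β)) ∧
    ConvergesUniformly (paraTerm χ (dCoeff A u j α β) (fun y => u y β))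

/-- The functions in `L² ∩ W^{1,∞}`, through their Lipschitz representatives. -/
def IsLipschitzL2 {n m : ℕ} (u : EuclideanSpace ℝ (Fin n) → EuclideanSpace ℝ (Fin m)) : Prop :=
  (∃ K : ℝ≥0, LipschitzWith K u) ∧ (∃ R : ℝ, ∀ x, ‖u x‖ ≤ R) ∧ MemLp u 2 volume

/-- The control parameter `A = ‖u‖_{L^∞}`. -/
def ctrlA {n m : ℕ} (u : EuclideanSpace ℝ (Fin n) → EuclideanSpace ℝ (Fin m)) : ℝ≥0∞ :=
  eLpNorm u ∞ volume

/-- The control parameter `B = ‖∇u‖_{L^∞}`. -/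
def ctrlB {n m : ℕ} (u : EuclideanSpace ℝ (Fin n) → EuclideanSpace ℝ (Fin m)) : ℝ≥0∞ :=
  eLpNorm (fderiv ℝ u) ∞ volume

/-- A function with values in `ℝᵐ`, seen as a function with values in `ℂᵐ`. -/
def complexify {n m : ℕ} (h : EuclideanSpace ℝ (Fin n) → EuclideanSpace ℝ (Fin m))
    (x : EuclideanSpace ℝ (Fin n)) : EuclideanSpace ℂ (Fin m) :=
  WithLp.toLp 2 fun α => ((h x α : ℝ) : ℂ)

open Classical in
/-- The norm of `h` in the Sobolev space `H^σ(ℝⁿ; ℝᵐ)`, `σ ≥ 0`, namely the `L²` norm of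
`(1 + |ξ|²)^{σ/2} ĥ(ξ)` for `h ∈ L²`; it is `∞` when `h` is not in `H^σ`. -/
def sobolevNorm {n m : ℕ} (σ : ℝ)
    (h : EuclideanSpace ℝ (Fin n) → EuclideanSpace ℝ (Fin m)) : ℝ≥0∞ :=
  if hh : MemLp (complexify h) 2 volume then
    eLpNorm (fun ξ => ((1 + ‖ξ‖ ^ 2) ^ (σ / 2) : ℝ) •
      (𝓕 (hh.toLp (complexify h)) : Lp (EuclideanSpace ℂ (Fin m)) 2 volume) ξ) 2 volume
  else ∞

end Paradiff

end

/-! `F` is a finite sum of scalar remainders Π(a(u), ∂_j u_β) + T_{∂_j u_β} a(u) − Σ_γ T_{∂_γ a(u)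
∂_j u_β} u_γ, where `a` runs through the entries of the matrices (`rterm`,
`IsLipschitzL2.cx_remainder`). It vanishes at u = 0, so the Sobolev bound is the difference bound
with v = 0, and only differences have to be estimated. Put w = u − v.

In L² the three parts are estimated separately, without any cancellation. The danger is a derivative
on w. In Π(a(u), ∂_j w) and T_{∂_j w} a(u) the factor 2^k it produces is traded against the gradient
of the Lipschitz factor, and in T_{p ∂_j w} u_γ one first writes p ∂_j w = ∂_j(p w) − (∂_j p) w.
What remains are bounded bilinear operators L^∞ × L² → L². If the low frequency factor is bounded,
almost orthogonality is enough. If the bounded factor carries the high frequencies, Carleson's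
estimate Σ_k ‖(P_k b)(S_k h)‖² ≤ C ‖b‖_∞² ‖h‖² is needed (`carleson`). It is proved for Gaussian
averages: by the variance inequality `weighted_variance_le`, the quantity 2‖b_k h_k‖² + 16β²‖h_k‖²
decreases towards coarser scales by at least the k-th term of the sum, so the sum telescopes. The
result is then transferred to general symbols.

In H^σ, σ > 0, the terms of index k have frequencies below a constant multiple of 2^k, so the square
sum of the terms controls the sum of the series (`exists_lps_su_le`). Most pieces are direct, given
Moser's estimates `moser` and `moser_sub`, which come from the telescoping series a(u) − a(0) = Σ_l
c(u_{<l+1}, u_{<l}) P_l u with Hadamard's coefficients `c`. The piece T_{∂_j w} a(u) − Σ_γ T_{∂_γ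
a(u) ∂_j w} u_γ needs a cancellation: with w only in L^∞, the low frequencies of ∂_j w cost 2^k. The
theorem `paralinearization` says that P_k a(u) − Σ_γ (∂_γ a(u))_{<k−8} P_k u_γ gains a factor
2^{-k}‖∇u‖_∞, and a commutator estimate handles the low frequencies of the product ∂_γ a(u) ∂_j w
(`exists_tsq_tT_cancel`).

Sup bounds on gradients enter as Lipschitz constants, and the vector valued Sobolev norms reduce to
components. -/

noncomputable section

namespace Paradiff

/-! ### Bounded Borel functions. -/

/-- Euclidean space of dimension `n`. -/
abbrev Eu (n : ℕ) := EuclideanSpace ℝ (Fin n)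

/-- Bounded Borel functions. -/
structure BM {n : ℕ} (f : Eu n → ℂ) : Prop where
  meas : Measurable f
  bdd : ∃ C : ℝ, ∀ x, ‖f x‖ ≤ C

/-- Convolution of a kernel with a function. -/
def cv {n : ℕ} (K f : Eu n → ℂ) (x : Eu n) : ℂ := ∫ y, K (x - y) * f y

section BMlemmas
variable {n : ℕ} {f g : Eu n → ℂ}

lemma BM.add (hf : BM f) (hg : BM g) : BM (f + g) := by
  obtain ⟨C, hC⟩ := hf.bdd
  obtain ⟨D, hD⟩ := hg.bdd
  exact ⟨hf.meas.add hg.meas, C + D, fun x => (norm_add_le _ _).trans (add_le_add (hC x) (hD x))⟩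

lemma BM.mul (hf : BM f) (hg : BM g) : BM (f * g) := by
  obtain ⟨C, hC⟩ := hf.bdd
  obtain ⟨D, hD⟩ := hg.bdd
  refine ⟨hf.meas.mul hg.meas, C * D, fun x => ?_⟩
  simp only [Pi.mul_apply, norm_mul]
  exact mul_le_mul (hC x) (hD x) (norm_nonneg _) ((norm_nonneg _).trans (hC x))

lemma BM.smul (c : ℂ) (hf : BM f) : BM (c • f) := by
  obtain ⟨C, hC⟩ := hf.bdd
  refine ⟨hf.meas.const_smul c, ‖c‖ * C, fun x => ?_⟩
  simp only [Pi.smul_apply, smul_eq_mul, norm_mul]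
  exact mul_le_mul_of_nonneg_left (hC x) (norm_nonneg _)

lemma BM.sub (hf : BM f) (hg : BM g) : BM (f - g) := by
  have := hf.add (hg.smul (-1))
  simpa [sub_eq_add_neg] using this

lemma BM.zero : BM (0 : Eu n → ℂ) := ⟨measurable_const, 0, by simp⟩

lemma BM.sum {ι : Type*} (s : Finset ι) {F : ι → Eu n → ℂ} (h : ∀ i ∈ s, BM (F i)) :
    BM (∑ i ∈ s, F i) := by
  classical
  induction s using Finset.induction_on with
  | empty => simpa using BM.zero
  | insert a s ha ih =>
    rw [Finset.sum_insert ha]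
    exact (h a (by simp)).add (ih fun i hi => h i (by simp [hi]))

end BMlemmas

/-! ### Weighted Cauchy–Schwarz and Young's inequality. -/

section Young
variable {n : ℕ}

lemma sq_lintegral_mul_le {X : Type*} [MeasurableSpace X] {μ : Measure X} {κ F : X → ℝ≥0∞}
    (hκ : Measurable κ) (hF : Measurable F) :
    (∫⁻ y, κ y * F y ∂μ) ^ 2 ≤ (∫⁻ y, κ y ∂μ) * ∫⁻ y, κ y * F y ^ 2 ∂μ := by
  have h := ENNReal.lintegral_mul_le_Lp_mul_Lq μ Real.HolderConjugate.two_two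
    (f := fun y => κ y ^ (1 / 2 : ℝ)) (g := fun y => κ y ^ (1 / 2 : ℝ) * F y)
    (hκ.pow_const _).aemeasurable ((hκ.pow_const _).mul hF).aemeasurable
  have e (y : X) : (κ y ^ (1 / 2 : ℝ)) ^ (2 : ℝ) = κ y := by
    rw [← ENNReal.rpow_mul]; norm_num
  have e' (y : X) : κ y ^ (1 / 2 : ℝ) * (κ y ^ (1 / 2 : ℝ) * F y) = κ y * F y := by
    rw [← mul_assoc, ← sq, ← ENNReal.rpow_natCast]
    simp only [Nat.cast_ofNat, e]
  simp only [Pi.mul_apply, e', ENNReal.mul_rpow_of_nonneg _ _ (zero_le_two (α := ℝ)), e] at h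
  calc (∫⁻ y, κ y * F y ∂μ) ^ 2
      ≤ ((∫⁻ y, κ y ∂μ) ^ (1 / 2 : ℝ) * (∫⁻ y, κ y * F y ^ (2 : ℝ) ∂μ) ^ (1 / 2 : ℝ)) ^ 2 := by
        gcongr
    _ = (∫⁻ y, κ y ∂μ) * ∫⁻ y, κ y * F y ^ 2 ∂μ := by
        rw [mul_pow, ← ENNReal.rpow_natCast, ← ENNReal.rpow_natCast, ← ENNReal.rpow_mul,
          ← ENNReal.rpow_mul]
        norm_num

/-- Weighted Cauchy–Schwarz in `y`, then Tonelli. The integrand is `F y x` and not just `F (x - y)`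
because it is also applied to translation differences `g x - g (x - y)`. -/
lemma lintegral_sq_lintegral_mul_le {κ : Eu n → ℝ≥0∞} {F : Eu n → Eu n → ℝ≥0∞}
    (hκ : Measurable κ) (hF : Measurable (Function.uncurry F)) :
    ∫⁻ x, (∫⁻ y, κ y * F y x) ^ 2 ≤ (∫⁻ y, κ y) * ∫⁻ y, κ y * ∫⁻ x, F y x ^ 2 := by
  have hF1 (x : Eu n) : Measurable fun y => F y x := hF.comp (by fun_prop : Measurable fun y => (y, x))
  have hF2 (y : Eu n) : Measurable fun x => F y x := hF.comp (by fun_prop : Measurable fun x => (y, x))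
  calc ∫⁻ x, (∫⁻ y, κ y * F y x) ^ 2
      ≤ ∫⁻ x, (∫⁻ y, κ y) * ∫⁻ y, κ y * F y x ^ 2 :=
        lintegral_mono fun x => sq_lintegral_mul_le hκ (hF1 x)
    _ = (∫⁻ y, κ y) * ∫⁻ x, ∫⁻ y, κ y * F y x ^ 2 := by
        rw [lintegral_const_mul]
        apply Measurable.lintegral_prod_right' (f := fun p : Eu n × Eu n => κ p.2 * F p.2 p.1 ^ 2)
        have := hF.comp measurable_swap
        exact (hκ.comp measurable_snd).mul (this.pow_const 2)
    _ = (∫⁻ y, κ y) * ∫⁻ y, κ y * ∫⁻ x, F y x ^ 2 := by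
        rw [lintegral_lintegral_swap]
        · congr 2
          ext y
          rw [lintegral_const_mul _ ((hF2 y).pow_const 2)]
        · have := hF.comp measurable_swap
          exact ((hκ.comp measurable_snd).mul (this.pow_const 2)).aemeasurable

/-- Young's inequality `L¹ * L² ⊆ L²`. -/
lemma lintegral_sq_conv_le {κ F : Eu n → ℝ≥0∞} (hκ : Measurable κ) (hF : Measurable F) :
    ∫⁻ x, (∫⁻ y, κ y * F (x - y)) ^ 2 ≤ (∫⁻ y, κ y) ^ 2 * ∫⁻ x, F x ^ 2 := by
  refine (lintegral_sq_lintegral_mul_le (F := fun y x => F (x - y)) hκ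
    (hF.comp (by fun_prop : Measurable fun p : Eu n × Eu n => p.2 - p.1))).trans (le_of_eq ?_)
  have (y : Eu n) : ∫⁻ x, F (x - y) ^ 2 = ∫⁻ x, F x ^ 2 :=
    lintegral_sub_right_eq_self (fun x => F x ^ 2) y
  simp only [this]
  rw [lintegral_mul_const _ hκ]
  ring

lemma eLpNorm_two_sq {F : Type*} [ENorm F] (f : Eu n → F) :
    eLpNorm f 2 volume ^ 2 = ∫⁻ x, ‖f x‖ₑ ^ 2 := by
  rw [eLpNorm_eq_lintegral_rpow_enorm_toReal (by simp) (by simp), ← ENNReal.rpow_natCast,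
    ← ENNReal.rpow_mul]
  norm_num

lemma eLpNorm_two_le_of_sq {F : Type*} [NormedAddCommGroup F] {f : Eu n → F} {c : ℝ≥0∞}
    (h : ∫⁻ x, ‖f x‖ₑ ^ 2 ≤ c ^ 2) : eLpNorm f 2 volume ≤ c := by
  rw [← eLpNorm_two_sq] at h
  exact (ENNReal.pow_le_pow_left_iff two_ne_zero).1 h

lemma eLpNorm_le_of_enorm_le_conv {F : Type*} [NormedAddCommGroup F] {κ G : Eu n → ℝ≥0∞}
    (hκ : Measurable κ) (hG : Measurable G) {f : Eu n → F}
    (h : ∀ x, ‖f x‖ₑ ≤ ∫⁻ y, κ y * G (x - y)) :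
    eLpNorm f 2 volume ≤ (∫⁻ y, κ y) * eLpNorm G 2 volume := by
  apply eLpNorm_two_le_of_sq
  rw [mul_pow, eLpNorm_two_sq]
  refine (lintegral_mono fun x => ?_).trans (lintegral_sq_conv_le hκ hG)
  gcongr
  exact h x

end Young

/-! ### Convolution of integrable kernels with bounded functions. -/

section Cv
variable {n : ℕ} {K f g : Eu n → ℂ}

lemma cv_eq (K f : Eu n → ℂ) (x : Eu n) : cv K f x = ∫ y, K y * f (x - y) := by
  rw [cv, ← integral_sub_left_eq_self _ volume x]
  simp

lemma cv_integrable (hK : Integrable K) (hf : BM f) (x : Eu n) :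
    Integrable fun y => K (x - y) * f y := by
  obtain ⟨C, hC⟩ := hf.bdd
  exact (hK.comp_sub_left x).mul_bdd hf.meas.aestronglyMeasurable (Filter.Eventually.of_forall hC)

lemma cv_integrable' (hK : Integrable K) (hf : BM f) (x : Eu n) :
    Integrable fun y => K y * f (x - y) := by
  obtain ⟨C, hC⟩ := hf.bdd
  exact hK.mul_bdd (hf.meas.comp (by fun_prop)).aestronglyMeasurable
    (Filter.Eventually.of_forall fun y => hC _)

lemma norm_cv_le (hK : Integrable K) {C : ℝ} (hC : ∀ x, ‖f x‖ ≤ C) (x : Eu n) :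
    ‖cv K f x‖ ≤ (∫ y, ‖K y‖) * C := by
  rw [cv_eq, ← integral_mul_const]
  refine norm_integral_le_of_norm_le (hK.norm.mul_const C) (Filter.Eventually.of_forall fun y => ?_)
  rw [norm_mul]
  exact mul_le_mul_of_nonneg_left (hC _) (norm_nonneg _)

lemma measurable_cv (hK : Measurable K) (hf : Measurable f) : Measurable (cv K f) := by
  have : StronglyMeasurable (Function.uncurry fun x y : Eu n => K (x - y) * f y) :=
    ((hK.comp (by fun_prop : Measurable fun p : Eu n × Eu n => p.1 - p.2)).mul
      (hf.comp measurable_snd)).stronglyMeasurable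
  exact this.integral_prod_right.measurable

lemma BM.cv (hf : BM f) (hKm : Measurable K) (hK : Integrable K) : BM (cv K f) := by
  obtain ⟨C, hC⟩ := hf.bdd
  exact ⟨measurable_cv hKm hf.meas, _, norm_cv_le hK hC⟩

lemma enorm_cv_le (K f : Eu n → ℂ) (x : Eu n) : ‖cv K f x‖ₑ ≤ ∫⁻ y, ‖K y‖ₑ * ‖f (x - y)‖ₑ := by
  rw [cv_eq]
  refine (enorm_integral_le_lintegral_enorm _).trans (le_of_eq ?_)
  simp only [enorm_mul]

lemma eLpNorm_cv_le (hKm : Measurable K) (hf : Measurable f) :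
    eLpNorm (cv K f) 2 volume ≤ (∫⁻ y, ‖K y‖ₑ) * eLpNorm f 2 volume := by
  have := eLpNorm_le_of_enorm_le_conv (κ := fun y => ‖K y‖ₑ) (G := fun y => ‖f y‖ₑ)
    hKm.enorm hf.enorm (enorm_cv_le K f)
  rwa [eLpNorm_enorm] at this

lemma MemLp.cv (hf : MemLp f 2 volume) (hfm : Measurable f) (hKm : Measurable K)
    (hK : Integrable K) : MemLp (cv K f) 2 volume :=
  ⟨(measurable_cv hKm hfm).aestronglyMeasurable, (eLpNorm_cv_le hKm hfm).trans_lt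
    (ENNReal.mul_lt_top hK.2 hf.2)⟩

lemma cv_add (hK : Integrable K) (hf : BM f) (hg : BM g) : cv K (f + g) = cv K f + cv K g := by
  ext x
  simp only [cv, Pi.add_apply, mul_add]
  exact integral_add (cv_integrable hK hf x) (cv_integrable hK hg x)

lemma cv_smul (c : ℂ) (K f : Eu n → ℂ) : cv K (c • f) = c • cv K f := by
  ext x
  simp only [cv, Pi.smul_apply, smul_eq_mul, ← integral_const_mul]
  congr 1; ext y; ring

lemma cv_sub (hK : Integrable K) (hf : BM f) (hg : BM g) : cv K (f - g) = cv K f - cv K g := by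
  ext x
  simp only [cv, Pi.sub_apply, mul_sub]
  exact integral_sub (cv_integrable hK hf x) (cv_integrable hK hg x)

lemma cv_congr_ae (K : Eu n → ℂ) (h : f =ᵐ[volume] g) : cv K f = cv K g := by
  ext x
  exact integral_congr_ae (h.mono fun y hy => by simp only [hy])

lemma cv_add_kernel {L : Eu n → ℂ} (hK : Integrable K) (hL : Integrable L) (hf : BM f) :
    cv (K + L) f = cv K f + cv L f := by
  ext x
  simp only [cv, Pi.add_apply, add_mul]
  exact integral_add (cv_integrable hK hf x) (cv_integrable hL hf x)

lemma cv_smul_kernel (c : ℂ) (K f : Eu n → ℂ) : cv (c • K) f = c • cv K f := by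
  ext x
  simp only [cv, Pi.smul_apply, smul_eq_mul, ← integral_const_mul, mul_assoc]

/-- Associativity of convolution. -/
lemma cv_cv {L : Eu n → ℂ} (hK : Integrable K) (hL : Integrable L) (hf : BM f) : cv K (cv L f) = cv (cv K L) f := by
  ext x
  have key : Integrable (Function.uncurry fun y z : Eu n => K y * (L z * f (x - y - z)))
      (volume.prod volume) := by
    obtain ⟨C, hC⟩ := hf.bdd
    have h := (hK.mul_prod hL).mul_bdd (g := fun p : Eu n × Eu n => f (x - p.1 - p.2)) (c := C)
      (hf.meas.comp (by fun_prop)).aestronglyMeasurable (Filter.Eventually.of_forall fun p => hC _)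
    refine h.congr (Filter.Eventually.of_forall fun p => ?_)
    simp only [Function.uncurry]; ring
  have h1 : cv K (cv L f) x = ∫ y, ∫ z, K y * (L z * f (x - y - z)) := by
    rw [cv_eq]
    congr 1; ext y
    rw [cv_eq, integral_const_mul]
  -- Replacing `z` by `z - y` makes the factor `f` independent of `y`; after the exchange of
  -- integrals the inner one is the convolution of the two kernels.
  have h2 : (fun y => ∫ z, K y * (L z * f (x - y - z)))
      = fun y => ∫ z, K y * (L (z - y) * f (x - z)) := by
    ext y
    rw [← integral_sub_right_eq_self _ y]
    congr 1; ext z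
    rw [show x - y - (z - y) = x - z by abel]
  have key2 : Integrable (Function.uncurry fun y z : Eu n => K y * (L (z - y) * f (x - z)))
      (volume.prod volume) := by
    obtain ⟨C, hC⟩ := hf.bdd
    have h0 : Integrable (fun p : Eu n × Eu n => L (p.1 - p.2) * K p.2) (volume.prod volume) := by
      have := hK.convolution_integrand (ContinuousLinearMap.mul ℂ ℂ) hL
      refine this.congr (Filter.Eventually.of_forall fun p => ?_)
      simp [mul_comm]
    have h := h0.swap.mul_bdd (g := fun p : Eu n × Eu n => f (x - p.2)) (c := C)
      (hf.meas.comp (by fun_prop)).aestronglyMeasurable (Filter.Eventually.of_forall fun p => hC _)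
    refine h.congr (Filter.Eventually.of_forall fun p => ?_)
    simp only [Function.uncurry, Function.comp, Prod.swap]; ring
  rw [h1, h2, integral_integral_swap key2, cv_eq (cv K L)]
  congr 1; ext z
  rw [cv_eq, ← integral_mul_const]
  congr 1; ext y
  ring

end Cv

/-! ### The Fourier transform on L². -/

open Classical in
/-- The Fourier transform of a square integrable function (zero for other functions). -/
def fhat {n : ℕ} (f : Eu n → ℂ) : Eu n → ℂ :=
  if h : MemLp f 2 volume then (𝓕 (h.toLp f) : Lp ℂ 2 (volume : Measure (Eu n))) else 0

section
open SchwartzMap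
variable {n : ℕ} {f g K : Eu n → ℂ}

lemma fhat_of_memLp (h : MemLp f 2 volume) :
    fhat f = (𝓕 (h.toLp f) : Lp ℂ 2 (volume : Measure (Eu n))) := by
  rw [fhat, dif_pos h]

lemma memLp_fhat (f : Eu n → ℂ) : MemLp (fhat f) 2 volume := by
  unfold fhat
  split_ifs
  · exact Lp.memLp _
  · exact MemLp.zero

lemma eLpNorm_fhat (h : MemLp f 2 volume) : eLpNorm (fhat f) 2 volume = eLpNorm f 2 volume := by
  rw [fhat_of_memLp h, ← Lp.enorm_def, ← eLpNorm_congr_ae h.coeFn_toLp, ← Lp.enorm_def]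
  have := Lp.norm_fourier_eq (h.toLp f)
  rw [← ofReal_norm, ← ofReal_norm, this]

lemma fhat_add (hf : MemLp f 2 volume) (hg : MemLp g 2 volume) :
    fhat (f + g) =ᵐ[volume] fhat f + fhat g := by
  rw [fhat_of_memLp hf, fhat_of_memLp hg, fhat_of_memLp (hf.add hg), MemLp.toLp_add,
    FourierAdd.fourier_add]
  exact Lp.coeFn_add _ _

lemma fhat_smul (c : ℂ) (hf : MemLp f 2 volume) : fhat (c • f) =ᵐ[volume] c • fhat f := by
  rw [fhat_of_memLp hf, fhat_of_memLp (hf.const_smul c), MemLp.toLp_const_smul,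
    FourierSMul.fourier_smul]
  exact Lp.coeFn_smul _ _

lemma fhat_sub (hf : MemLp f 2 volume) (hg : MemLp g 2 volume) :
    fhat (f - g) =ᵐ[volume] fhat f - fhat g := by
  have h := fhat_add hf (hg.const_smul (-1 : ℂ))
  have h2 := fhat_smul (-1) hg
  rw [show f + (-1 : ℂ) • g = f - g by simp [sub_eq_add_neg]] at h
  filter_upwards [h, h2] with x hx hx2
  rw [hx, Pi.add_apply, hx2]
  simp [sub_eq_add_neg]

/-- Parseval's identity. -/
lemma integral_conj_fhat (hf : MemLp f 2 volume) (hg : MemLp g 2 volume) :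
    ∫ x, (starRingEnd ℂ) (fhat f x) * fhat g x = ∫ x, (starRingEnd ℂ) (f x) * g x := by
  have h := Lp.inner_fourier_eq (hf.toLp f) (hg.toLp g)
  rw [L2.inner_def, L2.inner_def] at h
  rw [fhat_of_memLp hf, fhat_of_memLp hg]
  convert h using 1
  · congr 1; ext x; simp [mul_comm]
  · apply integral_congr_ae
    filter_upwards [hf.coeFn_toLp, hg.coeFn_toLp] with x h1 h2
    rw [h1, h2]; simp [mul_comm]

/-- The transform on L² is given by an extension, not by an integral. This multiplication formula,
read off from the compatibility with tempered distributions, is the means of computing it. -/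
lemma integral_mul_fhat (hf : MemLp f 2 volume) (ψ : 𝓢(Eu n, ℂ)) :
    ∫ x, ψ x * fhat f x = ∫ x, 𝓕 (ψ : Eu n → ℂ) x * f x := by
  have h := Lp.fourier_toTemperedDistribution_eq (hf.toLp f)
  have h2 := congrArg (fun D => D ψ) h
  simp only [TemperedDistribution.fourier_apply, Lp.toTemperedDistribution_apply, smul_eq_mul] at h2
  rw [fhat_of_memLp hf, ← h2]
  apply integral_congr_ae
  filter_upwards [hf.coeFn_toLp] with x h1
  rw [h1, SchwartzMap.fourier_coe]

lemma fourierInv_shift (η : 𝓢(Eu n, ℂ)) (y ξ : Eu n) :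
    𝓕⁻ (fun x => η (x + y)) ξ
      = Complex.exp (-(2 * Real.pi * inner ℝ ξ y : ℝ) * Complex.I) * 𝓕⁻ (η : Eu n → ℂ) ξ := by
  rw [Real.fourierInv_eq', Real.fourierInv_eq', ← integral_sub_right_eq_self _ y,
    ← integral_const_mul]
  congr 1; ext v
  simp only [sub_add_cancel, smul_eq_mul, ← mul_assoc, ← Complex.exp_add]
  congr 2
  rw [inner_sub_left, real_inner_comm y ξ]
  push_cast; ring

/-- Convolution with an integrable kernel is a Fourier multiplier. -/
lemma fhat_cv (hf : BM f) (hf2 : MemLp f 2 volume) (hK : Integrable K) (hKm : Measurable K) :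
    fhat (cv K f) =ᵐ[volume] fun ξ => 𝓕 K ξ * fhat f ξ := by
  have hcv : MemLp (cv K f) 2 volume := MemLp.cv hf2 hf.meas hKm hK
  have hFKc : Continuous (𝓕 K) := by
    have := VectorFourier.fourierIntegral_continuous (μ := (volume : Measure (Eu n)))
      Real.continuous_fourierChar (L := innerₗ (Eu n)) (by exact continuous_inner) hK
    exact this
  have hFKb (ξ : Eu n) : ‖𝓕 K ξ‖ ≤ ∫ y, ‖K y‖ := by
    exact VectorFourier.norm_fourierIntegral_le_integral_norm _ _ _ _ _
  have hprod : MemLp (fun ξ => 𝓕 K ξ * fhat f ξ) 2 volume := by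
    refine (memLp_fhat f).of_le_mul (c := ∫ y, ‖K y‖)
      (hFKc.aestronglyMeasurable.mul (memLp_fhat f).1) (Filter.Eventually.of_forall fun ξ => ?_)
    rw [norm_mul]
    exact mul_le_mul_of_nonneg_right (hFKb ξ) (norm_nonneg _)
  -- Both sides are identified by testing against smooth compactly supported functions, where
  -- `integral_mul_fhat` moves the transform onto the test function.
  apply ae_eq_of_integral_contDiff_smul_eq
  · exact (memLp_fhat _).locallyIntegrable (by norm_num)
  · exact hprod.locallyIntegrable (by norm_num)
  intro φ hφ hφc
  have hψc : HasCompactSupport (fun x => (φ x : ℂ)) := hφc.comp_left (g := fun t : ℝ => (t : ℂ)) (by simp)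
  set ψ : 𝓢(Eu n, ℂ) := hψc.toSchwartzMap (Complex.ofRealCLM.contDiff.comp hφ) with hψ
  have hψa (x : Eu n) : ψ x = (φ x : ℂ) := rfl
  obtain ⟨C, hC⟩ := hf.bdd
  have e1 : ∫ x, φ x • fhat (cv K f) x = ∫ x, 𝓕 (ψ : Eu n → ℂ) x * cv K f x := by
    rw [← integral_mul_fhat hcv ψ]
    simp only [hψa, Complex.real_smul]
  have e2 : ∫ x, 𝓕 (ψ : Eu n → ℂ) x * cv K f x
      = ∫ y, K y * ∫ x, (𝓕 ψ) x * f (x - y) := by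
    have key : Integrable (Function.uncurry fun x y : Eu n => (𝓕 ψ) x * (K y * f (x - y)))
        (volume.prod volume) := by
      have h := ((𝓕 ψ).integrable.mul_prod hK).mul_bdd (μ := (volume : Measure (Eu n)).prod volume)
        (g := fun p : Eu n × Eu n => f (p.1 - p.2)) (c := C)
        (hf.meas.comp (by fun_prop)).aestronglyMeasurable (Filter.Eventually.of_forall fun p => hC _)
      refine h.congr (Filter.Eventually.of_forall fun p => ?_)
      simp only [Function.uncurry]; ring
    have := integral_integral_swap key
    simp only [cv_eq, ← integral_const_mul, ← SchwartzMap.fourier_coe]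
    rw [this]
    congr 1; ext y; congr 1; ext x; ring
  -- Translation by `y` becomes modulation: the multiplication formula is applied to the inverse
  -- transform of the translate of `𝓕 ψ`.
  have e3 (y : Eu n) : ∫ x, (𝓕 ψ) x * f (x - y)
      = ∫ ξ, Complex.exp (-(2 * Real.pi * inner ℝ ξ y : ℝ) * Complex.I) * (ψ ξ * fhat f ξ) := by
    rw [← integral_add_right_eq_self _ y]
    simp only [add_sub_cancel_right]
    set η : 𝓢(Eu n, ℂ) := SchwartzMap.compSubConstCLM ℂ (-y) (𝓕 ψ) with hη
    have hηa (x : Eu n) : η x = (𝓕 ψ) (x + y) := by simp [hη]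
    have h1 := integral_mul_fhat hf2 (𝓕⁻ η)
    rw [← SchwartzMap.fourier_coe, FourierInvPair.fourier_fourierInv_eq] at h1
    simp only [hηa] at h1
    rw [← h1]
    congr 1; ext ξ
    have h2 : (𝓕⁻ η) ξ = Complex.exp (-(2 * Real.pi * inner ℝ ξ y : ℝ) * Complex.I) * ψ ξ := by
      have h3 := fourierInv_shift (𝓕 ψ) y ξ
      rw [← SchwartzMap.fourierInv_coe, FourierPair.fourierInv_fourier_eq] at h3
      rw [← h3, SchwartzMap.fourierInv_coe]
      exact congrArg (fun F : Eu n → ℂ => 𝓕⁻ F ξ) (funext hηa)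
    rw [h2, mul_assoc]
  rw [e1, e2]
  simp only [e3]
  have hψf : Integrable fun ξ => ψ ξ * fhat f ξ := (ψ.memLp 2).integrable_mul (memLp_fhat f)
  have key : Integrable (Function.uncurry fun y ξ : Eu n => K y *
      (Complex.exp (-(2 * Real.pi * inner ℝ ξ y : ℝ) * Complex.I) * (ψ ξ * fhat f ξ)))
      (volume.prod volume) := by
    have h := (hK.mul_prod hψf).mul_bdd (μ := (volume : Measure (Eu n)).prod volume)
      (g := fun p : Eu n × Eu n => Complex.exp (-(2 * Real.pi * inner ℝ p.2 p.1 : ℝ) * Complex.I))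
      (c := 1) (by fun_prop : Continuous _).aestronglyMeasurable
      (Filter.Eventually.of_forall fun p => by
        rw [← Complex.ofReal_neg, Complex.norm_exp_ofReal_mul_I])
    refine h.congr (Filter.Eventually.of_forall fun p => ?_)
    simp only [Function.uncurry]; ring
  simp only [← integral_const_mul]
  rw [integral_integral_swap key]
  congr 1; ext ξ
  have hF : 𝓕 K ξ = ∫ y, Complex.exp (-(2 * Real.pi * inner ℝ ξ y : ℝ) * Complex.I) * K y := by
    rw [Real.fourier_eq']
    congr 1; ext y
    rw [real_inner_comm ξ y, smul_eq_mul]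
    push_cast
    ring_nf
  rw [hF, Complex.real_smul, ← hψa, mul_comm (∫ y, _) (fhat f ξ), ← mul_assoc,
    ← integral_const_mul]
  congr 1; ext y
  ring

end

/-! ### Fourier multipliers with Schwartz symbols and the supports of products. -/

section
open SchwartzMap
variable {n : ℕ}

/-- The dilation `ξ ↦ q (2⁻ᵏ ξ)` of a symbol. -/
def dil (k : ℤ) (q : 𝓢(Eu n, ℂ)) : 𝓢(Eu n, ℂ) :=
  SchwartzMap.compCLMOfContinuousLinearEquiv ℂ
    (ContinuousLinearEquiv.smulLeft (R₁ := ℝ) (M₁ := Eu n)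
      (Units.mk0 ((2 : ℝ) ^ (-k)) (zpow_ne_zero _ two_ne_zero))) q

@[simp] lemma dil_apply (k : ℤ) (q : 𝓢(Eu n, ℂ)) (ξ : Eu n) :
    dil k q ξ = q ((2 : ℝ) ^ (-k) • ξ) := rfl

/-- The convolution kernel of the Fourier multiplier with symbol `q`. -/
def ker (q : 𝓢(Eu n, ℂ)) : 𝓢(Eu n, ℂ) := 𝓕⁻ q

lemma ker_coe (q : 𝓢(Eu n, ℂ)) : ⇑(ker q) = 𝓕⁻ (q : Eu n → ℂ) := SchwartzMap.fourierInv_coe q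

lemma fourier_ker (q : 𝓢(Eu n, ℂ)) : 𝓕 (⇑(ker q)) = q := by
  rw [← SchwartzMap.fourier_coe, ker, FourierInvPair.fourier_fourierInv_eq]

/-- The Fourier multiplier with symbol `q`. -/
def fm (q : 𝓢(Eu n, ℂ)) (f : Eu n → ℂ) : Eu n → ℂ := cv (ker q) f

variable {q r s : 𝓢(Eu n, ℂ)} {f g : Eu n → ℂ}

lemma BM.fm (hf : BM f) (q : 𝓢(Eu n, ℂ)) : BM (fm q f) :=
  hf.cv (ker q).continuous.measurable (ker q).integrable

lemma MemLp.fm (hf2 : MemLp f 2 volume) (hf : BM f) (q : 𝓢(Eu n, ℂ)) :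
    MemLp (fm q f) 2 volume :=
  MemLp.cv hf2 hf.meas (ker q).continuous.measurable (ker q).integrable

lemma fm_add (q : 𝓢(Eu n, ℂ)) (hf : BM f) (hg : BM g) : fm q (f + g) = fm q f + fm q g :=
  cv_add (ker q).integrable hf hg

lemma fm_sub (q : 𝓢(Eu n, ℂ)) (hf : BM f) (hg : BM g) : fm q (f - g) = fm q f - fm q g :=
  cv_sub (ker q).integrable hf hg

lemma fm_smul (q : 𝓢(Eu n, ℂ)) (c : ℂ) (f : Eu n → ℂ) : fm q (c • f) = c • fm q f :=
  cv_smul c _ f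

lemma fm_zero (q : 𝓢(Eu n, ℂ)) : fm q (0 : Eu n → ℂ) = 0 := by
  simpa using fm_smul q 0 0

lemma fm_congr_ae (q : 𝓢(Eu n, ℂ)) (h : f =ᵐ[volume] g) : fm q f = fm q g := cv_congr_ae _ h

lemma fm_sum {ι : Type*} (t : Finset ι) {F : ι → Eu n → ℂ} (h : ∀ i ∈ t, BM (F i)) :
    fm q (∑ i ∈ t, F i) = ∑ i ∈ t, fm q (F i) := by
  classical
  induction t using Finset.induction_on with
  | empty => simp [fm_zero]
  | insert a t ha ih =>
    rw [Finset.sum_insert ha, Finset.sum_insert ha,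
      fm_add q (h a (by simp)) (BM.sum t fun i hi => h i (by simp [hi])),
      ih fun i hi => h i (by simp [hi])]

lemma ker_symbol_add (q r : 𝓢(Eu n, ℂ)) : ker (q + r) = ker q + ker r :=
  FourierInvAdd.fourierInv_add q r

lemma ker_symbol_smul (c : ℂ) (q : 𝓢(Eu n, ℂ)) : ker (c • q) = c • ker q :=
  FourierInvSMul.fourierInv_smul c q

lemma fm_symbol_add (hf : BM f) : fm (q + r) f = fm q f + fm r f := by
  unfold fm
  rw [ker_symbol_add]
  exact cv_add_kernel (ker q).integrable (ker r).integrable hf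

lemma fm_symbol_smul (c : ℂ) (q : 𝓢(Eu n, ℂ)) (f : Eu n → ℂ) : fm (c • q) f = c • fm q f := by
  unfold fm
  rw [ker_symbol_smul]
  exact cv_smul_kernel c _ f

lemma fm_symbol_sub (hf : BM f) : fm (q - r) f = fm q f - fm r f := by
  have : q - r = q + (-1 : ℂ) • r := by ext x; simp [sub_eq_add_neg]
  rw [this, fm_symbol_add hf, fm_symbol_smul]
  simp [sub_eq_add_neg]

lemma fm_symbol_zero (f : Eu n → ℂ) : fm (0 : 𝓢(Eu n, ℂ)) f = 0 := by
  simpa using fm_symbol_smul 0 (0 : 𝓢(Eu n, ℂ)) f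

lemma fm_symbol_sum {ι : Type*} (t : Finset ι) (Q : ι → 𝓢(Eu n, ℂ)) (hf : BM f) :
    fm (∑ i ∈ t, Q i) f = ∑ i ∈ t, fm (Q i) f := by
  classical
  induction t using Finset.induction_on with
  | empty => simp [fm_symbol_zero]
  | insert a t ha ih => rw [Finset.sum_insert ha, Finset.sum_insert ha, fm_symbol_add hf, ih]

lemma fhat_fm (hf : BM f) (hf2 : MemLp f 2 volume) (q : 𝓢(Eu n, ℂ)) :
    fhat (fm q f) =ᵐ[volume] fun ξ => q ξ * fhat f ξ := by
  have h := fhat_cv hf hf2 (ker q).integrable (ker q).continuous.measurable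
  rw [fourier_ker] at h
  exact h

/-- The plane wave with frequency `ξ`. -/
def wave (ξ x : Eu n) : ℂ := Complex.exp ((2 * Real.pi * inner ℝ ξ x : ℝ) * Complex.I)

lemma norm_wave (ξ x : Eu n) : ‖wave ξ x‖ = 1 := Complex.norm_exp_ofReal_mul_I _

lemma wave_sub (ξ x y : Eu n) : wave ξ (x - y) = wave ξ x * wave ξ (-y) := by
  rw [wave, wave, wave, ← Complex.exp_add, inner_sub_right, inner_neg_right]
  congr 1; push_cast; ring

lemma wave_add_left (ξ η x : Eu n) : wave (ξ + η) x = wave ξ x * wave η x := by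
  rw [wave, wave, wave, ← Complex.exp_add, inner_add_left]
  congr 1; push_cast; ring

lemma continuous_wave {X : Type*} [TopologicalSpace X] {φ ψ : X → Eu n} (hφ : Continuous φ)
    (hψ : Continuous ψ) : Continuous fun t => wave (φ t) (ψ t) := by
  unfold wave; fun_prop

lemma fourierInv_eq_wave (q : Eu n → ℂ) (x : Eu n) : 𝓕⁻ q x = ∫ ξ, wave ξ x * q ξ := by
  rw [Real.fourierInv_eq']; rfl

lemma fourier_eq_wave (K : Eu n → ℂ) (ξ : Eu n) : 𝓕 K ξ = ∫ x, wave ξ (-x) * K x := by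
  rw [Real.fourier_eq']
  congr 1; ext x
  rw [wave, inner_neg_right, real_inner_comm, smul_eq_mul]
  congr 3; push_cast; ring

lemma integral_kernel_wave (q : 𝓢(Eu n, ℂ)) (x ξ : Eu n) :
    ∫ y, (ker q) (x - y) * wave ξ y = q ξ * wave ξ x := by
  rw [← integral_sub_left_eq_self _ volume x]
  have h : ∫ y, wave ξ (-y) * ker q y = q ξ := by
    rw [← fourier_eq_wave, fourier_ker]
  rw [← h, ← integral_mul_const]
  congr 1; ext y
  rw [sub_sub_cancel, wave_sub]; ring

/-- Convolution of the kernel of a multiplier with an integrable function. -/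
lemma fm_integrable {K : Eu n → ℂ} (hK : Integrable K) (q : 𝓢(Eu n, ℂ)) (x : Eu n) :
    fm q K x = 𝓕⁻ (fun ξ => q ξ * 𝓕 K ξ) x := by
  have key : Integrable (Function.uncurry fun y ξ : Eu n => K y * q ξ * wave ξ (x - y))
      (volume.prod volume) := by
    have h := (hK.mul_prod q.integrable).mul_bdd (μ := (volume : Measure (Eu n)).prod volume)
      (g := fun p : Eu n × Eu n => wave p.2 (x - p.1)) (c := 1)
      (continuous_wave (by fun_prop) (by fun_prop)).aestronglyMeasurable
      (Filter.Eventually.of_forall fun p => (norm_wave _ _).le)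
    exact h
  rw [fourierInv_eq_wave]
  calc fm q K x = ∫ y, ∫ ξ, K y * q ξ * wave ξ (x - y) := by
        unfold fm cv
        congr 1; ext y
        rw [ker_coe, fourierInv_eq_wave, ← integral_mul_const]
        congr 1; ext ξ; ring
    _ = ∫ ξ, ∫ y, K y * q ξ * wave ξ (x - y) := integral_integral_swap key
    _ = ∫ ξ, wave ξ x * (q ξ * 𝓕 K ξ) := by
        congr 1; ext ξ
        rw [fourier_eq_wave, ← integral_const_mul, ← integral_const_mul]
        congr 1; ext y
        rw [wave_sub]; ring

/-- Only the kernels are composed, and for them the identity is Fourier inversion; `f` is merely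
bounded and needs no Fourier transform. The symbol `s` is any Schwartz function with the values of
the product. -/
lemma fm_fm (hf : BM f) (h : ∀ ξ, q ξ * r ξ = s ξ) : fm q (fm r f) = fm s f := by
  unfold fm
  rw [cv_cv (ker q).integrable (ker r).integrable hf]
  congr 1; ext x
  have h2 := fm_integrable (ker r).integrable q x
  rw [fourier_ker] at h2
  simp only [h] at h2
  rw [ker_coe s, ← h2]
  rfl

lemma fm_fm_eq_zero (hf : BM f) (h : ∀ ξ, q ξ * r ξ = 0) : fm q (fm r f) = 0 := by
  rw [fm_fm (s := 0) hf (by simpa using h), fm_symbol_zero]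

/-- The product of two kernels is a superposition of plane waves of frequency `p.1 + p.2`, and the
multiplier `s` acts on such a wave through the value `s (p.1 + p.2)`. -/
lemma integral_kernel_triple (h : ∀ ξ η, q ξ * r η * s (ξ + η) = 0) (x z w : Eu n) :
    ∫ y, (ker s) (x - y) * ((ker q) (y - z) * (ker r) (y - w)) = 0 := by
  have e (y : Eu n) : (ker q) (y - z) * (ker r) (y - w)
      = ∫ p : Eu n × Eu n, (q p.1 * r p.2) * (wave p.1 (y - z) * wave p.2 (y - w)) := by
    rw [ker_coe, ker_coe, fourierInv_eq_wave,
      fourierInv_eq_wave, ← integral_prod_mul]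
    rw [Measure.volume_eq_prod]
    congr 1; ext p; ring
  have key : Integrable (Function.uncurry fun (y : Eu n) (p : Eu n × Eu n) =>
      (ker s) (x - y) * ((q p.1 * r p.2) * (wave p.1 (y - z) * wave p.2 (y - w))))
      (volume.prod volume) := by
    have h0 : Integrable (fun p : Eu n × Eu n => q p.1 * r p.2) volume := by
      rw [Measure.volume_eq_prod]; exact q.integrable.mul_prod r.integrable
    have hc1 : Continuous fun t : Eu n × (Eu n × Eu n) => wave t.2.1 (t.1 - z) :=
      continuous_wave (by fun_prop) (by fun_prop)
    have hc2 : Continuous fun t : Eu n × (Eu n × Eu n) => wave t.2.2 (t.1 - w) :=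
      continuous_wave (by fun_prop) (by fun_prop)
    have hs : Integrable (fun y => ker s (x - y)) volume := (ker s).integrable.comp_sub_left x
    have h1 := (Integrable.mul_prod (f := fun y => ker s (x - y))
      (g := fun p : Eu n × Eu n => q p.1 * r p.2) hs h0).mul_bdd
      (μ := (volume : Measure (Eu n)).prod volume)
      (g := fun t : Eu n × (Eu n × Eu n) => wave t.2.1 (t.1 - z) * wave t.2.2 (t.1 - w)) (c := 1)
      (hc1.mul hc2).aestronglyMeasurable
      (Filter.Eventually.of_forall fun t => by simp [norm_wave])
    refine h1.congr (Filter.Eventually.of_forall fun p => ?_)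
    simp only [Function.uncurry]; ring
  simp only [e, ← integral_const_mul]
  rw [integral_integral_swap key]
  refine integral_eq_zero_of_ae (Filter.Eventually.of_forall fun p => ?_)
  have e2 (y : Eu n) : (ker s) (x - y) * ((q p.1 * r p.2) * (wave p.1 (y - z) * wave p.2 (y - w)))
      = (q p.1 * r p.2 * (wave p.1 (-z) * wave p.2 (-w))) *
        ((ker s) (x - y) * wave (p.1 + p.2) y) := by
    rw [wave_sub, wave_sub, wave_add_left]; ring
  simp only [e2]
  rw [integral_const_mul, integral_kernel_wave]
  have := h p.1 p.2
  simp only [Pi.zero_apply]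
  linear_combination (wave p.1 (-z) * wave p.2 (-w) * wave (p.1 + p.2) x) * this

/-- The spectrum of a product is contained in the sum of the spectra. -/
lemma fm_mul_eq_zero (hf : BM f) (hg : BM g) (h : ∀ ξ η, q ξ * r η * s (ξ + η) = 0) :
    fm s (fm q f * fm r g) = 0 := by
  ext x
  obtain ⟨C, hC⟩ := hf.bdd
  obtain ⟨D, hD⟩ := hg.bdd
  -- For bounded `f` and `g` the spectrum is tracked through the kernels: the product is an integral
  -- over pairs of points of products of kernels, to which the trilinear cancellation applies.
  have e (y : Eu n) : fm q f y * fm r g y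
      = ∫ p : Eu n × Eu n, (f p.1 * g p.2) * ((ker q) (y - p.1) * (ker r) (y - p.2)) := by
    unfold fm cv
    rw [← integral_prod_mul, Measure.volume_eq_prod]
    congr 1; ext p; ring
  have hmeas : Measurable fun t : Eu n × (Eu n × Eu n) => f t.2.1 * g t.2.2 :=
    (hf.meas.comp (by fun_prop)).mul (hg.meas.comp (by fun_prop))
  have hc : Continuous fun t : Eu n × (Eu n × Eu n) =>
      (ker s) (x - t.1) * ((ker q) (t.1 - t.2.1) * (ker r) (t.1 - t.2.2)) := by fun_prop
  have key0 : Integrable (fun t : Eu n × (Eu n × Eu n) =>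
      (ker s) (x - t.1) * ((ker q) (t.1 - t.2.1) * (ker r) (t.1 - t.2.2)))
      (volume.prod volume) := by
    rw [integrable_prod_iff hc.aestronglyMeasurable]
    have hi (y : Eu n) : Integrable (fun p : Eu n × Eu n =>
        (ker q) (y - p.1) * (ker r) (y - p.2)) volume := by
      have h1 : Integrable (fun z => ker q (y - z)) volume := (ker q).integrable.comp_sub_left y
      have h2 : Integrable (fun z => ker r (y - z)) volume := (ker r).integrable.comp_sub_left y
      rw [Measure.volume_eq_prod]
      exact Integrable.mul_prod (f := fun z => ker q (y - z)) (g := fun z => ker r (y - z)) h1 h2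
    refine ⟨Filter.Eventually.of_forall fun y => (hi y).const_mul (ker s (x - y)), ?_⟩
    have e3 (y : Eu n) : ∫ p : Eu n × Eu n,
        ‖(ker s) (x - y) * ((ker q) (y - p.1) * (ker r) (y - p.2))‖
        = ‖(ker s) (x - y)‖ * ((∫ z, ‖(ker q) z‖) * ∫ w, ‖(ker r) w‖) := by
      simp only [norm_mul]
      rw [integral_const_mul, Measure.volume_eq_prod,
        integral_prod_mul (fun z => ‖(ker q) (y - z)‖) (fun w => ‖(ker r) (y - w)‖),
        integral_sub_left_eq_self (fun z => ‖(ker q) z‖),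
        integral_sub_left_eq_self (fun z => ‖(ker r) z‖)]
    simp only [e3]
    have hs : Integrable (fun y => ker s (x - y)) volume := (ker s).integrable.comp_sub_left x
    exact hs.norm.mul_const _
  have key : Integrable (Function.uncurry fun (y : Eu n) (p : Eu n × Eu n) =>
      (ker s) (x - y) * ((f p.1 * g p.2) * ((ker q) (y - p.1) * (ker r) (y - p.2))))
      (volume.prod volume) := by
    have h1 := key0.mul_bdd (g := fun t : Eu n × (Eu n × Eu n) => f t.2.1 * g t.2.2) (c := C * D)
      hmeas.aestronglyMeasurable (Filter.Eventually.of_forall fun t => by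
        rw [norm_mul]
        exact mul_le_mul (hC _) (hD _) (norm_nonneg _) ((norm_nonneg _).trans (hC t.2.1)))
    refine h1.congr (Filter.Eventually.of_forall fun p => ?_)
    simp only [Function.uncurry]; ring
  calc fm s (fm q f * fm r g) x
      = ∫ y, (ker s) (x - y) * (fm q f y * fm r g y) := rfl
    _ = 0 := by
      simp only [e, ← integral_const_mul]
      rw [integral_integral_swap key]
      refine integral_eq_zero_of_ae (Filter.Eventually.of_forall fun p => ?_)
      have := integral_kernel_triple h x p.1 p.2
      simp only [Pi.zero_apply]
      rw [← mul_zero (f p.1 * g p.2), ← this, ← integral_const_mul]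
      congr 1; ext y; ring

end

/-! ### Dyadic dilations: scale invariant norms and first moments of kernels. -/

section Scaling
open SchwartzMap
variable {n : ℕ}

lemma ker_dil (k : ℤ) (q : 𝓢(Eu n, ℂ)) (x : Eu n) :
    ker (dil k q) x = (((2 : ℝ) ^ k) ^ n : ℝ) * ker q ((2 : ℝ) ^ k • x) := by
  rw [ker_coe, ker_coe, fourierInv_eq_wave, fourierInv_eq_wave]
  have h := Measure.integral_comp_smul (volume : Measure (Eu n))
    (fun η => wave η ((2 : ℝ) ^ k • x) * q η) ((2 : ℝ) ^ (-k))
  have e (ξ : Eu n) : wave ((2 : ℝ) ^ (-k) • ξ) ((2 : ℝ) ^ k • x) = wave ξ x := by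
    unfold wave
    rw [inner_smul_left, inner_smul_right]
    simp only [conj_trivial, ← mul_assoc, zpow_neg]
    congr 3
    field_simp
  simp only [e] at h
  rw [finrank_euclideanSpace_fin] at h
  simp only [dil_apply]
  rw [h, Complex.real_smul]
  congr 2
  rw [abs_of_pos (by positivity), zpow_neg, inv_pow, inv_inv]

lemma lintegral_ker_dil (k : ℤ) (q : 𝓢(Eu n, ℂ)) {G : Eu n → ℝ≥0∞} (hG : Measurable G) :
    ∫⁻ y, ‖ker (dil k q) y‖ₑ * G ((2 : ℝ) ^ k • y) = ∫⁻ y, ‖ker q y‖ₑ * G y := by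
  have hne : (2 : ℝ) ^ k ≠ 0 := zpow_ne_zero _ two_ne_zero
  have h := Measure.map_addHaar_smul (volume : Measure (Eu n)) hne
  have h2 : ∫⁻ y, ‖ker q y‖ₑ * G y ∂(Measure.map (fun y => (2 : ℝ) ^ k • y) volume)
      = ∫⁻ y, ‖ker q ((2 : ℝ) ^ k • y)‖ₑ * G ((2 : ℝ) ^ k • y) :=
    lintegral_map ((ker q).continuous.measurable.enorm.mul hG) (measurable_const_smul _)
  rw [h, lintegral_smul_measure, finrank_euclideanSpace_fin] at h2
  have e (y : Eu n) : ‖ker (dil k q) y‖ₑ * G ((2 : ℝ) ^ k • y)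
      = ENNReal.ofReal (((2 : ℝ) ^ k) ^ n) * (‖ker q ((2 : ℝ) ^ k • y)‖ₑ * G ((2 : ℝ) ^ k • y)) := by
    rw [ker_dil, enorm_mul, mul_assoc]
    congr 1
    rw [← ofReal_norm, Complex.norm_real, Real.norm_of_nonneg (by positivity)]
  simp only [e]
  rw [lintegral_const_mul', ← h2, smul_eq_mul, ← mul_assoc, ← ENNReal.ofReal_mul (by positivity),
    abs_of_pos (by positivity), mul_inv_cancel₀ (by positivity), ENNReal.ofReal_one, one_mul]
  exact ENNReal.ofReal_ne_top

/-- The `L¹` norm of the kernel of a multiplier. -/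
def nk (q : 𝓢(Eu n, ℂ)) : ℝ≥0 := (∫⁻ y, ‖ker q y‖ₑ).toNNReal

/-- The first moment of the kernel of a multiplier. -/
def mk (q : 𝓢(Eu n, ℂ)) : ℝ≥0 := (∫⁻ y, ‖ker q y‖ₑ * ‖y‖ₑ).toNNReal

lemma coe_nk (q : 𝓢(Eu n, ℂ)) : (nk q : ℝ≥0∞) = ∫⁻ y, ‖ker q y‖ₑ :=
  ENNReal.coe_toNNReal (ker q).integrable.2.ne

lemma coe_mk (q : 𝓢(Eu n, ℂ)) : (mk q : ℝ≥0∞) = ∫⁻ y, ‖ker q y‖ₑ * ‖y‖ₑ := by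
  apply ENNReal.coe_toNNReal
  have h : Integrable (fun y : Eu n => ‖y‖ ^ 1 * ‖ker q y‖) volume := (ker q).integrable_pow_mul volume 1
  have := h.2.ne
  simp only [pow_one] at this
  refine ne_of_eq_of_ne (lintegral_congr fun y => ?_) this
  rw [enorm_mul, enorm_norm, enorm_norm, mul_comm]

lemma lintegral_ker_dil_one (k : ℤ) (q : 𝓢(Eu n, ℂ)) : ∫⁻ y, ‖ker (dil k q) y‖ₑ = nk q := by
  have := lintegral_ker_dil k q (G := fun _ => 1) measurable_const
  simpa [coe_nk] using this

lemma enorm_two_zpow (k : ℤ) : ‖(2 : ℝ) ^ k‖ₑ = (2 : ℝ≥0∞) ^ k := by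
  have h : ‖(2 : ℝ) ^ k‖₊ = (2 : ℝ≥0) ^ k := by
    rw [nnnorm_zpow]; norm_num
  rw [enorm_eq_nnnorm, h, ENNReal.coe_zpow two_ne_zero]; rfl

lemma lintegral_ker_dil_norm (k : ℤ) (q : 𝓢(Eu n, ℂ)) :
    ∫⁻ y, ‖ker (dil k q) y‖ₑ * ‖y‖ₑ = 2 ^ (-k) * mk q := by
  have h := lintegral_ker_dil k q (G := fun y => ‖y‖ₑ) measurable_enorm
  simp only [enorm_smul, enorm_two_zpow] at h
  rw [coe_mk, ← h, ← lintegral_const_mul' _ _ (ENNReal.zpow_ne_top (by simp) (by simp) _)]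
  congr 1; ext y
  rw [mul_left_comm, ← mul_assoc (2 ^ (-k)), ← ENNReal.zpow_add (by simp) (by simp)]
  simp

lemma integral_norm_ker_dil (k : ℤ) (q : 𝓢(Eu n, ℂ)) : ∫ y, ‖ker (dil k q) y‖ = nk q := by
  rw [integral_norm_eq_lintegral_enorm (ker (dil k q)).continuous.aestronglyMeasurable,
    lintegral_ker_dil_one]
  simp

lemma integral_norm_ker_dil_norm (k : ℤ) (q : 𝓢(Eu n, ℂ)) :
    ∫ y, ‖ker (dil k q) y‖ * ‖y‖ = 2 ^ (-k) * mk q := by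
  have h := integral_norm_eq_lintegral_enorm (μ := (volume : Measure (Eu n)))
    (f := fun y => ‖ker (dil k q) y‖ * ‖y‖)
    (by fun_prop : Continuous fun y => ‖ker (dil k q) y‖ * ‖y‖).aestronglyMeasurable
  simp only [norm_mul, norm_norm, enorm_mul, enorm_norm] at h
  rw [h, lintegral_ker_dil_norm, ENNReal.toReal_mul, ← enorm_two_zpow, toReal_enorm,
    Real.norm_of_nonneg (by positivity)]
  simp

lemma integrable_ker_norm (q : 𝓢(Eu n, ℂ)) : Integrable (fun y => ‖ker q y‖ * ‖y‖) := by
  have h := (ker q).integrable_pow_mul volume 1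
  refine h.congr (Filter.Eventually.of_forall fun y => ?_)
  simp [mul_comm]

lemma norm_fm_dil_le {f : Eu n → ℂ} {C : ℝ} (hC : ∀ x, ‖f x‖ ≤ C) (k : ℤ) (q : 𝓢(Eu n, ℂ))
    (x : Eu n) : ‖fm (dil k q) f x‖ ≤ nk q * C := by
  rw [← integral_norm_ker_dil k q]
  exact norm_cv_le (ker (dil k q)).integrable hC x

lemma eLpNorm_fm_dil_le {f : Eu n → ℂ} (hf : Measurable f) (k : ℤ) (q : 𝓢(Eu n, ℂ)) :
    eLpNorm (fm (dil k q) f) 2 volume ≤ nk q * eLpNorm f 2 volume := by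
  rw [← lintegral_ker_dil_one k q]
  exact eLpNorm_cv_le (ker (dil k q)).continuous.measurable hf

end Scaling

/-! ### Derivatives of multipliers and integration by parts. -/

section Derivative
open SchwartzMap LineDeriv
variable {n : ℕ}

/-- The `j`-th vector of the standard basis. -/
abbrev ej (j : Fin n) : Eu n := EuclideanSpace.single j 1

/-- Multiplication of a symbol by `2πi ξ_j`. -/
def sd (j : Fin n) (q : 𝓢(Eu n, ℂ)) : 𝓢(Eu n, ℂ) :=
  (2 * Real.pi * Complex.I) • smulLeftCLM ℂ (inner ℝ · (ej j)) q

lemma sd_apply (j : Fin n) (q : 𝓢(Eu n, ℂ)) (ξ : Eu n) :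
    sd j q ξ = 2 * Real.pi * Complex.I * (ξ j : ℂ) * q ξ := by
  have : (fun x : Eu n => inner ℝ x (ej j)).HasTemperateGrowth :=
    ((innerSL ℝ).flip (ej j)).hasTemperateGrowth
  have hi : inner ℝ ξ (ej j) = ξ j := by simp [ej, EuclideanSpace.inner_single_right]
  rw [sd, smul_apply, smulLeftCLM_apply_apply this, hi, Complex.real_smul, smul_eq_mul]
  ring

lemma ker_sd (j : Fin n) (q : 𝓢(Eu n, ℂ)) (x : Eu n) :
    ker (sd j q) x = fderiv ℝ (ker q) x (ej j) := by
  have h := lineDerivOp_fourierInv_eq q (ej j)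
  have h2 := congrArg (fun F : 𝓢(Eu n, ℂ) => F x) h
  simp only [lineDerivOp_apply] at h2
  rw [((ker q).differentiableAt).lineDeriv_eq_fderiv.symm]
  exact h2.symm

lemma sd_dil (j : Fin n) (k : ℤ) (q : 𝓢(Eu n, ℂ)) :
    sd j (dil k q) = (((2 : ℝ) ^ k : ℝ) : ℂ) • dil k (sd j q) := by
  ext ξ
  rw [smul_apply, dil_apply, sd_apply, sd_apply, dil_apply]
  simp only [PiLp.smul_apply, smul_eq_mul, Complex.ofReal_mul, zpow_neg, Complex.ofReal_inv]
  have : (((2 : ℝ) ^ k : ℝ) : ℂ) ≠ 0 := by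
    rw [Complex.ofReal_ne_zero]; positivity
  field_simp

/-- The majorant for differentiating under the integral sign, uniform on a unit ball, where `1 + ‖x₀
- y‖ ≤ 2 * (1 + ‖x - y‖)`. The exponent `n + 1` makes it integrable. -/
lemma exists_fderiv_decay (K : 𝓢(Eu n, ℂ)) (x₀ : Eu n) : ∃ C : ℝ, ∀ x ∈ Metric.ball x₀ 1, ∀ y,
    ‖fderiv ℝ K (x - y)‖ ≤ C * (1 + ‖x₀ - y‖) ^ (-((n : ℝ) + 1)) := by
  obtain ⟨C, hC⟩ : ∃ C : ℝ, ∀ z, (1 + ‖z‖) ^ (n + 1) * ‖fderiv ℝ K z‖ ≤ C := by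
    refine ⟨2 ^ (n + 1) * (Finset.Iic (n + 1, 1)).sup
      (fun m => SchwartzMap.seminorm ℝ m.1 m.2) K, fun z => ?_⟩
    have := one_add_le_sup_seminorm_apply (𝕜 := ℝ) (m := (n + 1, 1)) le_rfl le_rfl K z
    rwa [norm_iteratedFDeriv_one] at this
  refine ⟨2 ^ (n + 1) * C, fun x hx y => ?_⟩
  have h1 : 1 + ‖x₀ - y‖ ≤ 2 * (1 + ‖x - y‖) := by
    have h2 : ‖x₀ - y‖ ≤ ‖x₀ - x‖ + ‖x - y‖ := norm_sub_le_norm_sub_add_norm_sub _ _ _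
    have h3 : ‖x₀ - x‖ < 1 := by rw [← dist_eq_norm, dist_comm]; exact hx
    have := norm_nonneg (x - y)
    linarith
  have hpos : 0 < 1 + ‖x₀ - y‖ := by positivity
  rw [Real.rpow_neg hpos.le, ← div_eq_mul_inv, le_div_iff₀ (by positivity)]
  have e : (1 + ‖x₀ - y‖) ^ ((n : ℝ) + 1) = (1 + ‖x₀ - y‖) ^ (n + 1) := by
    rw [← Real.rpow_natCast]; push_cast; rfl
  rw [e]
  calc ‖fderiv ℝ K (x - y)‖ * (1 + ‖x₀ - y‖) ^ (n + 1)
      ≤ ‖fderiv ℝ K (x - y)‖ * (2 * (1 + ‖x - y‖)) ^ (n + 1) := by gcongr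
    _ = 2 ^ (n + 1) * ((1 + ‖x - y‖) ^ (n + 1) * ‖fderiv ℝ K (x - y)‖) := by rw [mul_pow]; ring
    _ ≤ 2 ^ (n + 1) * C := by gcongr; exact hC _

lemma hasFDerivAt_fm (q : 𝓢(Eu n, ℂ)) {f : Eu n → ℂ} (hf : BM f) (x₀ : Eu n) :
    ∃ L : Eu n →L[ℝ] ℂ, HasFDerivAt (fm q f) L x₀ ∧ ∀ j, L (ej j) = fm (sd j q) f x₀ := by
  obtain ⟨C, hC⟩ := hf.bdd
  obtain ⟨D, hD⟩ := exists_fderiv_decay (ker q) x₀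
  have hsm : ContDiff ℝ ∞ (ker q) := (ker q).smooth _
  have hcf : Continuous (fderiv ℝ (ker q)) := hsm.continuous_fderiv (by simp)
  set F' : Eu n → Eu n → (Eu n →L[ℝ] ℂ) := fun x y => f y • fderiv ℝ (ker q) (x - y) with hF'
  set bound : Eu n → ℝ := fun y => C * (D * (1 + ‖x₀ - y‖) ^ (-((n : ℝ) + 1))) with hbound
  have hbi : Integrable bound := by
    have h0 : Integrable (fun y : Eu n => (1 + ‖y‖) ^ (-((n : ℝ) + 1))) volume :=
      integrable_one_add_norm (by rw [finrank_euclideanSpace_fin]; linarith)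
    exact ((h0.comp_sub_left x₀).const_mul D).const_mul C
  have hFm : AEStronglyMeasurable (F' x₀) volume :=
    hf.meas.aestronglyMeasurable.smul (hcf.comp (by fun_prop)).aestronglyMeasurable
  have hFb : ∀ y, ∀ x ∈ Metric.ball x₀ 1, ‖F' x y‖ ≤ bound y := fun y x hx => by
    rw [hF', norm_smul]
    exact mul_le_mul (hC y) (hD x hx y) (norm_nonneg _) ((norm_nonneg _).trans (hC y))
  have hd : ∀ y, ∀ x ∈ Metric.ball x₀ 1, HasFDerivAt (fun x => ker q (x - y) * f y) (F' x y) x := by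
    intro y x _
    have h1 : HasFDerivAt (fun x => ker q (x - y)) (fderiv ℝ (ker q) (x - y)) x := by
      exact (hasFDerivAt_comp_sub y).2 ((ker q).differentiableAt (x := x - y)).hasFDerivAt
    exact (h1.mul_const' (f y)).congr_fderiv (by ext v; simp [hF'])
  have main := hasFDerivAt_integral_of_dominated_of_fderiv_le (μ := (volume : Measure (Eu n)))
    (𝕜 := ℝ) (F := fun x y => ker q (x - y) * f y) (F' := F') (bound := bound)
    (Metric.ball_mem_nhds x₀ one_pos)
    (Filter.Eventually.of_forall fun x => (cv_integrable (ker q).integrable hf x).1)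
    (cv_integrable (ker q).integrable hf x₀) hFm (Filter.Eventually.of_forall hFb) hbi
    (Filter.Eventually.of_forall hd)
  refine ⟨_, main, fun j => ?_⟩
  have hint : Integrable (F' x₀) volume := hbi.mono' hFm
    (Filter.Eventually.of_forall fun y => hFb y x₀ (Metric.mem_ball_self one_pos))
  rw [ContinuousLinearMap.integral_apply hint]
  unfold fm cv
  congr 1; ext y
  rw [ker_sd]
  simp [hF', mul_comm]

/-- A continuous linear map on Euclidean space in coordinates. -/
lemma clm_eq_sum {F : Type*} [NormedAddCommGroup F] [NormedSpace ℝ F] (L : Eu n →L[ℝ] F) :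
    L = ∑ j, (EuclideanSpace.proj (𝕜 := ℝ) j : Eu n →L[ℝ] ℝ).smulRight (L (ej j)) := by
  ext v
  have hv : v = ∑ j, v j • ej j := by
    have := (EuclideanSpace.basisFun (Fin n) ℝ).sum_repr v
    simpa using this.symm
  conv_lhs => rw [hv]
  simp [map_sum, map_smul]

lemma hasFDerivAt_fm' (q : 𝓢(Eu n, ℂ)) {f : Eu n → ℂ} (hf : BM f) (x : Eu n) :
    HasFDerivAt (fm q f)
      (∑ j, (EuclideanSpace.proj (𝕜 := ℝ) j : Eu n →L[ℝ] ℝ).smulRight (fm (sd j q) f x)) x := by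
  obtain ⟨L, hL, hj⟩ := hasFDerivAt_fm q hf x
  rw [clm_eq_sum L] at hL
  simpa only [hj] using hL

/-- The induction generalizes the symbol, since the derivatives of `fm q f` are the multipliers `fm
(sd j q) f` of the same function. -/
lemma contDiff_fm (q : 𝓢(Eu n, ℂ)) {f : Eu n → ℂ} (hf : BM f) : ContDiff ℝ ∞ (fm q f) := by
  rw [contDiff_infty]
  intro N
  induction N generalizing q with
  | zero =>
    rw [Nat.cast_zero, contDiff_zero]
    exact continuous_iff_continuousAt.2 fun x => (hasFDerivAt_fm' q hf x).continuousAt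
  | succ N ih =>
    rw [Nat.cast_succ, contDiff_succ_iff_hasFDerivAt]
    refine ⟨_, ?_, hasFDerivAt_fm' q hf⟩
    refine ContDiff.sum fun j _ => ?_
    exact ((ContinuousLinearMap.smulRightL ℝ (Eu n) ℂ (EuclideanSpace.proj j)).contDiff).comp
      (ih (sd j q))

lemma fderiv_fm (q : 𝓢(Eu n, ℂ)) {f : Eu n → ℂ} (hf : BM f) (x : Eu n) (j : Fin n) :
    fderiv ℝ (fm q f) x (ej j) = fm (sd j q) f x := by
  obtain ⟨L, hL, hj⟩ := hasFDerivAt_fm q hf x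
  rw [hL.fderiv, hj]

/-- The `j`-th partial derivative. -/
def pdc (j : Fin n) (f : Eu n → ℂ) (x : Eu n) : ℂ := fderiv ℝ f x (ej j)

lemma norm_pdc_le {K : ℝ≥0} {f : Eu n → ℂ} (hf : LipschitzWith K f) (j : Fin n) (x : Eu n) :
    ‖pdc j f x‖ ≤ K := by
  refine (ContinuousLinearMap.le_opNorm _ _).trans ?_
  simpa [ej] using norm_fderiv_le_of_lipschitz ℝ hf

lemma measurable_pdc (j : Fin n) (f : Eu n → ℂ) : Measurable (pdc j f) := by
  exact measurable_fderiv_apply_const ℝ f (ej j)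

lemma bm_pdc {K : ℝ≥0} {f : Eu n → ℂ} (hf : LipschitzWith K f) (j : Fin n) : BM (pdc j f) :=
  ⟨measurable_pdc j f, K, norm_pdc_le hf j⟩

/-- Integration by parts. -/
lemma fm_pdc (q : 𝓢(Eu n, ℂ)) {K : ℝ≥0} {f : Eu n → ℂ} (hf : BM f) (hL : LipschitzWith K f)
    (j : Fin n) : fm q (pdc j f) = fm (sd j q) f := by
  ext x
  have h1 : Filter.Tendsto (fun t : ℝ => t⁻¹ • (fm q f (x + t • ej j) - fm q f x))
      (nhdsWithin 0 (Set.Ioi 0)) (nhds (fm (sd j q) f x)) := by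
    obtain ⟨L, hL, hj⟩ := hasFDerivAt_fm q hf x
    rw [← hj]
    exact (hL.hasLineDerivAt (ej j)).tendsto_slope_zero_right
  have e (t : ℝ) : t⁻¹ • (fm q f (x + t • ej j) - fm q f x)
      = ∫ y, ker q y * (t⁻¹ • (f (x - y + t • ej j) - f (x - y))) := by
    unfold fm
    rw [cv_eq, cv_eq, ← integral_sub (cv_integrable' (ker q).integrable hf _)
      (cv_integrable' (ker q).integrable hf _), ← integral_smul]
    congr 1; ext y
    rw [show x + t • ej j - y = x - y + t • ej j by abel]
    simp only [Complex.real_smul]; ring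
  have h2 : Filter.Tendsto (fun t : ℝ => t⁻¹ • (fm q f (x + t • ej j) - fm q f x))
      (nhdsWithin 0 (Set.Ioi 0)) (nhds (fm q (pdc j f) x)) := by
    simp only [e]
    unfold fm
    rw [cv_eq]
    apply tendsto_integral_filter_of_dominated_convergence (fun y => ‖ker q y‖ * K)
    · refine Filter.Eventually.of_forall fun t => ?_
      have h1 : Measurable fun y : Eu n => f (x - y + t • ej j) := hf.meas.comp (by fun_prop)
      have h2 : Measurable fun y : Eu n => f (x - y) := hf.meas.comp (by fun_prop)
      exact ((ker q).continuous.measurable.mul ((h1.sub h2).const_smul t⁻¹)).aestronglyMeasurable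
    · filter_upwards [self_mem_nhdsWithin] with t (ht : 0 < t)
      refine Filter.Eventually.of_forall fun y => ?_
      rw [norm_mul, norm_smul]
      refine mul_le_mul_of_nonneg_left ?_ (norm_nonneg _)
      have := hL.norm_sub_le (x - y + t • ej j) (x - y)
      rw [add_sub_cancel_left, norm_smul] at this
      rw [norm_inv, Real.norm_of_nonneg ht.le] at *
      rw [inv_mul_le_iff₀ ht]
      simpa [ej, mul_comm] using this
    · exact (ker q).integrable.norm.mul_const _
    -- Rademacher's theorem, transported by the reflection `y ↦ x - y`, gives the pointwise limit of
    -- the difference quotients; the Lipschitz constant dominates them.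
    · have hd := hL.ae_differentiableAt (μ := (volume : Measure (Eu n)))
      have hd2 : ∀ᵐ y ∂(volume : Measure (Eu n)), DifferentiableAt ℝ f (x - y) :=
        (quasiMeasurePreserving_sub_left volume x).ae hd
      filter_upwards [hd2] with y hy
      exact ((hy.hasFDerivAt.hasLineDerivAt (ej j)).tendsto_slope_zero_right).const_mul _
  exact tendsto_nhds_unique h2 h1

end Derivative

/-! ### Discrete convolution inequalities with dyadic weights. -/

section Schur

/-- The weight `2^{σk}`. -/
def wt (σ : ℝ) (k : ℤ) : ℝ≥0∞ := (2 : ℝ≥0∞) ^ (σ * (k : ℝ))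

lemma wt_add (σ : ℝ) (k l : ℤ) : wt σ (k + l) = wt σ k * wt σ l := by
  unfold wt
  rw [← ENNReal.rpow_add _ _ (by simp) (by simp)]
  congr 1; push_cast; ring

lemma wt_ne_top (σ : ℝ) (k : ℤ) : wt σ k ≠ ⊤ := by simp [wt]

@[simp] lemma wt_zero_left (k : ℤ) : wt 0 k = 1 := by simp [wt]

@[simp] lemma wt_zero_right (σ : ℝ) : wt σ 0 = 1 := by simp [wt]

lemma wt_add_left (σ τ : ℝ) (k : ℤ) : wt (σ + τ) k = wt σ k * wt τ k := by
  unfold wt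
  rw [← ENNReal.rpow_add _ _ (by simp) (by simp)]
  congr 1; ring

lemma wt_one (k : ℤ) : wt 1 k = (2 : ℝ≥0∞) ^ k := by
  rw [wt, one_mul, ENNReal.rpow_intCast]

lemma sq_tsum_mul_le {ι : Type*} (c x : ι → ℝ≥0∞) :
    (∑' l, c l * x l) ^ 2 ≤ (∑' l, c l) * ∑' l, c l * x l ^ 2 := by
  let : MeasurableSpace ι := ⊤
  have := sq_lintegral_mul_le (μ := (Measure.count : Measure ι)) (κ := c) (F := x)
    (measurable_from_top) (measurable_from_top)
  simpa only [lintegral_count' (measurable_from_top)] using this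

/-- Young's inequality `ℓ¹ * ℓ² ⊆ ℓ²`. -/
lemma tsum_sq_conv_le (c x : ℤ → ℝ≥0∞) :
    ∑' k, (∑' l, c (k - l) * x l) ^ 2 ≤ (∑' j, c j) ^ 2 * ∑' l, x l ^ 2 := by
  have h1 (k : ℤ) : ∑' l, c (k - l) = ∑' j, c j := (Equiv.subLeft k).tsum_eq c
  have h2 (l : ℤ) : ∑' k, c (k - l) = ∑' j, c j := (Equiv.subRight l).tsum_eq c
  calc ∑' k, (∑' l, c (k - l) * x l) ^ 2
      ≤ ∑' k, (∑' j, c j) * ∑' l, c (k - l) * x l ^ 2 := by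
        refine ENNReal.tsum_le_tsum fun k => ?_
        rw [← h1 k]
        exact sq_tsum_mul_le _ _
    _ = (∑' j, c j) * ∑' l, ∑' k, c (k - l) * x l ^ 2 := by
        rw [ENNReal.tsum_mul_left, ENNReal.tsum_comm]
    _ = (∑' j, c j) ^ 2 * ∑' l, x l ^ 2 := by
        simp only [ENNReal.tsum_mul_right, h2, ENNReal.tsum_mul_left]
        ring

/-- The weight is multiplicative, so along `k = (k - l) + l` it splits between the kernel and the
sequence, and the unweighted inequality applies. -/
lemma tsum_wt_sq_conv_le (σ : ℝ) (c x : ℤ → ℝ≥0∞) :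
    ∑' k, (wt σ k * ∑' l, c (k - l) * x l) ^ 2
      ≤ (∑' j, wt σ j * c j) ^ 2 * ∑' l, (wt σ l * x l) ^ 2 := by
  refine le_trans (le_of_eq ?_) (tsum_sq_conv_le (fun j => wt σ j * c j) fun l => wt σ l * x l)
  congr 1; ext k
  rw [← ENNReal.tsum_mul_left]
  congr 2; ext l
  rw [show k = (k - l) + l by ring, wt_add]
  simp only [sub_add_cancel]
  ring

lemma tsum_wt_natAbs_ne_top {a : ℝ} (ha : 0 < a) : ∑' k : ℤ, wt (-a) |k| ≠ ⊤ := by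
  have h1 : wt (-a) 1 < 1 := by
    unfold wt
    exact ENNReal.rpow_lt_one_of_one_lt_of_neg (by norm_num) (by simpa using ha)
  have hp (k : ℕ) : wt (-a) (k : ℤ) = wt (-a) 1 ^ k := by
    unfold wt
    rw [← ENNReal.rpow_natCast, ← ENNReal.rpow_mul]
    simp
  have hs : ∑' k : ℕ, wt (-a) (k : ℤ) ≠ ⊤ := by
    simp only [hp, ENNReal.tsum_geometric]
    rw [ENNReal.inv_ne_top]
    exact (tsub_pos_of_lt h1).ne'
  have : ∑' k : ℤ, wt (-a) |k| ≤ (∑' k : ℕ, wt (-a) (k : ℤ)) + ∑' k : ℕ, wt (-a) (k : ℤ) := by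
    rw [tsum_of_nat_of_neg_add_one (f := fun k : ℤ => wt (-a) |k|) ENNReal.summable
      ENNReal.summable]
    gcongr with k k
    · simp
    · have e : |-(k : ℤ) + -1| = (k : ℤ) + 1 := by
        rw [← neg_add, abs_neg]; exact abs_of_nonneg (by positivity)
      rw [show -((k : ℤ) + 1) = -(k : ℤ) + -1 by ring, e, wt_add]
      exact mul_le_of_le_one_right' h1.le
  exact ne_top_of_le_ne_top (ENNReal.add_ne_top.2 ⟨hs, hs⟩) this

end Schur

/-! ### Littlewood–Paley square functions. -/

section SquareFunction
open SchwartzMap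
variable {n : ℕ}

/-- The square of the homogeneous Sobolev norm. -/
def hsq (σ : ℝ) (f : Eu n → ℂ) : ℝ≥0∞ := ∫⁻ ξ, (‖ξ‖ₑ ^ σ * ‖fhat f ξ‖ₑ) ^ 2

lemma measurable_enorm_rpow (σ : ℝ) : Measurable fun ξ : Eu n => ‖ξ‖ₑ ^ σ :=
  measurable_enorm.pow_const σ

lemma hsq_zero {f : Eu n → ℂ} (hf : MemLp f 2 volume) : hsq 0 f = eLpNorm f 2 volume ^ 2 := by
  rw [← eLpNorm_fhat hf, eLpNorm_two_sq, hsq]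
  simp

/-- Plancherel turns the square sum into an integral against `∑' k, (wt σ k * ‖m k ξ‖ₑ) ^ 2`. The
pointwise hypothesis may fail at one point `x`, a null set because `0 < n`; in practice this is the
origin. -/
lemma tsum_multiplier_le {f : Eu n → ℂ} {F : ℤ → Eu n → ℂ} {m : ℤ → Eu n → ℂ}
    (σ : ℝ) (C : ℝ≥0∞) (hF : ∀ k, MemLp (F k) 2 volume)
    (hm : ∀ k, fhat (F k) =ᵐ[volume] fun ξ => m k ξ * fhat f ξ) (x : Eu n) 
    (h : ∀ ξ ≠ x, ∑' k, (wt σ k * ‖m k ξ‖ₑ) ^ 2 ≤ C * (‖ξ‖ₑ ^ σ) ^ 2)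
    (hn : 0 < n) :
    ∑' k, (wt σ k * eLpNorm (F k) 2 volume) ^ 2 ≤ C * hsq σ f := by
  have : Nonempty (Fin n) := ⟨⟨0, hn⟩⟩
  have e (k : ℤ) : (wt σ k * eLpNorm (F k) 2 volume) ^ 2
      = ∫⁻ ξ, (wt σ k) ^ 2 * ‖fhat (F k) ξ‖ₑ ^ 2 := by
    rw [mul_pow, ← eLpNorm_fhat (hF k), eLpNorm_two_sq, lintegral_const_mul']
    exact ENNReal.pow_ne_top (wt_ne_top _ _)
  simp only [e]
  rw [← lintegral_tsum fun k => ((memLp_fhat (F k)).1.enorm.pow_const 2).const_mul _]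
  have hall : ∀ᵐ ξ, ∀ k, fhat (F k) ξ = m k ξ * fhat f ξ := ae_all_iff.2 hm
  have hne : ∀ᵐ ξ ∂(volume : Measure (Eu n)), ξ ≠ x := by
    simp [ae_iff, measure_singleton]
  have hmeas : AEMeasurable (fun ξ => (‖ξ‖ₑ ^ σ * ‖fhat f ξ‖ₑ) ^ 2) volume :=
    ((measurable_enorm_rpow σ).aemeasurable.mul (memLp_fhat f).1.enorm).pow_const 2
  rw [hsq, ← lintegral_const_mul'' _ hmeas]
  refine lintegral_mono_ae ?_
  filter_upwards [hall, hne] with ξ h1 h2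
  calc ∑' k, wt σ k ^ 2 * ‖fhat (F k) ξ‖ₑ ^ 2
      = (∑' k, (wt σ k * ‖m k ξ‖ₑ) ^ 2) * ‖fhat f ξ‖ₑ ^ 2 := by
        rw [← ENNReal.tsum_mul_right]
        congr 1; ext k
        rw [h1 k, enorm_mul]; ring
    _ ≤ C * (‖ξ‖ₑ ^ σ) ^ 2 * ‖fhat f ξ‖ₑ ^ 2 := by gcongr; exact h ξ h2
    _ = C * (‖ξ‖ₑ ^ σ * ‖fhat f ξ‖ₑ) ^ 2 := by ring

lemma enorm_zpow_smul (k : ℤ) (ξ : Eu n) : ‖(2 : ℝ) ^ (-k) • ξ‖ₑ = wt (-1) k * ‖ξ‖ₑ := by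
  rw [enorm_smul, enorm_two_zpow, wt, ← ENNReal.rpow_intCast]
  congr 2; push_cast; ring

lemma exists_zpow_near {ξ : Eu n} (h : ξ ≠ 0) : ∃ j : ℤ, wt 1 j ≤ ‖ξ‖ₑ ∧ ‖ξ‖ₑ < 2 * wt 1 j := by
  obtain ⟨j, h1, h2⟩ := ENNReal.exists_mem_Ico_zpow (x := ‖ξ‖ₑ) (y := 2) (by simpa using h) (by simp)
    (by norm_num) (by simp)
  refine ⟨j, by rwa [wt_one], ?_⟩
  rw [ENNReal.zpow_add (by simp) (by simp), zpow_one, mul_comm] at h2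
  rwa [wt_one]

/-- The constant of the square function estimate. -/
def sfConst : ℝ≥0∞ := ∑' k : ℤ, (2 * wt (-1) |k|) ^ 2

lemma sfConst_ne_top : sfConst ≠ ⊤ := by
  have e (k : ℤ) : (2 * wt (-1) |k|) ^ 2 = 4 * wt (-2) |k| := by
    rw [mul_pow, sq (wt _ _), ← wt_add_left]; norm_num
  unfold sfConst
  simp only [e, ENNReal.tsum_mul_left]
  exact ENNReal.mul_ne_top (by simp) (tsum_wt_natAbs_ne_top two_pos)

/-- If `2 ^ j ≤ ‖ξ‖ < 2 ^ (j + 1)`, the bound with exponent `σ + 1` serves for `k ≥ j`, where the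
rescaled argument is small, and the bound with `σ - 1` for `k ≤ j`. Either way the terms decay
geometrically in `|k - j|`. -/
lemma tsum_geometric_le {ξ : Eu n} (h : ξ ≠ 0) (σ : ℝ) {C : ℝ≥0∞} {Θ : Eu n → ℝ≥0∞}
    (h1 : ∀ η, η ≠ 0 → Θ η ≤ C * ‖η‖ₑ ^ (σ + 1)) (h2 : ∀ η, η ≠ 0 → Θ η ≤ C * ‖η‖ₑ ^ (σ - 1)) :
    ∑' k : ℤ, (wt σ k * Θ ((2 : ℝ) ^ (-k) • ξ)) ^ 2 ≤ C ^ 2 * sfConst * (‖ξ‖ₑ ^ σ) ^ 2 := by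
  obtain ⟨j, hj1, hj2⟩ := exists_zpow_near h
  have hξ0 : ‖ξ‖ₑ ≠ 0 := by simpa using h
  have hξt : ‖ξ‖ₑ ≠ ⊤ := by simp
  have key (k : ℤ) : wt σ k * Θ ((2 : ℝ) ^ (-k) • ξ) ≤ C * ‖ξ‖ₑ ^ σ * (2 * wt (-1) |k - j|) := by
    have hne : (2 : ℝ) ^ (-k) • ξ ≠ 0 := smul_ne_zero (zpow_ne_zero _ two_ne_zero) h
    have hw : ∀ s : ℝ, (wt (-1) k * ‖ξ‖ₑ) ^ s = wt (-s) k * ‖ξ‖ₑ ^ s := by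
      intro s
      rw [ENNReal.mul_rpow_of_ne_top (wt_ne_top _ _) hξt, wt, wt, ← ENNReal.rpow_mul]
      congr 2; ring
    rcases le_total j k with hjk | hjk
    · have := h1 _ hne
      rw [enorm_zpow_smul, hw] at this
      calc wt σ k * Θ ((2 : ℝ) ^ (-k) • ξ)
          ≤ wt σ k * (C * (wt (-(σ + 1)) k * ‖ξ‖ₑ ^ (σ + 1))) := by gcongr
        _ = C * ‖ξ‖ₑ ^ σ * (wt σ k * wt (-(σ + 1)) k * ‖ξ‖ₑ) := by
            rw [ENNReal.rpow_add _ _ hξ0 hξt, ENNReal.rpow_one]; ring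
        _ ≤ C * ‖ξ‖ₑ ^ σ * (wt (-1) k * (2 * wt 1 j)) := by
            rw [← wt_add_left]
            gcongr
            ring_nf; exact le_rfl
        _ = C * ‖ξ‖ₑ ^ σ * (2 * wt (-1) |k - j|) := by
            rw [abs_of_nonneg (sub_nonneg.2 hjk), show wt 1 j = wt (-1) (-j) by simp [wt],
              sub_eq_add_neg, wt_add]; ring
    · have := h2 _ hne
      rw [enorm_zpow_smul, hw] at this
      calc wt σ k * Θ ((2 : ℝ) ^ (-k) • ξ)
          ≤ wt σ k * (C * (wt (-(σ - 1)) k * ‖ξ‖ₑ ^ (σ - 1))) := by gcongr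
        _ = C * ‖ξ‖ₑ ^ σ * (wt σ k * wt (-(σ - 1)) k * ‖ξ‖ₑ ^ (-1 : ℝ)) := by
            rw [sub_eq_add_neg, ENNReal.rpow_add _ _ hξ0 hξt]; ring
        _ ≤ C * ‖ξ‖ₑ ^ σ * (wt 1 k * (2 * (wt 1 j) ^ (-1 : ℝ))) := by
            rw [← wt_add_left]
            have : ‖ξ‖ₑ ^ (-1 : ℝ) ≤ 2 * (wt 1 j) ^ (-1 : ℝ) := by
              rw [ENNReal.rpow_neg_one, ENNReal.rpow_neg_one]
              exact (ENNReal.inv_le_inv.2 hj1).trans (le_mul_of_one_le_left' (by norm_num))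
            gcongr
            ring_nf; exact le_rfl
        _ = C * ‖ξ‖ₑ ^ σ * (2 * wt (-1) |k - j|) := by
            rw [abs_sub_comm, abs_of_nonneg (sub_nonneg.2 hjk),
              show wt 1 k = wt (-1) (-k) by simp [wt],
              show wt 1 j ^ (-1 : ℝ) = wt (-1) j by
                rw [wt, wt, ← ENNReal.rpow_mul]; congr 1; ring,
              sub_eq_add_neg, wt_add]; ring
  calc ∑' k : ℤ, (wt σ k * Θ ((2 : ℝ) ^ (-k) • ξ)) ^ 2
      ≤ ∑' k : ℤ, (C * ‖ξ‖ₑ ^ σ * (2 * wt (-1) |k - j|)) ^ 2 := by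
        exact ENNReal.tsum_le_tsum fun k => pow_le_pow_left' (key k) 2
    _ = C ^ 2 * sfConst * (‖ξ‖ₑ ^ σ) ^ 2 := by
        simp only [mul_pow (C * _), ENNReal.tsum_mul_left]
        rw [sfConst, ← (Equiv.subRight j).tsum_eq fun k : ℤ => (2 * wt (-1) |k|) ^ 2]
        simp only [Equiv.subRight_apply]
        ring

/-- Littlewood-Paley square function estimate. -/
lemma square_function_le (hn : 0 < n) (q : 𝓢(Eu n, ℂ)) (σ : ℝ) {C : ℝ≥0∞}
    (h1 : ∀ η, η ≠ 0 → ‖q η‖ₑ ≤ C * ‖η‖ₑ ^ (σ + 1))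
    (h2 : ∀ η, η ≠ 0 → ‖q η‖ₑ ≤ C * ‖η‖ₑ ^ (σ - 1))
    {f : Eu n → ℂ} (hf : BM f) (hf2 : MemLp f 2 volume) :
    ∑' k : ℤ, (wt σ k * eLpNorm (fm (dil k q) f) 2 volume) ^ 2 ≤ C ^ 2 * sfConst * hsq σ f :=
  tsum_multiplier_le σ _ (fun _ => MemLp.fm hf2 hf _) (fun _ => fhat_fm hf hf2 _) 0
    (fun _ hξ => tsum_geometric_le (Θ := fun η => ‖q η‖ₑ) hξ σ h1 h2) hn

/-- Symbols supported in an annulus. -/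
def Annular (q : 𝓢(Eu n, ℂ)) : Prop :=
  ∃ r R : ℝ, 0 < r ∧ 0 < R ∧ ∀ ξ, q ξ ≠ 0 → r ≤ ‖ξ‖ ∧ ‖ξ‖ ≤ R

lemma Annular.exists_bound {q : 𝓢(Eu n, ℂ)} (hq : Annular q) (s : ℝ) :
    ∃ C : ℝ≥0, ∀ η, η ≠ 0 → ‖q η‖ₑ ≤ C * ‖η‖ₑ ^ s := by
  obtain ⟨r, R, hr, hR, hs⟩ := hq
  obtain ⟨D, hD⟩ : ∃ D : ℝ≥0, ∀ η, ‖q η‖ₑ ≤ D := by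
    refine ⟨(SchwartzMap.seminorm ℝ 0 0 q).toNNReal, fun η => ?_⟩
    rw [← ofReal_norm]
    exact ENNReal.ofReal_le_ofReal (norm_le_seminorm ℝ q η)
  obtain ⟨c, hc0, hc⟩ : ∃ c : ℝ, 0 < c ∧ ∀ t : ℝ, r ≤ t → t ≤ R → c ≤ t ^ s := by
    by_cases hs0 : 0 ≤ s
    · exact ⟨r ^ s, by positivity, fun t h1 _ => Real.rpow_le_rpow hr.le h1 hs0⟩
    · exact ⟨R ^ s, by positivity, fun t h1 h2 =>
        Real.rpow_le_rpow_of_nonpos (hr.trans_le h1) h2 (not_le.1 hs0).le⟩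
  refine ⟨D * (Real.toNNReal c)⁻¹, fun η hη => ?_⟩
  by_cases h0 : q η = 0
  · simp [h0]
  · obtain ⟨h1, h2⟩ := hs η h0
    have h3 : (Real.toNNReal c : ℝ≥0∞) ≤ ‖η‖ₑ ^ s := by
      rw [← ofReal_norm, ENNReal.ofReal_rpow_of_pos (hr.trans_le h1)]
      exact ENNReal.ofReal_le_ofReal (hc _ h1 h2)
    have hcne : Real.toNNReal c ≠ 0 := by simpa using hc0
    calc ‖q η‖ₑ ≤ D := hD η
      _ = (D * (Real.toNNReal c)⁻¹ : ℝ≥0) * (Real.toNNReal c : ℝ≥0∞) := by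
          rw [← ENNReal.coe_mul, inv_mul_cancel_right₀ hcne]
      _ ≤ _ := by gcongr

lemma Annular.square_function {q : 𝓢(Eu n, ℂ)} (hq : Annular q) (hn : 0 < n) (σ : ℝ) :
    ∃ C : ℝ≥0, ∀ f : Eu n → ℂ, BM f → MemLp f 2 volume →
      ∑' k : ℤ, (wt σ k * eLpNorm (fm (dil k q) f) 2 volume) ^ 2 ≤ C * hsq σ f := by
  obtain ⟨C1, h1⟩ := hq.exists_bound (σ + 1)
  obtain ⟨C2, h2⟩ := hq.exists_bound (σ - 1)
  refine ⟨(C1 + C2) ^ 2 * sfConst.toNNReal, fun f hf hf2 => ?_⟩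
  have := square_function_le hn q σ (C := (C1 + C2 : ℝ≥0))
    (fun η hη => (h1 η hη).trans (by gcongr; simp))
    (fun η hη => (h2 η hη).trans (by gcongr; simp)) hf hf2
  have e : ((C1 + C2 : ℝ≥0) : ℝ≥0∞) ^ 2 * sfConst = ((C1 + C2) ^ 2 * sfConst.toNNReal : ℝ≥0) := by
    rw [ENNReal.coe_mul, ENNReal.coe_toNNReal sfConst_ne_top, ENNReal.coe_pow]
  rwa [e] at this

end SquareFunction

/-! ### Annular symbols, Bernstein inequalities and commutators with Lipschitz functions. -/

section Symbols
open SchwartzMap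
variable {n : ℕ}

lemma dil_dil (k l : ℤ) (q : 𝓢(Eu n, ℂ)) : dil k (dil l q) = dil (k + l) q := by
  ext ξ
  simp only [dil_apply, smul_smul]
  rw [← zpow_add₀ two_ne_zero]
  congr 3; ring

lemma dil_sub_symbol (k : ℤ) (q r : 𝓢(Eu n, ℂ)) : dil k (q - r) = dil k q - dil k r :=
  map_sub _ q r

lemma dil_smul_symbol (k : ℤ) (c : ℂ) (q : 𝓢(Eu n, ℂ)) : dil k (c • q) = c • dil k q :=
  map_smul _ c q

lemma dil_sum_symbol {ι : Type*} (t : Finset ι) (k : ℤ) (Q : ι → 𝓢(Eu n, ℂ)) :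
    dil k (∑ i ∈ t, Q i) = ∑ i ∈ t, dil k (Q i) := map_sum _ _ _

lemma norm_zpow_smul (k : ℤ) (ξ : Eu n) : ‖(2 : ℝ) ^ (-k) • ξ‖ = 2 ^ (-k) * ‖ξ‖ := by
  rw [norm_smul, Real.norm_of_nonneg (by positivity)]

/-- Division of an annular symbol by a function that is smooth away from the origin. -/
lemma Annular.exists_mul {q : 𝓢(Eu n, ℂ)} (hq : Annular q) {m : Eu n → ℂ}
    (hm : ∀ ξ, ξ ≠ 0 → ContDiffAt ℝ ∞ m ξ) : ∃ s : 𝓢(Eu n, ℂ), ∀ ξ, s ξ = q ξ * m ξ := by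
  obtain ⟨r, R, hr, hR, hs⟩ := hq
  have h1 : HasCompactSupport fun ξ => q ξ * m ξ := by
    refine HasCompactSupport.intro (isCompact_closedBall (0 : Eu n) R) fun ξ hξ => ?_
    by_contra h0
    have := (hs ξ (left_ne_zero_of_mul h0)).2
    simp at hξ
    linarith
  have h2 : ContDiff ℝ ∞ fun ξ => q ξ * m ξ := by
    rw [contDiff_iff_contDiffAt]
    intro ξ
    by_cases hξ : ξ = 0
    · have h0 : (fun ξ => q ξ * m ξ) =ᶠ[nhds ξ] fun _ => 0 := by
        filter_upwards [Metric.ball_mem_nhds ξ hr] with η hη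
        by_contra h0
        have := (hs η (left_ne_zero_of_mul h0)).1
        rw [hξ, mem_ball_zero_iff] at hη
        linarith
      exact contDiffAt_const.congr_of_eventuallyEq h0
    · exact ((q.smooth ⊤).contDiffAt).mul (hm ξ hξ)
  exact ⟨h1.toSchwartzMap h2, fun ξ => rfl⟩

lemma Annular.of_support {q s : 𝓢(Eu n, ℂ)} (hq : Annular q) (h : ∀ ξ, s ξ ≠ 0 → q ξ ≠ 0) :
    Annular s := by
  obtain ⟨r, R, hr, hR, hs⟩ := hq
  exact ⟨r, R, hr, hR, fun ξ hξ => hs ξ (h ξ hξ)⟩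

lemma sd_support (j : Fin n) (q : 𝓢(Eu n, ℂ)) (ξ : Eu n) (h : sd j q ξ ≠ 0) : q ξ ≠ 0 := by
  rw [sd_apply] at h
  exact right_ne_zero_of_mul h

/-- An annular symbol is a divergence. -/
lemma Annular.exists_div {q : 𝓢(Eu n, ℂ)} (hq : Annular q) : ∃ R : Fin n → 𝓢(Eu n, ℂ),
    (∀ j ξ, R j ξ ≠ 0 → q ξ ≠ 0) ∧ q = ∑ j, sd j (R j) := by
  -- The components are `q ξ * ξ_j / (2πi ‖ξ‖²)`, because the sum of `ξ_j * ξ_j` is `‖ξ‖²`; the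
  -- division is harmless away from the origin.
  have hm (j : Fin n) (ξ : Eu n) (hξ : ξ ≠ 0) : ContDiffAt ℝ ∞
      (fun ξ : Eu n => (ξ j : ℂ) * ((‖ξ‖ ^ 2 : ℝ) : ℂ)⁻¹ * (2 * Real.pi * Complex.I)⁻¹) ξ := by
    have h1 : ContDiffAt ℝ ∞ (fun ξ : Eu n => (ξ j : ℂ)) ξ :=
      (Complex.ofRealCLM.contDiff.comp (EuclideanSpace.proj (𝕜 := ℝ) j).contDiff).contDiffAt
    have h2 : ContDiffAt ℝ ∞ (fun ξ : Eu n => ((‖ξ‖ ^ 2 : ℝ) : ℂ)) ξ :=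
      (Complex.ofRealCLM.contDiff.comp (contDiff_norm_sq ℝ)).contDiffAt
    refine (h1.mul (h2.inv ?_)).mul contDiffAt_const
    simpa using hξ
  choose R hR using fun j => hq.exists_mul (hm j)
  refine ⟨R, fun j ξ h => ?_, ?_⟩
  · rw [hR] at h; exact left_ne_zero_of_mul h
  · ext ξ
    rw [sum_apply]
    simp only [sd_apply, hR]
    by_cases hξ : ξ = 0
    · have : q ξ = 0 := by
        obtain ⟨r, R, hr, hR, hs⟩ := hq
        by_contra h0
        have := (hs ξ h0).1
        rw [hξ, norm_zero] at this
        linarith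
      simp [this]
    · have hsum : (∑ j, (ξ j : ℂ) * (ξ j : ℂ)) = ((‖ξ‖ ^ 2 : ℝ) : ℂ) := by
        rw [EuclideanSpace.real_norm_sq_eq]; push_cast
        simp only [sq]
      have hne : ((‖ξ‖ ^ 2 : ℝ) : ℂ) ≠ 0 := by simpa using hξ
      have hpi : (2 * Real.pi * Complex.I : ℂ) ≠ 0 := Complex.two_pi_I_ne_zero
      have e (j : Fin n) : 2 * Real.pi * Complex.I * (ξ j : ℂ) * (q ξ * ((ξ j : ℂ) *
          ((‖ξ‖ ^ 2 : ℝ) : ℂ)⁻¹ * (2 * Real.pi * Complex.I)⁻¹))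
          = ((ξ j : ℂ) * (ξ j : ℂ)) * (q ξ * ((‖ξ‖ ^ 2 : ℝ) : ℂ)⁻¹) := by
        have : 2 * Real.pi * Complex.I * (2 * Real.pi * Complex.I)⁻¹ = 1 := mul_inv_cancel₀ hpi
        linear_combination ((ξ j : ℂ) * (ξ j : ℂ)) * (q ξ * ((‖ξ‖ ^ 2 : ℝ) : ℂ)⁻¹) * this
      simp only [e]
      rw [← Finset.sum_mul, hsum, mul_left_comm, mul_inv_cancel₀ hne, mul_one]

lemma fm_dil_pdc (k : ℤ) (q : 𝓢(Eu n, ℂ)) {K : ℝ≥0} {f : Eu n → ℂ} (hf : BM f)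
    (hL : LipschitzWith K f) (j : Fin n) :
    fm (dil k q) (pdc j f) = (((2 : ℝ) ^ k : ℝ) : ℂ) • fm (dil k (sd j q)) f := by
  rw [fm_pdc _ hf hL, sd_dil, fm_symbol_smul]

/-- Integration by parts moves each factor `2πi ξ_j` of the symbol onto `f`, and the dilation by `2
^ k` leaves the gain `2 ^ (-k)`. All trading of derivatives between frequency pieces rests on this
identity. -/
lemma fm_dil_eq_sum {q : 𝓢(Eu n, ℂ)} {R : Fin n → 𝓢(Eu n, ℂ)} (h : q = ∑ j, sd j (R j)) (k : ℤ)
    {K : ℝ≥0} {f : Eu n → ℂ} (hf : BM f) (hL : LipschitzWith K f) :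
    fm (dil k q) f = (((2 : ℝ) ^ (-k) : ℝ) : ℂ) • ∑ j, fm (dil k (R j)) (pdc j f) := by
  simp only [fm_dil_pdc k _ hf hL, ← Finset.smul_sum]
  rw [smul_smul, ← Complex.ofReal_mul, ← zpow_add₀ two_ne_zero, neg_add_cancel, zpow_zero,
    Complex.ofReal_one, one_smul, ← fm_symbol_sum _ _ hf, ← dil_sum_symbol, ← h]

/-- Frequency pieces of Lipschitz functions decay. -/
lemma Annular.norm_fm_le {q : 𝓢(Eu n, ℂ)} (hq : Annular q) : ∃ C : ℝ≥0, ∀ (k : ℤ) (K : ℝ≥0)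
    (f : Eu n → ℂ), BM f → LipschitzWith K f → ∀ x, ‖fm (dil k q) f x‖ ≤ C * 2 ^ (-k) * K := by
  obtain ⟨R, -, hR⟩ := hq.exists_div
  refine ⟨∑ j, nk (R j), fun k K f hf hL x => ?_⟩
  rw [fm_dil_eq_sum hR k hf hL, Pi.smul_apply, norm_smul, Complex.norm_real,
    Real.norm_of_nonneg (by positivity), mul_comm _ ((2 : ℝ) ^ (-k)), mul_assoc]
  refine mul_le_mul_of_nonneg_left ?_ (by positivity)
  rw [Finset.sum_apply]
  refine (norm_sum_le _ _).trans ?_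
  rw [NNReal.coe_sum, Finset.sum_mul]
  exact Finset.sum_le_sum fun j _ => norm_fm_dil_le (norm_pdc_le hL j) k _ x

lemma integral_ker (q : 𝓢(Eu n, ℂ)) : ∫ y, ker q y = q 0 := by
  have h := fourier_eq_wave (⇑(ker q)) 0
  rw [fourier_ker] at h
  rw [h]
  simp [wave]

lemma integral_ker_dil (k : ℤ) (q : 𝓢(Eu n, ℂ)) : ∫ y, ker (dil k q) y = q 0 := by
  rw [integral_ker]; simp

/-- For Lipschitz `a` the difference contributes a factor `‖y‖`, and the first moment of the dilated
kernel is `2 ^ (-k) * mk q`; both commutator bounds below follow. -/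
lemma commutator_eq {a g : Eu n → ℂ} (ha : BM a) (hg : BM g) (q : 𝓢(Eu n, ℂ)) (x : Eu n) :
    fm q (a * g) x - a x * fm q g x = ∫ y, ker q y * ((a (x - y) - a x) * g (x - y)) := by
  unfold fm
  rw [cv_eq, cv_eq, ← integral_const_mul, ← integral_sub (cv_integrable' (ker q).integrable
    (ha.mul hg) x) ((cv_integrable' (ker q).integrable hg x).const_mul _)]
  congr 1; ext y
  simp only [Pi.mul_apply]; ring

lemma norm_commutator_le {a g : Eu n → ℂ} (ha : BM a) (hg : BM g) {K : ℝ≥0}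
    (hL : LipschitzWith K a) {C : ℝ} (hC : ∀ x, ‖g x‖ ≤ C) (k : ℤ) (q : 𝓢(Eu n, ℂ)) (x : Eu n) :
    ‖fm (dil k q) (a * g) x - a x * fm (dil k q) g x‖ ≤ 2 ^ (-k) * mk q * (K * C) := by
  rw [commutator_eq ha hg, ← integral_norm_ker_dil_norm k q, ← integral_mul_const]
  refine norm_integral_le_of_norm_le ((integrable_ker_norm _).mul_const _)
    (Filter.Eventually.of_forall fun y => ?_)
  rw [norm_mul, norm_mul]
  have h1 := hL.norm_sub_le (x - y) x
  rw [sub_sub_cancel_left, norm_neg] at h1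
  calc ‖ker (dil k q) y‖ * (‖a (x - y) - a x‖ * ‖g (x - y)‖)
      ≤ ‖ker (dil k q) y‖ * ((K * ‖y‖) * C) := by
        gcongr
        exact hC _
    _ = ‖ker (dil k q) y‖ * ‖y‖ * (K * C) := by ring

lemma eLpNorm_commutator_le {a g : Eu n → ℂ} (ha : BM a) (hg : BM g) {K : ℝ≥0}
    (hL : LipschitzWith K a) (k : ℤ) (q : 𝓢(Eu n, ℂ)) :
    eLpNorm (fun x => fm (dil k q) (a * g) x - a x * fm (dil k q) g x) 2 volume
      ≤ 2 ^ (-k) * mk q * (K * eLpNorm g 2 volume) := by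
  have h := eLpNorm_le_of_enorm_le_conv (f := fun x => fm (dil k q) (a * g) x - a x * fm (dil k q) g x)
    (κ := fun y => ‖ker (dil k q) y‖ₑ * ‖y‖ₑ) (G := fun y => K * ‖g y‖ₑ)
    ((ker (dil k q)).continuous.measurable.enorm.mul measurable_enorm)
    (hg.meas.enorm.const_mul _) (fun x => ?_)
  · rw [lintegral_ker_dil_norm] at h
    have e : eLpNorm (fun y => (K : ℝ≥0∞) * ‖g y‖ₑ) 2 volume ≤ K * eLpNorm g 2 volume := by
      rw [← ENNReal.pow_le_pow_left_iff two_ne_zero, eLpNorm_two_sq]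
      simp_rw [enorm_eq_self, mul_pow]
      rw [lintegral_const_mul' _ _ (by simp), eLpNorm_two_sq]
    exact h.trans (mul_le_mul_right e _)
  · show ‖fm (dil k q) (a * g) x - a x * fm (dil k q) g x‖ₑ ≤ _
    rw [commutator_eq ha hg]
    refine (enorm_integral_le_lintegral_enorm _).trans (lintegral_mono fun y => ?_)
    rw [enorm_mul, enorm_mul, mul_assoc]
    have h1 := hL.norm_sub_le (x - y) x
    rw [sub_sub_cancel_left, norm_neg] at h1
    have h2 : ‖a (x - y) - a x‖ₑ ≤ K * ‖y‖ₑ := by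
      rw [enorm_eq_nnnorm, enorm_eq_nnnorm, ← ENNReal.coe_mul, ENNReal.coe_le_coe]
      exact h1
    calc ‖ker (dil k q) y‖ₑ * (‖a (x - y) - a x‖ₑ * ‖g (x - y)‖ₑ)
        ≤ ‖ker (dil k q) y‖ₑ * (K * ‖y‖ₑ * ‖g (x - y)‖ₑ) := by gcongr
      _ = _ := by ring

/-- Multipliers at high scales act as multiplication by the value of the symbol at the origin. -/
lemma norm_fm_dil_sub_le {f : Eu n → ℂ} (hf : BM f) {K : ℝ≥0} (hL : LipschitzWith K f) (k : ℤ)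
    (q : 𝓢(Eu n, ℂ)) (x : Eu n) : ‖fm (dil k q) f x - q 0 * f x‖ ≤ 2 ^ (-k) * mk q * K := by
  -- This is the commutator estimate with `g = 1`, on which the multiplier acts as the scalar `q 0`.
  have h1 : BM (fun _ : Eu n => (1 : ℂ)) := ⟨measurable_const, 1, by simp⟩
  have h := norm_commutator_le hf h1 hL (C := 1) (by simp) k q x
  have e : f * (fun _ : Eu n => (1 : ℂ)) = f := by ext; simp
  have e2 : fm (dil k q) (fun _ : Eu n => (1 : ℂ)) x = q 0 := by
    unfold fm
    rw [cv_eq]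
    simp [integral_ker_dil]
  rw [e, e2, mul_comm (f x), mul_one] at h
  exact h

lemma ae_pdc_mul {K L : ℝ≥0} {f g : Eu n → ℂ} (hf : LipschitzWith K f) (hg : LipschitzWith L g)
    (j : Fin n) : pdc j (f * g) =ᵐ[volume] pdc j f * g + f * pdc j g := by
  filter_upwards [hf.ae_differentiableAt, hg.ae_differentiableAt] with x h1 h2
  simp only [pdc, Pi.add_apply, Pi.mul_apply]
  rw [fderiv_mul h1 h2]
  simp only [add_apply, smul_apply, smul_eq_mul]
  ring

lemma lipschitz_mul {K L : ℝ≥0} {f g : Eu n → ℂ} (hf : LipschitzWith K f) (hg : LipschitzWith L g)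
    {C D : ℝ≥0} (hC : ∀ x, ‖f x‖ ≤ C) (hD : ∀ x, ‖g x‖ ≤ D) :
    LipschitzWith (C * L + D * K) (f * g) := by
  apply LipschitzWith.of_dist_le_mul
  intro x y
  rw [dist_eq_norm, dist_eq_norm]
  have h1 := hf.norm_sub_le x y
  have h2 := hg.norm_sub_le x y
  calc ‖(f * g) x - (f * g) y‖ = ‖f x * (g x - g y) + (f x - f y) * g y‖ := by
        simp only [Pi.mul_apply]; congr 1; ring
    _ ≤ ‖f x‖ * ‖g x - g y‖ + ‖f x - f y‖ * ‖g y‖ := by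
        refine (norm_add_le _ _).trans ?_
        rw [norm_mul, norm_mul]
    _ ≤ C * (L * ‖x - y‖) + K * ‖x - y‖ * D := by
        gcongr
        · exact hC x
        · exact hD y
    _ = ((C * L + D * K : ℝ≥0) : ℝ) * ‖x - y‖ := by push_cast; ring

lemma BM.exists_nnreal {f : Eu n → ℂ} (hf : BM f) : ∃ C : ℝ≥0, ∀ x, ‖f x‖ ≤ C := by
  obtain ⟨C, hC⟩ := hf.bdd
  exact ⟨⟨max C 0, le_max_right _ _⟩, fun x => (hC x).trans (le_max_left _ _)⟩

lemma fm_mul_pdc (q : 𝓢(Eu n, ℂ)) {K L : ℝ≥0} {a g : Eu n → ℂ} (ha : BM a) (hg : BM g)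
    (hL : LipschitzWith K a) (hgL : LipschitzWith L g) (j : Fin n) :
    fm q (a * pdc j g) = fm (sd j q) (a * g) - fm q (pdc j a * g) := by
  obtain ⟨C, hC⟩ := ha.exists_nnreal
  obtain ⟨D, hD⟩ := hg.exists_nnreal
  rw [← fm_pdc q (ha.mul hg) (lipschitz_mul hL hgL hC hD), fm_congr_ae q (ae_pdc_mul hL hgL j),
    fm_add q ((bm_pdc hL j).mul hg) (ha.mul (bm_pdc hgL j))]
  simp

/-- The derivative is removed from `g`: by Leibniz it moves to the kernel, at the price `2 ^ k` that
the commutator with a Lipschitz function pays back, or to `a`. The resulting bound depends on `g`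
only through its supremum. -/
lemma commutator_pdc_eq (k : ℤ) (q : 𝓢(Eu n, ℂ)) {K L : ℝ≥0} {a g : Eu n → ℂ} (ha : BM a)
    (hg : BM g) (hL : LipschitzWith K a) (hgL : LipschitzWith L g) (j : Fin n) (x : Eu n) :
    fm (dil k q) (a * pdc j g) x - a x * fm (dil k q) (pdc j g) x
      = (((2 : ℝ) ^ k : ℝ) : ℂ) *
        (fm (dil k (sd j q)) (a * g) x - a x * fm (dil k (sd j q)) g x)
        - fm (dil k q) (pdc j a * g) x := by
  rw [fm_mul_pdc _ ha hg hL hgL, fm_pdc _ hg hgL, sd_dil, fm_symbol_smul, fm_symbol_smul]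
  simp only [Pi.sub_apply, Pi.smul_apply, smul_eq_mul]
  ring

lemma norm_commutator_pdc_le {K L : ℝ≥0} {a g : Eu n → ℂ} (ha : BM a) (hg : BM g)
    (hL : LipschitzWith K a) (hgL : LipschitzWith L g) {C : ℝ} (hC : ∀ x, ‖g x‖ ≤ C) (k : ℤ)
    (q : 𝓢(Eu n, ℂ)) (j : Fin n) (x : Eu n) :
    ‖fm (dil k q) (a * pdc j g) x - a x * fm (dil k q) (pdc j g) x‖
      ≤ (mk (sd j q) + nk q) * (K * C) := by
  rw [commutator_pdc_eq k q ha hg hL hgL]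
  refine (norm_sub_le _ _).trans ?_
  rw [add_mul]
  have hC0 : 0 ≤ C := (norm_nonneg _).trans (hC x)
  refine add_le_add ?_ (norm_fm_dil_le (fun y => ?_) k q x)
  · rw [norm_mul, Complex.norm_real, Real.norm_of_nonneg (by positivity)]
    refine (mul_le_mul_of_nonneg_left (norm_commutator_le ha hg hL hC k (sd j q) x)
      (by positivity)).trans (le_of_eq ?_)
    rw [zpow_neg]; field_simp
  · rw [Pi.mul_apply, norm_mul]
    exact mul_le_mul (norm_pdc_le hL j y) (hC y) (norm_nonneg _) K.2

lemma eLpNorm_mul_le_sup {f g : Eu n → ℂ} {C : ℝ≥0} (hC : ∀ x, ‖f x‖ ≤ C) :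
    eLpNorm (f * g) 2 volume ≤ C * eLpNorm g 2 volume := by
  have := eLpNorm_le_nnreal_smul_eLpNorm_of_ae_le_mul (f := f * g) (g := g) (c := C)
    (μ := volume) (Filter.Eventually.of_forall fun x => by
      rw [Pi.mul_apply, nnnorm_mul]
      exact mul_le_mul_of_nonneg_right (hC x) (zero_le)) 2
  rwa [ENNReal.smul_def, smul_eq_mul] at this

end Symbols

/-! ### Littlewood–Paley projections and frequency localization of products. -/

section LittlewoodPaley
open SchwartzMap
variable {n : ℕ} {χ : Eu n → ℝ}

/-- The cutoff, as a Schwartz function. -/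
def chiS (hχ : IsLPCutoff χ) : 𝓢(Eu n, ℂ) :=
  HasCompactSupport.toSchwartzMap (f := fun ξ => (χ ξ : ℂ))
    (HasCompactSupport.intro (isCompact_closedBall (0 : Eu n) 1) fun ξ hξ => by
      rw [hχ.eq_zero ξ (by simpa using (le_of_lt (by simpa using hξ))), Complex.ofReal_zero])
    (Complex.ofRealCLM.contDiff.comp hχ.smooth)

lemma chiS_apply (hχ : IsLPCutoff χ) (ξ : Eu n) : chiS hχ ξ = (χ ξ : ℂ) := rfl

/-- The symbol of the Littlewood-Paley projection `P_0`. -/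
def phiS (hχ : IsLPCutoff χ) : 𝓢(Eu n, ℂ) := dil 1 (chiS hχ) - chiS hχ

lemma dil_phiS (hχ : IsLPCutoff χ) (k : ℤ) :
    dil k (phiS hχ) = dil (k + 1) (chiS hχ) - dil k (chiS hχ) := by
  rw [phiS, dil_sub_symbol, dil_dil]

/-- The symbol is supported in the unit ball. -/
def LowS (q : 𝓢(Eu n, ℂ)) : Prop := ∀ ξ, q ξ ≠ 0 → ‖ξ‖ < 1

/-- The symbol is supported in the standard dyadic annulus. -/
def RingS (q : 𝓢(Eu n, ℂ)) : Prop := ∀ ξ, q ξ ≠ 0 → 1 / 2 < ‖ξ‖ ∧ ‖ξ‖ < 2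

lemma lowS_chiS (hχ : IsLPCutoff χ) : LowS (chiS hχ) := by
  intro ξ h
  by_contra h1
  exact h (by rw [chiS_apply, hχ.eq_zero ξ (not_lt.1 h1), Complex.ofReal_zero])

lemma ringS_phiS (hχ : IsLPCutoff χ) : RingS (phiS hχ) := by
  intro ξ h
  have e : phiS hχ ξ = ((χ ((2 : ℝ) ^ (-1 : ℤ) • ξ) : ℝ) : ℂ) - (χ ξ : ℂ) := rfl
  have hn := norm_zpow_smul 1 ξ
  norm_num at hn
  constructor
  · by_contra h1
    rw [not_lt] at h1
    refine h ?_
    rw [e, hχ.eq_one ξ h1, hχ.eq_one _ (by rw [norm_zpow_smul]; norm_num; linarith), sub_self]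
  · by_contra h1
    rw [not_lt] at h1
    refine h ?_
    rw [e, hχ.eq_zero ξ (by linarith), hχ.eq_zero _ (by rw [norm_zpow_smul]; norm_num; linarith),
      sub_self]

lemma RingS.annular {q : 𝓢(Eu n, ℂ)} (h : RingS q) : Annular q :=
  ⟨1 / 2, 2, by norm_num, by norm_num, fun ξ hξ => ⟨(h ξ hξ).1.le, (h ξ hξ).2.le⟩⟩

lemma RingS.of_support {q s : 𝓢(Eu n, ℂ)} (hq : RingS q) (h : ∀ ξ, s ξ ≠ 0 → q ξ ≠ 0) :
    RingS s := fun ξ hξ => hq ξ (h ξ hξ)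

lemma LowS.of_support {q s : 𝓢(Eu n, ℂ)} (hq : LowS q) (h : ∀ ξ, s ξ ≠ 0 → q ξ ≠ 0) :
    LowS s := fun ξ hξ => hq ξ (h ξ hξ)

lemma RingS.sd {q : 𝓢(Eu n, ℂ)} (hq : RingS q) (j : Fin n) : RingS (sd j q) :=
  hq.of_support (sd_support j q)

lemma LowS.sd {q : 𝓢(Eu n, ℂ)} (hq : LowS q) (j : Fin n) : LowS (Paradiff.sd j q) :=
  hq.of_support (sd_support j q)

lemma LowS.dil {q : 𝓢(Eu n, ℂ)} (hq : LowS q) {k : ℤ} {ξ : Eu n} (h : dil k q ξ ≠ 0) :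
    ‖ξ‖ < 2 ^ k := by
  have : ‖(2 : ℝ) ^ (-k) • ξ‖ < 1 := hq _ h
  rw [norm_zpow_smul, zpow_neg, inv_mul_lt_iff₀ (by positivity), mul_one] at this
  exact this

lemma RingS.dil {q : 𝓢(Eu n, ℂ)} (hq : RingS q) {k : ℤ} {ξ : Eu n} (h : dil k q ξ ≠ 0) :
    (2 : ℝ) ^ (k - 1) < ‖ξ‖ ∧ ‖ξ‖ < 2 ^ (k + 1) := by
  have : 1 / 2 < ‖(2 : ℝ) ^ (-k) • ξ‖ ∧ ‖(2 : ℝ) ^ (-k) • ξ‖ < 2 := hq _ h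
  rw [norm_zpow_smul, zpow_neg, inv_mul_lt_iff₀ (by positivity), lt_inv_mul_iff₀ (by positivity)]
    at this
  rw [zpow_sub_one₀ two_ne_zero, zpow_add_one₀ two_ne_zero]
  exact ⟨by linarith [this.1], this.2⟩

lemma zpow_two_le {k l : ℤ} (h : k ≤ l) : (2 : ℝ) ^ k ≤ 2 ^ l :=
  zpow_le_zpow_right₀ one_le_two h

/-- Paraproduct terms are localized in frequency. -/
lemma fm_para_eq_zero {f g : Eu n → ℂ} (hf : BM f) (hg : BM g) {q r s : 𝓢(Eu n, ℂ)} (hq : LowS q)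
    (hr : RingS r) (hs : RingS s) {k l : ℤ} (hkl : 3 ≤ |l - k|) :
    fm (dil l s) (fm (dil (k - 8) q) f * fm (dil k r) g) = 0 := by
  refine fm_mul_eq_zero hf hg fun ξ η => ?_
  by_contra h
  have h1 := hq.dil (left_ne_zero_of_mul (left_ne_zero_of_mul h))
  have h2 := hr.dil (right_ne_zero_of_mul (left_ne_zero_of_mul h))
  have h3 := hs.dil (right_ne_zero_of_mul h)
  have t1 := norm_add_le ξ η
  have t2 : ‖η‖ ≤ ‖ξ + η‖ + ‖ξ‖ := by
    have := norm_sub_le (ξ + η) ξ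
    rwa [add_sub_cancel_left] at this
  have p : (0 : ℝ) < 2 ^ k := by positivity
  -- The sum frequency has norm between `(1/2 - 1/256) * 2 ^ k` and `(2 + 1/256) * 2 ^ k`. For `l ≥
  -- k + 3` the ring at `l` lies beyond `4 * 2 ^ k`, and for `l ≤ k - 3` inside `2 ^ k / 4`.
  have e1 : (2 : ℝ) ^ (k - 8) = 2 ^ k / 256 := by
    rw [zpow_sub₀ two_ne_zero]; norm_num
  rw [zpow_sub_one₀ two_ne_zero, zpow_add_one₀ two_ne_zero] at h2
  rcases le_abs.1 hkl with h4 | h4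
  · have := zpow_two_le (k := k + 2) (l := l - 1) (by linarith)
    have e2 : (2 : ℝ) ^ (k + 2) = 2 ^ k * 4 := by
      rw [zpow_add₀ two_ne_zero]; norm_num
    linarith [h2.1, h2.2, h3.1, h3.2]
  · have := zpow_two_le (k := l + 1) (l := k - 2) (by linarith)
    have e2 : (2 : ℝ) ^ (k - 2) = 2 ^ k / 4 := by
      rw [zpow_sub₀ two_ne_zero]; norm_num
    linarith [h2.1, h2.2, h3.1, h3.2]

/-- High-high interactions have no frequencies above the common scale. -/
lemma fm_high_eq_zero {f g : Eu n → ℂ} (hf : BM f) (hg : BM g) {q r s : 𝓢(Eu n, ℂ)} (hq : RingS q)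
    (hr : RingS r) (hs : RingS s) {i k l : ℤ} (hik : i ≤ k + 8) (hkl : k + 12 ≤ l) :
    fm (dil l s) (fm (dil i q) f * fm (dil k r) g) = 0 := by
  refine fm_mul_eq_zero hf hg fun ξ η => ?_
  by_contra h
  have h1 := hq.dil (left_ne_zero_of_mul (left_ne_zero_of_mul h))
  have h2 := hr.dil (right_ne_zero_of_mul (left_ne_zero_of_mul h))
  have h3 := hs.dil (right_ne_zero_of_mul h)
  have t1 := norm_add_le ξ η
  -- Both frequencies are below `2 ^ (k + 9)`, so their sum is below `2 ^ (k + 10) ≤ 2 ^ (l - 1)`,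
  -- the inner radius of the ring at `l`.
  have a1 := zpow_two_le (k := i + 1) (l := k + 9) (by linarith)
  have a2 := zpow_two_le (k := k + 1) (l := k + 9) (by linarith)
  have a3 := zpow_two_le (k := k + 10) (l := l - 1) (by linarith)
  have e : (2 : ℝ) ^ (k + 10) = 2 ^ (k + 9) * 2 := by
    rw [← zpow_add_one₀ two_ne_zero]; congr 1; ring
  linarith [h1.2, h2.2, h3.1]

lemma fm_phiS (hχ : IsLPCutoff χ) {f : Eu n → ℂ} (hf : BM f) (k : ℤ) :
    fm (dil k (phiS hχ)) f = fm (dil (k + 1) (chiS hχ)) f - fm (dil k (chiS hχ)) f := by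
  rw [dil_phiS, fm_symbol_sub hf]

/-- Bernstein from L² to L^∞ at low frequencies. The dilated kernel is bounded by a multiple of `(2
^ k) ^ n`, hence of `2 ^ k` since `k ≤ 0` and `0 < n`. The resulting decay makes series converge as
`k → -∞`. -/
lemma norm_fm_dil_le_of_memLp (hn : 0 < n) (q : 𝓢(Eu n, ℂ)) : ∃ C : ℝ≥0, ∀ (k : ℤ), k ≤ 0 →
    ∀ f : Eu n → ℂ, Measurable f → ∀ x,
      ‖fm (dil k q) f x‖ₑ ^ 2 ≤ C * 2 ^ k * eLpNorm f 2 volume ^ 2 := by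
  obtain ⟨S, hS⟩ : ∃ S : ℝ≥0, ∀ x, ‖ker q x‖ₑ ≤ S := by
    obtain ⟨C, hC⟩ := (ker q).decay 0 0
    refine ⟨C.toNNReal, fun x => ?_⟩
    have := hC.2 x
    simp only [pow_zero, one_mul, norm_iteratedFDeriv_zero] at this
    rw [enorm_eq_nnnorm, ENNReal.coe_le_coe]
    exact NNReal.le_toNNReal_of_coe_le this
  refine ⟨nk q * S, fun k hk f hf x => ?_⟩
  have hS2 (y : Eu n) : ‖ker (dil k q) y‖ₑ ≤ 2 ^ k * S := by
    rw [ker_dil]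
    rw [enorm_mul]
    refine mul_le_mul' ?_ (hS _)
    rw [← ofReal_norm, Complex.norm_real, Real.norm_of_nonneg (by positivity), ← enorm_two_zpow,
      Real.enorm_of_nonneg (by positivity)]
    apply ENNReal.ofReal_le_ofReal
    exact pow_le_of_le_one (by positivity) (zpow_le_one_of_nonpos₀ one_le_two hk) hn.ne'
  have hm : Measurable fun y => ‖f (x - y)‖ₑ := (hf.comp (by fun_prop)).enorm
  calc ‖fm (dil k q) f x‖ₑ ^ 2
      ≤ (∫⁻ y, ‖ker (dil k q) y‖ₑ * ‖f (x - y)‖ₑ) ^ 2 := by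
        gcongr; exact enorm_cv_le _ _ _
    _ ≤ (∫⁻ y, ‖ker (dil k q) y‖ₑ) * ∫⁻ y, ‖ker (dil k q) y‖ₑ * ‖f (x - y)‖ₑ ^ 2 :=
        sq_lintegral_mul_le (ker _).continuous.measurable.enorm hm
    _ ≤ nk q * ∫⁻ y, (2 ^ k * S) * ‖f (x - y)‖ₑ ^ 2 := by
        rw [lintegral_ker_dil_one]
        gcongr with y
        exact hS2 y
    _ = _ := by
        rw [lintegral_const_mul _ (hm.pow_const 2), eLpNorm_two_sq,
          lintegral_sub_left_eq_self (fun y => ‖f y‖ₑ ^ 2) x]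
        push_cast; ring

/-- The two ring symbols telescope to the cutoff at scale `j + 2`, which is `1` here, minus the one
at scale `j`, which is `0`. -/
lemma chi_add_chi (hχ : IsLPCutoff χ) {j : ℤ} {ξ : Eu n} (h1 : (2 : ℝ) ^ j ≤ ‖ξ‖)
    (h2 : ‖ξ‖ ≤ (2 : ℝ) ^ (j + 1)) : dil j (phiS hχ) ξ + dil (j + 1) (phiS hχ) ξ = 1 := by
  have e1 : χ ((2 : ℝ) ^ (-(j + 1 + 1)) • ξ) = 1 := by
    apply hχ.eq_one
    rw [norm_zpow_smul, zpow_neg, inv_mul_le_iff₀ (by positivity), zpow_add_one₀ two_ne_zero]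
    linarith
  have e2 : χ ((2 : ℝ) ^ (-j) • ξ) = 0 := by
    apply hχ.eq_zero
    rw [norm_zpow_smul, zpow_neg, le_inv_mul_iff₀ (by positivity)]
    linarith
  have d (k : ℤ) : dil k (phiS hχ) ξ
      = (χ ((2 : ℝ) ^ (-(k + 1)) • ξ) : ℂ) - (χ ((2 : ℝ) ^ (-k) • ξ) : ℂ) := by
    rw [dil_phiS]; rfl
  rw [d, d, e1, e2]
  push_cast; ring

/-- The square function controls the homogeneous Sobolev norm. -/
lemma hsq_le (hχ : IsLPCutoff χ) (hn : 0 < n) {σ : ℝ} (hσ : 0 ≤ σ) {f : Eu n → ℂ} (hf : BM f)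
    (hf2 : MemLp f 2 volume) : hsq σ f ≤ (2 * wt σ 1) ^ 2 *
      ∑' k : ℤ, (wt σ k * eLpNorm (fm (dil k (phiS hχ)) f) 2 volume) ^ 2 := by
  have e (k : ℤ) : (wt σ k * eLpNorm (fm (dil k (phiS hχ)) f) 2 volume) ^ 2
      = ∫⁻ ξ, (wt σ k * (‖dil k (phiS hχ) ξ‖ₑ * ‖fhat f ξ‖ₑ)) ^ 2 := by
    rw [← eLpNorm_fhat (MemLp.fm hf2 hf _), mul_pow, eLpNorm_two_sq, ← lintegral_const_mul' _ _
      (ENNReal.pow_ne_top (wt_ne_top σ k))]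
    refine lintegral_congr_ae ((fhat_fm hf hf2 (dil k (phiS hχ))).mono fun ξ h => ?_)
    simp only
    rw [h, enorm_mul]; ring
  simp only [e]
  rw [← lintegral_tsum fun k => ?_, ← lintegral_const_mul' _ _ (ENNReal.pow_ne_top (ENNReal.mul_ne_top (by simp) (wt_ne_top σ 1)))]
  · refine lintegral_mono_ae ?_
    have := Fin.pos_iff_nonempty.1 hn
    filter_upwards [compl_mem_ae_iff.2 (measure_singleton (0 : Eu n))] with ξ hξ
    have hξ : ξ ≠ 0 := hξ
    obtain ⟨j, h1, h2⟩ := exists_zpow_near hξ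
    have c1 : (2 : ℝ) ^ j ≤ ‖ξ‖ := by
      rw [wt_one, ← enorm_two_zpow, Real.enorm_of_nonneg (by positivity), ← ofReal_norm] at h1
      exact (ENNReal.ofReal_le_ofReal_iff (norm_nonneg _)).1 h1
    have c2 : ‖ξ‖ ≤ (2 : ℝ) ^ (j + 1) := by
      have e : 2 * wt 1 j = ‖(2 : ℝ) ^ (j + 1)‖ₑ := by
        rw [enorm_two_zpow, ENNReal.zpow_add (by simp) (by simp), zpow_one, wt_one, mul_comm]
      rw [e, Real.enorm_of_nonneg (by positivity), ← ofReal_norm] at h2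
      exact (ENNReal.ofReal_le_ofReal_iff (by positivity)).1 h2.le
    have hw : ‖ξ‖ₑ ^ σ ≤ wt σ (j + 1) := by
      have : wt σ (j + 1) = (wt 1 (j + 1)) ^ σ := by
        unfold wt
        rw [← ENNReal.rpow_mul]; congr 1; ring
      rw [this, wt_add, wt_one 1, zpow_one, mul_comm]
      exact ENNReal.rpow_le_rpow h2.le hσ
    have hone : 1 ≤ wt σ 1 := by
      unfold wt
      rw [← ENNReal.rpow_zero (x := 2)]
      exact ENNReal.rpow_le_rpow_of_exponent_le one_le_two (by simpa using hσ)
    -- Two neighbouring symbols add up to `1`, so one of them has modulus at least `1/2`; that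
    -- single index bounds the whole sum from below.
    obtain ⟨l, hl, hl2⟩ : ∃ l : ℤ, 1 ≤ 2 * ‖dil l (phiS hχ) ξ‖ₑ ∧ ‖ξ‖ₑ ^ σ ≤ wt σ 1 * wt σ l := by
      have hs : (1 : ℝ≥0∞) ≤ ‖dil j (phiS hχ) ξ‖ₑ + ‖dil (j + 1) (phiS hχ) ξ‖ₑ := by
        refine le_trans ?_ (enorm_add_le _ _)
        rw [chi_add_chi hχ c1 c2]; simp
      rcases le_total ‖dil j (phiS hχ) ξ‖ₑ ‖dil (j + 1) (phiS hχ) ξ‖ₑ with h | h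
      · refine ⟨j + 1, hs.trans (by rw [two_mul]; gcongr), hw.trans (le_mul_of_one_le_left' hone)⟩
      · refine ⟨j, hs.trans (by rw [two_mul]; gcongr), hw.trans (by rw [wt_add, mul_comm])⟩
    calc (‖ξ‖ₑ ^ σ * ‖fhat f ξ‖ₑ) ^ 2
        ≤ ((wt σ 1 * wt σ l) * (2 * ‖dil l (phiS hχ) ξ‖ₑ) * ‖fhat f ξ‖ₑ) ^ 2 := by
          gcongr
          exact hl2.trans (le_mul_of_one_le_right' hl)
      _ = (2 * wt σ 1) ^ 2 * (wt σ l * (‖dil l (phiS hχ) ξ‖ₑ * ‖fhat f ξ‖ₑ)) ^ 2 := by ring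
      _ ≤ _ := by
          gcongr
          exact ENNReal.le_tsum (f := fun l => (wt σ l * (‖dil l (phiS hχ) ξ‖ₑ * ‖fhat f ξ‖ₑ)) ^ 2) l
  · exact (((dil k (phiS hχ)).continuous.measurable.enorm.aemeasurable.mul
      (memLp_fhat f).1.enorm).const_mul _).pow_const 2

lemma conj_wave (ξ x : Eu n) : (starRingEnd ℂ) (wave ξ x) = wave (-ξ) x := by
  unfold wave
  rw [← Complex.exp_conj, map_mul, Complex.conj_ofReal, Complex.conj_I, inner_neg_left]
  congr 1; push_cast; ring

/-- A radial symbol is even, so its real kernel coincides with the complex one and taking the real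
part in `lowKernel` loses nothing. -/
lemma ker_chiS_real (hχ : IsLPCutoff χ) (k : ℤ) (x : Eu n) :
    ((lowKernel χ k x : ℝ) : ℂ) = ker (dil k (chiS hχ)) x := by
  have h : (starRingEnd ℂ) (ker (dil k (chiS hχ)) x) = ker (dil k (chiS hχ)) x := by
    rw [ker_coe, fourierInv_eq_wave, ← integral_conj, ← integral_neg_eq_self]
    congr 1; ext ξ
    rw [map_mul, conj_wave, neg_neg]
    congr 1
    show (starRingEnd ℂ) ((χ ((2 : ℝ) ^ (-k) • -ξ) : ℝ) : ℂ) = ((χ ((2 : ℝ) ^ (-k) • ξ) : ℝ) : ℂ)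
    rw [Complex.conj_ofReal, hχ.radial _ ((2 : ℝ) ^ (-k) • ξ) (by rw [smul_neg, norm_neg])]
  rw [← Complex.conj_eq_iff_re.1 h, ker_coe]
  rfl

/-- Real functions as complex functions. -/
def cx (f : Eu n → ℝ) (x : Eu n) : ℂ := (f x : ℂ)

lemma lowFreq_eq (hχ : IsLPCutoff χ) (k : ℤ) (f : Eu n → ℝ) :
    cx (lowFreq χ k f) = fm (dil k (chiS hχ)) (cx f) := by
  ext x
  simp only [cx, lowFreq, fm, cv]
  rw [← integral_complex_ofReal]
  congr 1; ext y
  rw [Complex.ofReal_mul, ker_chiS_real hχ]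

lemma dyadic_eq (hχ : IsLPCutoff χ) (k : ℤ) {f : Eu n → ℝ} (hf : BM (cx f)) :
    cx (dyadic χ k f) = fm (dil k (phiS hχ)) (cx f) := by
  rw [fm_phiS hχ hf, ← lowFreq_eq, ← lowFreq_eq]
  ext x
  simp [cx, dyadic]

end LittlewoodPaley

/-! ### Uniformly convergent series of frequency pieces and almost orthogonality. -/

section Synthesis
open SchwartzMap
variable {n : ℕ}

/-- Series of functions with a summable uniform bound. -/
def UConv (t : ℤ → Eu n → ℂ) : Prop := ∃ b : ℤ → ℝ, Summable b ∧ ∀ k x, ‖t k x‖ ≤ b k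

/-- The sum of a series of functions. -/
def su (t : ℤ → Eu n → ℂ) (x : Eu n) : ℂ := ∑' k, t k x

variable {t s : ℤ → Eu n → ℂ}

lemma UConv.hasSum (h : UConv t) (x : Eu n) : HasSum (fun k => t k x) (su t x) := by
  obtain ⟨b, hb, h⟩ := h
  exact (Summable.of_norm_bounded hb fun k => h k x).hasSum

lemma UConv.bm (h : UConv t) (ht : ∀ k, Measurable (t k)) (k : ℤ) : BM (t k) := by
  obtain ⟨b, hb, h⟩ := h
  exact ⟨ht k, b k, h k⟩

lemma UConv.bm_su (h : UConv t) (ht : ∀ k, Measurable (t k)) : BM (su t) := by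
  constructor
  · refine measurable_of_tendsto_metrizable' (Filter.atTop : Filter (Finset ℤ))
      (f := fun S x => ∑ k ∈ S, t k x) (fun S => Finset.measurable_sum S fun k _ => ht k) ?_
    rw [tendsto_pi_nhds]
    exact fun x => h.hasSum x
  · obtain ⟨b, hb, h⟩ := h
    exact ⟨∑' k, b k, fun x => tsum_of_norm_bounded hb.hasSum fun k => h k x⟩

lemma UConv.add (h : UConv t) (h' : UConv s) : UConv (t + s) := by
  obtain ⟨b, hb, h⟩ := h
  obtain ⟨c, hc, h'⟩ := h'
  exact ⟨b + c, hb.add hc, fun k x => (norm_add_le _ _).trans (add_le_add (h k x) (h' k x))⟩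

lemma UConv.neg (h : UConv t) : UConv (-t) := by
  obtain ⟨b, hb, h⟩ := h
  exact ⟨b, hb, fun k x => by simpa using h k x⟩

lemma UConv.sub (h : UConv t) (h' : UConv s) : UConv (t - s) := by
  rw [sub_eq_add_neg]; exact h.add h'.neg

lemma su_add (h : UConv t) (h' : UConv s) : su (t + s) = su t + su s := by
  ext x
  exact ((h.hasSum x).add (h'.hasSum x)).tsum_eq

lemma su_sub (h : UConv t) (h' : UConv s) : su (t - s) = su t - su s := by
  ext x
  exact ((h.hasSum x).sub (h'.hasSum x)).tsum_eq

lemma UConv.sum {ι : Type*} (S : Finset ι) {T : ι → ℤ → Eu n → ℂ} (h : ∀ i ∈ S, UConv (T i)) :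
    UConv (∑ i ∈ S, T i) := by
  classical
  induction S using Finset.induction_on with
  | empty => exact ⟨0, summable_zero, by simp⟩
  | insert a S ha ih =>
    rw [Finset.sum_insert ha]
    exact (h a (by simp)).add (ih fun i hi => h i (by simp [hi]))

lemma su_sum {ι : Type*} (S : Finset ι) {T : ι → ℤ → Eu n → ℂ} (h : ∀ i ∈ S, UConv (T i)) :
    su (∑ i ∈ S, T i) = ∑ i ∈ S, su (T i) := by
  ext x
  have := hasSum_sum (fun i hi => (h i hi).hasSum x)
  simp only [su, Finset.sum_apply]
  exact this.tsum_eq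

lemma UConv.mono (h : UConv s) {C : ℝ} (hC : ∀ k x, ‖t k x‖ ≤ C * ‖s k x‖) (hC0 : 0 ≤ C) :
    UConv t := by
  obtain ⟨b, hb, h⟩ := h
  exact ⟨fun k => C * b k, hb.mul_left _,
    fun k x => (hC k x).trans (mul_le_mul_of_nonneg_left (h k x) hC0)⟩

/-- High frequencies decay like `2 ^ (-k)` by the Lipschitz bound. At low frequencies the embedding
from L² gives only half a power, hence the base `√2`. -/
lemma UConv.of_bounds {C D : ℝ} (h1 : ∀ k x, ‖t k x‖ ≤ C * 2 ^ (-k))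
    (h2 : ∀ k ≤ 0, ∀ x, ‖t k x‖ ≤ D * (√2) ^ k) : UConv t := by
  refine ⟨fun k => if k ≤ 0 then D * (√2) ^ k else C * 2 ^ (-k), ?_, fun k x => ?_⟩
  · have e1 : ∀ m : ℕ, (2 : ℝ) ^ (-((m : ℤ) + 1)) = (1 / 2) ^ m * (1 / 2) := fun m => by
      rw [zpow_neg, zpow_add_one₀ two_ne_zero, zpow_natCast, mul_inv, one_div, inv_pow]
    have e2 : ∀ m : ℕ, (√2) ^ (-(m : ℤ)) = (1 / √2) ^ m := fun m => by
      rw [zpow_neg, zpow_natCast]; simp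
    have h2 : (1 : ℝ) < √2 := by rw [Real.lt_sqrt] <;> norm_num
    apply Summable.of_nat_of_neg
    · rw [← summable_nat_add_iff 1]
      have : ∀ m : ℕ, (if ((m + 1 : ℕ) : ℤ) ≤ 0 then D * (√2) ^ ((m + 1 : ℕ) : ℤ)
          else C * 2 ^ (-((m + 1 : ℕ) : ℤ))) = C * ((1 / 2) ^ m * (1 / 2)) := fun m => by
        rw [if_neg (by push_cast; linarith), ← e1]; push_cast; rfl
      simp only [this]
      exact ((summable_geometric_of_lt_one (by norm_num) (by norm_num)).mul_right _).mul_left _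
    · have : ∀ m : ℕ, (if (-(m : ℤ)) ≤ 0 then D * (√2) ^ (-(m : ℤ)) else C * 2 ^ (-(-(m : ℤ))))
          = D * (1 / √2) ^ m := fun m => by rw [if_pos (by simp), e2]
      simp only [this]
      exact (summable_geometric_of_lt_one (by positivity)
        (by rw [div_lt_one (by positivity)]; exact h2)).mul_left _
  · simp only
    split_ifs with h
    · exact h2 k h x
    · exact h1 k x

/-- Multipliers commute with uniformly convergent series. -/
lemma UConv.hasSum_fm (h : UConv t) (ht : ∀ k, Measurable (t k)) (q : 𝓢(Eu n, ℂ)) (x : Eu n) :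
    HasSum (fun k => fm q (t k) x) (fm q (su t) x) := by
  have hb := h.bm ht
  obtain ⟨b, hs, h⟩ := h
  have := hasSum_integral_of_summable_integral_norm (F := fun k y => ker q (x - y) * t k y)
    (μ := volume) (fun k => cv_integrable (ker q).integrable (hb k) x) ?_
  · simp only [tsum_mul_left] at this
    exact this
  · refine Summable.of_nonneg_of_le (fun k => by positivity) (fun k => ?_)
      (hs.mul_left (∫ y, ‖ker q (x - y)‖))
    rw [← integral_mul_const]
    refine integral_mono_of_nonneg (Filter.Eventually.of_forall fun y => by positivity)
      (((ker q).integrable.comp_sub_left x).norm.mul_const _) (Filter.Eventually.of_forall fun y => ?_)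
    simp only [norm_mul]
    exact mul_le_mul_of_nonneg_left (h k y) (norm_nonneg _)

/-- Fatou's lemma for series of functions. -/
lemma eLpNorm_le_of_hasSum {F : Eu n → ℂ} (h : ∀ x, HasSum (fun k => t k x) (F x))
    (ht : ∀ k, Measurable (t k)) {C : ℝ≥0∞}
    (hC : ∀ S : Finset ℤ, eLpNorm (∑ k ∈ S, t k) 2 volume ≤ C) : eLpNorm F 2 volume ≤ C := by
  obtain ⟨u, hu⟩ := Filter.exists_seq_tendsto (Filter.atTop : Filter (Finset ℤ))
  refine (Lp.eLpNorm_lim_le_liminf_eLpNorm (f := fun m => ∑ k ∈ u m, t k) (fun m => ?_) F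
    (Filter.Eventually.of_forall fun x => ?_)).trans ?_
  · have := (Finset.measurable_sum (u m) fun k _ => ht k).aestronglyMeasurable (μ := volume)
    rwa [← Finset.sum_fn] at this
  · have := (h x).comp hu
    refine this.congr fun m => ?_
    simp
  · refine Filter.liminf_le_of_le (by isBoundedDefault) fun b hb => ?_
    obtain ⟨m, hm⟩ := hb.exists
    exact hm.trans (hC _)

lemma eLpNorm_le_tsum {F : Eu n → ℂ} (h : ∀ x, HasSum (fun k => t k x) (F x))
    (ht : ∀ k, Measurable (t k)) : eLpNorm F 2 volume ≤ ∑' k, eLpNorm (t k) 2 volume :=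
  eLpNorm_le_of_hasSum h ht fun S =>
    (eLpNorm_sum_le (fun k _ => (ht k).aestronglyMeasurable) one_le_two).trans
      (ENNReal.sum_le_tsum S)

/-- A Schur test for synthesis: if the piece at `l` of the term `k` is bounded by `c (l - k) * x k`,
the weighted norm of the sum is a discrete convolution. Band limited terms, Moser's telescoping
series and the remainder all enter through it. -/
lemma tsum_wt_fm_su_le (h : UConv t) (ht : ∀ k, Measurable (t k)) (q : 𝓢(Eu n, ℂ)) (σ : ℝ)
    {c x : ℤ → ℝ≥0∞} (hc : ∀ l k, eLpNorm (fm (dil l q) (t k)) 2 volume ≤ c (l - k) * x k) :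
    ∑' l, (wt σ l * eLpNorm (fm (dil l q) (su t)) 2 volume) ^ 2
      ≤ (∑' j, wt σ j * c j) ^ 2 * ∑' k, (wt σ k * x k) ^ 2 := by
  refine le_trans (ENNReal.tsum_le_tsum fun l => ?_) (tsum_wt_sq_conv_le σ c x)
  gcongr
  exact (eLpNorm_le_tsum (h.hasSum_fm ht _) fun k => ((h.bm ht k).fm _).meas).trans
    (ENNReal.tsum_le_tsum fun k => hc l k)

lemma uConv_finset (S : Finset ℤ) (ht : ∀ k, BM (t k)) :
    UConv (fun k => if k ∈ S then t k else 0) := by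
  choose C hC using fun k => (ht k).bdd
  refine ⟨fun k => if k ∈ S then C k else 0, ?_, fun k x => ?_⟩
  · exact summable_of_ne_finset_zero (s := S) fun k hk => if_neg hk
  · simp only
    split_ifs
    · exact hC k x
    · simp

lemma su_finset (S : Finset ℤ) : su (fun k => if k ∈ S then t k else 0) = ∑ k ∈ S, t k := by
  ext x
  rw [su, tsum_eq_sum (s := S) fun k hk => by simp [hk], Finset.sum_apply]
  exact Finset.sum_congr rfl fun k hk => by simp [hk]

variable {χ : Eu n → ℝ}

/-- The weights of bands. -/
def bandConst (σ : ℝ) : ℝ≥0∞ := ∑' j : ℤ, wt σ j * if |j| ≤ 2 then 1 else 0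

lemma bandConst_ne_top (σ : ℝ) : bandConst σ ≠ ⊤ := by
  rw [bandConst, tsum_eq_sum (s := Finset.Icc (-2 : ℤ) 2)]
  · refine (ENNReal.sum_lt_top.2 fun j _ => ?_).ne
    split_ifs <;> simp [(wt_ne_top σ j).lt_top]
  · intro j hj
    rw [if_neg, mul_zero]
    rwa [Finset.mem_Icc, ← abs_le] at hj

/-- Sums of terms localized in dyadic annuli. -/
lemma tsum_wt_fm_band (hχ : IsLPCutoff χ) (h : UConv t) (ht : ∀ k, Measurable (t k)) (σ : ℝ)
    (h0 : ∀ l k, 3 ≤ |l - k| → fm (dil l (phiS hχ)) (t k) = 0) :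
    ∑' l, (wt σ l * eLpNorm (fm (dil l (phiS hχ)) (su t)) 2 volume) ^ 2
      ≤ (bandConst σ * nk (phiS hχ)) ^ 2 * ∑' k, (wt σ k * eLpNorm (t k) 2 volume) ^ 2 := by
  refine (tsum_wt_fm_su_le h ht (phiS hχ) σ (c := fun j => (if |j| ≤ 2 then 1 else 0) * nk (phiS hχ))
    (x := fun k => eLpNorm (t k) 2 volume) fun l k => ?_).trans (le_of_eq ?_)
  · split_ifs with hlk
    · rw [one_mul]; exact eLpNorm_fm_dil_le (ht k) _ _
    · rw [h0 l k (by omega)]; simp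
  · simp only [← mul_assoc, ENNReal.tsum_mul_right]
    rfl

/-- Almost orthogonality of terms localized in dyadic annuli. -/
lemma eLpNorm_sq_sum_le_band (hχ : IsLPCutoff χ) (hn : 0 < n) : ∃ C : ℝ≥0, ∀ t : ℤ → Eu n → ℂ,
    (∀ k, BM (t k)) → (∀ k, MemLp (t k) 2 volume) →
    (∀ l k, 3 ≤ |l - k| → fm (dil l (phiS hχ)) (t k) = 0) → ∀ S : Finset ℤ,
    eLpNorm (∑ k ∈ S, t k) 2 volume ^ 2 ≤ C * ∑' k, eLpNorm (t k) 2 volume ^ 2 := by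
  refine ⟨((2 * wt 0 1) ^ 2 * (bandConst 0 * nk (phiS hχ)) ^ 2).toNNReal, fun t ht h2 h0 S => ?_⟩
  have hCt : (2 * wt 0 1) ^ 2 * (bandConst 0 * nk (phiS hχ)) ^ 2 ≠ ⊤ := by
    have := bandConst_ne_top 0
    simp only [wt_zero_left]
    finiteness
  rw [ENNReal.coe_toNNReal hCt]
  have hm : MemLp (∑ k ∈ S, t k) 2 volume := memLp_finsetSum' _ fun k _ => h2 k
  rw [← hsq_zero hm]
  refine (hsq_le hχ hn le_rfl (BM.sum S fun k _ => ht k) hm).trans ?_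
  rw [mul_assoc]
  gcongr
  -- A partial sum is regarded as a series with zero terms outside `S`, so that the band estimate
  -- for series applies with a constant independent of `S`.
  rw [← su_finset]
  refine (tsum_wt_fm_band hχ (uConv_finset S ht) (fun k => ?_) 0 fun l k hlk => ?_).trans ?_
  · split_ifs
    exacts [(ht k).meas, measurable_const]
  · split_ifs
    exacts [h0 l k hlk, fm_zero _]
  · gcongr with k
    rw [wt_zero_left, one_mul]
    split_ifs
    · rfl
    · simp

lemma sq_tsum_mul_le_mul {ι : Type*} (x y : ι → ℝ≥0∞) :
    (∑' k, x k * y k) ^ 2 ≤ (∑' k, x k ^ 2) * ∑' k, y k ^ 2 := by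
  let _ : MeasurableSpace ι := ⊤
  have h := ENNReal.lintegral_mul_le_Lp_mul_Lq (Measure.count : Measure ι)
    Real.HolderConjugate.two_two (f := x) (g := y) measurable_from_top.aemeasurable
    measurable_from_top.aemeasurable
  simp only [Pi.mul_apply, lintegral_count, ENNReal.rpow_two] at h
  calc (∑' k, x k * y k) ^ 2 ≤ ((∑' k, x k ^ 2) ^ (1 / 2 : ℝ) * (∑' k, y k ^ 2) ^ (1 / 2 : ℝ)) ^ 2 := by
        gcongr
    _ = _ := by
        rw [mul_pow, ← ENNReal.rpow_two, ← ENNReal.rpow_two, ← ENNReal.rpow_mul, ← ENNReal.rpow_mul]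
        norm_num

lemma lintegral_enorm_mul_le {f g : Eu n → ℂ} (hf : Measurable f) (hg : Measurable g) :
    ∫⁻ x, ‖f x‖ₑ * ‖g x‖ₑ ≤ eLpNorm f 2 volume * eLpNorm g 2 volume := by
  have h := ENNReal.lintegral_mul_le_Lp_mul_Lq (volume : Measure (Eu n))
    Real.HolderConjugate.two_two (f := fun x => ‖f x‖ₑ) (g := fun x => ‖g x‖ₑ)
    hf.enorm.aemeasurable hg.enorm.aemeasurable
  rw [eLpNorm_eq_lintegral_rpow_enorm_toReal (by simp) (by simp),
    eLpNorm_eq_lintegral_rpow_enorm_toReal (by simp) (by simp)]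
  simpa using h

/-- Testing a function without high frequencies. -/
lemma integral_conj_low (hχ : IsLPCutoff χ) {f H : Eu n → ℂ} (hf : BM f) (hf2 : MemLp f 2 volume)
    (hH : BM H) (hH2 : MemLp H 2 volume) {L : ℤ}
    (h0 : ∀ l, L ≤ l → fm (dil l (phiS hχ)) f = 0) :
    ∫ x, (starRingEnd ℂ) (H x) * f x
      = ∫ x, (starRingEnd ℂ) (fm (dil (L + 1) (chiS hχ)) H x) * f x := by
  rw [← integral_conj_fhat hH2 hf2, ← integral_conj_fhat (MemLp.fm hH2 hH _) hf2]
  have hz : ∀ᵐ ξ : Eu n, ∀ l : ℤ, L ≤ l → dil l (phiS hχ) ξ * fhat f ξ = 0 := by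
    rw [ae_all_iff]
    intro l
    by_cases hl : L ≤ l
    · have h1 := fhat_fm hf hf2 (dil l (phiS hχ))
      have h2 : fhat (0 : Eu n → ℂ) =ᵐ[volume] 0 := by
        have := eLpNorm_fhat (f := (0 : Eu n → ℂ)) MemLp.zero
        rw [eLpNorm_zero, eLpNorm_eq_zero_iff (memLp_fhat _).1 (by simp)] at this
        exact this
      rw [h0 l hl] at h1
      filter_upwards [h1, h2] with ξ h3 h4 _
      rw [← h3, h4]; rfl
    · exact Filter.Eventually.of_forall fun ξ h => absurd h hl
  refine integral_congr_ae ?_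
  filter_upwards [hz, fhat_fm hH hH2 (dil (L + 1) (chiS hχ))] with ξ h1 h2
  rw [h2, map_mul]
  by_cases hξ : ‖ξ‖ ≤ 2 ^ L
  · have : dil (L + 1) (chiS hχ) ξ = 1 := by
      show ((χ ((2 : ℝ) ^ (-(L + 1)) • ξ) : ℝ) : ℂ) = 1
      rw [hχ.eq_one, Complex.ofReal_one]
      rw [norm_zpow_smul, zpow_neg, inv_mul_le_iff₀ (by positivity), zpow_add_one₀ two_ne_zero]
      linarith
    rw [this]; simp
  -- Beyond `2 ^ L` two consecutive ring symbols with indices at least `L` add up to `1`, and both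
  -- annihilate the transform of `f`.
  · have : fhat f ξ = 0 := by
      rw [not_le] at hξ
      have hp : 0 < ‖ξ‖ := lt_trans (by positivity) hξ
      obtain ⟨j, hj1, hj2⟩ := exists_mem_Ico_zpow hp one_lt_two
      have hjL : L ≤ j := by
        have := (zpow_lt_zpow_iff_right₀ (one_lt_two (α := ℝ))).1 (hξ.trans hj2)
        linarith
      have hs := chi_add_chi hχ hj1 hj2.le
      calc fhat f ξ = (dil j (phiS hχ) ξ + dil (j + 1) (phiS hχ) ξ) * fhat f ξ := by
            rw [hs, one_mul]
        _ = 0 := by rw [add_mul, h1 j hjL, h1 (j + 1) (by linarith), add_zero]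
    rw [this]; simp

end Synthesis

/-! ### Gaussian multipliers and the variance inequality behind Carleson's estimate. -/

section Gaussian
open SchwartzMap
variable {n : ℕ}

lemma one_add_pow_mul_exp_le {s : ℝ} (hs : 0 < s) (N : ℕ) {t : ℝ} (ht : 0 ≤ t) :
    (1 + t) ^ N * Real.exp (-s * t ^ 2) ≤ (2 / s) ^ N * N.factorial * Real.exp s := by
  have h := Real.pow_div_factorial_le_exp (s * (1 + t ^ 2)) (by positivity) N
  rw [div_le_iff₀ (by positivity)] at h
  have e : Real.exp (s * (1 + t ^ 2)) * Real.exp (-s * t ^ 2) = Real.exp s := by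
    rw [← Real.exp_add]; ring_nf
  calc (1 + t) ^ N * Real.exp (-s * t ^ 2)
      ≤ (2 * (1 + t ^ 2)) ^ N * Real.exp (-s * t ^ 2) := by
        gcongr; nlinarith [sq_nonneg (t - 1)]
    _ = (2 / s) ^ N * (s * (1 + t ^ 2)) ^ N * Real.exp (-s * t ^ 2) := by
        rw [← mul_pow]; congr 2; field_simp
    _ ≤ (2 / s) ^ N * (Real.exp (s * (1 + t ^ 2)) * N.factorial) * Real.exp (-s * t ^ 2) := by
        gcongr
    _ = (2 / s) ^ N * N.factorial * (Real.exp (s * (1 + t ^ 2)) * Real.exp (-s * t ^ 2)) := by ring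
    _ = _ := by rw [e]

/-- Every derivative of `exp` is `exp` and the exponent has temperate growth, so derivatives of the
Gaussian are bounded by a power of `1 + ‖x‖` times the Gaussian. -/
lemma gaussian_decay {s : ℝ} (hs : 0 < s) (k m : ℕ) : ∃ C : ℝ, ∀ x : Eu n,
    ‖x‖ ^ k * ‖iteratedFDeriv ℝ m (fun x : Eu n => Real.exp (-s * ‖x‖ ^ 2)) x‖ ≤ C := by
  have htg : Function.HasTemperateGrowth (fun x : Eu n => -s * ‖x‖ ^ 2) := by
    have h1 := ((-s) • innerSL ℝ : Eu n →L[ℝ] Eu n →L[ℝ] ℝ).bilinear_hasTemperateGrowth (𝕜 := ℝ)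
      Function.HasTemperateGrowth.id' Function.HasTemperateGrowth.id'
    refine (congrArg _ ?_).mp h1
    ext x
    show -s * inner ℝ x x = _
    rw [real_inner_self_eq_norm_sq]
  obtain ⟨p, C, hC0, hC⟩ := htg.norm_iteratedFDeriv_le_uniform m
  refine ⟨m.factorial * (1 + C) ^ m * ((2 / s) ^ (k + p * m) * (k + p * m).factorial * Real.exp s),
    fun x => ?_⟩
  have h := norm_iteratedFDeriv_comp_le (𝕜 := ℝ) (g := Real.exp) (f := fun x : Eu n => -s * ‖x‖ ^ 2)
    (n := m) Real.contDiff_exp htg.1 (mod_cast le_top) x (C := Real.exp (-s * ‖x‖ ^ 2))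
    (D := (1 + C) * (1 + ‖x‖) ^ p) (fun i _ => ?_) (fun i hi hi2 => ?_)
  · have := one_add_pow_mul_exp_le hs (k + p * m) (norm_nonneg x)
    calc _ ≤ (1 + ‖x‖) ^ k * (m.factorial * Real.exp (-s * ‖x‖ ^ 2) *
          ((1 + C) * (1 + ‖x‖) ^ p) ^ m) := by
          gcongr
          · linarith
          · exact h
      _ = m.factorial * (1 + C) ^ m * ((1 + ‖x‖) ^ (k + p * m) * Real.exp (-s * ‖x‖ ^ 2)) := by
          rw [mul_pow, ← pow_mul, pow_add]; ring
      _ ≤ _ := by gcongr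
  · rw [norm_iteratedFDeriv_eq_norm_iteratedDeriv, iteratedDeriv_eq_iterate, Real.iter_deriv_exp,
      Real.norm_of_nonneg (Real.exp_nonneg _)]
  · have hx : 1 ≤ (1 + ‖x‖) ^ p := one_le_pow₀ (by linarith [norm_nonneg x])
    have h1 : 1 ≤ (1 + C) * (1 + ‖x‖) ^ p := by nlinarith
    calc _ ≤ C * (1 + ‖x‖) ^ p := hC i hi2 x
      _ ≤ (1 + C) * (1 + ‖x‖) ^ p := by gcongr; linarith
      _ ≤ _ := le_self_pow₀ h1 (by omega)

/-- The Gaussian `exp (-s |ξ|²)` as a real Schwartz function. -/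
def gauR {s : ℝ} (hs : 0 < s) : 𝓢(Eu n, ℝ) where
  toFun x := Real.exp (-s * ‖x‖ ^ 2)
  smooth' := Real.contDiff_exp.comp (contDiff_const.mul (contDiff_norm_sq ℝ))
  decay' := gaussian_decay hs

/-- The Gaussian `exp (-s |ξ|²)`. -/
def gau {s : ℝ} (hs : 0 < s) : 𝓢(Eu n, ℂ) :=
  SchwartzMap.bilinLeftCLM (ContinuousLinearMap.lsmul ℝ ℝ : ℝ →L[ℝ] ℂ →L[ℝ] ℂ)
    (Function.HasTemperateGrowth.const (1 : ℂ)) (gauR hs)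

lemma gau_apply {s : ℝ} (hs : 0 < s) (ξ : Eu n) : gau hs ξ = (Real.exp (-s * ‖ξ‖ ^ 2) : ℂ) := by
  show Real.exp (-s * ‖ξ‖ ^ 2) • (1 : ℂ) = _
  simp

/-- The kernel of the Gaussian multiplier. -/
def gk (n : ℕ) (s : ℝ) (x : Eu n) : ℝ :=
  (Real.pi / s) ^ (n / 2 : ℝ) * Real.exp (-(Real.pi ^ 2 / s) * ‖x‖ ^ 2)

lemma ker_gau {s : ℝ} (hs : 0 < s) (x : Eu n) : ker (gau hs) x = (gk n s x : ℂ) := by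
  have h := fourier_gaussian_innerProductSpace (V := Eu n) (b := (s : ℂ)) (by simpa) (-x)
  rw [ker_coe, Real.fourierInv_eq_fourier_neg]
  have e : (gau hs : Eu n → ℂ) = fun v => Complex.exp (-s * ‖v‖ ^ 2) := by
    ext v; rw [gau_apply]; push_cast; rfl
  rw [e, h, gk]
  push_cast
  rw [Complex.ofReal_cpow (by positivity)]
  simp only [finrank_euclideanSpace, Fintype.card_fin, norm_neg, Complex.ofReal_div,
    Complex.ofReal_natCast, Complex.ofReal_ofNat]
  congr 2
  ring

/-- A Bellman function inequality: when `b` and `h` are replaced by their means, the functional `2 *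
‖b * h‖² + 16 * β² * ‖h‖²` drops by at least the squared mean of `h` times the variance of `b`.
Iterated over scales, these drops form Carleson's sum. -/
lemma weighted_variance_le {Ω : Type*} [MeasurableSpace Ω] (μ : Measure Ω) [IsProbabilityMeasure μ]
    {b h : Ω → ℂ} (hb : Measurable b) (hh : Measurable h) {β : ℝ≥0} (hβ : ∀ y, ‖b y‖ ≤ β)
    (hD : ∃ D : ℝ, ∀ y, ‖h y‖ ≤ D) :
    ‖∫ y, h y ∂μ‖ ^ 2 * ∫ y, ‖b y - ∫ z, b z ∂μ‖ ^ 2 ∂μ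
        + 2 * (‖∫ y, b y ∂μ‖ ^ 2 * ‖∫ y, h y ∂μ‖ ^ 2) + 16 * β ^ 2 * ‖∫ y, h y ∂μ‖ ^ 2
      ≤ 2 * ∫ y, ‖b y * h y‖ ^ 2 ∂μ + 16 * β ^ 2 * ∫ y, ‖h y‖ ^ 2 ∂μ := by
  obtain ⟨D, hD⟩ := hD
  set B := ∫ y, b y ∂μ with hB
  set H := ∫ y, h y ∂μ with hH
  have ib : Integrable b μ := Integrable.of_bound hb.aestronglyMeasurable _ (ae_of_all _ hβ)
  have ih : Integrable h μ := Integrable.of_bound hh.aestronglyMeasurable _ (ae_of_all _ hD)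
  have hBβ : ‖B‖ ≤ β := by
    have := norm_integral_le_of_norm_le_const (μ := μ) (ae_of_all _ hβ)
    simpa using this
  have sqi : ∀ {g : Ω → ℂ} {c : ℝ}, Measurable g → (∀ y, ‖g y‖ ≤ c) →
      Integrable (fun y => ‖g y‖ ^ 2) μ := fun {g c} hg hc =>
    Integrable.of_bound (hg.norm.pow_const 2).aestronglyMeasurable (c ^ 2) (ae_of_all _ fun y => by
      rw [Real.norm_of_nonneg (by positivity)]
      exact pow_le_pow_left₀ (norm_nonneg _) (hc y) 2)
  have i1 := sqi hb hβ
  have i2 := sqi hh hD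
  have i3 : Integrable (fun y => ‖b y - B‖ ^ 2) μ :=
    sqi (hb.sub_const B) fun y => (norm_sub_le _ _).trans (add_le_add (hβ y) hBβ)
  have i4 : Integrable (fun y => ‖h y - H‖ ^ 2) μ :=
    sqi (hh.sub_const H) fun y => (norm_sub_le _ _).trans (add_le_add (hD y) le_rfl)
  have i5 : Integrable (fun y => ‖b y * h y‖ ^ 2) μ :=
    sqi (hb.mul hh) (c := β * D) fun y => by
      rw [norm_mul]; exact mul_le_mul (hβ y) (hD y) (norm_nonneg _) β.2
  have re0 : ∀ {g : Ω → ℂ} (_ : Integrable g μ) (c : ℂ),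
      ∫ y, ((starRingEnd ℂ) c * (g y - ∫ z, g z ∂μ)).re ∂μ = 0 := by
    intro g hg c
    have i : Integrable (fun y => (starRingEnd ℂ) c * (g y - ∫ z, g z ∂μ)) μ :=
      (hg.sub (integrable_const _)).const_mul _
    have := integral_re i
    simp only [RCLike.re_to_complex] at this
    rw [this, integral_const_mul, integral_sub hg (integrable_const _)]
    simp
  have var : ∀ {g : Ω → ℂ} (_ : Integrable g μ) (_ : Integrable (fun y => ‖g y‖ ^ 2) μ),
      ∫ y, ‖g y - ∫ z, g z ∂μ‖ ^ 2 ∂μ = ∫ y, ‖g y‖ ^ 2 ∂μ - ‖∫ z, g z ∂μ‖ ^ 2 := by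
    intro g hg hg2
    have e (y : Ω) : ‖g y - ∫ z, g z ∂μ‖ ^ 2 = ‖g y‖ ^ 2 - ‖∫ z, g z ∂μ‖ ^ 2
        - 2 * ((starRingEnd ℂ) (∫ z, g z ∂μ) * (g y - ∫ z, g z ∂μ)).re := by
      simp only [← Complex.normSq_eq_norm_sq, Complex.normSq_apply, Complex.mul_re, Complex.sub_re,
        Complex.sub_im, Complex.conj_re, Complex.conj_im]
      ring
    simp only [e]
    have i : Integrable (fun y => ((starRingEnd ℂ) (∫ z, g z ∂μ) * (g y - ∫ z, g z ∂μ)).re) μ :=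
      ((hg.sub (integrable_const _)).const_mul _).re
    have i' : Integrable (fun y => ‖g y‖ ^ 2 - ‖∫ z, g z ∂μ‖ ^ 2) μ := hg2.sub (integrable_const _)
    rw [integral_sub i' (i.const_mul 2), integral_const_mul, re0 hg,
      integral_sub hg2 (integrable_const _)]
    simp
  have ire : Integrable (fun y => ((starRingEnd ℂ) H * (h y - H)).re) μ :=
    ((ih.sub (integrable_const _)).const_mul _).re
  -- The term with `2 * ‖B‖ ^ 2` has mean zero and is inserted so that only `‖b y‖ ^ 2 - ‖B‖ ^ 2`,
  -- at most `2 * β * ‖b y - B‖`, multiplies the linear part of `h y - H`. The inequality of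
  -- arithmetic and geometric means then absorbs the product and fixes the constant `16`.
  have pt (y : Ω) : ‖H‖ ^ 2 * ‖b y‖ ^ 2 + 2 * ‖B‖ ^ 2 * ((starRingEnd ℂ) H * (h y - H)).re
      ≤ ‖b y * h y‖ ^ 2 + (1 / 2 * ‖H‖ ^ 2 * ‖b y - B‖ ^ 2 + 8 * β ^ 2 * ‖h y - H‖ ^ 2) := by
    have e : ‖h y‖ ^ 2 = ‖H‖ ^ 2 + 2 * ((starRingEnd ℂ) H * (h y - H)).re + ‖h y - H‖ ^ 2 := by
      simp only [← Complex.normSq_eq_norm_sq, Complex.normSq_apply, Complex.mul_re, Complex.sub_re,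
        Complex.sub_im, Complex.conj_re, Complex.conj_im]
      ring
    set ρ := ((starRingEnd ℂ) H * (h y - H)).re with hρ
    have h1 : |ρ| ≤ ‖H‖ * ‖h y - H‖ := by
      refine (Complex.abs_re_le_norm _).trans ?_
      rw [norm_mul, RCLike.norm_conj]
    have h2 : |‖b y‖ ^ 2 - ‖B‖ ^ 2| ≤ 2 * β * ‖b y - B‖ := by
      have h3 := abs_norm_sub_norm_le (b y) B
      rw [sq_sub_sq, abs_mul, abs_of_nonneg (by positivity)]
      have := hβ y
      exact mul_le_mul (by linarith) h3 (abs_nonneg _) (by positivity)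
    have h4 : |(‖b y‖ ^ 2 - ‖B‖ ^ 2) * ρ| ≤ (2 * β * ‖b y - B‖) * (‖H‖ * ‖h y - H‖) := by
      rw [abs_mul]; exact mul_le_mul h2 h1 (abs_nonneg _) (by positivity)
    have h5 := (abs_le.1 h4).1
    rw [norm_mul, mul_pow, e]
    nlinarith [sq_nonneg (‖H‖ * ‖b y - B‖ - 4 * β * ‖h y - H‖), sq_nonneg (‖b y‖ * ‖h y - H‖)]
  have i6 : Integrable (fun y => 1 / 2 * ‖H‖ ^ 2 * ‖b y - B‖ ^ 2 + 8 * β ^ 2 * ‖h y - H‖ ^ 2) μ :=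
    (i3.const_mul _).add (i4.const_mul _)
  have key := integral_mono (μ := μ) ((i1.const_mul (‖H‖ ^ 2)).add (ire.const_mul (2 * ‖B‖ ^ 2)))
    (i5.add i6) pt
  simp only [Pi.add_apply] at key
  rw [integral_add (i1.const_mul _) (ire.const_mul _), integral_add i5 i6] at key
  rw [integral_add (i3.const_mul _) (i4.const_mul _), integral_const_mul, integral_const_mul,
    integral_const_mul, integral_const_mul, re0 ih, var ih i2, var ib i1] at key
  rw [var ib i1]
  nlinarith [key]

/-- The local variance of `b` with respect to the kernel of `q`. -/
def lvar (q : 𝓢(Eu n, ℂ)) (b : Eu n → ℂ) (x : Eu n) : ℝ≥0∞ :=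
  ∫⁻ y, ‖ker q y‖ₑ * ‖b (x - y) - fm q b x‖ₑ ^ 2

lemma measurable_lvar (q : 𝓢(Eu n, ℂ)) {b : Eu n → ℂ} (hb : BM b) : Measurable (lvar q b) := by
  apply Measurable.lintegral_prod_right' (f := fun p : Eu n × Eu n =>
    ‖ker q p.2‖ₑ * ‖b (p.1 - p.2) - fm q b p.1‖ₑ ^ 2)
  have h1 := (ker q).continuous.measurable
  have h2 := hb.meas
  have h3 := (hb.fm q).meas
  fun_prop

section Step
variable {q : 𝓢(Eu n, ℂ)} {γ : Eu n → ℝ}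

lemma lintegral_ker_eq_one (hγ : ∀ x, ker q x = (γ x : ℂ)) (h0 : ∀ x, 0 ≤ γ x) (hq : q 0 = 1) :
    ∫⁻ y, ‖ker q y‖ₑ = 1 := by
  have h1 := integral_ker q
  have h2 : Integrable γ := by
    have := (ker q).integrable.re (μ := volume)
    simpa [hγ] using this
  simp only [hγ, hq] at h1 ⊢
  rw [integral_complex_ofReal] at h1
  have h3 : ∫ y, γ y = 1 := by exact_mod_cast h1
  calc ∫⁻ y, ‖(γ y : ℂ)‖ₑ = ∫⁻ y, ENNReal.ofReal (γ y) := by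
        congr 1; ext y
        rw [← ofReal_norm, Complex.norm_real, Real.norm_of_nonneg (h0 y)]
    _ = 1 := by rw [← ofReal_integral_eq_lintegral_ofReal h2 (ae_of_all _ h0), h3, ENNReal.ofReal_one]

/-- The variance inequality for the probability measure with density `ker q`, applied to `y ↦ b (x -
y)` and `y ↦ h (x - y)`. -/
lemma pointwise_step (hγ : ∀ x, ker q x = (γ x : ℂ)) (h0 : ∀ x, 0 ≤ γ x) (hq : q 0 = 1)
    {b h : Eu n → ℂ} (hb : BM b) (hh : BM h) {β : ℝ≥0} (hβ : ∀ x, ‖b x‖ ≤ β) (x : Eu n) :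
    ‖fm q h x‖ₑ ^ 2 * lvar q b x
      + (2 * (‖fm q b x‖ₑ ^ 2 * ‖fm q h x‖ₑ ^ 2) + 16 * β ^ 2 * ‖fm q h x‖ₑ ^ 2)
      ≤ 2 * (∫⁻ y, ‖ker q y‖ₑ * ‖b (x - y) * h (x - y)‖ₑ ^ 2)
        + 16 * β ^ 2 * ∫⁻ y, ‖ker q y‖ₑ * ‖h (x - y)‖ₑ ^ 2 := by
  have hkm : Measurable fun y => ‖ker q y‖ₑ := (ker q).continuous.measurable.enorm
  set μ := (volume : Measure (Eu n)).withDensity fun y => ‖ker q y‖ₑ with hμ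
  have hpr : IsProbabilityMeasure μ := ⟨by
    rw [hμ, withDensity_apply _ MeasurableSet.univ, Measure.restrict_univ,
      lintegral_ker_eq_one hγ h0 hq]⟩
  have hint (f : Eu n → ℂ) : ∫ y, f (x - y) ∂μ = fm q f x := by
    rw [hμ, integral_withDensity_eq_integral_toReal_smul hkm (ae_of_all _ fun y => by simp), fm, cv_eq]
    congr 1; ext y
    rw [toReal_enorm, hγ, Complex.norm_real, Real.norm_of_nonneg (h0 y), Complex.real_smul]
  have hlint {f : Eu n → ℂ} (hf : BM f) : ENNReal.ofReal (∫ y, ‖f y‖ ^ 2 ∂μ)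
      = ∫⁻ y, ‖ker q y‖ₑ * ‖f y‖ₑ ^ 2 := by
    obtain ⟨C, hC⟩ := hf.bdd
    rw [ofReal_integral_eq_lintegral_ofReal (Integrable.of_bound
      (hf.meas.norm.pow_const 2).aestronglyMeasurable (C ^ 2) (ae_of_all _ fun y => by
      rw [Real.norm_of_nonneg (by positivity)]
      exact pow_le_pow_left₀ (norm_nonneg _) (hC y) 2)) (ae_of_all _ fun y => by positivity), hμ,
      lintegral_withDensity_eq_lintegral_mul _ hkm (by
        have := hf.meas
        fun_prop)]
    simp only [Pi.mul_apply, ENNReal.ofReal_pow (norm_nonneg _), ofReal_norm]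
  have hs {f : Eu n → ℂ} (hf : BM f) : BM fun y => f (x - y) := by
    obtain ⟨C, hC⟩ := hf.bdd
    exact ⟨hf.meas.comp (by fun_prop), C, fun y => hC _⟩
  obtain ⟨D, hD⟩ := hh.bdd
  have key := weighted_variance_le μ (b := fun y => b (x - y)) (h := fun y => h (x - y))
    (hs hb).meas (hs hh).meas (fun y => hβ _) ⟨D, fun y => hD _⟩
  rw [hint, hint] at key
  have key := ENNReal.ofReal_le_ofReal key
  have hconst : BM fun _ : Eu n => fm q b x := ⟨measurable_const, _, fun _ => le_rfl⟩
  have p1 : 0 ≤ ∫ y, ‖b (x - y) - fm q b x‖ ^ 2 ∂μ := integral_nonneg fun y => by positivity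
  have p2 : 0 ≤ ∫ y, ‖b (x - y) * h (x - y)‖ ^ 2 ∂μ := integral_nonneg fun y => by positivity
  have p3 : 0 ≤ ∫ y, ‖h (x - y)‖ ^ 2 ∂μ := integral_nonneg fun y => by positivity
  rw [ENNReal.ofReal_add (by positivity) (by positivity),
    ENNReal.ofReal_add (by positivity) (by positivity),
    ENNReal.ofReal_add (by positivity) (by positivity)] at key
  simp only [ENNReal.ofReal_mul (show (0 : ℝ) ≤ 2 by norm_num), ENNReal.ofReal_mul (show (0 : ℝ) ≤ 16 by norm_num),
    ENNReal.ofReal_mul (sq_nonneg ‖fm q h x‖), ENNReal.ofReal_mul (sq_nonneg ‖fm q b x‖),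
    ENNReal.ofReal_mul (show (0 : ℝ) ≤ 16 * β ^ 2 by positivity),
    ENNReal.ofReal_pow (norm_nonneg _), ofReal_norm, ENNReal.ofReal_pow (NNReal.coe_nonneg β), ENNReal.ofReal_coe_nnreal,
    ENNReal.ofReal_ofNat] at key
  have k1 := hlint ((hs hb).sub hconst)
  have k2 := hlint ((hs hb).mul (hs hh))
  have k3 := hlint (hs hh)
  simp only [Pi.sub_apply, Pi.mul_apply] at k1 k2 k3
  rw [k1, k2, k3, add_assoc] at key
  exact key

end Step

end Gaussian

/-! ### Carleson's estimate for Gaussian averages. -/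

section Carleson
open SchwartzMap
variable {n : ℕ}

lemma lintegral_conv {κ F : Eu n → ℝ≥0∞} (hκ : Measurable κ) (hF : Measurable F) :
    ∫⁻ x, ∫⁻ y, κ y * F (x - y) = (∫⁻ y, κ y) * ∫⁻ x, F x := by
  rw [lintegral_lintegral_swap]
  · rw [← lintegral_mul_const _ hκ]
    congr 1; ext y
    rw [lintegral_const_mul (κ y) (f := fun x => F (x - y)) (hF.comp (measurable_id.sub_const y)),
      lintegral_sub_right_eq_self]
  · exact ((hκ.comp measurable_snd).mul (hF.comp (by fun_prop :
      Measurable fun p : Eu n × Eu n => p.1 - p.2))).aemeasurable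

section Step
variable {q : 𝓢(Eu n, ℂ)} {γ : Eu n → ℝ}

/-- Averaging preserves integrals, so after integration in `x` the right side is the functional at
the finer scale and the sum on the left contains the same functional at the coarser one. -/
lemma integrated_step (hγ : ∀ x, ker q x = (γ x : ℂ)) (h0 : ∀ x, 0 ≤ γ x) (hq : q 0 = 1)
    {b h : Eu n → ℂ} (hb : BM b) (hh : BM h) {β : ℝ≥0} (hβ : ∀ x, ‖b x‖ ≤ β) :
    (∫⁻ x, ‖fm q h x‖ₑ ^ 2 * lvar q b x)
      + (2 * eLpNorm (fm q b * fm q h) 2 volume ^ 2 + 16 * β ^ 2 * eLpNorm (fm q h) 2 volume ^ 2)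
      ≤ 2 * eLpNorm (b * h) 2 volume ^ 2 + 16 * β ^ 2 * eLpNorm h 2 volume ^ 2 := by
  have h1 := lintegral_mono (μ := volume) (pointwise_step hγ h0 hq hb hh hβ)
  have mb := hb.meas
  have mh := hh.meas
  have mb' := (hb.fm q).meas
  have mh' := (hh.fm q).meas
  have mk : Measurable fun y => ‖ker q y‖ₑ := (ker q).continuous.measurable.enorm
  have mv := measurable_lvar q hb
  have e1 : ∫⁻ x, ∫⁻ y, ‖ker q y‖ₑ * ‖b (x - y) * h (x - y)‖ₑ ^ 2 = ∫⁻ x, ‖b x * h x‖ₑ ^ 2 := by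
    rw [lintegral_conv (F := fun x => ‖b x * h x‖ₑ ^ 2) mk (by fun_prop),
      lintegral_ker_eq_one hγ h0 hq, one_mul]
  have e2 : ∫⁻ x, ∫⁻ y, ‖ker q y‖ₑ * ‖h (x - y)‖ₑ ^ 2 = ∫⁻ x, ‖h x‖ₑ ^ 2 := by
    rw [lintegral_conv (F := fun x => ‖h x‖ₑ ^ 2) mk (by fun_prop),
      lintegral_ker_eq_one hγ h0 hq, one_mul]
  have hc : (16 * β ^ 2 : ℝ≥0∞) ≠ ⊤ := by finiteness
  rw [lintegral_add_left (by fun_prop), lintegral_add_left (by fun_prop), lintegral_add_left,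
    lintegral_const_mul' _ _ (by simp), lintegral_const_mul' _ _ hc, lintegral_const_mul' _ _ (by simp),
    lintegral_const_mul' _ _ hc, e1, e2] at h1
  · rw [eLpNorm_two_sq, eLpNorm_two_sq, eLpNorm_two_sq, eLpNorm_two_sq]
    simpa only [Pi.mul_apply, enorm_mul, mul_pow] using h1
  · refine Measurable.const_mul ?_ _
    apply Measurable.lintegral_prod_right' (f := fun p : Eu n × Eu n =>
      ‖ker q p.2‖ₑ * ‖b (p.1 - p.2) * h (p.1 - p.2)‖ₑ ^ 2)
    have := (ker q).continuous.measurable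
    fun_prop

/-- Differences of averages are controlled by the local variance. -/
lemma fm_sub_sq_le_lvar {p : 𝓢(Eu n, ℂ)} (hγ : ∀ x, ker q x = (γ x : ℂ)) (h0 : ∀ x, 0 ≤ γ x)
    (hq : q 0 = 1) (hp : p 0 = 1) {Λ : ℝ≥0} (hΛ : ∀ x, ‖ker p x‖ₑ ≤ Λ * ‖ker q x‖ₑ)
    {b : Eu n → ℂ} (hb : BM b) (x : Eu n) :
    ‖fm (p - q) b x‖ₑ ^ 2 ≤ (Λ + 1) ^ 2 * lvar q b x := by
  have mk : Measurable fun y => ‖ker q y‖ₑ := (ker q).continuous.measurable.enorm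
  set c := fm q b x
  have hker : ker (p - q) = ker p - ker q := by
    have e : p - q = p + (-1 : ℂ) • q := by ext; simp [sub_eq_add_neg]
    rw [e, ker_symbol_add, ker_symbol_smul]
    ext; simp [sub_eq_add_neg]
  -- The symbol `p - q` vanishes at the origin, so the kernel has integral zero and the local mean
  -- `c` may be subtracted from `b`.
  have e : fm (p - q) b x = ∫ y, ker (p - q) y * (b (x - y) - c) := by
    have hz : ∫ y, ker (p - q) y = 0 := by
      rw [integral_ker]; simp [hp, hq]
    simp only [mul_sub]
    rw [integral_sub (cv_integrable' (ker _).integrable hb x) ((ker _).integrable.mul_const c),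
      integral_mul_const, hz, zero_mul, sub_zero, fm, cv_eq]
  have h1 : ‖fm (p - q) b x‖ₑ ≤ (Λ + 1) * ∫⁻ y, ‖ker q y‖ₑ * ‖b (x - y) - c‖ₑ := by
    rw [e, ← lintegral_const_mul' _ _ (by finiteness)]
    refine (enorm_integral_le_lintegral_enorm _).trans (lintegral_mono fun y => ?_)
    rw [enorm_mul, ← mul_assoc]
    gcongr
    rw [hker, add_mul, one_mul]
    exact (enorm_sub_le).trans (add_le_add (hΛ y) le_rfl)
  have hm : Measurable fun y => ‖b (x - y) - c‖ₑ := by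
    have := hb.meas
    fun_prop
  calc ‖fm (p - q) b x‖ₑ ^ 2 ≤ ((Λ + 1) * ∫⁻ y, ‖ker q y‖ₑ * ‖b (x - y) - c‖ₑ) ^ 2 := by gcongr
    _ = (Λ + 1) ^ 2 * (∫⁻ y, ‖ker q y‖ₑ * ‖b (x - y) - c‖ₑ) ^ 2 := by rw [mul_pow]
    _ ≤ (Λ + 1) ^ 2 * ((∫⁻ y, ‖ker q y‖ₑ) * ∫⁻ y, ‖ker q y‖ₑ * ‖b (x - y) - c‖ₑ ^ 2) := by
        gcongr; exact sq_lintegral_mul_le mk hm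
    _ = _ := by rw [lintegral_ker_eq_one hγ h0 hq, one_mul]; rfl

end Step

lemma tsum_int_le {f : ℤ → ℝ≥0∞} {C : ℝ≥0∞}
    (h : ∀ (a : ℤ) (N : ℕ), ∑ i ∈ Finset.range N, f (a + i) ≤ C) : ∑' k, f k ≤ C := by
  rw [ENNReal.tsum_eq_iSup_sum]
  refine iSup_le fun S => ?_
  obtain ⟨a, ha⟩ := S.bddBelow
  obtain ⟨c, hc⟩ := S.bddAbove
  refine le_trans ?_ (h a (c - a + 1).toNat)
  rw [← Finset.sum_image (f := f) (g := fun i : ℕ => a + i) (s := Finset.range _)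
    (fun i _ j _ hij => by simpa using hij)]
  refine Finset.sum_le_sum_of_subset fun k hk => ?_
  have h1 := ha hk
  have h2 := hc hk
  rw [Finset.mem_image]
  exact ⟨(k - a).toNat, by rw [Finset.mem_range]; omega, by omega⟩

lemma gau_zero {s : ℝ} (hs : 0 < s) : gau (n := n) hs 0 = 1 := by simp [gau_apply]

lemma dil_zero (k : ℤ) (q : 𝓢(Eu n, ℂ)) : dil k q 0 = q 0 := by simp

/-- The dilated Gaussian kernel. -/
def gd (n : ℕ) (s : ℝ) (k : ℤ) (x : Eu n) : ℝ := ((2 : ℝ) ^ k) ^ n * gk n s ((2 : ℝ) ^ k • x)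

lemma ker_dil_gau {s : ℝ} (hs : 0 < s) (k : ℤ) (x : Eu n) :
    ker (dil k (gau hs)) x = (gd n s k x : ℂ) := by
  rw [ker_dil, ker_gau, gd]; push_cast; rfl

lemma gd_nonneg {s : ℝ} (hs : 0 < s) (k : ℤ) (x : Eu n) : 0 ≤ gd n s k x := by
  unfold gd gk; positivity

/-- The kernel of `gau` with parameter `s` is `(π/s)^(n/2) * exp (-π² ‖x‖² / s)`: the Gaussian with
`s = 1` is the narrower one, and the ratio of the prefactors is `3^(n/2)`. -/
lemma ker_gau_le (k : ℤ) (x : Eu n) : ‖ker (dil k (gau one_pos)) x‖ₑ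
    ≤ (Real.toNNReal (3 ^ (n / 2 : ℝ)) : ℝ≥0∞) * ‖ker (dil k (gau three_pos)) x‖ₑ := by
  rw [ker_dil_gau, ker_dil_gau, ← ofReal_norm, ← ofReal_norm, Complex.norm_real, Complex.norm_real,
    Real.norm_of_nonneg (gd_nonneg one_pos k x), Real.norm_of_nonneg (gd_nonneg three_pos k x)]
  rw [← ENNReal.ofReal, ← ENNReal.ofReal_mul (by positivity)]
  apply ENNReal.ofReal_le_ofReal
  unfold gd gk
  have e : (Real.pi / 1) ^ (n / 2 : ℝ) = 3 ^ (n / 2 : ℝ) * (Real.pi / 3) ^ (n / 2 : ℝ) := by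
    rw [← Real.mul_rpow (by norm_num) (by positivity)]; congr 1; ring
  rw [e]
  have h2 : Real.exp (-(Real.pi ^ 2 / 1) * ‖(2 : ℝ) ^ k • x‖ ^ 2)
      ≤ Real.exp (-(Real.pi ^ 2 / 3) * ‖(2 : ℝ) ^ k • x‖ ^ 2) := by
    rw [Real.exp_le_exp]
    have : 0 ≤ Real.pi ^ 2 * ‖(2 : ℝ) ^ k • x‖ ^ 2 := by positivity
    nlinarith
  calc _ = ((2 : ℝ) ^ k) ^ n * (3 ^ (n / 2 : ℝ) * (Real.pi / 3) ^ (n / 2 : ℝ)) *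
        Real.exp (-(Real.pi ^ 2 / 1) * ‖(2 : ℝ) ^ k • x‖ ^ 2) := by ring
    _ ≤ ((2 : ℝ) ^ k) ^ n * (3 ^ (n / 2 : ℝ) * (Real.pi / 3) ^ (n / 2 : ℝ)) *
        Real.exp (-(Real.pi ^ 2 / 3) * ‖(2 : ℝ) ^ k • x‖ ^ 2) := by gcongr
    _ = _ := by ring

/-- Since `exp (-3t²) * exp (-t²) = exp (-(2t)²)`, the average at scale `k` is the parameter `3`
Gaussian average of the one at scale `k + 1`. This semigroup relation dictates the parameters `1`,
`3` and `4`. -/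
lemma fm_gau_succ {f : Eu n → ℂ} (hf : BM f) (k : ℤ) :
    fm (dil (k + 1) (gau three_pos)) (fm (dil (k + 1) (gau one_pos)) f)
      = fm (dil k (gau one_pos)) f := by
  refine fm_fm hf fun ξ => ?_
  have h1 : ‖(2 : ℝ) ^ (-k) • ξ‖ = 2 * ‖(2 : ℝ) ^ (-(k + 1)) • ξ‖ := by
    rw [norm_zpow_smul, norm_zpow_smul, neg_add, zpow_add₀ two_ne_zero]; norm_num; ring
  simp only [dil_apply, gau_apply, h1]
  rw [← Complex.ofReal_mul, ← Real.exp_add]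
  congr 2; ring

/-- Carleson's estimate for the Gaussian semigroup. -/
lemma carleson_gaussian {b h : Eu n → ℂ} (hb : BM b) (hh : BM h) {β : ℝ≥0} (hβ : ∀ x, ‖b x‖ ≤ β) :
    ∑' k : ℤ, ∫⁻ x, ‖fm (dil k (gau one_pos)) h x‖ₑ ^ 2
      * lvar (dil (k + 1) (gau three_pos)) (fm (dil (k + 1) (gau one_pos)) b) x
      ≤ 18 * β ^ 2 * eLpNorm h 2 volume ^ 2 := by
  -- The monotone quantity: `X (k + 1) - X k` dominates the `k`-th term of the sum, while `X` stays
  -- below `18 * β ^ 2` times the squared norm of `h`, where `18 = 2 + 16`.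
  set X : ℤ → ℝ≥0∞ := fun k => 2 * eLpNorm (fm (dil k (gau one_pos)) b * fm (dil k (gau one_pos)) h) 2 volume ^ 2
    + 16 * β ^ 2 * eLpNorm (fm (dil k (gau one_pos)) h) 2 volume ^ 2 with hX
  have hnorm (k : ℤ) : ∫⁻ y, ‖ker (dil k (gau (n := n) one_pos)) y‖ₑ = 1 :=
    lintegral_ker_eq_one (ker_dil_gau one_pos k) (gd_nonneg one_pos k) (by rw [dil_zero, gau_zero])
  have hbβ (k : ℤ) (x : Eu n) : ‖fm (dil k (gau one_pos)) b x‖ ≤ β := by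
    have h1 := norm_fm_dil_le hβ k (gau one_pos) x
    have h2 : nk (gau (n := n) one_pos) = 1 := by
      rw [← ENNReal.coe_inj, ← lintegral_ker_dil_one k, hnorm k, ENNReal.coe_one]
    simpa [h2] using h1
  have step (k : ℤ) : (∫⁻ x, ‖fm (dil k (gau one_pos)) h x‖ₑ ^ 2
      * lvar (dil (k + 1) (gau three_pos)) (fm (dil (k + 1) (gau one_pos)) b) x) + X k ≤ X (k + 1) := by
    have := integrated_step (ker_dil_gau three_pos (k + 1)) (gd_nonneg three_pos (k + 1))
      (by rw [dil_zero, gau_zero]) (hb.fm (dil (k + 1) (gau one_pos)))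
      (hh.fm (dil (k + 1) (gau one_pos))) (hbβ (k + 1))
    rwa [fm_gau_succ hb, fm_gau_succ hh] at this
  have hXle (k : ℤ) : X k ≤ 18 * β ^ 2 * eLpNorm h 2 volume ^ 2 := by
    have h1 : eLpNorm (fm (dil k (gau one_pos)) h) 2 volume ≤ eLpNorm h 2 volume := by
      have := eLpNorm_cv_le (ker (dil k (gau (n := n) one_pos))).continuous.measurable hh.meas
      rwa [hnorm, one_mul] at this
    have h2 := (eLpNorm_mul_le_sup (g := fm (dil k (gau one_pos)) h) (hbβ k)).trans
      (mul_le_mul_right h1 _)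
    calc X k ≤ 2 * (β * eLpNorm h 2 volume) ^ 2 + 16 * β ^ 2 * eLpNorm h 2 volume ^ 2 := by
          simp only [hX]; gcongr
      _ = _ := by ring
  -- Telescoping over the window from `a` to `a + N`; the bound for `X (a + N)` depends neither on
  -- `a` nor on `N`.
  refine tsum_int_le fun a N => le_trans ?_ (hXle (a + N))
  refine le_trans (le_self_add (b := X a)) ?_
  induction N with
  | zero => simp
  | succ N ih =>
    rw [Finset.sum_range_succ]
    calc _ = (∫⁻ x, ‖fm (dil (a + N) (gau one_pos)) h x‖ₑ ^ 2
      * lvar (dil (a + N + 1) (gau three_pos)) (fm (dil (a + N + 1) (gau one_pos)) b) x) +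
        (∑ i ∈ Finset.range N, (∫⁻ x, ‖fm (dil (a + i) (gau one_pos)) h x‖ₑ ^ 2
      * lvar (dil (a + i + 1) (gau three_pos)) (fm (dil (a + i + 1) (gau one_pos)) b) x) + X a) := by ring
      _ ≤ _ + X (a + N) := by gcongr
      _ ≤ X (a + N + 1) := step _
      _ = _ := by push_cast; ring_nf

/-- The symbol of the differences of two Gaussian averages. -/
def gd2 (n : ℕ) : 𝓢(Eu n, ℂ) := gau two_pos - gau four_pos

lemma gd2_apply (ξ : Eu n) : gd2 n ξ = (Real.exp (-2 * ‖ξ‖ ^ 2) - Real.exp (-4 * ‖ξ‖ ^ 2) : ℝ) := by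
  rw [gd2, sub_apply, gau_apply, gau_apply]; push_cast; rfl

lemma gd2_ne_zero {ξ : Eu n} (h : ξ ≠ 0) : gd2 n ξ ≠ 0 := by
  rw [gd2_apply, Complex.ofReal_ne_zero, sub_ne_zero]
  intro h1
  have := Real.exp_injective h1
  have h2 : 0 < ‖ξ‖ ^ 2 := by positivity
  linarith

/-- Multiplying the difference of the Gaussians with parameters `1` and `3` by the one with
parameter `1` gives parameters `2` and `4`. Thus `gd2` measures a difference of averages controlled
by the local variance. -/
lemma fm_gd2 {b : Eu n → ℂ} (hb : BM b) (k : ℤ) : fm (dil k (gau one_pos) - dil k (gau three_pos))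
    (fm (dil k (gau one_pos)) b) = fm (dil k (gd2 n)) b := by
  refine fm_fm hb fun ξ => ?_
  simp only [sub_apply, dil_apply, gd2_apply, gau_apply]
  rw [← Complex.ofReal_sub, ← Complex.ofReal_mul, sub_mul, ← Real.exp_add, ← Real.exp_add]
  congr 3 <;> ring_nf

lemma dil_gau_four (k : ℤ) : dil (k + 1) (gau four_pos) = dil k (gau (n := n) one_pos) := by
  ext ξ
  have h1 : ‖(2 : ℝ) ^ (-k) • ξ‖ = 2 * ‖(2 : ℝ) ^ (-(k + 1)) • ξ‖ := by
    rw [norm_zpow_smul, norm_zpow_smul, neg_add, zpow_add₀ two_ne_zero]; norm_num; ring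
  simp only [dil_apply, gau_apply, h1]
  congr 2; ring

lemma carleson_gd2 (n : ℕ) : ∃ C : ℝ≥0, ∀ (b h : Eu n → ℂ), BM b → BM h → ∀ β : ℝ≥0,
    (∀ x, ‖b x‖ ≤ β) → ∑' k : ℤ, eLpNorm (fm (dil k (gau four_pos)) h * fm (dil k (gd2 n)) b) 2 volume ^ 2
      ≤ C * β ^ 2 * eLpNorm h 2 volume ^ 2 := by
  refine ⟨(Real.toNNReal (3 ^ (n / 2 : ℝ)) + 1) ^ 2 * 18, fun b h hb hh β hβ => ?_⟩
  rw [← (Equiv.addRight (1 : ℤ)).tsum_eq]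
  simp only [Equiv.coe_addRight, dil_gau_four]
  have key (k : ℤ) : eLpNorm (fm (dil k (gau one_pos)) h * fm (dil (k + 1) (gd2 n)) b) 2 volume ^ 2
      ≤ (Real.toNNReal (3 ^ (n / 2 : ℝ)) + 1) ^ 2 * ∫⁻ x, ‖fm (dil k (gau one_pos)) h x‖ₑ ^ 2
      * lvar (dil (k + 1) (gau three_pos)) (fm (dil (k + 1) (gau one_pos)) b) x := by
    rw [eLpNorm_two_sq, ← lintegral_const_mul' _ _ (by finiteness)]
    refine lintegral_mono fun x => ?_
    rw [Pi.mul_apply, enorm_mul, mul_pow, mul_left_comm]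
    gcongr
    rw [← fm_gd2 hb]
    exact fm_sub_sq_le_lvar (ker_dil_gau three_pos _) (gd_nonneg three_pos _)
      (by rw [dil_zero, gau_zero]) (by rw [dil_zero, gau_zero]) (ker_gau_le _) (hb.fm _) x
  refine (ENNReal.tsum_le_tsum key).trans ?_
  rw [ENNReal.tsum_mul_left]
  refine (mul_le_mul_right (carleson_gaussian hb hh hβ) _).trans (le_of_eq ?_)
  push_cast; ring

end Carleson

/-! ### Carleson's estimate for general symbols. -/

section Translation
open SchwartzMap
variable {n : ℕ}

lemma schwartz_bounds (q : 𝓢(Eu n, ℂ)) : ∃ C : ℝ≥0, (∀ η, ‖q η‖ₑ ≤ C) ∧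
    (∀ η, η ≠ 0 → ‖q η‖ₑ ≤ C * ‖η‖ₑ ^ (-1 : ℝ)) ∧ ∀ η, ‖q η - q 0‖ₑ ≤ C * ‖η‖ₑ := by
  obtain ⟨C0, h0⟩ := q.decay 0 0
  obtain ⟨C1, h1⟩ := q.decay 1 0
  obtain ⟨C2, h2⟩ := q.decay 0 1
  have en : ∀ {x : ℂ} {c : ℝ≥0}, ‖x‖ ≤ c → ‖x‖ₑ ≤ c := fun {x c} h => by
    rw [enorm_eq_nnnorm, ENNReal.coe_le_coe]; exact h
  have l0 : (C0 : ℝ) ≤ (max (max C0 C1) C2).toNNReal :=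
    ((le_max_left _ _).trans (le_max_left _ _)).trans (Real.le_coe_toNNReal _)
  have l1 : (C1 : ℝ) ≤ (max (max C0 C1) C2).toNNReal :=
    ((le_max_right _ _).trans (le_max_left _ _)).trans (Real.le_coe_toNNReal _)
  have l2 : (C2 : ℝ) ≤ (max (max C0 C1) C2).toNNReal :=
    (le_max_right _ _).trans (Real.le_coe_toNNReal _)
  refine ⟨(max (max C0 C1) C2).toNNReal, fun η => en ?_, fun η hη => ?_, fun η => ?_⟩
  · have := h0.2 η
    simp only [pow_zero, one_mul, norm_iteratedFDeriv_zero] at this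
    exact this.trans l0
  · have := h1.2 η
    simp only [pow_one, norm_iteratedFDeriv_zero] at this
    rw [ENNReal.rpow_neg_one, ← div_eq_mul_inv, ENNReal.le_div_iff_mul_le (by simp [hη]) (by simp),
      ← enorm_norm η, ← enorm_norm (q η), ← enorm_mul, mul_comm, enorm_eq_nnnorm, ENNReal.coe_le_coe,
      ← NNReal.coe_le_coe, coe_nnnorm, Real.norm_of_nonneg (by positivity)]
    exact this.trans l1
  · have := Convex.norm_image_sub_le_of_norm_fderiv_le (𝕜 := ℝ) (f := q) (s := Set.univ) (C := C2) (x := 0)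
      (y := η) (fun x _ => q.differentiableAt) (fun x _ => ?_) convex_univ trivial trivial
    · rw [sub_zero] at this
      have h3 := this.trans (mul_le_mul_of_nonneg_right l2 (norm_nonneg η))
      rw [enorm_eq_nnnorm, enorm_eq_nnnorm, ← ENNReal.coe_mul, ENNReal.coe_le_coe]
      exact h3
    · have h3 := h2.2 x
      rwa [pow_zero, one_mul, norm_iteratedFDeriv_one] at h3

/-- Translation. -/
def tr (y : Eu n) (f : Eu n → ℂ) (x : Eu n) : ℂ := f (x - y)

lemma tr_fm (q : 𝓢(Eu n, ℂ)) (y : Eu n) (h : Eu n → ℂ) :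
    tr y (fm q h) = cv (fun z => ker q (z - y)) h := by
  ext x
  simp only [tr, fm, cv]
  congr 1; ext z
  rw [sub_right_comm]

lemma fourier_ker_sub (q : 𝓢(Eu n, ℂ)) (y ξ : Eu n) :
    𝓕 (fun z => ker q (z - y)) ξ = wave ξ (-y) * q ξ := by
  rw [← fourier_ker q, fourier_eq_wave, fourier_eq_wave,
    ← integral_add_right_eq_self _ y, ← integral_const_mul]
  congr 1; ext x
  rw [add_sub_cancel_right, neg_add, ← sub_eq_add_neg, wave_sub]; ring

lemma norm_one_sub_wave_le (ξ y : Eu n) : ‖1 - wave ξ (-y)‖ ≤ 2 * Real.pi * (‖ξ‖ * ‖y‖) := by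
  have h := Real.norm_exp_I_mul_ofReal_sub_one_le (x := 2 * Real.pi * inner ℝ ξ (-y))
  rw [mul_comm Complex.I] at h
  rw [norm_sub_rev]
  refine h.trans ?_
  rw [norm_mul, Real.norm_of_nonneg (by positivity)]
  gcongr
  exact (norm_inner_le_norm _ _).trans (by rw [norm_neg])

/-- Square function of translation differences. -/
lemma tsum_sub_tr_le (hn : 0 < n) (q : 𝓢(Eu n, ℂ)) : ∃ C : ℝ≥0, ∀ h : Eu n → ℂ, BM h →
    MemLp h 2 volume → ∀ y : Eu n,
    ∑' k : ℤ, eLpNorm (fm (dil k q) h - tr ((2 : ℝ) ^ (-k) • y) (fm (dil k q) h)) 2 volume ^ 2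
      ≤ C * (1 + ‖y‖ₑ) ^ 2 * eLpNorm h 2 volume ^ 2 := by
  obtain ⟨S, h1, h2, -⟩ := schwartz_bounds q
  set D : ℝ≥0 := 2 * Real.pi.toNNReal + 2
  refine ⟨(D * S) ^ 2 * sfConst.toNNReal, fun h hh hh2 y => ?_⟩
  have hK (k : ℤ) : Integrable fun z => ker (dil k q) (z - (2 : ℝ) ^ (-k) • y) :=
    (ker (dil k q)).integrable.comp_sub_right _
  have hKm (k : ℤ) : Measurable fun z => ker (dil k q) (z - (2 : ℝ) ^ (-k) • y) :=
    (ker (dil k q)).continuous.measurable.comp (by fun_prop)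
  have hmem (k : ℤ) : MemLp (tr ((2 : ℝ) ^ (-k) • y) (fm (dil k q) h)) 2 volume := by
    rw [tr_fm]
    exact MemLp.cv hh2 hh.meas (hKm k) (hK k)
  have hpi : (Real.pi.toNNReal : ℝ) = Real.pi := Real.coe_toNNReal _ Real.pi_pos.le
  have hw1 (η : Eu n) : ‖1 - wave η (-y)‖ₑ ≤ D * (1 + ‖y‖ₑ) * ‖η‖ₑ := by
    rw [enorm_eq_nnnorm, enorm_eq_nnnorm, enorm_eq_nnnorm]
    norm_cast
    rw [← NNReal.coe_le_coe]
    push_cast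
    refine (norm_one_sub_wave_le η y).trans ?_
    simp only [D]
    push_cast
    rw [hpi]
    have := Real.pi_pos
    calc 2 * Real.pi * (‖η‖ * ‖y‖) = (2 * Real.pi * ‖y‖) * ‖η‖ := by ring
      _ ≤ _ := by
        gcongr <;> linarith [norm_nonneg y]
  have hw2 (η : Eu n) : ‖1 - wave η (-y)‖ₑ ≤ D * (1 + ‖y‖ₑ) := by
    have : ‖1 - wave η (-y)‖ₑ ≤ 2 := by
      refine enorm_sub_le.trans ?_
      rw [enorm_one, ← ofReal_norm, norm_wave, ENNReal.ofReal_one]; norm_num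
    calc _ ≤ (2 : ℝ≥0∞) * 1 := by rwa [mul_one]
      _ ≤ _ := by
        gcongr
        · simp only [D]; push_cast; exact le_add_self
        · exact le_self_add
  -- On the Fourier side the factor `q` decays at infinity and `1 - wave` vanishes linearly at the
  -- origin, so the geometric criterion applies with `σ = 0`. The factor `1 + ‖y‖ₑ` covers both
  -- bounds of `1 - wave`.
  have := tsum_multiplier_le (f := h) (F := fun k => fm (dil k q) h - tr ((2 : ℝ) ^ (-k) • y) (fm (dil k q) h))
    (m := fun k ξ => q ((2 : ℝ) ^ (-k) • ξ) * (1 - wave ((2 : ℝ) ^ (-k) • ξ) (-y))) 0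
    ((D * (1 + ‖y‖ₑ) * S) ^ 2 * sfConst) (fun k => (MemLp.fm hh2 hh _).sub (hmem k)) (fun k => ?_) 0
    (fun ξ hξ => ?_) hn
  · simp only [wt_zero_left, one_mul, hsq_zero hh2] at this
    refine this.trans (le_of_eq ?_)
    rw [ENNReal.coe_mul, ENNReal.coe_toNNReal sfConst_ne_top]
    push_cast; ring
  · have e1 := fhat_sub (MemLp.fm hh2 hh (dil k q)) (hmem k)
    rw [tr_fm] at e1
    rw [tr_fm]
    filter_upwards [e1, fhat_fm hh hh2 (dil k q), fhat_cv hh hh2 (hK k) (hKm k)] with ξ h1 h2 h3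
    rw [h1, Pi.sub_apply, h2, h3, fourier_ker_sub]
    have : wave ((2 : ℝ) ^ (-k) • ξ) (-y) = wave ξ (-(2 : ℝ) ^ (-k) • y) := by
      unfold wave
      rw [real_inner_smul_left, inner_neg_right, neg_smul, inner_neg_right, real_inner_smul_right]
      congr 3; ring
    rw [this, dil_apply, neg_smul]; ring
  · refine tsum_geometric_le (Θ := fun η => ‖q η * (1 - wave η (-y))‖ₑ) hξ 0 (fun η hη => ?_)
      (fun η hη => ?_)
    · rw [zero_add, ENNReal.rpow_one, enorm_mul]
      calc _ ≤ S * (D * (1 + ‖y‖ₑ) * ‖η‖ₑ) := by gcongr; exacts [h1 η, hw1 η]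
        _ = _ := by ring
    · rw [zero_sub, enorm_mul]
      calc _ ≤ (S * ‖η‖ₑ ^ (-1 : ℝ)) * (D * (1 + ‖y‖ₑ)) := by gcongr; exacts [h2 η hη, hw2 η]
        _ = _ := by ring

lemma sq_add_le (a b : ℝ≥0∞) : (a + b) ^ 2 ≤ 2 * (a ^ 2 + b ^ 2) := by
  induction a with
  | top => simp
  | coe a =>
    induction b with
    | top => simp
    | coe b =>
      norm_cast
      have := add_pow_le (zero_le (a := a)) (zero_le (a := b)) 2
      simpa using this

lemma eLpNorm_sq_add_le {f g : Eu n → ℂ} (hf : Measurable f) (hg : Measurable g) :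
    eLpNorm (f + g) 2 volume ^ 2 ≤ 2 * (eLpNorm f 2 volume ^ 2 + eLpNorm g 2 volume ^ 2) :=
  (pow_le_pow_left' (eLpNorm_add_le hf.aestronglyMeasurable hg.aestronglyMeasurable one_le_two) 2).trans
    (sq_add_le _ _)

lemma schwartz_moment (q : 𝓢(Eu n, ℂ)) : ∫⁻ y, ‖ker q y‖ₑ * (1 + ‖y‖ₑ) ^ 2 ≠ ⊤ := by
  have h1 := ((ker q).integrable_pow_mul volume 0).2
  have h2 := ((ker q).integrable_pow_mul volume 2).2
  have hm : Measurable fun y => ‖ker q y‖ₑ := (ker q).continuous.measurable.enorm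
  refine ne_top_of_le_ne_top (b := ∫⁻ y, 2 * (‖ker q y‖ₑ + ‖y‖ₑ ^ 2 * ‖ker q y‖ₑ)) ?_ (lintegral_mono fun y => ?_)
  · rw [lintegral_const_mul' _ _ (by simp), lintegral_add_left hm]
    refine ENNReal.mul_ne_top (by simp) (ENNReal.add_ne_top.2 ⟨?_, ?_⟩)
    · simpa [hasFiniteIntegral_iff_enorm] using h1.ne
    · simpa [hasFiniteIntegral_iff_enorm, enorm_mul] using h2.ne
  · simp only
    calc ‖ker q y‖ₑ * (1 + ‖y‖ₑ) ^ 2 ≤ ‖ker q y‖ₑ * (2 * (1 ^ 2 + ‖y‖ₑ ^ 2)) := by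
          gcongr; exact sq_add_le _ _
      _ = _ := by ring

/-- Products with a local average, moved through a multiplier. -/
lemma eLpNorm_sq_mul_fm_le (s : 𝓢(Eu n, ℂ)) {D g : Eu n → ℂ} (hD : BM D) (hg : BM g) {c : ℝ≥0}
    (hc : ∀ x, ‖D x‖ ≤ c) : eLpNorm (fm s D * g) 2 volume ^ 2 ≤
      2 * (((∫⁻ y, ‖ker s y‖ₑ) * eLpNorm (g * D) 2 volume) ^ 2
        + c ^ 2 * ((∫⁻ y, ‖ker s y‖ₑ) * ∫⁻ y, ‖ker s y‖ₑ * eLpNorm (g - tr y g) 2 volume ^ 2)) := by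
  have mk : Measurable fun y => ‖ker s y‖ₑ := (ker s).continuous.measurable.enorm
  have mg := hg.meas
  have mW : Measurable (Function.uncurry fun y x : Eu n => ‖g x - g (x - y)‖ₑ) := by
    unfold Function.uncurry
    fun_prop
  have mW2 : Measurable fun x => ∫⁻ y, ‖ker s y‖ₑ * ‖g x - g (x - y)‖ₑ := by
    apply Measurable.lintegral_prod_right' (f := fun p : Eu n × Eu n =>
      ‖ker s p.2‖ₑ * ‖g p.1 - g (p.1 - p.2)‖ₑ)
    have := (ker s).continuous.measurable
    fun_prop
  -- The multiplier `s` is moved outside the product, and the error involves only translation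
  -- differences of `g`.
  have e : fm s D * g = fm s (D * g) + fun x => ∫ y, ker s y * (D (x - y) * (g x - g (x - y))) := by
    ext x
    simp only [Pi.mul_apply, Pi.add_apply, fm]
    rw [cv_eq, cv_eq, ← integral_mul_const, ← integral_add (cv_integrable' (ker s).integrable (hD.mul hg) x)]
    · congr 1; ext y
      simp only [Pi.mul_apply]; ring
    · have h1 := (cv_integrable' (ker s).integrable hD x).mul_const (g x)
      have h2 := cv_integrable' (ker s).integrable (hD.mul hg) x
      refine (h1.sub h2).congr (ae_of_all _ fun y => ?_)
      simp only [Pi.sub_apply, Pi.mul_apply]; ring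
  have m2 : Measurable fun x => ∫ y, ker s y * (D (x - y) * (g x - g (x - y))) := by
    have := e ▸ ((hD.fm s).meas.mul mg).sub ((hD.mul hg).fm s).meas
    have e2 : (fun x => ∫ y, ker s y * (D (x - y) * (g x - g (x - y)))) = fm s D * g - fm s (D * g) := by
      rw [e, add_sub_cancel_left]
    rw [e2]
    exact ((hD.fm s).meas.mul mg).sub ((hD.mul hg).fm s).meas
  rw [e]
  refine (eLpNorm_sq_add_le ((hD.mul hg).fm s).meas m2).trans ?_
  gcongr
  · rw [mul_comm D g]
    exact eLpNorm_cv_le (ker s).continuous.measurable (hg.mul hD).meas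
  · rw [eLpNorm_two_sq]
    calc ∫⁻ x, ‖∫ y, ker s y * (D (x - y) * (g x - g (x - y)))‖ₑ ^ 2
        ≤ ∫⁻ x, (c * ∫⁻ y, ‖ker s y‖ₑ * ‖g x - g (x - y)‖ₑ) ^ 2 := by
          refine lintegral_mono fun x => pow_le_pow_left' ?_ 2
          rw [← lintegral_const_mul' _ _ (by simp)]
          refine (enorm_integral_le_lintegral_enorm _).trans (lintegral_mono fun y => ?_)
          rw [enorm_mul, enorm_mul, mul_left_comm]
          gcongr
          rw [enorm_eq_nnnorm, ENNReal.coe_le_coe]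
          exact hc _
      _ = c ^ 2 * ∫⁻ x, (∫⁻ y, ‖ker s y‖ₑ * ‖g x - g (x - y)‖ₑ) ^ 2 := by
          simp only [mul_pow]
          rw [lintegral_const_mul' _ _ (by simp)]
      _ ≤ c ^ 2 * ((∫⁻ y, ‖ker s y‖ₑ) * ∫⁻ y, ‖ker s y‖ₑ * ∫⁻ x, ‖g x - g (x - y)‖ₑ ^ 2) := by
          gcongr
          exact lintegral_sq_lintegral_mul_le (F := fun y x => ‖g x - g (x - y)‖ₑ) mk mW
      _ = _ := by simp only [eLpNorm_two_sq]; rfl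

lemma measurable_eLpNorm_sub_tr {g : Eu n → ℂ} (hg : Measurable g) :
    Measurable fun y => eLpNorm (g - tr y g) 2 volume ^ 2 := by
  simp only [eLpNorm_two_sq]
  apply Measurable.lintegral_prod_right' (f := fun p : Eu n × Eu n => ‖g p.2 - g (p.2 - p.1)‖ₑ ^ 2)
  fun_prop

/-- Away from the origin `gd2` has no zeros, so an annular `q` factors as `s * gd2`. The multiplier
`s` is moved across the product with the average of `h`; the translation differences this leaves are
square summable. -/
lemma carleson_gau {q : 𝓢(Eu n, ℂ)} (hq : Annular q) (hn : 0 < n) : ∃ C : ℝ≥0, ∀ (b h : Eu n → ℂ),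
    BM b → BM h → MemLp h 2 volume → ∀ β : ℝ≥0, (∀ x, ‖b x‖ ≤ β) →
    ∑' k : ℤ, eLpNorm (fm (dil k q) b * fm (dil k (gau four_pos)) h) 2 volume ^ 2
      ≤ C * β ^ 2 * eLpNorm h 2 volume ^ 2 := by
  obtain ⟨s, hs⟩ := hq.exists_mul (m := fun ξ => (gd2 n ξ)⁻¹) fun ξ hξ =>
    ((gd2 n).smooth ⊤).contDiffAt.inv (gd2_ne_zero hξ)
  have hsq (ξ : Eu n) : s ξ * gd2 n ξ = q ξ := by
    rw [hs]
    by_cases h0 : q ξ = 0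
    · simp [h0]
    · have hξ : ξ ≠ 0 := by
        rintro rfl
        obtain ⟨r, R, hr, hR, hs⟩ := hq
        have := (hs 0 h0).1
        simp at this; linarith
      rw [mul_assoc, inv_mul_cancel₀ (gd2_ne_zero hξ), mul_one]
  obtain ⟨C1, h1⟩ := carleson_gd2 n
  obtain ⟨C2, h2⟩ := tsum_sub_tr_le hn (gau (n := n) four_pos)
  set M := (∫⁻ y, ‖ker s y‖ₑ * (1 + ‖y‖ₑ) ^ 2).toNNReal
  have hM : (M : ℝ≥0∞) = ∫⁻ y, ‖ker s y‖ₑ * (1 + ‖y‖ₑ) ^ 2 := ENNReal.coe_toNNReal (schwartz_moment s)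
  refine ⟨2 * (nk s ^ 2 * C1 + nk (gd2 n) ^ 2 * (nk s * (M * C2))), fun b h hb hh hh2 β hβ => ?_⟩
  have hD (k : ℤ) (x : Eu n) : ‖fm (dil k (gd2 n)) b x‖ ≤ (nk (gd2 n) * β : ℝ≥0) := by
    push_cast; exact norm_fm_dil_le hβ k _ x
  have e (k : ℤ) : fm (dil k q) b = fm (dil k s) (fm (dil k (gd2 n)) b) :=
    (fm_fm hb fun ξ => by simp only [dil_apply]; exact hsq _).symm
  set T : ℤ → Eu n → ℝ≥0∞ := fun k y => eLpNorm (fm (dil k (gau four_pos)) h -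
    tr ((2 : ℝ) ^ (-k) • y) (fm (dil k (gau four_pos)) h)) 2 volume ^ 2 with hT
  have mT (k : ℤ) : Measurable (T k) :=
    (measurable_eLpNorm_sub_tr (hh.fm (dil k (gau four_pos))).meas).comp (by fun_prop)
  have hTk (k : ℤ) : ∫⁻ y, ‖ker (dil k s) y‖ₑ * eLpNorm (fm (dil k (gau four_pos)) h -
      tr y (fm (dil k (gau four_pos)) h)) 2 volume ^ 2 = ∫⁻ y, ‖ker s y‖ₑ * T k y := by
    rw [← lintegral_ker_dil k s (mT k)]
    simp only [hT, smul_smul, ← zpow_add₀ (two_ne_zero (α := ℝ)), neg_add_cancel, zpow_zero, one_smul]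
  have key (k : ℤ) := eLpNorm_sq_mul_fm_le (dil k s) (hb.fm (dil k (gd2 n)))
    (hh.fm (dil k (gau four_pos))) (hD k)
  simp only [← e, lintegral_ker_dil_one, hTk] at key
  have mk : Measurable fun y => ‖ker s y‖ₑ := (ker s).continuous.measurable.enorm
  refine (ENNReal.tsum_le_tsum key).trans ?_
  simp only [mul_pow]
  rw [ENNReal.tsum_mul_left, ENNReal.tsum_add, ENNReal.tsum_mul_left, ENNReal.tsum_mul_left,
    ENNReal.tsum_mul_left]
  have k2 : ∑' k, ∫⁻ y, ‖ker s y‖ₑ * T k y ≤ M * (C2 * eLpNorm h 2 volume ^ 2) := by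
    rw [← lintegral_tsum (f := fun k y => ‖ker s y‖ₑ * T k y) fun k => (mk.mul (mT k)).aemeasurable, hM, ← lintegral_mul_const _ (by fun_prop)]
    refine lintegral_mono fun y => ?_
    rw [ENNReal.tsum_mul_left]
    calc _ ≤ ‖ker s y‖ₑ * (C2 * (1 + ‖y‖ₑ) ^ 2 * eLpNorm h 2 volume ^ 2) := by
          gcongr; exact h2 h hh hh2 y
      _ = _ := by ring
  calc _ ≤ 2 * ((nk s : ℝ≥0∞) ^ 2 * (C1 * β ^ 2 * eLpNorm h 2 volume ^ 2)
        + ((nk (gd2 n) * β : ℝ≥0) : ℝ≥0∞) ^ 2 * (nk s * (M * (C2 * eLpNorm h 2 volume ^ 2)))) := by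
        gcongr
        exact h1 b h hb hh β hβ
    _ = _ := by push_cast; ring

/-- **Carleson's estimate** for Littlewood-Paley pieces of bounded functions. -/
theorem carleson {q : 𝓢(Eu n, ℂ)} (hq : Annular q) (r : 𝓢(Eu n, ℂ)) (hn : 0 < n) : ∃ C : ℝ≥0,
    ∀ (b h : Eu n → ℂ), BM b → BM h → MemLp h 2 volume → ∀ β : ℝ≥0, (∀ x, ‖b x‖ ≤ β) →
    ∑' k : ℤ, eLpNorm (fm (dil k q) b * fm (dil k r) h) 2 volume ^ 2
      ≤ C * β ^ 2 * eLpNorm h 2 volume ^ 2 := by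
  obtain ⟨C1, h1⟩ := carleson_gau hq hn
  -- The part `r 0 • gau` is covered by the Gaussian case. The rest vanishes at the origin, so its
  -- pieces of `h` are square summable and the pieces of `b` need only be bounded.
  set p := r - r 0 • gau four_pos with hp
  obtain ⟨C2, -, h2, h3⟩ := schwartz_bounds p
  have hp0 : p 0 = 0 := by simp [hp, gau_apply]
  simp only [hp0, sub_zero] at h3
  refine ⟨2 * (‖r 0‖₊ ^ 2 * C1 + nk q ^ 2 * (C2 ^ 2 * sfConst.toNNReal)), fun b h hb hh hh2 β hβ => ?_⟩
  have e (k : ℤ) : fm (dil k q) b * fm (dil k r) h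
      = r 0 • (fm (dil k q) b * fm (dil k (gau four_pos)) h) + fm (dil k q) b * fm (dil k p) h := by
    rw [hp, dil_sub_symbol, dil_smul_symbol, fm_symbol_sub hh, fm_symbol_smul, mul_sub, mul_smul_comm]
    abel
  have hq' (k : ℤ) (x : Eu n) : ‖fm (dil k q) b x‖ ≤ (nk q * β : ℝ≥0) := by
    push_cast; exact norm_fm_dil_le hβ k _ x
  have key (k : ℤ) : eLpNorm (fm (dil k q) b * fm (dil k r) h) 2 volume ^ 2 ≤
      2 * (‖r 0‖ₑ ^ 2 * eLpNorm (fm (dil k q) b * fm (dil k (gau four_pos)) h) 2 volume ^ 2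
        + ((nk q * β : ℝ≥0) : ℝ≥0∞) ^ 2 * eLpNorm (fm (dil k p) h) 2 volume ^ 2) := by
    rw [e k]
    refine (eLpNorm_sq_add_le (((hb.fm _).mul (hh.fm _)).smul _).meas ((hb.fm _).mul (hh.fm _)).meas).trans ?_
    rw [eLpNorm_const_smul, mul_pow, ← mul_pow ((nk q * β : ℝ≥0) : ℝ≥0∞)]
    gcongr
    exact eLpNorm_mul_le_sup (hq' k)
  have sf := square_function_le hn p 0 (C := C2) (fun η _ => by simpa using h3 η)
    (fun η hη => by simpa using h2 η hη) hh hh2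
  simp only [wt_zero_left, one_mul, hsq_zero hh2] at sf
  refine (ENNReal.tsum_le_tsum key).trans ?_
  rw [ENNReal.tsum_mul_left, ENNReal.tsum_add, ENNReal.tsum_mul_left, ENNReal.tsum_mul_left]
  calc _ ≤ 2 * (‖r 0‖ₑ ^ 2 * (C1 * β ^ 2 * eLpNorm h 2 volume ^ 2)
        + ((nk q * β : ℝ≥0) : ℝ≥0∞) ^ 2 * (C2 ^ 2 * sfConst * eLpNorm h 2 volume ^ 2)) := by
        gcongr
        exact h1 b h hb hh hh2 β hβ
    _ = _ := by
        rw [enorm_eq_nnnorm]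
        push_cast
        rw [ENNReal.coe_toNNReal sfConst_ne_top]
        ring

end Translation

/-! ### Bounds in L² for paraproducts and high-high interactions. -/

section Bilinear
open SchwartzMap
variable {n : ℕ} {χ : Eu n → ℝ}

/-- Terms of a low-high paraproduct. -/
def tT (q r : 𝓢(Eu n, ℂ)) (f g : Eu n → ℂ) (k : ℤ) : Eu n → ℂ :=
  fm (dil (k - 8) q) f * fm (dil k r) g

/-- Terms of a high-high interaction. -/
def tH (d : ℤ) (q r : 𝓢(Eu n, ℂ)) (f g : Eu n → ℂ) (k : ℤ) : Eu n → ℂ :=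
  fm (dil (k + d) q) f * fm (dil k r) g

/-- A bound for the square norms of all partial sums. -/
def SB (t : ℤ → Eu n → ℂ) (C : ℝ≥0∞) : Prop :=
  ∀ S : Finset ℤ, eLpNorm (∑ k ∈ S, t k) 2 volume ≤ C

variable {t s : ℤ → Eu n → ℂ}

lemma SB.add {C D : ℝ≥0∞} (h : SB t C) (h' : SB s D) (ht : ∀ k, BM (t k)) (hs : ∀ k, BM (s k)) :
    SB (t + s) (C + D) := by
  intro S
  simp only [Pi.add_apply]
  rw [Finset.sum_add_distrib]
  exact (eLpNorm_add_le (BM.sum S fun k _ => ht k).meas.aestronglyMeasurable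
    (BM.sum S fun k _ => hs k).meas.aestronglyMeasurable one_le_two).trans
    (add_le_add (h S) (h' S))

lemma SB.smul {C : ℝ≥0∞} (h : SB t C) (c : ℂ) : SB (c • t) (‖c‖ₑ * C) := by
  intro S
  simp only [Pi.smul_apply]
  rw [← Finset.smul_sum, eLpNorm_const_smul]
  gcongr
  exact h S

lemma SB.sub {C D : ℝ≥0∞} (h : SB t C) (h' : SB s D) (ht : ∀ k, BM (t k)) (hs : ∀ k, BM (s k)) :
    SB (t - s) (C + D) := by
  have := h.add (h'.smul (-1)) ht fun k => (hs k).smul _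
  simpa [sub_eq_add_neg] using this

lemma SB.sum {ι : Type*} (A : Finset ι) {T : ι → ℤ → Eu n → ℂ} {C : ι → ℝ≥0∞}
    (h : ∀ i ∈ A, SB (T i) (C i)) (hT : ∀ i ∈ A, ∀ k, BM (T i k)) :
    SB (∑ i ∈ A, T i) (∑ i ∈ A, C i) := by
  classical
  induction A using Finset.induction_on with
  | empty => intro S; simp
  | insert a A ha ih =>
    rw [Finset.sum_insert ha, Finset.sum_insert ha]
    refine (h a (by simp)).add (ih (fun i hi => h i (by simp [hi])) fun i hi => hT i (by simp [hi]))
      (hT a (by simp)) fun k => ?_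
    rw [Finset.sum_apply]
    exact BM.sum A fun i hi => hT i (by simp [hi]) k

lemma SB.mono {C D : ℝ≥0∞} (h : SB t C) (hCD : C ≤ D) : SB t D := fun S => (h S).trans hCD

lemma bm_tT {f g : Eu n → ℂ} (hf : BM f) (hg : BM g) (q r : 𝓢(Eu n, ℂ)) (k : ℤ) :
    BM (tT q r f g k) := (hf.fm _).mul (hg.fm _)

lemma bm_tH {f g : Eu n → ℂ} (hf : BM f) (hg : BM g) (d : ℤ) (q r : 𝓢(Eu n, ℂ)) (k : ℤ) :
    BM (tH d q r f g k) := (hf.fm _).mul (hg.fm _)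

lemma memLp_mul_right {f g : Eu n → ℂ} (hf : BM f) (hg : BM g) (hg2 : MemLp g 2 volume) :
    MemLp (f * g) 2 volume := by
  obtain ⟨C, hC⟩ := hf.exists_nnreal
  exact ⟨(hf.mul hg).meas.aestronglyMeasurable,
    (eLpNorm_mul_le_sup hC).trans_lt (ENNReal.mul_lt_top (by simp) hg2.2)⟩

lemma memLp_mul_left {f g : Eu n → ℂ} (hf : BM f) (hg : BM g) (hf2 : MemLp f 2 volume) :
    MemLp (f * g) 2 volume := by
  rw [mul_comm]; exact memLp_mul_right hg hf hf2

lemma dil_sub_eight (k : ℤ) (q : 𝓢(Eu n, ℂ)) : dil (k - 8) q = dil k (dil (-8) q) := by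
  rw [dil_dil, sub_eq_add_neg]

lemma le_sqrt_const {x y : ℝ≥0∞} {C : ℝ≥0} (h : x ^ 2 ≤ C * y ^ 2) :
    x ≤ (NNReal.sqrt C : ℝ≥0) * y := by
  rw [← ENNReal.pow_le_pow_left_iff two_ne_zero, mul_pow, ← ENNReal.coe_pow, NNReal.sq_sqrt]
  exact h

lemma tT_band (hχ : IsLPCutoff χ) {q r : 𝓢(Eu n, ℂ)} (hq : LowS q) (hr : RingS r) {f g : Eu n → ℂ}
    (hf : BM f) (hg : BM g) (l k : ℤ) (h : 3 ≤ |l - k|) :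
    fm (dil l (phiS hχ)) (tT q r f g k) = 0 :=
  fm_para_eq_zero hf hg hq hr (ringS_phiS hχ) h

/-- The paraproduct with a bounded low frequency factor. -/
lemma SB_tT_bounded (hχ : IsLPCutoff χ) (hn : 0 < n) {q r : 𝓢(Eu n, ℂ)} (hq : LowS q)
    (hr : RingS r) : ∃ C : ℝ≥0, ∀ f g : Eu n → ℂ, BM f → BM g → MemLp g 2 volume →
    ∀ β : ℝ≥0, (∀ x, ‖f x‖ ≤ β) → SB (tT q r f g) (C * β * eLpNorm g 2 volume) := by
  obtain ⟨C1, h1⟩ := eLpNorm_sq_sum_le_band hχ hn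
  obtain ⟨C2, h2⟩ := hr.annular.square_function hn 0
  refine ⟨NNReal.sqrt (C1 * (nk q ^ 2 * C2)), fun f g hf hg hg2 β hβ S => ?_⟩
  rw [mul_assoc]
  apply le_sqrt_const
  refine (h1 _ (bm_tT hf hg q r) (fun k => memLp_mul_right (hf.fm _) (hg.fm _) (MemLp.fm hg2 hg _))
    (tT_band hχ hq hr hf hg) S).trans ?_
  have h3 := h2 g hg hg2
  simp only [wt_zero_left, one_mul, hsq_zero hg2] at h3
  have h4 (k : ℤ) : eLpNorm (tT q r f g k) 2 volume ^ 2
      ≤ ((nk q * β : ℝ≥0) : ℝ≥0∞) ^ 2 * eLpNorm (fm (dil k r) g) 2 volume ^ 2 := by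
    rw [← mul_pow]
    gcongr
    exact eLpNorm_mul_le_sup fun x => by push_cast; exact norm_fm_dil_le hβ _ _ x
  calc _ ≤ C1 * ∑' k, ((nk q * β : ℝ≥0) : ℝ≥0∞) ^ 2 * eLpNorm (fm (dil k r) g) 2 volume ^ 2 := by
        gcongr with k; exact h4 k
    _ ≤ C1 * (((nk q * β : ℝ≥0) : ℝ≥0∞) ^ 2 * (C2 * eLpNorm g 2 volume ^ 2)) := by
        rw [ENNReal.tsum_mul_left]; gcongr
    _ = _ := by push_cast; ring

/-- The paraproduct with a bounded high frequency factor. -/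
lemma SB_tT_square (hχ : IsLPCutoff χ) (hn : 0 < n) {q r : 𝓢(Eu n, ℂ)} (hq : LowS q)
    (hr : RingS r) : ∃ C : ℝ≥0, ∀ f g : Eu n → ℂ, BM f → BM g → MemLp f 2 volume →
    ∀ β : ℝ≥0, (∀ x, ‖g x‖ ≤ β) → SB (tT q r f g) (C * β * eLpNorm f 2 volume) := by
  obtain ⟨C1, h1⟩ := eLpNorm_sq_sum_le_band hχ hn
  obtain ⟨C2, h2⟩ := carleson hr.annular (dil (-8) q) hn
  refine ⟨NNReal.sqrt (C1 * C2), fun f g hf hg hf2 β hβ S => ?_⟩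
  rw [mul_assoc]
  apply le_sqrt_const
  refine (h1 _ (bm_tT hf hg q r) (fun k => memLp_mul_left (hf.fm _) (hg.fm _) (MemLp.fm hf2 hf _))
    (tT_band hχ hq hr hf hg) S).trans ?_
  have h3 := h2 g f hg hf hf2 β hβ
  simp only [tT, dil_sub_eight, mul_comm (fm (dil _ (dil (-8) q)) f)]
  calc _ ≤ C1 * (C2 * β ^ 2 * eLpNorm f 2 volume ^ 2) := by gcongr
    _ = _ := by push_cast; ring

/-- The derivative on the low factor costs `2 ^ (k - 8)` and expressing the high factor through its
gradient gains `2 ^ (-k)`. So the derivative passes from `z` to `g` with the constant `2 ^ (-8)`. -/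
lemma tT_pdc_eq {q r : 𝓢(Eu n, ℂ)} {R : Fin n → 𝓢(Eu n, ℂ)} (hR : r = ∑ i, sd i (R i))
    {K L : ℝ≥0} {z g : Eu n → ℂ} (hz : BM z) (hg : BM g) (hzL : LipschitzWith L z)
    (hgL : LipschitzWith K g) (j : Fin n) :
    tT q r (pdc j z) g = ∑ i, ((2 : ℂ) ^ (-8 : ℤ)) • tT (sd j q) (R i) z (pdc i g) := by
  ext k x
  simp only [tT, Finset.sum_apply, Pi.smul_apply, Pi.mul_apply, smul_eq_mul]
  rw [fm_dil_pdc _ _ hz hzL, fm_dil_eq_sum hR k hg hgL]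
  simp only [Pi.smul_apply, Finset.sum_apply, smul_eq_mul, Finset.mul_sum]
  refine Finset.sum_congr rfl fun i _ => ?_
  have : (((2 : ℝ) ^ (k - 8) : ℝ) : ℂ) * (((2 : ℝ) ^ (-k) : ℝ) : ℂ) = (2 : ℂ) ^ (-8 : ℤ) := by
    rw [← Complex.ofReal_mul, ← zpow_add₀ two_ne_zero]
    push_cast; congr 1; ring
  rw [← this]; ring

/-- The paraproduct of a derivative with a Lipschitz function. -/
lemma SB_tT_pdc (hχ : IsLPCutoff χ) (hn : 0 < n) {q r : 𝓢(Eu n, ℂ)} (hq : LowS q)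
    (hr : RingS r) : ∃ C : ℝ≥0, ∀ (z g : Eu n → ℂ) (L K : ℝ≥0) (j : Fin n), BM z → BM g →
    MemLp z 2 volume → LipschitzWith L z → LipschitzWith K g →
    SB (tT q r (pdc j z) g) (C * K * eLpNorm z 2 volume) := by
  obtain ⟨R, hR1, hR2⟩ := hr.annular.exists_div
  choose C hC using fun (j i : Fin n) => SB_tT_square hχ hn (hq.sd j) (hr.of_support (hR1 i))
  refine ⟨∑ j, ∑ i, ‖(2 : ℂ) ^ (-8 : ℤ)‖₊ * C j i, fun z g L K j hz hg hz2 hzL hgL => ?_⟩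
  rw [tT_pdc_eq hR2 hz hg hzL hgL]
  refine (SB.sum Finset.univ (C := fun i => ‖(2 : ℂ) ^ (-8 : ℤ)‖ₑ * (C j i * K * eLpNorm z 2 volume))
    (fun i _ => (hC j i z _ hz (bm_pdc hgL i) hz2 K (norm_pdc_le hgL i)).smul _) fun i _ k =>
    (bm_tT hz (bm_pdc hgL i) _ _ k).smul _).mono ?_
  calc _ = (∑ i, ‖(2 : ℂ) ^ (-8 : ℤ)‖ₑ * C j i) * K * eLpNorm z 2 volume := by
        rw [Finset.sum_mul, Finset.sum_mul]
        exact Finset.sum_congr rfl fun i _ => by ring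
    _ ≤ _ := by
        gcongr
        push_cast
        exact Finset.single_le_sum (f := fun j => ∑ i, ‖(2 : ℂ) ^ (-8 : ℤ)‖ₑ * (C j i : ℝ≥0∞)) (fun _ _ => zero_le)
          (Finset.mem_univ j)

lemma tH_high (hχ : IsLPCutoff χ) {q r : 𝓢(Eu n, ℂ)} (hq : RingS q) (hr : RingS r) {f g : Eu n → ℂ}
    (hf : BM f) (hg : BM g) {d : ℤ} (hd : d ≤ 8) (l k : ℤ) (h : k + 12 ≤ l) :
    fm (dil l (phiS hχ)) (tH d q r f g k) = 0 :=
  fm_high_eq_zero hf hg hq hr (ringS_phiS hχ) (by linarith) h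

/-- High-high interactions of a bounded and a square integrable function. -/
lemma SB_tH (hχ : IsLPCutoff χ) (hn : 0 < n) {q r : 𝓢(Eu n, ℂ)} (hq : RingS q) (hr : RingS r)
    {d : ℤ} (hd : d ≤ 8) : ∃ C : ℝ≥0, ∀ b g : Eu n → ℂ, BM b → BM g → MemLp g 2 volume →
    ∀ β : ℝ≥0, (∀ x, ‖b x‖ ≤ β) → SB (tH d q r b g) (C * β * eLpNorm g 2 volume) := by
  obtain ⟨C1, h1⟩ := hr.annular.square_function hn 0
  have hqd : Annular (dil d q) := by
    obtain hq := hq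
    refine ⟨2 ^ (d - 1), 2 ^ (d + 1), by positivity, by positivity, fun ξ hξ => ?_⟩
    exact ⟨(hq.dil hξ).1.le, (hq.dil hξ).2.le⟩
  obtain ⟨C2, h2⟩ := carleson hqd (dil 13 (chiS hχ)) hn
  refine ⟨NNReal.sqrt (C2 * C1), fun b g hb hg hg2 β hβ S => ?_⟩
  set F := ∑ k ∈ S, tH d q r b g k with hF
  have hmt (k : ℤ) : MemLp (tH d q r b g k) 2 volume :=
    memLp_mul_right (hb.fm _) (hg.fm _) (MemLp.fm hg2 hg _)
  have hFB : BM F := BM.sum S fun k _ => bm_tH hb hg d q r k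
  have hF2 : MemLp F 2 volume := memLp_finsetSum' _ fun k _ => hmt k
  -- High-high terms are not almost orthogonal, since they reach arbitrarily low frequencies. The
  -- partial sum `F` is therefore paired with itself.
  have e1 : (eLpNorm F 2 volume ^ 2) = ‖∑ k ∈ S, ∫ x, (starRingEnd ℂ) (F x) * tH d q r b g k x‖ₑ := by
    have hi (k : ℤ) : Integrable (fun x => (starRingEnd ℂ) (F x) * tH d q r b g k x) :=
      MemLp.integrable_mul hF2.star (hmt k)
    rw [← integral_finsetSum S fun k _ => hi k]
    have e2 (x : Eu n) : ∑ k ∈ S, (starRingEnd ℂ) (F x) * tH d q r b g k x = ((‖F x‖ ^ 2 : ℝ) : ℂ) := by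
      rw [← Finset.mul_sum, ← Finset.sum_apply, ← hF, mul_comm, Complex.mul_conj, Complex.normSq_eq_norm_sq]
    simp only [e2]
    rw [integral_complex_ofReal, ← ofReal_norm, Complex.norm_real, Real.norm_of_nonneg (by positivity),
      ofReal_integral_eq_lintegral_ofReal ((memLp_two_iff_integrable_sq_norm hF2.1).1 hF2) (ae_of_all _ fun x => by positivity),
      eLpNorm_two_sq]
    congr 1; ext x
    rw [ENNReal.ofReal_pow (norm_nonneg _), ofReal_norm]
  -- The `k`-th term has no frequencies above `2 ^ (k + 12)`, so only the low frequencies of `F` at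
  -- scale `k + 13` are tested. The cutoff then plays the averaging role in Carleson's estimate.
  have e3 (k : ℤ) : ‖∫ x, (starRingEnd ℂ) (F x) * tH d q r b g k x‖ₑ
      ≤ eLpNorm (fm (dil k (dil d q)) b * fm (dil k (dil 13 (chiS hχ))) F) 2 volume
        * eLpNorm (fm (dil k r) g) 2 volume := by
    rw [integral_conj_low hχ (bm_tH hb hg d q r k) (hmt k) hFB hF2 (L := k + 12)
      fun l hl => tH_high hχ hq hr hb hg hd l k hl, dil_dil, dil_dil]
    refine (enorm_integral_le_lintegral_enorm _).trans (le_trans (le_of_eq ?_) (lintegral_enorm_mul_le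
      ((hb.fm _).mul (hFB.fm _)).meas (hg.fm _).meas))
    congr 1; ext x
    rw [show k + 12 + 1 = k + 13 by ring]
    simp only [tH, Pi.mul_apply, enorm_mul, RCLike.enorm_conj]
    ring
  have e4 : eLpNorm F 2 volume ^ 2 ≤ ∑' k, eLpNorm (fm (dil k (dil d q)) b *
      fm (dil k (dil 13 (chiS hχ))) F) 2 volume * eLpNorm (fm (dil k r) g) 2 volume := by
    rw [e1]
    exact (enorm_sum_le _ _).trans ((Finset.sum_le_sum fun k _ => e3 k).trans (ENNReal.sum_le_tsum S))
  have h3 := h1 g hg hg2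
  simp only [wt_zero_left, one_mul, hsq_zero hg2] at h3
  have e5 : (eLpNorm F 2 volume ^ 2) ^ 2
      ≤ (C2 * β ^ 2 * eLpNorm F 2 volume ^ 2) * (C1 * eLpNorm g 2 volume ^ 2) :=
    (pow_le_pow_left' e4 2).trans ((sq_tsum_mul_le_mul _ _).trans
      (mul_le_mul' (h2 b F hb hFB hF2 β hβ) h3))
  rw [mul_assoc]
  apply le_sqrt_const
  -- The duality bound has one extra factor of the squared norm of `F` on both sides. It is finite,
  -- because `F` is a finite sum, and can be cancelled unless it is zero.
  by_cases hz : eLpNorm F 2 volume = 0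
  · rw [hz]; simp
  · have hz2 : eLpNorm F 2 volume ^ 2 ≠ 0 := pow_ne_zero 2 hz
    have ht2 : eLpNorm F 2 volume ^ 2 ≠ ⊤ := ENNReal.pow_ne_top hF2.2.ne
    rw [← ENNReal.mul_le_mul_iff_right hz2 ht2]
    calc _ = (eLpNorm F 2 volume ^ 2) ^ 2 := by ring
      _ ≤ _ := e5
      _ = _ := by push_cast; ring

lemma tH_pdc_eq {q r : 𝓢(Eu n, ℂ)} {R : Fin n → 𝓢(Eu n, ℂ)} (hR : q = ∑ i, sd i (R i)) (d : ℤ)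
    {K L : ℝ≥0} {f g : Eu n → ℂ} (hf : BM f) (hg : BM g) (hfL : LipschitzWith K f)
    (hgL : LipschitzWith L g) (j : Fin n) :
    tH d q r f (pdc j g) = ∑ i, ((2 : ℂ) ^ (-d)) • tH d (R i) (sd j r) (pdc i f) g := by
  ext k x
  simp only [tH, Finset.sum_apply, Pi.smul_apply, Pi.mul_apply, smul_eq_mul]
  rw [fm_dil_pdc _ _ hg hgL, fm_dil_eq_sum hR _ hf hfL]
  simp only [Pi.smul_apply, Finset.sum_apply, smul_eq_mul, Finset.mul_sum, Finset.sum_mul]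
  refine Finset.sum_congr rfl fun i _ => ?_
  have : (((2 : ℝ) ^ (-(k + d)) : ℝ) : ℂ) * (((2 : ℝ) ^ k : ℝ) : ℂ) = (2 : ℂ) ^ (-d) := by
    rw [← Complex.ofReal_mul, ← zpow_add₀ two_ne_zero]
    push_cast; congr 1; ring
  rw [← this]; ring

/-- High-high interactions of a Lipschitz function with a derivative. -/
lemma SB_tH_pdc (hχ : IsLPCutoff χ) (hn : 0 < n) {q r : 𝓢(Eu n, ℂ)} (hq : RingS q) (hr : RingS r)
    {d : ℤ} (hd : d ≤ 8) : ∃ C : ℝ≥0, ∀ (f g : Eu n → ℂ) (K L : ℝ≥0) (j : Fin n), BM f → BM g →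
    MemLp g 2 volume → LipschitzWith K f → LipschitzWith L g →
    SB (tH d q r f (pdc j g)) (C * K * eLpNorm g 2 volume) := by
  obtain ⟨R, hR1, hR2⟩ := hq.annular.exists_div
  choose C hC using fun (j i : Fin n) => SB_tH hχ hn (hq.of_support (hR1 i)) (hr.sd j) hd
  refine ⟨∑ j, ∑ i, ‖(2 : ℂ) ^ (-d)‖₊ * C j i, fun f g K L j hf hg hg2 hfL hgL => ?_⟩
  rw [tH_pdc_eq hR2 d hf hg hfL hgL]
  refine (SB.sum Finset.univ (C := fun i => ‖(2 : ℂ) ^ (-d)‖ₑ * (C j i * K * eLpNorm g 2 volume))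
    (fun i _ => (hC j i _ g (bm_pdc hfL i) hg hg2 K (norm_pdc_le hfL i)).smul _) fun i _ k =>
    (bm_tH (bm_pdc hfL i) hg _ _ _ k).smul _).mono ?_
  calc _ = (∑ i, ‖(2 : ℂ) ^ (-d)‖ₑ * C j i) * K * eLpNorm g 2 volume := by
        rw [Finset.sum_mul, Finset.sum_mul]
        exact Finset.sum_congr rfl fun i _ => by ring
    _ ≤ _ := by
        gcongr
        push_cast
        exact Finset.single_le_sum (f := fun j => ∑ i, ‖(2 : ℂ) ^ (-d)‖ₑ * (C j i : ℝ≥0∞)) (fun _ _ => zero_le)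
          (Finset.mem_univ j)

end Bilinear

/-! ### Algebra of the remainder and its difference bound in L². -/

section Remainder
open SchwartzMap
variable {n m : ℕ} {χ : Eu n → ℝ}

/-- Since each property persists for larger constants, the sum of the finitely many constants serves
for every index. -/
lemma exists_uniform {ι : Type*} (s : Finset ι) {P : ι → ℝ≥0 → Prop}
    (mono : ∀ i a b, a ≤ b → P i a → P i b) (h : ∀ i ∈ s, ∃ C, P i C) : ∃ C, ∀ i ∈ s, P i C := by
  classical
  choose! C hC using h
  exact ⟨∑ i ∈ s, C i, fun i hi => mono i _ _ (Finset.single_le_sum (fun _ _ => zero_le) hi) (hC i hi)⟩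

lemma tT_sub (q r : 𝓢(Eu n, ℂ)) {f g f' g' : Eu n → ℂ} (hf : BM f) (hg : BM g) (hf' : BM f')
    (hg' : BM g') : tT q r f g - tT q r f' g' = tT q r (f - f') g + tT q r f' (g - g') := by
  ext k x
  simp only [tT, Pi.sub_apply, Pi.add_apply, Pi.mul_apply, fm_sub _ hf hf', fm_sub _ hg hg']
  ring

lemma tH_sub (d : ℤ) (q r : 𝓢(Eu n, ℂ)) {f g f' g' : Eu n → ℂ} (hf : BM f) (hg : BM g) (hf' : BM f')
    (hg' : BM g') : tH d q r f g - tH d q r f' g' = tH d q r f (g - g') + tH d q r (f - f') g' := by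
  ext k x
  simp only [tH, Pi.sub_apply, Pi.add_apply, Pi.mul_apply, fm_sub _ hf hf', fm_sub _ hg hg']
  ring

lemma ae_pdc_sub {K L : ℝ≥0} {f g : Eu n → ℂ} (hf : LipschitzWith K f) (hg : LipschitzWith L g)
    (j : Fin n) : pdc j (f - g) =ᵐ[volume] pdc j f - pdc j g := by
  filter_upwards [hf.ae_differentiableAt, hg.ae_differentiableAt] with x h1 h2
  simp only [pdc, Pi.sub_apply]
  rw [fderiv_sub h1 h2]
  rfl

lemma tT_congr_left (q r : 𝓢(Eu n, ℂ)) {f f' : Eu n → ℂ} (h : f =ᵐ[volume] f') (g : Eu n → ℂ) :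
    tT q r f g = tT q r f' g := by
  ext k x
  simp only [tT, fm_congr_ae _ h]

lemma tH_congr_right (d : ℤ) (q r : 𝓢(Eu n, ℂ)) {g g' : Eu n → ℂ} (h : g =ᵐ[volume] g')
    (f : Eu n → ℂ) : tH d q r f g = tH d q r f g' := by
  ext k x
  simp only [tH, fm_congr_ae _ h]

/-- Reindexing by `k + d` exchanges the roles of the factors. It maps finite sets to finite sets,
which is one reason why `SB` ranges over all of them. -/
lemma SB_tH_comm {d : ℤ} {q r : 𝓢(Eu n, ℂ)} {f g : Eu n → ℂ} {C : ℝ≥0∞}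
    (h : SB (tH (-d) r q g f) C) : SB (tH d q r f g) C := by
  intro S
  convert h (S.image (· + d)) using 2
  rw [Finset.sum_image (fun a _ b _ hab => by simpa using hab)]
  refine Finset.sum_congr rfl fun k _ => ?_
  simp only [tH, add_neg_cancel_right]
  exact mul_comm _ _

/-- The terms of the scalar remainder
`Π(f, ∂_j y) + T_{∂_j y} f - ∑_γ T_{f'_γ ∂_j y} U_γ`. -/
def gterm (hχ : IsLPCutoff χ) (j : Fin n) (f y : Eu n → ℂ) (fp U : Fin m → Eu n → ℂ) :
    ℤ → Eu n → ℂ :=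
  ∑ d ∈ Finset.Icc (-8 : ℤ) 8, tH d (phiS hχ) (phiS hχ) f (pdc j y)
    + tT (chiS hχ) (phiS hχ) (pdc j y) f
    - ∑ γ, tT (chiS hχ) (phiS hχ) (fp γ * pdc j y) (U γ)

/-- The qualitative and quantitative bounds for the functions entering the remainder. -/
structure Data (A B M : ℝ≥0) (f y : Eu n → ℂ) (fp U : Fin m → Eu n → ℂ) : Prop where
  bf : BM f
  lf : LipschitzWith (A * B) f
  by' : BM y
  ly : LipschitzWith B y
  bfp : ∀ γ, BM (fp γ)
  lfp : ∀ γ, LipschitzWith (A * B) (fp γ)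
  afp : ∀ γ x, ‖fp γ x‖ ≤ A
  bU : ∀ γ, BM (U γ)
  lU : ∀ γ, LipschitzWith B (U γ)
  aU : ∀ γ x, ‖U γ x‖ ≤ M

variable {A B M : ℝ≥0} {f y f' y' : Eu n → ℂ} {fp U fp' U' : Fin m → Eu n → ℂ}

/-- The difference of two low-high paraproducts with coefficient `f'_γ ∂_j y`. -/
lemma tT_coeff_eq (hχ : IsLPCutoff χ) (j : Fin n) (h : Data A B M f y fp U)
    (h' : Data A B M f' y' fp' U') (γ : Fin m) :
    tT (chiS hχ) (phiS hχ) (fp γ * pdc j y) (U γ) - tT (chiS hχ) (phiS hχ) (fp' γ * pdc j y') (U' γ)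
      = (tT (chiS hχ) (phiS hχ) (fp γ * pdc j (y - y')) (U γ)
        + tT (chiS hχ) (phiS hχ) ((fp γ - fp' γ) * pdc j y') (U γ))
        + tT (chiS hχ) (phiS hχ) (fp' γ * pdc j y') (U γ - U' γ) := by
  have b1 := bm_pdc h.ly j
  have b2 := bm_pdc h'.ly j
  rw [tT_sub _ _ ((h.bfp γ).mul b1) (h.bU γ) ((h'.bfp γ).mul b2) (h'.bU γ)]
  congr 1
  have hw : BM (pdc j (y - y')) := bm_pdc (h.ly.sub h'.ly) j
  have : fp γ * pdc j y - fp' γ * pdc j y' =ᵐ[volume]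
      fp γ * pdc j (y - y') + (fp γ - fp' γ) * pdc j y' := by
    filter_upwards [ae_pdc_sub h.ly h'.ly j] with x hx
    simp only [Pi.sub_apply, Pi.mul_apply, Pi.add_apply, hx]; ring
  rw [tT_congr_left _ _ this]
  ext k x
  have e := congrFun (fm_add (dil (k - 8) (chiS hχ)) ((h.bfp γ).mul hw)
    (((h.bfp γ).sub (h'.bfp γ)).mul b2)) x
  simp only [tT, Pi.add_apply, Pi.mul_apply] at e ⊢
  rw [e, add_mul]

/-- The algebraic structure of differences of remainders. -/
lemma gterm_sub (hχ : IsLPCutoff χ) (j : Fin n) (h : Data A B M f y fp U)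
    (h' : Data A B M f' y' fp' U') :
    gterm hχ j f y fp U - gterm hχ j f' y' fp' U'
      = ∑ d ∈ Finset.Icc (-8 : ℤ) 8, (tH d (phiS hχ) (phiS hχ) f (pdc j (y - y'))
          + tH d (phiS hχ) (phiS hχ) (f - f') (pdc j y'))
        + (tT (chiS hχ) (phiS hχ) (pdc j (y - y')) f + tT (chiS hχ) (phiS hχ) (pdc j y') (f - f'))
        - ∑ γ, ((tT (chiS hχ) (phiS hχ) (fp γ * pdc j (y - y')) (U γ)
        + tT (chiS hχ) (phiS hχ) ((fp γ - fp' γ) * pdc j y') (U γ))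
        + tT (chiS hχ) (phiS hχ) (fp' γ * pdc j y') (U γ - U' γ)) := by
  have b1 := bm_pdc h.ly j
  have b2 := bm_pdc h'.ly j
  have e1 (d : ℤ) : tH d (phiS hχ) (phiS hχ) f (pdc j y) - tH d (phiS hχ) (phiS hχ) f' (pdc j y')
      = tH d (phiS hχ) (phiS hχ) f (pdc j (y - y')) + tH d (phiS hχ) (phiS hχ) (f - f') (pdc j y') := by
    rw [tH_sub _ _ _ h.bf b1 h'.bf b2, tH_congr_right _ _ _ (ae_pdc_sub h.ly h'.ly j).symm]
  have e2 : tT (chiS hχ) (phiS hχ) (pdc j y) f - tT (chiS hχ) (phiS hχ) (pdc j y') f'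
      = tT (chiS hχ) (phiS hχ) (pdc j (y - y')) f + tT (chiS hχ) (phiS hχ) (pdc j y') (f - f') := by
    rw [tT_sub _ _ b1 h.bf b2 h'.bf, tT_congr_left _ _ (ae_pdc_sub h.ly h'.ly j).symm]
  simp only [← e1, ← e2, ← tT_coeff_eq hχ j h h', Finset.sum_sub_distrib, gterm]
  abel

lemma eLpNorm_mul_le_sup' {f g : Eu n → ℂ} {C : ℝ≥0} (hC : ∀ x, ‖g x‖ ≤ C) :
    eLpNorm (f * g) 2 volume ≤ C * eLpNorm f 2 volume := by
  rw [mul_comm]; exact eLpNorm_mul_le_sup hC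

/-- The paraproduct with coefficient `p ∂_j w`, for Lipschitz `p` and square integrable `w`. -/
lemma SB_tT_coeff (hχ : IsLPCutoff χ) (hn : 0 < n) (A M : ℝ≥0) : ∃ C : ℝ≥0,
    ∀ (p w V : Eu n → ℂ) (B L : ℝ≥0) (j : Fin n), BM p → LipschitzWith (A * B) p →
    (∀ x, ‖p x‖ ≤ A) → BM w → LipschitzWith L w → MemLp w 2 volume → BM V → LipschitzWith B V →
    (∀ x, ‖V x‖ ≤ M) →
    SB (tT (chiS hχ) (phiS hχ) (p * pdc j w) V) (C * B * eLpNorm w 2 volume) := by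
  obtain ⟨C1, h1⟩ := SB_tT_pdc hχ hn (lowS_chiS hχ) (ringS_phiS hχ)
  obtain ⟨C2, h2⟩ := SB_tT_square hχ hn (lowS_chiS hχ) (ringS_phiS hχ)
  refine ⟨C1 * A + C2 * M * A, fun p w V B L j hp hpL hpA hw hwL hw2 hV hVL hVM => ?_⟩
  obtain ⟨D, hD⟩ := hw.exists_nnreal
  have hpw := lipschitz_mul hpL hwL hpA hD
  -- Writing `p ∂_j w = ∂_j (p w) - (∂_j p) w`, the first part uses that `V` is Lipschitz and the
  -- second only that `V` is bounded, since `∂_j p` already carries the factor `B`.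
  have e : tT (chiS hχ) (phiS hχ) (p * pdc j w) V = tT (chiS hχ) (phiS hχ) (pdc j (p * w)) V
      - tT (chiS hχ) (phiS hχ) (pdc j p * w) V := by
    have : p * pdc j w =ᵐ[volume] pdc j (p * w) - pdc j p * w := by
      filter_upwards [ae_pdc_mul hpL hwL j] with x hx
      simp only [Pi.sub_apply, Pi.mul_apply, Pi.add_apply] at hx ⊢
      rw [hx]; ring
    rw [tT_congr_left _ _ this]
    ext k x
    simp only [tT, Pi.sub_apply, Pi.mul_apply, fm_sub _ (bm_pdc hpw j) ((bm_pdc hpL j).mul hw)]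
    ring
  rw [e]
  refine ((h1 _ _ _ _ j (hp.mul hw) hV (memLp_mul_right hp hw hw2) hpw hVL).sub
    (h2 _ _ ((bm_pdc hpL j).mul hw) hV (memLp_mul_right (bm_pdc hpL j) hw hw2) M hVM)
    (bm_tT (bm_pdc hpw j) hV _ _) (bm_tT ((bm_pdc hpL j).mul hw) hV _ _)).mono ?_
  have e1 := eLpNorm_mul_le_sup (f := p) (g := w) hpA
  have e2 := eLpNorm_mul_le_sup (f := pdc j p) (g := w) (norm_pdc_le hpL j)
  calc _ ≤ C1 * B * (A * eLpNorm w 2 volume) + C2 * M * ((A * B : ℝ≥0) * eLpNorm w 2 volume) := by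
        gcongr
    _ = _ := by push_cast; ring

/-- The difference of two remainders, in the space of square integrable functions. -/
theorem SB_gterm_sub (hχ : IsLPCutoff χ) (hn : 0 < n) (m : ℕ) (A M : ℝ≥0) : ∃ C : ℝ≥0,
    ∀ (j : Fin n) (B : ℝ≥0) (f y f' y' : Eu n → ℂ) (fp U fp' U' : Fin m → Eu n → ℂ),
    Data A B M f y fp U → Data A B M f' y' fp' U' → ∀ N : ℝ≥0∞, N ≠ ⊤ →
    eLpNorm (f - f') 2 volume ≤ A * N → eLpNorm (y - y') 2 volume ≤ N →
    (∀ γ, eLpNorm (fp γ - fp' γ) 2 volume ≤ A * N) → (∀ γ, eLpNorm (U γ - U' γ) 2 volume ≤ N) →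
    SB (gterm hχ j f y fp U - gterm hχ j f' y' fp' U') (C * B * N) := by
  have hr := ringS_phiS hχ
  have hl := lowS_chiS hχ
  obtain ⟨C1, h1⟩ := exists_uniform (Finset.Icc (-8 : ℤ) 8) (P := fun d C => ∀ (f g : Eu n → ℂ)
    (K L : ℝ≥0) (j : Fin n), BM f → BM g → MemLp g 2 volume → LipschitzWith K f → LipschitzWith L g →
    SB (tH d (phiS hχ) (phiS hχ) f (pdc j g)) (C * K * eLpNorm g 2 volume))
    (fun d a b hab h f g K L j h1 h2 h3 h4 h5 => (h f g K L j h1 h2 h3 h4 h5).mono (by gcongr))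
    fun d hd => SB_tH_pdc hχ hn hr hr (Finset.mem_Icc.1 hd).2
  obtain ⟨C2, h2⟩ := exists_uniform (Finset.Icc (-8 : ℤ) 8) (P := fun d C => ∀ b g : Eu n → ℂ,
    BM b → BM g → MemLp g 2 volume → ∀ β : ℝ≥0, (∀ x, ‖b x‖ ≤ β) →
    SB (tH (-d) (phiS hχ) (phiS hχ) b g) (C * β * eLpNorm g 2 volume))
    (fun d a b hab h f g h1 h2 h3 K h4 => (h f g h1 h2 h3 K h4).mono (by gcongr))
    fun d hd => SB_tH hχ hn hr hr (by have := (Finset.mem_Icc.1 hd).1; linarith)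
  obtain ⟨C3, h3⟩ := SB_tT_pdc hχ hn hl hr
  obtain ⟨C4, h4⟩ := SB_tT_bounded hχ hn hl hr
  obtain ⟨C5, h5⟩ := SB_tT_coeff hχ hn A M
  obtain ⟨C6, h6⟩ := SB_tT_square hχ hn hl hr
  -- There are `17` offsets between `-8` and `8` in the high-high part and `m` summands in the last
  -- part.
  refine ⟨17 * (C1 * A + C2 * A) + (C3 * A + C4 * A) + m * (C5 + C6 * M * A + C4 * A),
    fun j B f y f' y' fp U fp' U' h h' N hN hf hy hfp hU => ?_⟩
  have fin {g : Eu n → ℂ} {c : ℝ≥0} (hg : BM g) (hgN : eLpNorm g 2 volume ≤ c * N) :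
      MemLp g 2 volume := ⟨hg.meas.aestronglyMeasurable,
        hgN.trans_lt (ENNReal.mul_lt_top (by simp) hN.lt_top)⟩
  have by2 := h.by'.sub h'.by'
  have ly2 := h.ly.sub h'.ly
  have my2 : MemLp (y - y') 2 volume := fin (c := 1) by2 (by simpa using hy)
  have bf2 := h.bf.sub h'.bf
  have mf2 : MemLp (f - f') 2 volume := fin bf2 hf
  have bd' := bm_pdc h'.ly j
  have bdw := bm_pdc ly2 j
  rw [gterm_sub hχ j h h']
  -- In the first term the derivative of `y - y'` is traded against the gradient of `f`. In the
  -- second `pdc j y'` is the bounded factor, and the bound is used with the factors exchanged.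
  have s1 := SB.sum (Finset.Icc (-8 : ℤ) 8) (T := fun d => tH d (phiS hχ) (phiS hχ) f (pdc j (y - y'))
      + tH d (phiS hχ) (phiS hχ) (f - f') (pdc j y'))
    (C := fun _ => C1 * (A * B : ℝ≥0) * eLpNorm (y - y') 2 volume + C2 * B * eLpNorm (f - f') 2 volume)
    (fun d hd => (h1 d hd _ _ _ _ j h.bf by2 my2 h.lf ly2).add
      (SB_tH_comm (h2 d hd _ _ bd' bf2 mf2 B (norm_pdc_le h'.ly j)))
      (bm_tH h.bf bdw _ _ _) (bm_tH bf2 bd' _ _ _))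
    (fun d hd k => (bm_tH h.bf bdw _ _ _ k).add (bm_tH bf2 bd' _ _ _ k))
  have s2 := (h3 _ _ _ _ j by2 h.bf my2 ly2 h.lf).add
    (h4 _ _ bd' bf2 mf2 B (norm_pdc_le h'.ly j)) (bm_tT bdw h.bf _ _) (bm_tT bd' bf2 _ _)
  have c1 (γ : Fin m) := h5 _ _ _ B _ j (h.bfp γ) (h.lfp γ) (h.afp γ) by2 ly2 my2 (h.bU γ) (h.lU γ) (h.aU γ)
  have bq (γ : Fin m) := ((h.bfp γ).sub (h'.bfp γ)).mul bd'
  have mq (γ : Fin m) : MemLp ((fp γ - fp' γ) * pdc j y') 2 volume :=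
    memLp_mul_left ((h.bfp γ).sub (h'.bfp γ)) bd' (fin ((h.bfp γ).sub (h'.bfp γ)) (hfp γ))
  have c2 (γ : Fin m) := h6 _ _ (bq γ) (h.bU γ) (mq γ) M (h.aU γ)
  have be (γ : Fin m) := (h'.bfp γ).mul bd'
  have bU2 (γ : Fin m) := (h.bU γ).sub (h'.bU γ)
  have c3 (γ : Fin m) := h4 _ _ (be γ) (bU2 γ) (fin (c := 1) (bU2 γ) (by simpa using hU γ)) (A * B)
    fun x => by
      rw [Pi.mul_apply, norm_mul]
      push_cast
      exact mul_le_mul (h'.afp γ x) (norm_pdc_le h'.ly j x) (norm_nonneg _) A.2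
  have s3 := SB.sum Finset.univ (fun γ _ => ((c1 γ).add (c2 γ) (bm_tT ((h.bfp γ).mul bdw) (h.bU γ) _ _)
      (bm_tT (bq γ) (h.bU γ) _ _)).add (c3 γ)
      (fun k => (bm_tT ((h.bfp γ).mul bdw) (h.bU γ) _ _ k).add (bm_tT (bq γ) (h.bU γ) _ _ k))
      (bm_tT (be γ) (bU2 γ) _ _))
    (fun γ _ k => ((bm_tT ((h.bfp γ).mul bdw) (h.bU γ) _ _ k).add (bm_tT (bq γ) (h.bU γ) _ _ k)).add
      (bm_tT (be γ) (bU2 γ) _ _ k))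
  refine ((s1.add s2 (fun k => ?_) (fun k => ?_)).sub s3 (fun k => ?_) fun k => ?_).mono ?_
  · rw [Finset.sum_apply]
    exact BM.sum _ fun d _ => (bm_tH h.bf bdw _ _ _ k).add (bm_tH bf2 bd' _ _ _ k)
  · exact (bm_tT bdw h.bf _ _ k).add (bm_tT bd' bf2 _ _ k)
  · rw [Pi.add_apply, Finset.sum_apply]
    exact (BM.sum _ fun d _ => (bm_tH h.bf bdw _ _ _ k).add (bm_tH bf2 bd' _ _ _ k)).add
      ((bm_tT bdw h.bf _ _ k).add (bm_tT bd' bf2 _ _ k))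
  · rw [Finset.sum_apply]
    exact BM.sum _ fun γ _ => ((bm_tT ((h.bfp γ).mul bdw) (h.bU γ) _ _ k).add
      (bm_tT (bq γ) (h.bU γ) _ _ k)).add (bm_tT (be γ) (bU2 γ) _ _ k)
  · have e (γ : Fin m) : eLpNorm ((fp γ - fp' γ) * pdc j y') 2 volume ≤ B * (A * N) :=
      (eLpNorm_mul_le_sup' (norm_pdc_le h'.ly j)).trans (by gcongr; exact hfp γ)
    calc _ ≤ ∑ d ∈ Finset.Icc (-8 : ℤ) 8, (C1 * (A * B : ℝ≥0) * N + C2 * B * (A * N))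
          + (C3 * (A * B : ℝ≥0) * N + C4 * B * (A * N))
          + ∑ γ : Fin m, (C5 * B * N + C6 * M * (B * (A * N)) + C4 * (A * B : ℝ≥0) * N) := by
          gcongr with d _ γ _ γ
          · exact e γ
          · exact hU γ
      _ = _ := by
          rw [Finset.sum_const, Finset.sum_const, Finset.card_univ, Fintype.card_fin, Int.card_Icc]
          simp only [nsmul_eq_mul]
          push_cast
          ring

end Remainder

/-! ### Hadamard's lemma with smooth dependence on both points. -/

section Hadamard

/-- Smoothness of integrals over the unit interval depending on a parameter. -/
lemma contDiff_integral_unitInterval {P : Type*} [NormedAddCommGroup P] [NormedSpace ℝ P]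
    {F : P × ℝ → ℝ} (hF : ContDiff ℝ ∞ F) : ContDiff ℝ ∞ fun p => ∫ t in (0 : ℝ)..1, F (p, t) := by
  -- The integral is written as the value at `0` of the convolution of the indicator of `(0, 1]`
  -- with `t ↦ η t * F (p, -t)`. The bump supplies the compact support that smoothness of
  -- convolutions with parameters requires.
  let η : ContDiffBump (0 : ℝ) := ⟨2, 3, by norm_num, by norm_num⟩
  have hf : LocallyIntegrable ((Set.Ioc (0 : ℝ) 1).indicator fun _ => (1 : ℝ)) volume :=
    (integrable_indicator_iff measurableSet_Ioc |>.2 (by simp)).locallyIntegrable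
  have key := contDiffOn_convolution_right_with_param_comp (𝕜 := ℝ) (μ := (volume : Measure ℝ))
    (n := ⊤) (ContinuousLinearMap.mul ℝ ℝ) (v := fun _ : P => (0 : ℝ)) (s := Set.univ)
    contDiffOn_const (f := (Set.Ioc (0 : ℝ) 1).indicator fun _ => (1 : ℝ))
    (g := fun p t => η t * F (p, -t)) (k := Metric.closedBall 0 3) isOpen_univ
    (isCompact_closedBall _ _)
    (fun p t _ ht => by
      rw [η.zero_of_le_dist (by
        rw [Metric.mem_closedBall, not_le] at ht; exact ht.le), zero_mul]) hf
    (by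
      apply ContDiff.contDiffOn
      exact (η.contDiff.comp contDiff_snd).mul
        (hF.comp (contDiff_fst.prodMk contDiff_snd.neg)))
  rw [contDiffOn_univ] at key
  convert key using 2 with p
  rw [convolution_def, intervalIntegral.integral_of_le zero_le_one,
    ← integral_indicator measurableSet_Ioc]
  refine integral_congr_ae (Filter.Eventually.of_forall fun t => ?_)
  by_cases ht : t ∈ Set.Ioc (0 : ℝ) 1
  · have : η (-t) = 1 := η.one_of_mem_closedBall (by
      simp only [Metric.mem_closedBall, dist_zero_right, norm_neg, Real.norm_eq_abs]
      rw [abs_of_pos ht.1]; exact ht.2.trans (by norm_num [η]))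
    simp [ht, this]
  · simp [ht]

variable {ι : Type*} [Fintype ι] [DecidableEq ι]

lemma fderiv_eq_sum_single {a : (ι → ℝ) → ℝ} (x v : ι → ℝ) :
    fderiv ℝ a x v = ∑ γ, fderiv ℝ a x (Pi.single γ 1) * v γ := by
  conv_lhs => rw [pi_eq_sum_univ v]
  rw [map_sum]
  refine Finset.sum_congr rfl fun γ _ => ?_
  rw [map_smul, smul_eq_mul, mul_comm]
  congr 2
  ext i
  simp [Pi.single_apply, eq_comm]

/-- Hadamard's lemma. -/
lemma exists_hadamard {a : (ι → ℝ) → ℝ} (ha : ContDiff ℝ ∞ a) :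
    ∃ c : ι → (ι ⊕ ι → ℝ) → ℝ, (∀ γ, ContDiff ℝ ∞ (c γ)) ∧
      (∀ x y, a x - a y = ∑ γ, c γ (Sum.elim x y) * (x γ - y γ)) ∧
      ∀ γ x, c γ (Sum.elim x x) = fderiv ℝ a x (Pi.single γ 1) := by
  have hda : ContDiff ℝ ∞ (fderiv ℝ a) := ha.fderiv_right (by simp)
  have hF (γ : ι) : ContDiff ℝ ∞ fun p : (ι ⊕ ι → ℝ) × ℝ => fderiv ℝ a
      (fun i => p.1 (.inr i) + p.2 * (p.1 (.inl i) - p.1 (.inr i))) (Pi.single γ 1) := by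
    refine (hda.comp ?_).clm_apply contDiff_const
    refine contDiff_pi.2 fun i => ?_
    fun_prop
  -- Partial derivatives are averaged along the segment between the points; `Sum.inl` holds the
  -- endpoint `x` and `Sum.inr` the endpoint `y`.
  refine ⟨fun γ z => ∫ t in (0 : ℝ)..1, fderiv ℝ a
    (fun i => z (.inr i) + t * (z (.inl i) - z (.inr i))) (Pi.single γ 1),
    fun γ => contDiff_integral_unitInterval (hF γ), fun x y => ?_, fun γ x => ?_⟩
  · have hγ (t : ℝ) : HasDerivAt (fun t : ℝ => fun i => y i + t * (x i - y i)) (x - y) t := by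
      refine hasDerivAt_pi.2 fun i => ?_
      simpa using ((hasDerivAt_id t).mul_const (x i - y i)).const_add (y i)
    have hd (t : ℝ) : HasDerivAt (fun t : ℝ => a fun i => y i + t * (x i - y i))
        (fderiv ℝ a (fun i => y i + t * (x i - y i)) (x - y)) t :=
      ((ha.differentiable (by simp) _).hasFDerivAt).comp_hasDerivAt t (hγ t)
    have hcont (v : ι → ℝ) : Continuous fun t : ℝ =>
        fderiv ℝ a (fun i => y i + t * (x i - y i)) v :=
      ((hda.continuous).comp (by fun_prop)).clm_apply continuous_const
    have e := intervalIntegral.integral_eq_sub_of_hasDerivAt (a := 0) (b := 1) (fun t _ => hd t)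
      ((hcont (x - y)).intervalIntegrable _ _)
    have e2 : a x - a y = ∫ t in (0 : ℝ)..1, fderiv ℝ a (fun i => y i + t * (x i - y i)) (x - y) := by
      rw [e]; simp
    rw [e2]
    simp_rw [fderiv_eq_sum_single _ (x - y)]
    have hi (γ : ι) : IntervalIntegrable (fun t : ℝ => fderiv ℝ a (fun i => y i + t * (x i - y i))
        (Pi.single γ 1) * (x - y) γ) volume 0 1 :=
      ((hcont _).mul continuous_const).intervalIntegrable _ _
    rw [intervalIntegral.integral_finsetSum fun γ _ => hi γ]
    simp [intervalIntegral.integral_mul_const]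
  · simp

end Hadamard

/-! ### Functions whose derivatives scale like frequency `2 ^ l`. -/

section Jets
open SchwartzMap
variable {n : ℕ}

/-- Partial derivatives of real functions. -/
def pr (i : Fin n) (f : Eu n → ℝ) (x : Eu n) : ℝ := fderiv ℝ f x (ej i)

/-- Smooth functions with `|∂^α f| ≤ K 2^{l|α|}` for `|α| ≤ N`. -/
def JB (l : ℤ) : ℕ → ℝ≥0 → (Eu n → ℝ) → Prop
  | 0, K, f => ContDiff ℝ ∞ f ∧ ∀ x, |f x| ≤ K
  | N + 1, K, f => (ContDiff ℝ ∞ f ∧ ∀ x, |f x| ≤ K) ∧ ∀ i, JB l N (2 ^ l * K) (pr i f)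

variable {l : ℤ} {N : ℕ} {K K' : ℝ≥0} {f g : Eu n → ℝ}

lemma JB.base (h : JB l N K f) : ContDiff ℝ ∞ f ∧ ∀ x, |f x| ≤ K := by
  cases N with
  | zero => exact h
  | succ N => exact h.1

lemma JB.mono (h : JB l N K f) (hK : K ≤ K') : JB l N K' f := by
  induction N generalizing K K' f with
  | zero => exact ⟨h.1, fun x => (h.2 x).trans (by exact_mod_cast hK)⟩
  | succ N ih =>
    exact ⟨⟨h.1.1, fun x => (h.1.2 x).trans (by exact_mod_cast hK)⟩, fun i => ih (h.2 i) (by gcongr)⟩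

lemma JB.of_succ (h : JB l (N + 1) K f) : JB l N K f := by
  induction N generalizing K f with
  | zero => exact h.1
  | succ N ih => exact ⟨h.1, fun i => ih (h.2 i)⟩

lemma pr_add (hf : ContDiff ℝ ∞ f) (hg : ContDiff ℝ ∞ g) (i : Fin n) :
    pr i (f + g) = pr i f + pr i g := by
  ext x
  simp only [pr, Pi.add_apply]
  rw [fderiv_add (hf.differentiable (by simp) x) (hg.differentiable (by simp) x)]
  rfl

lemma pr_mul (hf : ContDiff ℝ ∞ f) (hg : ContDiff ℝ ∞ g) (i : Fin n) :
    pr i (f * g) = pr i f * g + f * pr i g := by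
  ext x
  simp only [pr, Pi.add_apply, Pi.mul_apply]
  rw [fderiv_mul (hf.differentiable (by simp) x) (hg.differentiable (by simp) x)]
  simp [mul_comm, add_comm]

lemma pr_smul (c : ℝ) (hf : ContDiff ℝ ∞ f) (i : Fin n) : pr i (c • f) = c • pr i f := by
  ext x
  simp only [pr, Pi.smul_apply]
  rw [fderiv_const_smul (hf.differentiable (by simp) x)]
  rfl

lemma JB.add (hf : JB l N K f) (hg : JB l N K' g) : JB l N (K + K') (f + g) := by
  induction N generalizing K K' f g with
  | zero =>
    exact ⟨hf.1.add hg.1, fun x => (abs_add_le _ _).trans (add_le_add (hf.2 x) (hg.2 x))⟩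
  | succ N ih =>
    refine ⟨⟨hf.1.1.add hg.1.1, fun x => (abs_add_le _ _).trans (add_le_add (hf.1.2 x) (hg.1.2 x))⟩,
      fun i => ?_⟩
    rw [pr_add hf.1.1 hg.1.1, mul_add]
    exact ih (hf.2 i) (hg.2 i)

lemma JB.smul (hf : JB l N K f) (c : ℝ) : JB l N (‖c‖₊ * K) (c • f) := by
  have h0 {f : Eu n → ℝ} {K : ℝ≥0} (h : ∀ x, |f x| ≤ K) (x : Eu n) : |(c • f) x| ≤ (‖c‖₊ * K : ℝ≥0) := by
    rw [Pi.smul_apply, smul_eq_mul, abs_mul]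
    push_cast
    exact mul_le_mul_of_nonneg_left (h x) (abs_nonneg c)
  induction N generalizing K f with
  | zero => exact ⟨hf.1.const_smul c, h0 hf.2⟩
  | succ N ih =>
    refine ⟨⟨hf.1.1.const_smul c, h0 hf.1.2⟩, fun i => ?_⟩
    rw [pr_smul c hf.1.1, mul_left_comm]
    exact ih (hf.2 i)

lemma JB.sub (hf : JB l N K f) (hg : JB l N K' g) : JB l N (K + K') (f - g) := by
  have := hf.add (hg.smul (-1))
  simpa [sub_eq_add_neg] using this

lemma JB.sum {ι : Type*} (s : Finset ι) {F : ι → Eu n → ℝ} {K : ι → ℝ≥0}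
    (h : ∀ i ∈ s, JB l N (K i) (F i)) : JB l N (∑ i ∈ s, K i) (∑ i ∈ s, F i) := by
  classical
  induction s using Finset.induction_on with
  | empty =>
    have h0 : ∀ N, JB l N 0 (0 : Eu n → ℝ) := fun N => by
      induction N with
      | zero => exact ⟨contDiff_const, fun x => by simp⟩
      | succ N ih =>
        refine ⟨⟨contDiff_const, fun x => by simp⟩, fun i => ?_⟩
        have : pr i (0 : Eu n → ℝ) = 0 := by ext x; simp [pr]
        rwa [this, mul_zero]
    simpa using h0 N
  | insert a s ha ih =>
    rw [Finset.sum_insert ha, Finset.sum_insert ha]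
    exact (h a (by simp)).add (ih fun i hi => h i (by simp [hi]))

lemma JB.mul (hf : JB l N K f) (hg : JB l N K' g) : JB l N (2 ^ N * (K * K')) (f * g) := by
  have h0 {f g : Eu n → ℝ} {K K' : ℝ≥0} (N : ℕ) (h : ∀ x, |f x| ≤ K) (h' : ∀ x, |g x| ≤ K') (x : Eu n) :
      |(f * g) x| ≤ (2 ^ N * (K * K') : ℝ≥0) := by
    rw [Pi.mul_apply, abs_mul]
    have h1 : |f x| * |g x| ≤ K * K' := mul_le_mul (h x) (h' x) (abs_nonneg _) K.2
    have h2 : (1 : ℝ) ≤ 2 ^ N := one_le_pow₀ (by norm_num)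
    push_cast
    exact h1.trans (le_mul_of_one_le_left (mul_nonneg K.2 K'.2) h2)
  induction N generalizing K K' f g with
  | zero => exact ⟨hf.1.mul hg.1, h0 0 hf.2 hg.2⟩
  | succ N ih =>
    refine ⟨⟨hf.1.1.mul hg.1.1, h0 _ hf.1.2 hg.1.2⟩, fun i => ?_⟩
    rw [pr_mul hf.1.1 hg.1.1]
    refine ((ih (hf.2 i) hg.of_succ).add (ih hf.of_succ (hg.2 i))).mono (le_of_eq ?_)
    ring

variable {ι : Type*} [Fintype ι]

lemma pr_comp [DecidableEq ι] {c : (ι → ℝ) → ℝ} (hc : ContDiff ℝ ∞ c) {X : ι → Eu n → ℝ}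
    (hX : ∀ γ, ContDiff ℝ ∞ (X γ)) (i : Fin n) : pr i (fun x => c fun γ => X γ x)
      = ∑ γ, (fun x => fderiv ℝ c (fun γ => X γ x) (Pi.single γ 1)) * pr i (X γ) := by
  ext x
  have h1 : HasFDerivAt (fun x => fun γ => X γ x) (ContinuousLinearMap.pi fun γ => fderiv ℝ (X γ) x) x :=
    hasFDerivAt_pi.2 fun γ => ((hX γ).differentiable (by simp) x).hasFDerivAt
  have h2 := (hc.differentiable (by simp) (fun γ => X γ x)).hasFDerivAt.comp x h1
  simp only [pr, Finset.sum_apply, Pi.mul_apply]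
  rw [show (fun x => c fun γ => X γ x) = c ∘ (fun x => fun γ => X γ x) from rfl, h2.fderiv,
    ContinuousLinearMap.comp_apply, fderiv_eq_sum_single]
  rfl

lemma exists_bound_of_contDiff {c : (ι → ℝ) → ℝ} (hc : ContDiff ℝ ∞ c) (R : ℝ≥0) :
    ∃ C : ℝ≥0, ∀ x : ι → ℝ, (∀ γ, |x γ| ≤ R) → |c x| ≤ C := by
  obtain ⟨C, hC⟩ := (isCompact_closedBall (0 : ι → ℝ) R).exists_bound_of_continuousOn
    hc.continuous.continuousOn
  refine ⟨C.toNNReal, fun x hx => (hC x ?_).trans (Real.le_coe_toNNReal C)⟩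
  rw [mem_closedBall_zero_iff]
  exact (pi_norm_le_iff_of_nonneg R.2).2 hx

/-- Smooth functions of functions with controlled derivatives. -/
lemma JB.comp (N : ℕ) {c : (ι → ℝ) → ℝ} (hc : ContDiff ℝ ∞ c) (R : ℝ≥0) :
    ∃ C : ℝ≥0, ∀ (l : ℤ) (X : ι → Eu n → ℝ), (∀ γ, JB l N R (X γ)) →
      JB l N C (fun x => c fun γ => X γ x) := by
  classical
  have hsm {c : (ι → ℝ) → ℝ} (hc : ContDiff ℝ ∞ c) {X : ι → Eu n → ℝ}
      (hX : ∀ γ, ContDiff ℝ ∞ (X γ)) : ContDiff ℝ ∞ (fun x => c fun γ => X γ x) :=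
    hc.comp (contDiff_pi.2 hX)
  induction N generalizing c with
  | zero =>
    obtain ⟨C, hC⟩ := exists_bound_of_contDiff hc R
    exact ⟨C, fun l X hX => ⟨hsm hc fun γ => (hX γ).1, fun x => hC _ fun γ => (hX γ).2 x⟩⟩
  | succ N ih =>
    obtain ⟨C, hC⟩ := exists_bound_of_contDiff hc R
    have hd (γ : ι) : ContDiff ℝ ∞ fun x => fderiv ℝ c x (Pi.single γ 1) :=
      (hc.fderiv_right (by simp)).clm_apply contDiff_const
    choose D hD using fun γ => ih (hd γ)
    refine ⟨C + ∑ γ, 2 ^ N * (D γ * R), fun l X hX => ⟨⟨hsm hc fun γ => (hX γ).base.1,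
      fun x => (hC _ fun γ => (hX γ).base.2 x).trans (by exact_mod_cast le_self_add)⟩, fun i => ?_⟩⟩
    rw [pr_comp hc fun γ => (hX γ).base.1]
    refine (JB.sum Finset.univ fun γ _ => (hD γ l X fun γ => (hX γ).of_succ).mul ((hX γ).2 i)).mono ?_
    rw [mul_add, Finset.mul_sum]
    refine le_trans (le_of_eq ?_) le_add_self
    refine Finset.sum_congr rfl fun γ _ => by ring

/-- The first derivatives of smooth functions of functions. -/
lemma JB.pr_comp (N : ℕ) {c : (ι → ℝ) → ℝ} (hc : ContDiff ℝ ∞ c) (R : ℝ≥0) :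
    ∃ C : ℝ≥0, ∀ (l : ℤ) (X : ι → Eu n → ℝ) (B : ℝ≥0) (i : Fin n), (∀ γ, JB l N R (X γ)) →
      (∀ γ, JB l N B (pr i (X γ))) → JB l N (C * B) (pr i fun x => c fun γ => X γ x) := by
  classical
  have hd (γ : ι) : ContDiff ℝ ∞ fun x => fderiv ℝ c x (Pi.single γ 1) :=
    (hc.fderiv_right (by simp)).clm_apply contDiff_const
  choose D hD using fun γ => JB.comp (n := n) N (hd γ) R
  refine ⟨∑ γ, 2 ^ N * D γ, fun l X B i hX hB => ?_⟩
  rw [Paradiff.pr_comp hc fun γ => (hX γ).base.1]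
  refine (JB.sum Finset.univ fun γ _ => (hD γ l X hX).mul (hB γ)).mono (le_of_eq ?_)
  rw [Finset.sum_mul]
  exact Finset.sum_congr rfl fun γ _ => by ring

end Jets

/-! ### Frequency gain by repeated integration by parts. -/

section Gain
open SchwartzMap
variable {n : ℕ}

lemma JB.differentiable {l : ℤ} {N : ℕ} {K : ℝ≥0} {f : Eu n → ℝ} (h : JB l N K f) :
    Differentiable ℝ f := h.base.1.differentiable (by simp)

lemma pdc_cx {f : Eu n → ℝ} (hf : Differentiable ℝ f) (i : Fin n) : pdc i (cx f) = cx (pr i f) := by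
  ext x
  have h := Complex.ofRealCLM.hasFDerivAt.comp x (hf x).hasFDerivAt
  simp only [pdc, pr, cx]
  rw [show cx f = Complex.ofRealCLM ∘ f from rfl, h.fderiv]
  rfl

lemma BM.cx_of_bound {f : Eu n → ℝ} (hf : Continuous f) {K : ℝ} (h : ∀ x, |f x| ≤ K) : BM (cx f) :=
  ⟨(Complex.continuous_ofReal.comp hf).measurable, K, fun x => by simpa [cx] using h x⟩

lemma norm_cx (f : Eu n → ℝ) (x : Eu n) : ‖cx f x‖ = |f x| := by simp [cx]

lemma JB.bm {l : ℤ} {N : ℕ} {K : ℝ≥0} {f : Eu n → ℝ} (h : JB l N K f) : BM (cx f) :=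
  .cx_of_bound h.base.1.continuous h.base.2

/-- A function with bounded partial derivatives is Lipschitz. -/
lemma lipschitzWith_of_pdc_le {f : Eu n → ℂ} (hf : Differentiable ℝ f) {C : Fin n → ℝ≥0}
    (hC : ∀ i x, ‖pdc i f x‖ ≤ C i) : LipschitzWith (∑ i, C i) f := by
  refine lipschitzWith_of_nnnorm_fderiv_le hf fun x => ?_
  rw [← NNReal.coe_le_coe, coe_nnnorm]
  refine ContinuousLinearMap.opNorm_le_bound _ (by positivity) fun v => ?_
  rw [clm_eq_sum (fderiv ℝ f x)]
  simp only [_root_.sum_apply, ContinuousLinearMap.smulRight_apply]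
  refine (norm_sum_le _ _).trans ?_
  push_cast
  rw [Finset.sum_mul]
  refine Finset.sum_le_sum fun i _ => ?_
  rw [norm_smul, mul_comm]
  exact mul_le_mul (hC i x) (PiLp.norm_apply_le v i) (norm_nonneg _) (C i).2

lemma exists_lipschitz {f : Eu n → ℂ} (hf : Differentiable ℝ f) (h : ∀ i, BM (pdc i f)) :
    ∃ K, LipschitzWith K f := by
  choose C hC using fun i => (h i).exists_nnreal
  exact ⟨_, lipschitzWith_of_pdc_le hf hC⟩

lemma pdc_fm (q : 𝓢(Eu n, ℂ)) {f : Eu n → ℂ} (hf : BM f) (i : Fin n) :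
    pdc i (fm q f) = fm (sd i q) f := funext fun x => fderiv_fm q hf x i

lemma differentiable_fm (q : 𝓢(Eu n, ℂ)) {f : Eu n → ℂ} (hf : BM f) : Differentiable ℝ (fm q f) :=
  (contDiff_fm q hf).differentiable (by simp)

lemma pdc_fm_dil (k : ℤ) (q : 𝓢(Eu n, ℂ)) {f : Eu n → ℂ} (hf : BM f) (i : Fin n) :
    pdc i (fm (dil k q) f) = (((2 : ℝ) ^ k : ℝ) : ℂ) • fm (dil k (sd i q)) f := by
  rw [pdc_fm _ hf, sd_dil, fm_symbol_smul]

lemma pdc_mul {f g : Eu n → ℂ} (hf : Differentiable ℝ f) (hg : Differentiable ℝ g) (i : Fin n) :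
    pdc i (f * g) = pdc i f * g + f * pdc i g := by
  ext x
  simp only [pdc, Pi.add_apply, Pi.mul_apply]
  rw [fderiv_mul (hf x) (hg x)]
  simp [mul_comm, add_comm]

lemma eLpNorm_smul_zpow (k : ℤ) (f : Eu n → ℂ) :
    eLpNorm ((((2 : ℝ) ^ k : ℝ) : ℂ) • f) 2 volume = wt 1 k * eLpNorm f 2 volume := by
  rw [eLpNorm_const_smul, wt_one, ← enorm_two_zpow]
  congr 1
  rw [← ofReal_norm, ← ofReal_norm, Complex.norm_real]

/-- High frequencies of the product of a function with controlled derivatives and of a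
function with low frequencies. -/
lemma exists_gain (N : ℕ) {q : 𝓢(Eu n, ℂ)} (hq : Annular q) (r : 𝓢(Eu n, ℂ)) : ∃ C : ℝ≥0,
    ∀ (l k : ℤ) (m : Eu n → ℝ) (K : ℝ≥0) (f : Eu n → ℂ), JB l N K m → BM f →
    eLpNorm (fm (dil k q) (cx m * fm (dil l r) f)) 2 volume
      ≤ C * K * wt N (l - k) * eLpNorm f 2 volume := by
  induction N generalizing q r with
  | zero =>
    refine ⟨nk q * nk r, fun l k m K f hm hf => ?_⟩
    have bb : BM (cx m * fm (dil l r) f) := hm.bm.mul (hf.fm _)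
    calc _ ≤ nk q * (K * (nk r * eLpNorm f 2 volume)) := by
          refine (eLpNorm_fm_dil_le bb.meas k q).trans (mul_le_mul_right ?_ _)
          refine (eLpNorm_mul_le_sup (C := K) fun x => by rw [norm_cx]; exact hm.2 x).trans ?_
          exact mul_le_mul_right (eLpNorm_fm_dil_le hf.meas l r) _
      _ = _ := by simp only [Nat.cast_zero, wt_zero_left]; push_cast; ring
  | succ N ih =>
    obtain ⟨R, hR, hRq⟩ := hq.exists_div
    choose C hC using fun i => ih (hq.of_support (hR i)) r
    choose D hD using fun i => ih (hq.of_support (hR i)) (sd i r)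
    refine ⟨∑ i, (C i + D i), fun l k m K f hm hf => ?_⟩
    have b1 := hm.bm
    have b2 := hf.fm (dil l r)
    have d1 : Differentiable ℝ (cx m) := fun x =>
      (Complex.ofRealCLM.hasFDerivAt.comp x (hm.differentiable x).hasFDerivAt).differentiableAt
    have d2 := differentiable_fm (dil l r) hf
    -- One integration by parts gains `2 ^ (-k)`. The derivative then falls on `m`, where it costs
    -- `2 ^ l` by the derivative bounds, or on the band limited factor, where it costs `2 ^ l` as
    -- well.
    have e (i : Fin n) : pdc i (cx m * fm (dil l r) f) = cx (pr i m) * fm (dil l r) f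
        + (((2 : ℝ) ^ l : ℝ) : ℂ) • (cx m * fm (dil l (sd i r)) f) := by
      rw [pdc_mul d1 d2, pdc_fm_dil _ _ hf, pdc_cx hm.differentiable, mul_smul_comm]
    have b3 (i : Fin n) := (hm.2 i).bm.mul b2
    have b4 (i : Fin n) := (b1.mul (hf.fm (dil l (sd i r)))).smul (((2 : ℝ) ^ l : ℝ) : ℂ)
    obtain ⟨L, hL⟩ := exists_lipschitz (d1.mul d2) fun i => by
      rw [e i]; exact (b3 i).add (b4 i)
    rw [fm_dil_eq_sum hRq k (b1.mul b2) hL, eLpNorm_smul_zpow]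
    have hi (i : Fin n) : eLpNorm (fm (dil k (R i)) (pdc i (cx m * fm (dil l r) f))) 2 volume
        ≤ (C i + D i) * K * wt 1 l * wt N (l - k) * eLpNorm f 2 volume := by
      rw [e i, fm_add _ (b3 i) (b4 i), fm_smul]
      refine (eLpNorm_add_le ((b3 i).fm _).meas.aestronglyMeasurable
        (((b1.mul (hf.fm _)).fm _).smul _).meas.aestronglyMeasurable one_le_two).trans ?_
      rw [eLpNorm_smul_zpow]
      have h1 := hC i l k _ _ f (hm.2 i) hf
      have h2 := hD i l k _ _ f hm.of_succ hf
      have h3 : ((2 ^ l * K : ℝ≥0) : ℝ≥0∞) = wt 1 l * K := by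
        rw [wt_one]; push_cast; rw [ENNReal.coe_zpow (by norm_num)]; simp
      rw [h3] at h1
      calc _ ≤ _ := add_le_add h1 (mul_le_mul_right h2 _)
        _ = _ := by ring
    calc _ ≤ wt 1 (-k) * ∑ i, (C i + D i) * K * wt 1 l * wt N (l - k) * eLpNorm f 2 volume := by
          refine mul_le_mul_right ((eLpNorm_sum_le (fun i _ => ?_) one_le_two).trans
            (Finset.sum_le_sum fun i _ => hi i)) _
          exact ((by rw [e i]; exact (b3 i).add (b4 i) : BM (pdc i _)).fm _).meas.aestronglyMeasurable
      _ = _ := by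
          push_cast
          rw [show l - k = -k + l by ring, wt_add_left, wt_add 1 (-k) l]
          simp only [Finset.sum_mul, Finset.mul_sum]
          exact Finset.sum_congr rfl fun i _ => by ring

/-- The real part of a Fourier multiplier. -/
def rfm (q : 𝓢(Eu n, ℂ)) (f : Eu n → ℂ) (x : Eu n) : ℝ := (fm q f x).re

lemma contDiff_rfm (q : 𝓢(Eu n, ℂ)) {f : Eu n → ℂ} (hf : BM f) : ContDiff ℝ ∞ (rfm q f) :=
  Complex.reCLM.contDiff.comp (contDiff_fm q hf)

lemma pr_rfm (q : 𝓢(Eu n, ℂ)) {f : Eu n → ℂ} (hf : BM f) (i : Fin n) :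
    pr i (rfm q f) = rfm (sd i q) f := by
  ext x
  have h := Complex.reCLM.hasFDerivAt.comp x ((differentiable_fm q hf) x).hasFDerivAt
  simp only [pr]
  rw [show rfm q f = Complex.reCLM ∘ fm q f from rfl, h.fderiv, ContinuousLinearMap.comp_apply,
    fderiv_fm q hf]
  rfl

lemma pr_rfm_dil (k : ℤ) (q : 𝓢(Eu n, ℂ)) {f : Eu n → ℂ} (hf : BM f) (i : Fin n) :
    pr i (rfm (dil k q) f) = (2 : ℝ) ^ k • rfm (dil k (sd i q)) f := by
  rw [pr_rfm _ hf, sd_dil]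
  ext x
  simp only [rfm, fm_symbol_smul, Pi.smul_apply, smul_eq_mul, Complex.re_ofReal_mul]

/-- Each derivative of the multiplier at scale `l` is `2 ^ l` times another multiplier at the same
scale, with symbol `sd i q`. The induction therefore generalizes `q`. -/
lemma exists_jb_rfm (N : ℕ) (q : 𝓢(Eu n, ℂ)) : ∃ C : ℝ≥0, ∀ (l : ℤ) (f : Eu n → ℂ) (c : ℝ≥0),
    BM f → (∀ x, ‖f x‖ ≤ c) → JB l N (C * c) (rfm (dil l q) f) := by
  have h0 (q : 𝓢(Eu n, ℂ)) (l : ℤ) (f : Eu n → ℂ) (c : ℝ≥0) (h : ∀ x, ‖f x‖ ≤ c) (x : Eu n) :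
      |rfm (dil l q) f x| ≤ nk q * c :=
    (Complex.abs_re_le_norm _).trans (norm_fm_dil_le h l q x)
  induction N generalizing q with
  | zero => exact ⟨nk q, fun l f c hf hc => ⟨contDiff_rfm _ hf, h0 q l f c hc⟩⟩
  | succ N ih =>
    choose C hC using fun i => ih (sd i q)
    refine ⟨nk q + ∑ i, C i, fun l f c hf hc => ⟨⟨contDiff_rfm _ hf, fun x => (h0 q l f c hc x).trans ?_⟩,
      fun i => ?_⟩⟩
    · push_cast
      exact mul_le_mul_of_nonneg_right (le_add_of_nonneg_right (by positivity)) c.2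
    · rw [pr_rfm_dil _ _ hf]
      refine ((hC i l f c hf hc).smul _).mono ?_
      have : ‖(2 : ℝ) ^ l‖₊ = 2 ^ l := by ext; simp
      rw [this]
      gcongr
      exact le_add_left (Finset.single_le_sum (f := C) (fun _ _ => zero_le) (Finset.mem_univ i))

end Gain

/-! ### Decay of interactions, families of functions and telescoping. -/

section Moser
open SchwartzMap Filter Topology
variable {n : ℕ} {χ : Eu n → ℝ}

/-- The cutoff dilated by `2 ^ 2` equals `1` on the support of `phiS`. A frequency piece can thus be
presented as a multiplier applied to itself, the form required by `exists_gain`. -/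
lemma fm_phiS_self (hχ : IsLPCutoff χ) (l : ℤ) {f : Eu n → ℂ} (hf : BM f) :
    fm (dil l (dil 2 (chiS hχ))) (fm (dil l (phiS hχ)) f) = fm (dil l (phiS hχ)) f := by
  refine fm_fm hf fun ξ => ?_
  rw [dil_apply l, dil_apply l, dil_apply 2, chiS_apply]
  set η := (2 : ℝ) ^ (-l) • ξ
  by_cases h : phiS hχ η = 0
  · rw [h, mul_zero]
  · have := (ringS_phiS hχ η h).2
    rw [hχ.eq_one _ (by rw [norm_zpow_smul]; norm_num; linarith), Complex.ofReal_one, one_mul]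

/-- The decay of the interactions between frequencies `2^k` and `2^l`, `j = k - l`. -/
def gainWt (N : ℕ) (j : ℤ) : ℝ≥0∞ := min 1 (wt N (-j))

lemma wt_neg_neg (σ : ℝ) (k : ℤ) : wt σ (-k) = wt (-σ) k := by
  unfold wt; congr 1; push_cast; ring

lemma wt_le_wt {a b : ℝ} {j k : ℤ} (h : a * j ≤ b * k) : wt a j ≤ wt b k :=
  ENNReal.rpow_le_rpow_of_exponent_le (by norm_num) h

/-- The positive weight `σ` gives convergence for `j < 0`, where nothing is gained; for `j > 0` the
gain of order `N` has to beat `σ`. -/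
lemma tsum_gainWt_ne_top {σ : ℝ} {N : ℕ} (h0 : 0 < σ) (hN : σ < N) :
    ∑' j, wt σ j * gainWt N j ≠ ⊤ := by
  have ha : 0 < min σ (N - σ) := lt_min h0 (by linarith)
  refine ne_top_of_le_ne_top (tsum_wt_natAbs_ne_top ha) (ENNReal.tsum_le_tsum fun j => ?_)
  rcases le_total 0 j with hj | hj
  · refine (mul_le_mul_right (min_le_right _ _) _).trans ?_
    rw [wt_neg_neg, ← wt_add_left]
    apply wt_le_wt
    have : (0 : ℝ) ≤ j := by exact_mod_cast hj
    rw [abs_of_nonneg hj]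
    nlinarith [min_le_right σ (N - σ)]
  · refine (mul_le_mul_right (min_le_left _ _) _).trans ?_
    rw [mul_one]
    apply wt_le_wt
    have : (j : ℝ) ≤ 0 := by exact_mod_cast hj
    rw [abs_of_nonpos hj]
    push_cast
    nlinarith [min_le_left σ (N - σ)]

/-- The minimum in `gainWt` combines the gain of order `N`, useful when `k > l`, with the trivial
estimate of order `0`. -/
lemma exists_gain_ring (hχ : IsLPCutoff χ) (N : ℕ) : ∃ C : ℝ≥0,
    ∀ (l k : ℤ) (m : Eu n → ℝ) (K : ℝ≥0) (f : Eu n → ℂ), JB l N K m → BM f →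
    eLpNorm (fm (dil k (phiS hχ)) (cx m * fm (dil l (phiS hχ)) f)) 2 volume
      ≤ C * K * gainWt N (k - l) * eLpNorm (fm (dil l (phiS hχ)) f) 2 volume := by
  obtain ⟨C, hC⟩ := exists_gain N (ringS_phiS hχ).annular (dil 2 (chiS hχ))
  obtain ⟨D, hD⟩ := exists_gain 0 (ringS_phiS hχ).annular (dil 2 (chiS hχ))
  refine ⟨C + D, fun l k m K f hm hf => ?_⟩
  have h1 := hC l k m K _ hm (hf.fm (dil l (phiS hχ)))
  have h2 := hD l k m K _ hm.base (hf.fm (dil l (phiS hχ)))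
  rw [fm_phiS_self hχ l hf] at h1 h2
  simp only [Nat.cast_zero, wt_zero_left, mul_one] at h2
  unfold gainWt
  rw [neg_sub]
  rcases min_choice 1 (wt N (l - k)) with h | h <;> rw [h]
  · refine h2.trans ?_
    rw [mul_one]; push_cast; gcongr; exact le_add_self
  · refine h1.trans ?_
    push_cast; gcongr; exact le_self_add

/-- The square function norm `∑_k 2^{2σk} ‖f_k‖²`. -/
def lps (hχ : IsLPCutoff χ) (σ : ℝ) (f : Eu n → ℂ) : ℝ≥0∞ :=
  ∑' k, (wt σ k * eLpNorm (fm (dil k (phiS hχ)) f) 2 volume) ^ 2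

lemma exists_norm_fm_low_le (hn : 0 < n) (q : 𝓢(Eu n, ℂ)) : ∃ C : ℝ, ∀ (k : ℤ), k ≤ 0 →
    ∀ f : Eu n → ℂ, Measurable f → MemLp f 2 volume →
    ∀ x, ‖fm (dil k q) f x‖ ≤ C * (eLpNorm f 2 volume).toReal * (√2) ^ k := by
  obtain ⟨D, hD⟩ := norm_fm_dil_le_of_memLp hn q
  refine ⟨√D, fun k hk f hf hf2 x => ?_⟩
  have h := ENNReal.toReal_mono (by finiteness [hf2.eLpNorm_ne_top]) (hD k hk f hf x)
  simp only [ENNReal.toReal_mul, ENNReal.toReal_pow, ENNReal.coe_toReal, toReal_enorm,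
    ← ENNReal.rpow_intCast, ← ENNReal.toReal_rpow, ENNReal.toReal_ofNat, Real.rpow_intCast] at h
  refine (abs_le_of_sq_le_sq' ?_ (by positivity)).2
  refine h.trans (le_of_eq ?_)
  have e : ((√2) ^ k) ^ 2 = (2 : ℝ) ^ k := by
    rw [pow_two, ← mul_zpow, Real.mul_self_sqrt (by norm_num)]
  rw [mul_pow, mul_pow, e, Real.sq_sqrt D.coe_nonneg]
  ring

lemma uConv_fm_phiS (hχ : IsLPCutoff χ) (hn : 0 < n) {f : Eu n → ℂ} (hf : BM f)
    (hf2 : MemLp f 2 volume) {L : ℝ≥0} (hL : LipschitzWith L f) :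
    UConv fun k => fm (dil k (phiS hχ)) f := by
  obtain ⟨C, hC⟩ := (ringS_phiS hχ).annular.norm_fm_le
  obtain ⟨D, hD⟩ := exists_norm_fm_low_le hn (phiS hχ)
  exact .of_bounds (C := C * L) (fun k x => (hC k L f hf hL x).trans (le_of_eq (by ring)))
    fun k hk x => hD k hk f hf.meas hf2 x

/-- Bounded Lipschitz square integrable families of functions. -/
structure Fam {ι : Type*} (L M : ℝ≥0) (U : ι → Eu n → ℝ) : Prop where
  lip : ∀ γ, LipschitzWith L (cx (U γ))
  bd : ∀ γ x, |U γ x| ≤ M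
  mem : ∀ γ, MemLp (cx (U γ)) 2 volume

variable {ι : Type*} {L M : ℝ≥0} {U : ι → Eu n → ℝ}

lemma Fam.bdc (h : Fam L M U) (γ : ι) (x : Eu n) : ‖cx (U γ) x‖ ≤ M := by
  rw [norm_cx]; exact h.bd γ x

lemma Fam.bm (h : Fam L M U) (γ : ι) : BM (cx (U γ)) :=
  ⟨(h.lip γ).continuous.measurable, M, h.bdc γ⟩

lemma cx_dyadic (hχ : IsLPCutoff χ) (k : ℤ) {f : Eu n → ℝ} (hf : BM (cx f)) (x : Eu n) :
    fm (dil k (phiS hχ)) (cx f) x = ((lowFreq χ (k + 1) f x - lowFreq χ k f x : ℝ) : ℂ) :=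
  (congrFun (dyadic_eq hχ k hf) x).symm

lemma lowFreq_eq_rfm (hχ : IsLPCutoff χ) (k : ℤ) (f : Eu n → ℝ) :
    lowFreq χ k f = rfm (dil k (chiS hχ)) (cx f) := by
  ext x
  rw [rfm, ← lowFreq_eq hχ]; rfl

lemma Fam.norm_lowFreq_sub_le (hχ : IsLPCutoff χ) (h : Fam L M U) (k : ℤ) (γ : ι) (x : Eu n) :
    |lowFreq χ k (U γ) x - U γ x| ≤ 2 ^ (-k) * Paradiff.mk (chiS hχ) * L := by
  have := norm_fm_dil_sub_le (h.bm γ) (h.lip γ) k (chiS hχ) x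
  rw [chiS_apply, hχ.eq_one 0 (by simp), ← lowFreq_eq hχ] at this
  simpa [cx, ← Complex.ofReal_sub] using this

lemma Fam.norm_lowFreq_le (hχ : IsLPCutoff χ) (h : Fam L M U) (k : ℤ) (γ : ι) (x : Eu n) :
    |lowFreq χ k (U γ) x| ≤ nk (chiS hχ) * M := by
  have := norm_fm_dil_le (h.bdc γ) k (chiS hχ) x
  rwa [← lowFreq_eq hχ, norm_cx] at this

/-- The low frequency parts `(U_{<l+1}, U_{<l})`. -/
def slot (χ : Eu n → ℝ) (l : ℤ) (U : ι → Eu n → ℝ) : ι ⊕ ι → Eu n → ℝ :=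
  Sum.elim (fun γ => lowFreq χ (l + 1) (U γ)) (fun γ => lowFreq χ l (U γ))

lemma slot_eq (χ : Eu n → ℝ) (l : ℤ) (U : ι → Eu n → ℝ) (x : Eu n) : (fun s => slot χ l U s x)
    = Sum.elim (fun γ => lowFreq χ (l + 1) (U γ) x) (fun γ => lowFreq χ l (U γ) x) := by
  ext s; cases s <;> rfl

lemma exists_jb_slot (hχ : IsLPCutoff χ) (N : ℕ) : ∃ R : ℝ≥0, ∀ (l : ℤ) (L M : ℝ≥0)
    (U : ι → Eu n → ℝ), Fam L M U → ∀ s, JB l N (R * M) (slot χ l U s) := by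
  obtain ⟨C, hC⟩ := exists_jb_rfm N (chiS hχ)
  obtain ⟨D, hD⟩ := exists_jb_rfm N (dil 1 (chiS hχ))
  refine ⟨C + D, fun l L M U h s => ?_⟩
  cases s with
  | inl γ =>
    have := hD l _ M (h.bm γ) (h.bdc γ)
    rw [dil_dil, ← lowFreq_eq_rfm] at this
    exact this.mono (by gcongr; exact le_add_self)
  | inr γ =>
    have := hC l _ M (h.bm γ) (h.bdc γ)
    rw [← lowFreq_eq_rfm] at this
    exact this.mono (by gcongr; exact le_self_add)

lemma lps_sum_le {ι : Type*} [Fintype ι] (σ : ℝ) (y : ι → ℤ → ℝ≥0∞) :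
    ∑' k, (wt σ k * ∑ γ, y γ k) ^ 2 ≤ Fintype.card ι * ∑ γ, ∑' k, (wt σ k * y γ k) ^ 2 := by
  rw [show ∑ γ, ∑' k, (wt σ k * y γ k) ^ 2 = ∑' γ, ∑' k, (wt σ k * y γ k) ^ 2 from
    (tsum_fintype _).symm, ENNReal.tsum_comm, ← ENNReal.tsum_mul_left]
  refine ENNReal.tsum_le_tsum fun k => ?_
  have := sq_tsum_mul_le (fun _ : ι => 1) fun γ => wt σ k * y γ k
  simpa [tsum_fintype, ← Finset.mul_sum] using this

lemma fm_const {q : 𝓢(Eu n, ℂ)} (hq : q 0 = 0) (k : ℤ) (c : ℂ) : fm (dil k q) (fun _ => c) = 0 := by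
  ext x
  have := norm_fm_dil_sub_le (f := fun _ => c) ⟨measurable_const, ‖c‖, fun _ => le_rfl⟩
    (K := 0) (LipschitzWith.const c) k q x
  simpa [hq] using this

lemma phiS_zero (hχ : IsLPCutoff χ) : phiS hχ 0 = 0 := by
  by_contra h
  have := (ringS_phiS hχ 0 h).1
  norm_num at this

/-- Telescoping series. -/
lemma su_telescope {F : ℤ → Eu n → ℂ} {a b : Eu n → ℂ} (h : UConv fun l => F (l + 1) - F l)
    (ha : ∀ x, Tendsto (fun N : ℕ => F N x) atTop (𝓝 (a x)))
    (hb : ∀ x, Tendsto (fun N : ℕ => F (-N) x) atTop (𝓝 (b x))) :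
    su (fun l => F (l + 1) - F l) = a - b := by
  ext x
  have h1 : Tendsto (fun N : ℕ => Finset.Ico (-N : ℤ) N) atTop atTop :=
    tendsto_atTop_finset_of_monotone (fun N M h => Finset.Ico_subset_Ico (by simpa) (by simpa))
      fun z => ⟨z.natAbs + 1, by simp only [Finset.mem_Ico]; omega⟩
  have h2 := (h.hasSum x).comp h1
  refine tendsto_nhds_unique h2 (((ha x).sub (hb x)).congr fun N => ?_)
  simp only [Function.comp_apply, Pi.sub_apply]
  rw [← neg_inj, ← Finset.sum_neg_distrib]
  simp only [neg_sub]
  exact (Finset.sum_Ico_int_sub N fun l => F l x).symm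

end Moser

/-! ### Moser's estimates for smooth functions of `U` and for their differences. -/

section MoserEstimate
open SchwartzMap Filter Topology
variable {n : ℕ} {χ : Eu n → ℝ} {ι : Type*} {L M : ℝ≥0} {U : ι → Eu n → ℝ}

lemma Fam.tendsto_lowFreq (hχ : IsLPCutoff χ) (h : Fam L M U) (γ : ι) (x : Eu n) :
    Tendsto (fun N : ℕ => lowFreq χ N (U γ) x) atTop (𝓝 (U γ x)) := by
  rw [tendsto_iff_norm_sub_tendsto_zero]
  refine squeeze_zero (fun _ => norm_nonneg _)
    (fun N => h.norm_lowFreq_sub_le hχ N γ x) ?_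
  have : Tendsto (fun N : ℕ => (2 : ℝ) ^ (-(N : ℤ))) atTop (𝓝 0) := by
    simpa using tendsto_pow_atTop_nhds_zero_of_lt_one (r := (2 : ℝ)⁻¹) (by norm_num) (by norm_num)
  simpa using (this.mul_const (Paradiff.mk (chiS hχ) : ℝ)).mul_const (L : ℝ)

lemma Fam.tendsto_lowFreq_neg (hχ : IsLPCutoff χ) (hn : 0 < n) (h : Fam L M U) (γ : ι) (x : Eu n) :
    Tendsto (fun N : ℕ => lowFreq χ (-N) (U γ) x) atTop (𝓝 0) := by
  obtain ⟨C, hC⟩ := exists_norm_fm_low_le hn (chiS hχ)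
  refine squeeze_zero_norm (fun N => ?_) (a := fun N : ℕ =>
    C * (eLpNorm (cx (U γ)) 2 volume).toReal * (√2)⁻¹ ^ N) ?_
  · have := hC (-N) (by simp) _ (h.bm γ).meas (h.mem γ) x
    rw [← lowFreq_eq hχ, norm_cx] at this
    simpa using this
  · simpa using (tendsto_pow_atTop_nhds_zero_of_lt_one (r := (√2)⁻¹) (by positivity)
      (inv_lt_one_of_one_lt₀ (by rw [Real.lt_sqrt] <;> norm_num))).const_mul
      (C * (eLpNorm (cx (U γ)) 2 volume).toReal)

variable [Fintype ι]

/-- The coefficients of the telescoping series of a smooth function. -/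
def mcoef (χ : Eu n → ℝ) (c : (ι ⊕ ι → ℝ) → ℝ) (U : ι → Eu n → ℝ) (l : ℤ) (x : Eu n) : ℝ :=
  c fun s => slot χ l U s x

lemma exists_jb_mcoef (hχ : IsLPCutoff χ) (N : ℕ) {c : (ι ⊕ ι → ℝ) → ℝ} (hc : ContDiff ℝ ∞ c)
    (M : ℝ≥0) : ∃ C : ℝ≥0, ∀ (L : ℝ≥0) (U : ι → Eu n → ℝ), Fam L M U → ∀ l,
    JB l N C (mcoef χ c U l) := by
  obtain ⟨R, hR⟩ := exists_jb_slot (ι := ι) hχ N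
  obtain ⟨C, hC⟩ := JB.comp (n := n) N hc (R * M)
  exact ⟨C, fun L U h l => hC l (slot χ l U) (hR l L M U h)⟩

/-- The terms of the telescoping series. -/
def mser (hχ : IsLPCutoff χ) (c : ι → (ι ⊕ ι → ℝ) → ℝ) (U : ι → Eu n → ℝ) (γ : ι) (l : ℤ) : Eu n → ℂ :=
  cx (mcoef χ (c γ) U l) * fm (dil l (phiS hχ)) (cx (U γ))

lemma uConv_mser (hχ : IsLPCutoff χ) (hn : 0 < n) {c : ι → (ι ⊕ ι → ℝ) → ℝ}
    (hc : ∀ γ, ContDiff ℝ ∞ (c γ)) (h : Fam L M U) (γ : ι) : UConv (mser hχ c U γ) := by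
  obtain ⟨C, hC⟩ := exists_jb_mcoef hχ 0 (hc γ) M
  refine (uConv_fm_phiS hχ hn (h.bm γ) (h.mem γ) (h.lip γ)).mono (C := C) (fun k x => ?_) C.2
  rw [mser, Pi.mul_apply, norm_mul, norm_cx]
  exact mul_le_mul_of_nonneg_right ((hC L U h k).2 x) (norm_nonneg _)

lemma bm_mser (hχ : IsLPCutoff χ) {c : ι → (ι ⊕ ι → ℝ) → ℝ} (hc : ∀ γ, ContDiff ℝ ∞ (c γ))
    (h : Fam L M U) (γ : ι) (l : ℤ) : BM (mser hχ c U γ l) := by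
  obtain ⟨C, hC⟩ := exists_jb_mcoef hχ 0 (hc γ) M
  exact (hC L U h l).bm.mul ((h.bm γ).fm _)

/-- The telescoping series of a smooth function `a(U) - a(0)`. -/
lemma su_mser (hχ : IsLPCutoff χ) (hn : 0 < n) {a : (ι → ℝ) → ℝ} (ha : ContDiff ℝ ∞ a)
    {c : ι → (ι ⊕ ι → ℝ) → ℝ} (hc : ∀ γ, ContDiff ℝ ∞ (c γ))
    (hac : ∀ x y, a x - a y = ∑ γ, c γ (Sum.elim x y) * (x γ - y γ)) (h : Fam L M U) :
    su (∑ γ, mser hχ c U γ) = cx (fun x => a fun γ => U γ x) - fun _ => (a 0 : ℂ) := by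
  set F : ℤ → Eu n → ℂ := fun l x => (a fun γ => lowFreq χ l (U γ) x : ℝ)
  have e : ∑ γ, mser hχ c U γ = fun l => F (l + 1) - F l := by
    ext l x
    simp only [Finset.sum_apply, mser, Pi.mul_apply, Pi.sub_apply, F]
    rw [← Complex.ofReal_sub, hac, Complex.ofReal_sum]
    refine Finset.sum_congr rfl fun γ _ => ?_
    rw [cx_dyadic hχ l (h.bm γ), cx, mcoef, slot_eq, ← Complex.ofReal_mul]
  rw [e]
  refine su_telescope (e ▸ UConv.sum _ fun γ _ => uConv_mser hχ hn hc h γ) (fun x => ?_) fun x => ?_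
  · exact (Complex.continuous_ofReal.tendsto _).comp ((ha.continuous.tendsto _).comp
      (tendsto_pi_nhds.2 fun γ => h.tendsto_lowFreq hχ γ x))
  · exact (Complex.continuous_ofReal.tendsto _).comp ((ha.continuous.tendsto _).comp
      (tendsto_pi_nhds.2 fun γ => h.tendsto_lowFreq_neg hχ hn γ x))

lemma Fam.bm_comp {a : (ι → ℝ) → ℝ} (ha : ContDiff ℝ ∞ a) (h : Fam L M U) :
    BM (cx fun x => a fun γ => U γ x) := by
  obtain ⟨C, hC⟩ := exists_bound_of_contDiff ha M
  have hU (γ : ι) : Continuous (U γ) := by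
    have := Complex.continuous_re.comp (h.lip γ).continuous
    exact this.congr fun x => by simp [cx]
  exact .cx_of_bound (ha.continuous.comp (continuous_pi hU)) fun x => hC _ fun γ => h.bd γ x

lemma fm_comp_eq (hχ : IsLPCutoff χ) (hn : 0 < n) {a : (ι → ℝ) → ℝ} (ha : ContDiff ℝ ∞ a)
    {c : ι → (ι ⊕ ι → ℝ) → ℝ} (hc : ∀ γ, ContDiff ℝ ∞ (c γ))
    (hac : ∀ x y, a x - a y = ∑ γ, c γ (Sum.elim x y) * (x γ - y γ)) (h : Fam L M U) (k : ℤ) :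
    fm (dil k (phiS hχ)) (cx fun x => a fun γ => U γ x)
      = fm (dil k (phiS hχ)) (su (∑ γ, mser hχ c U γ)) := by
  rw [su_mser hχ hn ha hc hac h, fm_sub _ (h.bm_comp ha) ⟨measurable_const, ‖(a 0 : ℂ)‖, fun _ => le_rfl⟩,
    fm_const (phiS_zero hχ), sub_zero]

/-- Moser's estimate. -/
theorem moser (hχ : IsLPCutoff χ) (hn : 0 < n) {σ : ℝ} (hσ : 0 < σ) {a : (ι → ℝ) → ℝ}
    (ha : ContDiff ℝ ∞ a) (M : ℝ≥0) : ∃ C : ℝ≥0, ∀ (L : ℝ≥0) (U : ι → Eu n → ℝ), Fam L M U →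
    lps hχ σ (cx fun x => a fun γ => U γ x) ≤ C * ∑ γ, lps hχ σ (cx (U γ)) := by
  classical
  obtain ⟨c, hc, hac, -⟩ := exists_hadamard ha
  obtain ⟨N, hN⟩ := exists_nat_gt σ
  choose K hK using fun γ => exists_jb_mcoef hχ N (hc γ) M
  obtain ⟨G, hG⟩ := exists_gain_ring hχ N
  have fin := tsum_gainWt_ne_top hσ hN
  obtain ⟨S, hS⟩ : ∃ S : ℝ≥0, (S : ℝ≥0∞) = (G * ∑ γ, K γ : ℝ≥0) * ∑' j, wt σ j * gainWt N j :=
    ⟨_, ENNReal.coe_toNNReal (ENNReal.mul_ne_top ENNReal.coe_ne_top fin)⟩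
  refine ⟨S ^ 2 * Fintype.card ι, fun L U h => ?_⟩
  have bm (γ : ι) (l : ℤ) := bm_mser hχ hc h γ l
  -- The coefficient of the `l`-th term has derivatives bounded as for frequency `2 ^ l`, so its
  -- piece at frequency `2 ^ k` is weighted by `gainWt N (k - l)`.
  have key := tsum_wt_fm_su_le (UConv.sum Finset.univ fun γ _ => uConv_mser hχ hn hc h γ)
    (fun k => by rw [Finset.sum_apply]; exact (BM.sum _ fun γ _ => bm γ k).meas) (phiS hχ) σ
    (c := fun j => (G * ∑ γ, K γ : ℝ≥0) * gainWt N j)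
    (x := fun k => ∑ γ, eLpNorm (fm (dil k (phiS hχ)) (cx (U γ))) 2 volume) fun k l => by
      rw [Finset.sum_apply, fm_sum _ fun γ _ => bm γ l, Finset.mul_sum]
      refine (eLpNorm_sum_le (fun γ _ => ((bm γ l).fm _).meas.aestronglyMeasurable) one_le_two).trans
        (Finset.sum_le_sum fun γ _ => (hG l k _ _ _ (hK γ L U h l) (h.bm γ)).trans ?_)
      push_cast
      gcongr
      exact Finset.single_le_sum (f := fun γ => (K γ : ℝ≥0∞)) (fun _ _ => zero_le) (Finset.mem_univ γ)
  simp only [← fm_comp_eq hχ hn ha hc hac h] at key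
  refine key.trans ?_
  have e : ∑' j, wt σ j * ((G * ∑ γ, K γ : ℝ≥0) * gainWt N j)
      = (G * ∑ γ, K γ : ℝ≥0) * ∑' j, wt σ j * gainWt N j := by
    rw [← ENNReal.tsum_mul_left]
    exact tsum_congr fun j => by ring
  rw [e, ← hS]
  refine (mul_le_mul_right (lps_sum_le σ _) _).trans (le_of_eq ?_)
  simp only [lps]
  push_cast
  ring

lemma lps_smul (hχ : IsLPCutoff χ) (σ : ℝ) (c : ℂ) (f : Eu n → ℂ) :
    lps hχ σ (c • f) = ‖c‖ₑ ^ 2 * lps hχ σ f := by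
  unfold lps
  rw [← ENNReal.tsum_mul_left]
  refine tsum_congr fun k => ?_
  rw [fm_smul, eLpNorm_const_smul]
  ring

lemma lps_zero (hχ : IsLPCutoff χ) (σ : ℝ) : lps hχ σ (0 : Eu n → ℂ) = 0 := by
  simp [lps, fm_zero]

/-- Moser's estimate for differences. -/
theorem moser_sub (hχ : IsLPCutoff χ) (hn : 0 < n) {σ : ℝ} (hσ : 0 < σ) {a : (ι → ℝ) → ℝ}
    (ha : ContDiff ℝ ∞ a) (M : ℝ≥0) : ∃ C : ℝ≥0, ∀ (L θ : ℝ≥0) (U V : ι → Eu n → ℝ), Fam L M U →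
    Fam L M V → (∀ γ x, |U γ x - V γ x| ≤ θ) →
    lps hχ σ ((cx fun x => a fun γ => U γ x) - cx fun x => a fun γ => V γ x)
      ≤ C * (∑ γ, lps hχ σ (cx (U γ) - cx (V γ))
        + θ ^ 2 * ∑ γ, (lps hχ σ (cx (U γ)) + lps hχ σ (cx (V γ)))) := by
  classical
  obtain ⟨c, hc, hac, -⟩ := exists_hadamard ha
  -- The difference is itself a smooth function: by Hadamard it is `θ` times `b (U, V, (U - V) /
  -- θ)`, where `b` is linear in its last argument. Moser's estimate is applied to `b`.
  have hb : ContDiff ℝ ∞ fun z : (ι ⊕ ι) ⊕ ι → ℝ => ∑ γ, c γ (fun s => z (.inl s)) * z (.inr γ) :=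
    ContDiff.sum fun γ _ => ((hc γ).comp (by fun_prop)).mul (by fun_prop)
  obtain ⟨C, hC⟩ := moser hχ hn hσ hb (M + 1)
  refine ⟨C, fun L θ U V hU hV hθ => ?_⟩
  -- The rescaling divides by `θ`; for `θ = 0` the two families coincide.
  rcases eq_or_ne θ 0 with rfl | h0
  · have : U = V := by
      ext γ x
      have := hθ γ x
      simp only [NNReal.coe_zero, abs_nonpos_iff, sub_eq_zero] at this
      exact this
    rw [this, sub_self, lps_zero]
    exact zero_le
  have h0' : (θ : ℝ) ≠ 0 := by exact_mod_cast h0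
  -- The rescaled difference is bounded by `1`, whence the bound `M + 1`. Its Lipschitz constant
  -- degenerates as `θ → 0`, but the constant in Moser's estimate does not depend on it.
  set W : (ι ⊕ ι) ⊕ ι → Eu n → ℝ :=
    Sum.elim (Sum.elim U V) fun γ x => (θ : ℝ)⁻¹ * (U γ x - V γ x) with hW
  have e1 (γ : ι) : cx (W (.inr γ)) = ((θ : ℝ)⁻¹ : ℂ) • (cx (U γ) - cx (V γ)) := by
    ext x
    simp [hW, cx]
  have hn1 : ‖((θ : ℝ)⁻¹ : ℂ)‖₊ = θ⁻¹ := by ext; simp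
  have hFam : Fam (L + θ⁻¹ * (L + L)) (M + 1) W := by
    refine ⟨fun s => ?_, fun s x => ?_, fun s => ?_⟩
    · rcases s with (γ | γ) | γ
      · exact (hU.lip γ).weaken le_self_add
      · exact (hV.lip γ).weaken le_self_add
      · rw [e1, ← hn1]
        exact ((lipschitzWith_smul _).comp ((hU.lip γ).sub (hV.lip γ))).weaken le_add_self
    · rcases s with (γ | γ) | γ
      · exact (hU.bd γ x).trans (by simp)
      · exact (hV.bd γ x).trans (by simp)
      · simp only [hW, Sum.elim_inr, abs_mul, abs_inv, NNReal.abs_eq]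
        have : (θ : ℝ)⁻¹ * |U γ x - V γ x| ≤ (θ : ℝ)⁻¹ * θ := by gcongr; exact hθ γ x
        rw [inv_mul_cancel₀ h0'] at this
        push_cast
        linarith [M.coe_nonneg]
    · rcases s with (γ | γ) | γ
      · exact hU.mem γ
      · exact hV.mem γ
      · rw [e1]
        exact ((hU.mem γ).sub (hV.mem γ)).const_smul _
  have key := hC _ W hFam
  have e2 : (cx fun x => a fun γ => U γ x) - (cx fun x => a fun γ => V γ x) = ((θ : ℝ) : ℂ) •
      cx fun x => ∑ γ, c γ (fun s => W (.inl s) x) * W (.inr γ) x := by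
    ext x
    simp only [Pi.sub_apply, Pi.smul_apply, cx, smul_eq_mul]
    rw [← Complex.ofReal_sub, hac, ← Complex.ofReal_mul, Finset.mul_sum]
    congr 1
    refine Finset.sum_congr rfl fun γ _ => ?_
    have : (fun s => W (.inl s) x) = Sum.elim (fun γ => U γ x) (fun γ => V γ x) := by
      ext s; cases s <;> rfl
    rw [this]
    simp only [hW, Sum.elim_inr]
    field_simp
  have hn2 : ‖((θ : ℝ) : ℂ)‖ₑ = θ := by
    rw [← enorm_norm, Complex.norm_real, enorm_norm]; simp
  have hn3 : ‖((θ : ℝ)⁻¹ : ℂ)‖ₑ = (θ : ℝ≥0∞)⁻¹ := by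
    rw [enorm_eq_nnnorm, hn1, ENNReal.coe_inv h0]
  rw [e2, lps_smul, hn2]
  refine (mul_le_mul_right key _).trans (le_of_eq ?_)
  rw [Fintype.sum_sum_type, Fintype.sum_sum_type]
  simp only [e1, lps_smul, hn3, ← Finset.mul_sum]
  have e4 : (θ : ℝ≥0∞) ^ 2 * (θ : ℝ≥0∞)⁻¹ ^ 2 = 1 := by
    rw [← mul_pow, ENNReal.mul_inv_cancel (by exact_mod_cast h0) ENNReal.coe_ne_top, one_pow]
  simp only [hW, Sum.elim_inl, Sum.elim_inr, Finset.sum_add_distrib]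
  calc _ = C * ((θ : ℝ≥0∞) ^ 2 * (θ : ℝ≥0∞)⁻¹ ^ 2 * ∑ γ, lps hχ σ (cx (U γ) - cx (V γ))
      + θ ^ 2 * (∑ γ, lps hχ σ (cx (U γ)) + ∑ γ, lps hχ σ (cx (V γ)))) := by ring
    _ = _ := by rw [e4, one_mul]

end MoserEstimate

/-! ### Ingredients of the paralinearization of `a(U)`. -/

section Paralinearization
open SchwartzMap Filter Topology
variable {n : ℕ} {χ : Eu n → ℝ} {ι : Type*} {L M : ℝ≥0} {U : ι → Eu n → ℝ}

/-- The Littlewood-Paley decomposition. -/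
lemma su_fm_phiS (hχ : IsLPCutoff χ) (hn : 0 < n) (h : Fam L M U) (γ : ι) :
    su (fun l => fm (dil l (phiS hχ)) (cx (U γ))) = cx (U γ) := by
  have e : (fun l => fm (dil l (phiS hχ)) (cx (U γ)))
      = fun l => (fun l => cx (lowFreq χ l (U γ))) (l + 1) - (fun l => cx (lowFreq χ l (U γ))) l := by
    ext l
    simp only [lowFreq_eq hχ, fm_phiS hχ (h.bm γ)]
  have hu := uConv_fm_phiS hχ hn (h.bm γ) (h.mem γ) (h.lip γ)
  rw [e] at hu ⊢
  refine (su_telescope (F := fun l => cx (lowFreq χ l (U γ))) hu (a := cx (U γ)) (b := 0)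
    (fun x => ?_) fun x => ?_).trans (sub_zero _)
  · exact (Complex.continuous_ofReal.tendsto _).comp (h.tendsto_lowFreq hχ γ x)
  · have := (Complex.continuous_ofReal.tendsto _).comp (h.tendsto_lowFreq_neg hχ hn γ x)
    rwa [Complex.ofReal_zero] at this

/-- Multipliers of a series with finitely many interacting terms. -/
lemma fm_su_eq_sum {t : ℤ → Eu n → ℂ} (h : UConv t) (ht : ∀ k, Measurable (t k)) (q : 𝓢(Eu n, ℂ))
    (S : Finset ℤ) (h0 : ∀ l ∉ S, fm q (t l) = 0) : fm q (su t) = ∑ l ∈ S, fm q (t l) := by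
  ext x
  rw [Finset.sum_apply]
  exact (h.hasSum_fm ht q x).unique (hasSum_sum_of_ne_finset_zero fun l hl => by rw [h0 l hl]; rfl)

lemma notMem_band {k l : ℤ} (h : l ∉ Finset.Icc (k - 2) (k + 2)) : 3 ≤ |k - l| := by
  simp only [Finset.mem_Icc, not_and_or, not_le] at h
  rw [le_abs]; omega

lemma phiS_mul_phiS (hχ : IsLPCutoff χ) {k l : ℤ} (h : 3 ≤ |k - l|) (ξ : Eu n) :
    dil k (phiS hχ) ξ * dil l (phiS hχ) ξ = 0 := by
  by_contra hne
  obtain ⟨h1, h2⟩ := mul_ne_zero_iff.1 hne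
  obtain ⟨a1, a2⟩ := (ringS_phiS hχ).dil h1
  obtain ⟨b1, b2⟩ := (ringS_phiS hχ).dil h2
  rcases le_abs.1 h with h | h
  · linarith [zpow_two_le (show l + 1 ≤ k - 1 by linarith)]
  · linarith [zpow_two_le (show k + 1 ≤ l - 1 by linarith)]

/-- The full decomposition of `U γ` is inserted and only the neighbours `|l - k| ≤ 2` survive. This
puts `P_k U` in the form in which it meets the band of the paraproduct. -/
lemma fm_phiS_eq_band (hχ : IsLPCutoff χ) (hn : 0 < n) (h : Fam L M U) (γ : ι) (k : ℤ) :
    fm (dil k (phiS hχ)) (cx (U γ)) = ∑ l ∈ Finset.Icc (k - 2) (k + 2),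
      fm (dil k (phiS hχ)) (fm (dil l (phiS hχ)) (cx (U γ))) := by
  conv_lhs => rw [← su_fm_phiS hχ hn h γ]
  exact fm_su_eq_sum (uConv_fm_phiS hχ hn (h.bm γ) (h.mem γ) (h.lip γ))
    (fun l => ((h.bm γ).fm _).meas) _ _ fun l hl =>
      fm_fm_eq_zero (h.bm γ) (phiS_mul_phiS hχ (notMem_band hl))

/-- The commutator of a frequency projection with a coefficient at nearby frequencies. -/
lemma exists_band_commutator (hχ : IsLPCutoff χ) : ∃ C : ℝ≥0, ∀ (k l : ℤ) (K : ℝ≥0) (g v : Eu n → ℂ),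
    BM g → BM v → LipschitzWith K g → l ∈ Finset.Icc (k - 2) (k + 2) →
    eLpNorm (fm (dil k (phiS hχ)) (fm (dil (l - 8) (chiS hχ)) g * v)
      - fm (dil (k - 8) (chiS hχ)) g * fm (dil k (phiS hχ)) v) 2 volume
      ≤ C * K * wt (-1) k * eLpNorm v 2 volume := by
  refine ⟨mk (phiS hχ) + 2 * 2 ^ 10 * mk (chiS hχ) * nk (phiS hχ), fun k l K g v hg hv hK hl => ?_⟩
  -- Both low frequency coefficients have indices at least `k - 10`, since `l ≥ k - 2`; this is the
  -- origin of the factor `2 ^ 10`.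
  have hsub (j : ℤ) (hj : k - 10 ≤ j) (x : Eu n) :
      ‖(fm (dil j (chiS hχ)) g - g) x‖ ≤ (2 ^ (-k) * (2 ^ 10 * mk (chiS hχ) * K) : ℝ≥0) := by
    have := norm_fm_dil_sub_le hg hK j (chiS hχ) x
    rw [chiS_apply, hχ.eq_one 0 (by simp), Complex.ofReal_one, one_mul] at this
    refine this.trans ?_
    have h2 : (2 : ℝ) ^ (-j) ≤ 2 ^ (-k) * 2 ^ 10 := by
      rw [← zpow_natCast, ← zpow_add₀ (by norm_num)]
      exact zpow_two_le (by push_cast; linarith)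
    push_cast
    calc (2 : ℝ) ^ (-j) * mk (chiS hχ) * K ≤ (2 ^ (-k) * 2 ^ 10) * mk (chiS hχ) * K := by gcongr
      _ = _ := by ring
  -- Both low frequency parts are replaced by `g`, with errors of size `2 ^ (-k) * K`; what remains
  -- is the commutator of the projection with the Lipschitz function `g`.
  have e : fm (dil k (phiS hχ)) (fm (dil (l - 8) (chiS hχ)) g * v)
      - fm (dil (k - 8) (chiS hχ)) g * fm (dil k (phiS hχ)) v
      = (fm (dil k (phiS hχ)) ((fm (dil (l - 8) (chiS hχ)) g - g) * v)
        - (fm (dil (k - 8) (chiS hχ)) g - g) * fm (dil k (phiS hχ)) v)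
        + fun x => fm (dil k (phiS hχ)) (g * v) x - g x * fm (dil k (phiS hχ)) v x := by
    rw [sub_mul, fm_sub _ ((hg.fm _).mul hv) (hg.mul hv)]
    ext x
    simp only [Pi.add_apply, Pi.sub_apply, Pi.mul_apply]
    ring
  have b1 := ((hg.fm (dil (l - 8) (chiS hχ))).sub hg).mul hv
  have b2 := ((hg.fm (dil (k - 8) (chiS hχ))).sub hg).mul (hv.fm (dil k (phiS hχ)))
  have b3 := ((hg.mul hv).fm (dil k (phiS hχ))).sub (hg.mul (hv.fm (dil k (phiS hχ))))
  have hw : ((2 ^ (-k) * (2 ^ 10 * mk (chiS hχ) * K) : ℝ≥0) : ℝ≥0∞)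
      = wt (-1) k * (2 ^ 10 * mk (chiS hχ) * K) := by
    rw [← wt_neg_neg, wt_one]; push_cast; rw [ENNReal.coe_zpow (by norm_num)]; simp
  rw [e]
  refine (eLpNorm_add_le ((b1.fm _).sub b2).meas.aestronglyMeasurable b3.meas.aestronglyMeasurable
    one_le_two).trans ((add_le_add_left (eLpNorm_sub_le (b1.fm _).meas.aestronglyMeasurable
      b2.meas.aestronglyMeasurable one_le_two) _).trans ?_)
  have h1 := (eLpNorm_fm_dil_le b1.meas k (phiS hχ)).trans
    (mul_le_mul_right (eLpNorm_mul_le_sup (g := v) (hsub (l - 8) (by simp at hl; linarith))) _)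
  have h2 := (eLpNorm_mul_le_sup (g := fm (dil k (phiS hχ)) v) (hsub (k - 8) (by linarith))).trans
    (mul_le_mul_right (eLpNorm_fm_dil_le hv.meas k (phiS hχ)) _)
  have h3 := eLpNorm_commutator_le hg hv hK k (phiS hχ)
  rw [hw] at h1 h2
  rw [← wt_one, wt_neg_neg] at h3
  refine (add_le_add (add_le_add h1 h2) h3).trans (le_of_eq ?_)
  push_cast
  ring

lemma Fam.abs_sub_le (h : Fam L M U) (γ : ι) (x y : Eu n) : |U γ x - U γ y| ≤ L * dist x y := by
  have := (h.lip γ).dist_le_mul x y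
  rwa [Complex.dist_eq, cx, cx, ← Complex.ofReal_sub, Complex.norm_real] at this

variable [Fintype ι]

/-- Smooth functions are Lipschitz on bounded sets. -/
lemma exists_lip_of_contDiff {a : (ι → ℝ) → ℝ} (ha : ContDiff ℝ ∞ a) (R : ℝ≥0) :
    ∃ C : ℝ≥0, ∀ x y : ι → ℝ, (∀ γ, |x γ| ≤ R) → (∀ γ, |y γ| ≤ R) →
      |a x - a y| ≤ C * ∑ γ, |x γ - y γ| := by
  classical
  obtain ⟨c, hc, hac, -⟩ := exists_hadamard ha
  choose K hK using fun γ => exists_bound_of_contDiff (hc γ) R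
  refine ⟨∑ γ, K γ, fun x y hx hy => ?_⟩
  rw [hac, Finset.mul_sum]
  refine (Finset.abs_sum_le_sum_abs _ _).trans (Finset.sum_le_sum fun γ _ => ?_)
  rw [abs_mul]
  gcongr
  refine (hK γ _ fun s => by cases s with
    | inl s => exact hx s
    | inr s => exact hy s).trans ?_
  exact_mod_cast Finset.single_le_sum (f := K) (fun _ _ => zero_le) (Finset.mem_univ γ)

lemma exists_lip_comp {a : (ι → ℝ) → ℝ} (ha : ContDiff ℝ ∞ a) (M : ℝ≥0) :
    ∃ C : ℝ≥0, ∀ (L : ℝ≥0) (U : ι → Eu n → ℝ), Fam L M U →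
      LipschitzWith (C * L) (cx fun x => a fun γ => U γ x) := by
  obtain ⟨C, hC⟩ := exists_lip_of_contDiff ha M
  refine ⟨C * Fintype.card ι, fun L U h => LipschitzWith.of_dist_le_mul fun x y => ?_⟩
  rw [Complex.dist_eq, cx, cx, ← Complex.ofReal_sub, Complex.norm_real]
  refine (hC _ _ (fun γ => h.bd γ x) fun γ => h.bd γ y).trans ?_
  calc (C : ℝ) * ∑ γ, |U γ x - U γ y| ≤ C * ∑ _γ : ι, L * dist x y := by
        gcongr with γ; exact h.abs_sub_le γ x y
    _ = _ := by simp; ring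

/-- The derivative of a smooth function along a family. -/
def dcoef [DecidableEq ι] (a : (ι → ℝ) → ℝ) (U : ι → Eu n → ℝ) (γ : ι) (x : Eu n) : ℝ :=
  fderiv ℝ a (fun γ => U γ x) (Pi.single γ 1)

lemma contDiff_partial [DecidableEq ι] {a : (ι → ℝ) → ℝ} (ha : ContDiff ℝ ∞ a) (γ : ι) :
    ContDiff ℝ ∞ fun z => fderiv ℝ a z (Pi.single γ 1) :=
  (ha.fderiv_right (by simp)).clm_apply contDiff_const

/-- The coefficients `c(U_{<l+1}, U_{<l}) - (∂_γ a(U))_{<l-8}`. -/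
lemma exists_jb_mcoef_sub [DecidableEq ι] (hχ : IsLPCutoff χ) (N : ℕ) {a : (ι → ℝ) → ℝ}
    (ha : ContDiff ℝ ∞ a) {c : (ι ⊕ ι → ℝ) → ℝ} (hc : ContDiff ℝ ∞ c) (γ : ι)
    (hca : ∀ x, c (Sum.elim x x) = fderiv ℝ a x (Pi.single γ 1)) (M : ℝ≥0) :
    ∃ C : ℝ≥0, ∀ (L : ℝ≥0) (U : ι → Eu n → ℝ), Fam L M U → ∀ l,
      JB l (N + 1) (C * L * 2 ^ (-l)) (mcoef χ c U l - lowFreq χ (l - 8) (dcoef a U γ)) := by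
  obtain ⟨R, hR⟩ := exists_jb_slot (ι := ι) hχ N
  obtain ⟨C1, h1⟩ := JB.pr_comp (n := n) N hc (R * M)
  obtain ⟨D1, e1⟩ := exists_jb_rfm N (chiS hχ)
  obtain ⟨D2, e2⟩ := exists_jb_rfm N (dil 1 (chiS hχ))
  obtain ⟨D3, e3⟩ := exists_jb_rfm N (dil (-8) (chiS hχ))
  obtain ⟨Λ, hΛ⟩ := exists_lip_comp (n := n) (contDiff_partial ha γ) M
  obtain ⟨Q, hQ⟩ := exists_lip_of_contDiff hc (nk (chiS hχ) * M + M)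
  refine ⟨(C1 * (D1 + D2) + D3 * Λ) + (Q * (2 * Fintype.card ι * mk (chiS hχ)) + 2 ^ 8 * mk (chiS hχ) * Λ),
    fun L U h l => ?_⟩
  have hg : BM (cx (dcoef a U γ)) := h.bm_comp (contDiff_partial ha γ)
  have hgL : LipschitzWith (Λ * L) (cx (dcoef a U γ)) := hΛ L U h
  have prl (k : ℤ) {f : Eu n → ℝ} {K : ℝ≥0} (hf : BM (cx f)) (hK : LipschitzWith K (cx f)) (i : Fin n) :
      pr i (lowFreq χ k f) = rfm (dil k (chiS hχ)) (pdc i (cx f)) := by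
    rw [lowFreq_eq_rfm hχ, pr_rfm _ hf]
    ext x
    rw [rfm, rfm, fm_pdc _ hf hK]
  have hs (s : ι ⊕ ι) := hR l L M U h s
  have hps (i : Fin n) (s : ι ⊕ ι) : JB l N ((D1 + D2) * L) (pr i (slot χ l U s)) := by
    cases s with
    | inl γ =>
      have := e2 l _ L (bm_pdc (h.lip γ) i) (norm_pdc_le (h.lip γ) i)
      rw [dil_dil, ← prl _ (h.bm γ) (h.lip γ)] at this
      exact this.mono (by gcongr; exact le_add_self)
    | inr γ =>
      have := e1 l _ L (bm_pdc (h.lip γ) i) (norm_pdc_le (h.lip γ) i)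
      rw [← prl _ (h.bm γ) (h.lip γ)] at this
      exact this.mono (by gcongr; exact le_self_add)
  obtain ⟨Cm, hCm⟩ := exists_jb_mcoef hχ 0 hc M
  have sm1 : ContDiff ℝ ∞ (mcoef χ c U l) := (hCm L U h l).1
  have sm2 : ContDiff ℝ ∞ (lowFreq χ (l - 8) (dcoef a U γ)) := by
    rw [lowFreq_eq_rfm hχ]; exact contDiff_rfm _ hg
  refine ⟨⟨sm1.sub sm2, fun x => ?_⟩, fun i => ?_⟩
  -- On the diagonal Hadamard's coefficient equals the partial derivative, so the difference is
  -- bounded by the distance of the low frequency parts from `U`, which is of order `2 ^ (-l) * L`.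
  · have b1 : |mcoef χ c U l x - dcoef a U γ x|
        ≤ Q * (Fintype.card ι * (2 ^ (-l) * mk (chiS hχ) * L) + Fintype.card ι * (2 ^ (-l) * mk (chiS hχ) * L)) := by
      rw [mcoef, slot_eq, dcoef, ← hca]
      refine (hQ _ _ (fun s => ?_) fun s => ?_).trans ?_
      · cases s with
        | inl γ => exact (h.norm_lowFreq_le hχ _ γ x).trans (by push_cast; linarith [M.coe_nonneg])
        | inr γ => exact (h.norm_lowFreq_le hχ _ γ x).trans (by push_cast; linarith [M.coe_nonneg])
      · have hp : (0 : ℝ) ≤ nk (chiS hχ) * M := by positivity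
        cases s with
        | inl γ => exact (h.bd γ x).trans (by push_cast; linarith)
        | inr γ => exact (h.bd γ x).trans (by push_cast; linarith)
      · rw [Fintype.sum_sum_type]
        simp only [Sum.elim_inl, Sum.elim_inr]
        have hcard (z : ℝ) : (Fintype.card ι : ℝ) * z = ∑ _γ : ι, z := by simp
        rw [hcard]
        gcongr with γ _ γ _
        · refine (h.norm_lowFreq_sub_le hχ (l + 1) γ x).trans ?_
          have := zpow_two_le (show -(l + 1) ≤ -l by linarith)
          gcongr
        · exact h.norm_lowFreq_sub_le hχ l γ x
    have b2 : |lowFreq χ (l - 8) (dcoef a U γ) x - dcoef a U γ x| ≤ 2 ^ (-l) * (2 ^ 8 * mk (chiS hχ) * (Λ * L)) := by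
      have := norm_fm_dil_sub_le hg hgL (l - 8) (chiS hχ) x
      rw [chiS_apply, hχ.eq_one 0 (by simp), ← lowFreq_eq hχ, Complex.ofReal_one, one_mul] at this
      simp only [cx] at this
      rw [← Complex.ofReal_sub, Complex.norm_real, Real.norm_eq_abs,
        show -(l - 8) = -l + 8 by ring, zpow_add₀ two_ne_zero,
        show (2 : ℝ) ^ (8 : ℤ) = 2 ^ 8 by norm_num] at this
      refine this.trans (le_of_eq ?_)
      push_cast; ring
    have b3 : |(mcoef χ c U l - lowFreq χ (l - 8) (dcoef a U γ)) x|
        ≤ |mcoef χ c U l x - dcoef a U γ x| + |lowFreq χ (l - 8) (dcoef a U γ) x - dcoef a U γ x| := by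
      rw [abs_sub_comm (lowFreq χ (l - 8) (dcoef a U γ) x)]
      exact abs_sub_le _ _ _
    refine (b3.trans (add_le_add b1 b2)).trans ?_
    have : (0 : ℝ) ≤ (C1 * (D1 + D2) + D3 * Λ) * L * 2 ^ (-l) := by positivity
    push_cast
    linarith
  -- For derivatives no cancellation is needed: each of the two terms has first derivatives of order
  -- `L`, which is `2 ^ l` times the claimed size `L * 2 ^ (-l)`.
  · have e : pr i (mcoef χ c U l - lowFreq χ (l - 8) (dcoef a U γ))
        = pr i (mcoef χ c U l) - pr i (lowFreq χ (l - 8) (dcoef a U γ)) := by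
      have s3 : ContDiff ℝ ∞ ((-1 : ℝ) • lowFreq χ (l - 8) (dcoef a U γ)) := sm2.const_smul (-1 : ℝ)
      have h3 : (-1 : ℝ) • lowFreq χ (l - 8) (dcoef a U γ) = - lowFreq χ (l - 8) (dcoef a U γ) := by simp
      rw [sub_eq_add_neg, ← h3, pr_add sm1 s3, pr_smul _ sm2]
      simp [sub_eq_add_neg]
    have h2 := e3 l _ (Λ * L) (bm_pdc hgL i) (norm_pdc_le hgL i)
    rw [dil_dil, show l + -8 = l - 8 by ring, ← prl _ hg hgL] at h2
    rw [e]
    refine ((h1 l (slot χ l U) ((D1 + D2) * L) i hs (hps i)).sub h2).mono ?_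
    have : (2 : ℝ≥0) ^ l * (2 : ℝ≥0) ^ (-l) = 1 := by rw [← zpow_add₀ two_ne_zero]; simp
    calc C1 * ((D1 + D2) * L) + D3 * (Λ * L) = (C1 * (D1 + D2) + D3 * Λ) * L := by ring
      _ ≤ ((C1 * (D1 + D2) + D3 * Λ) + (Q * (2 * Fintype.card ι * mk (chiS hχ))
          + 2 ^ 8 * mk (chiS hχ) * Λ)) * L := by
          exact mul_le_mul_left le_self_add _
      _ = (2 ^ l * 2 ^ (-l)) * (((C1 * (D1 + D2) + D3 * Λ) + (Q * (2 * Fintype.card ι * mk (chiS hχ))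
          + 2 ^ 8 * mk (chiS hχ) * Λ)) * L) := by rw [this, one_mul]
      _ = _ := by ring

end Paralinearization

/-! ### The paralinearization theorem. -/

section Paralinearization
open SchwartzMap
variable {n : ℕ} {χ : Eu n → ℝ} {ι : Type*} [Fintype ι] [DecidableEq ι]

/-- The remainder `P_k a(U) - ∑_γ (∂_γ a(U))_{<k-8} P_k U_γ` of the paralinearization of `a(U)`. -/
def plin (hχ : IsLPCutoff χ) (a : (ι → ℝ) → ℝ) (U : ι → Eu n → ℝ) (k : ℤ) : Eu n → ℂ :=
  fm (dil k (phiS hχ)) (cx fun x => a fun γ => U γ x)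
    - ∑ γ, fm (dil (k - 8) (chiS hχ)) (cx (dcoef a U γ)) * fm (dil k (phiS hχ)) (cx (U γ))

/-- Paralinearization gains one derivative. -/
theorem paralinearization (hχ : IsLPCutoff χ) (hn : 0 < n) {σ : ℝ} (hσ : 0 < σ) {a : (ι → ℝ) → ℝ}
    (ha : ContDiff ℝ ∞ a) (M : ℝ≥0) : ∃ C : ℝ≥0, ∀ (L : ℝ≥0) (U : ι → Eu n → ℝ), Fam L M U →
    ∃ y : ℤ → ℝ≥0∞, (∀ k, eLpNorm (plin hχ a U k) 2 volume ≤ L * wt (-1) k * y k) ∧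
      ∑' k, (wt σ k * y k) ^ 2 ≤ C * ∑ γ, lps hχ σ (cx (U γ)) := by
  obtain ⟨c, hc, hac, hca⟩ := exists_hadamard ha
  -- One order more than in Moser's estimate: the gain `2 ^ (-l)` of the coefficients will be
  -- converted into `2 ^ (-k)`, which costs `2 ^ (k - l)`.
  obtain ⟨N, hN⟩ := exists_nat_gt (σ + 1)
  choose K hK using fun γ => exists_jb_mcoef_sub (n := n) hχ N ha (hc γ) γ (hca γ) M
  choose Λ hΛ using fun γ => exists_lip_comp (n := n) (contDiff_partial ha γ) M
  obtain ⟨G, hG⟩ := exists_gain_ring hχ (N + 1)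
  obtain ⟨Q, hQ⟩ := exists_band_commutator hχ
  set κ : ℤ → ℝ≥0∞ := fun j => (G * ∑ γ, K γ : ℝ≥0) * (wt 1 j * gainWt (N + 1) j)
    + (Q * ∑ γ, Λ γ : ℝ≥0) * if |j| ≤ 2 then 1 else 0 with hκ
  have fin : ∑' j, wt σ j * κ j ≠ ⊤ := by
    have e (j : ℤ) : wt σ j * κ j = (G * ∑ γ, K γ : ℝ≥0) * (wt (σ + 1) j * gainWt (N + 1) j)
        + (Q * ∑ γ, Λ γ : ℝ≥0) * (wt σ j * if |j| ≤ 2 then 1 else 0) := by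
      rw [hκ, wt_add_left]; ring
    simp only [e]
    rw [ENNReal.tsum_add, ENNReal.tsum_mul_left, ENNReal.tsum_mul_left]
    exact ENNReal.add_ne_top.2 ⟨ENNReal.mul_ne_top ENNReal.coe_ne_top
      (tsum_gainWt_ne_top (by linarith) (by push_cast; linarith)),
      ENNReal.mul_ne_top ENNReal.coe_ne_top (bandConst_ne_top σ)⟩
  obtain ⟨S, hS⟩ : ∃ S : ℝ≥0, (S : ℝ≥0∞) = ∑' j, wt σ j * κ j := ⟨_, ENNReal.coe_toNNReal fin⟩
  refine ⟨S ^ 2 * Fintype.card ι, fun L U h => ?_⟩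
  set X : ι → ℤ → ℝ≥0∞ := fun γ l => eLpNorm (fm (dil l (phiS hχ)) (cx (U γ))) 2 volume with hX
  refine ⟨fun k => ∑' l, κ (k - l) * ∑ γ, X γ l, fun k => ?_, ?_⟩
  swap
  · refine (tsum_wt_sq_conv_le σ κ _).trans ?_
    rw [← hS]
    refine (mul_le_mul_right (lps_sum_le σ X) _).trans (le_of_eq ?_)
    simp only [lps, hX]
    push_cast
    ring
  have hg (γ : ι) : BM (cx (dcoef a U γ)) := h.bm_comp (contDiff_partial ha γ)
  have hgL (γ : ι) : LipschitzWith (Λ γ * L) (cx (dcoef a U γ)) := hΛ γ L U h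
  -- Subtracting the low frequencies of the true derivative from Hadamard's coefficient leaves `t1`,
  -- whose coefficient is smaller by `2 ^ (-l) * L`. The subtracted part `t2` is a paraproduct,
  -- hence localized near frequency `2 ^ l`.
  set t1 : ι → ℤ → Eu n → ℂ := fun γ l => cx (mcoef χ (c γ) U l - lowFreq χ (l - 8) (dcoef a U γ))
    * fm (dil l (phiS hχ)) (cx (U γ)) with ht1
  set t2 : ι → ℤ → Eu n → ℂ := fun γ l => fm (dil (l - 8) (chiS hχ)) (cx (dcoef a U γ))
    * fm (dil l (phiS hχ)) (cx (U γ)) with ht2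
  have e0 (γ : ι) : mser hχ c U γ = t1 γ + t2 γ := by
    ext l x
    simp only [mser, ht1, ht2, ← lowFreq_eq hχ, Pi.add_apply, Pi.mul_apply, cx, Pi.sub_apply]
    push_cast
    ring
  have b1 (γ : ι) (l : ℤ) : BM (t1 γ l) := (hK γ L U h l).bm.mul ((h.bm γ).fm _)
  have b2 (γ : ι) (l : ℤ) : BM (t2 γ l) := ((hg γ).fm _).mul ((h.bm γ).fm _)
  have u2 (γ : ι) : UConv (t2 γ) := by
    obtain ⟨D, hD⟩ := (hg γ).exists_nnreal
    refine (uConv_fm_phiS hχ hn (h.bm γ) (h.mem γ) (h.lip γ)).mono (C := nk (chiS hχ) * D)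
      (fun k x => ?_) (by positivity)
    simp only [ht2]
    rw [Pi.mul_apply, norm_mul]
    exact mul_le_mul_of_nonneg_right (norm_fm_dil_le hD _ _ x) (norm_nonneg _)
  have u1 (γ : ι) : UConv (t1 γ) := by
    have : t1 γ = mser hχ c U γ - t2 γ := by rw [e0 γ]; abel
    rw [this]
    exact (uConv_mser hχ hn hc h γ).sub (u2 γ)
  have e1 : fm (dil k (phiS hχ)) (cx fun x => a fun γ => U γ x)
      = ∑ γ, (fm (dil k (phiS hχ)) (su (t1 γ)) + fm (dil k (phiS hχ)) (su (t2 γ))) := by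
    rw [fm_comp_eq hχ hn ha hc hac h, su_sum _ fun γ _ => uConv_mser hχ hn hc h γ,
      fm_sum _ fun γ _ => (uConv_mser hχ hn hc h γ).bm_su fun l => (bm_mser hχ hc h γ l).meas]
    refine Finset.sum_congr rfl fun γ _ => ?_
    rw [← fm_add _ ((u1 γ).bm_su fun l => (b1 γ l).meas) ((u2 γ).bm_su fun l => (b2 γ l).meas),
      ← su_add (u1 γ) (u2 γ), ← e0 γ]
  -- Both terms on the left reduce to the indices `|l - k| ≤ 2`, so their difference is a finite sum
  -- of band commutators.
  have e2 (γ : ι) : fm (dil k (phiS hχ)) (su (t2 γ))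
      - fm (dil (k - 8) (chiS hχ)) (cx (dcoef a U γ)) * fm (dil k (phiS hχ)) (cx (U γ))
      = ∑ l ∈ Finset.Icc (k - 2) (k + 2), (fm (dil k (phiS hχ)) (t2 γ l)
        - fm (dil (k - 8) (chiS hχ)) (cx (dcoef a U γ))
          * fm (dil k (phiS hχ)) (fm (dil l (phiS hχ)) (cx (U γ)))) := by
    rw [Finset.sum_sub_distrib, ← Finset.mul_sum, ← fm_phiS_eq_band hχ hn h γ k,
      fm_su_eq_sum (u2 γ) (fun l => (b2 γ l).meas) _ (Finset.Icc (k - 2) (k + 2)) fun l hl =>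
        fm_para_eq_zero (hg γ) (h.bm γ) (lowS_chiS hχ) (ringS_phiS hχ) (ringS_phiS hχ) (notMem_band hl)]
  have e3 : plin hχ a U k = ∑ γ, (fm (dil k (phiS hχ)) (su (t1 γ))
      + ∑ l ∈ Finset.Icc (k - 2) (k + 2), (fm (dil k (phiS hχ)) (t2 γ l)
        - fm (dil (k - 8) (chiS hχ)) (cx (dcoef a U γ))
          * fm (dil k (phiS hχ)) (fm (dil l (phiS hχ)) (cx (U γ))))) := by
    rw [plin, e1, ← Finset.sum_sub_distrib]
    exact Finset.sum_congr rfl fun γ _ => by rw [← e2 γ]; abel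
  have bb (γ : ι) (l : ℤ) := ((b2 γ l).fm (dil k (phiS hχ))).sub
    (((hg γ).fm (dil (k - 8) (chiS hχ))).mul (((h.bm γ).fm (dil l (phiS hχ))).fm (dil k (phiS hχ))))
  have bs (γ : ι) := BM.sum (Finset.Icc (k - 2) (k + 2)) fun l _ => bb γ l
  have b1s (γ : ι) := ((u1 γ).bm_su fun l => (b1 γ l).meas).fm (dil k (phiS hχ))
  have w1 (l : ℤ) : ((2 ^ (-l) : ℝ≥0) : ℝ≥0∞) = wt (-1) k * wt 1 (k - l) := by
    rw [← wt_neg_neg, ← wt_add, wt_one, ENNReal.coe_zpow (by norm_num)]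
    congr 1; ring
  have f1 (γ : ι) : eLpNorm (fm (dil k (phiS hχ)) (su (t1 γ))) 2 volume
      ≤ L * wt (-1) k * ∑' l, (G * ∑ γ, K γ : ℝ≥0) * (wt 1 (k - l) * gainWt (N + 1) (k - l)) * X γ l := by
    refine (eLpNorm_le_tsum ((u1 γ).hasSum_fm (fun l => (b1 γ l).meas) _)
      fun l => ((b1 γ l).fm _).meas).trans ?_
    rw [← ENNReal.tsum_mul_left]
    refine ENNReal.tsum_le_tsum fun l => ?_
    refine (hG l k _ _ _ (hK γ L U h l) (h.bm γ)).trans ?_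
    have hKs : (K γ : ℝ≥0∞) ≤ ((∑ γ, K γ : ℝ≥0) : ℝ≥0∞) := by
      exact_mod_cast Finset.single_le_sum (f := K) (fun _ _ => zero_le) (Finset.mem_univ γ)
    rw [ENNReal.coe_mul, ENNReal.coe_mul (K γ), w1, ENNReal.coe_mul]
    calc _ = (L * wt (-1) k) * (G * K γ * (wt 1 (k - l) * gainWt (N + 1) (k - l)) * X γ l) := by
          simp only [hX]; ring
      _ ≤ _ := by gcongr
  have f2 (γ : ι) : eLpNorm (∑ l ∈ Finset.Icc (k - 2) (k + 2), (fm (dil k (phiS hχ)) (t2 γ l)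
        - fm (dil (k - 8) (chiS hχ)) (cx (dcoef a U γ))
          * fm (dil k (phiS hχ)) (fm (dil l (phiS hχ)) (cx (U γ))))) 2 volume
      ≤ L * wt (-1) k * ∑' l, (Q * ∑ γ, Λ γ : ℝ≥0) *
        (if |k - l| ≤ 2 then 1 else 0) * X γ l := by
    have hΛs : (Λ γ : ℝ≥0∞) ≤ ((∑ γ, Λ γ : ℝ≥0) : ℝ≥0∞) := by
      exact_mod_cast Finset.single_le_sum (f := Λ) (fun _ _ => zero_le) (Finset.mem_univ γ)
    refine (eLpNorm_sum_le (fun l _ => (bb γ l).meas.aestronglyMeasurable) one_le_two).trans ?_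
    rw [← ENNReal.tsum_mul_left]
    refine le_trans (Finset.sum_le_sum fun l hl => ?_) (ENNReal.sum_le_tsum (Finset.Icc (k - 2) (k + 2)))
    have hkl : |k - l| ≤ 2 := by rw [Finset.mem_Icc] at hl; rw [abs_le]; omega
    refine (hQ k l _ _ _ (hg γ) ((h.bm γ).fm (dil l (phiS hχ))) (hgL γ) hl).trans ?_
    rw [if_pos hkl, mul_one, ENNReal.coe_mul, ENNReal.coe_mul]
    calc _ = (L * wt (-1) k) * (Q * Λ γ * X γ l) := by simp only [hX]; ring
      _ ≤ _ := by gcongr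
  rw [e3]
  refine (eLpNorm_sum_le (fun γ _ => ((b1s γ).add (bs γ)).meas.aestronglyMeasurable) one_le_two).trans ?_
  have : L * wt (-1) k * ∑' l, κ (k - l) * ∑ γ, X γ l = ∑ γ, (L * wt (-1) k * (∑' l,
      (G * ∑ γ, K γ : ℝ≥0) * (wt 1 (k - l) * gainWt (N + 1) (k - l)) * X γ l)
      + L * wt (-1) k * ∑' l, (Q * ∑ γ, Λ γ : ℝ≥0) *
        (if |k - l| ≤ 2 then 1 else 0) * X γ l) := by
    simp only [← mul_add, ← Finset.mul_sum, ← ENNReal.tsum_add, ← add_mul]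
    rw [← Summable.tsum_finsetSum fun _ _ => ENNReal.summable]
    simp only [← Finset.mul_sum, hκ]
  rw [this]
  exact Finset.sum_le_sum fun γ _ => (eLpNorm_add_le (b1s γ).meas.aestronglyMeasurable
    (bs γ).meas.aestronglyMeasurable one_le_two).trans (add_le_add (f1 γ) (f2 γ))

end Paralinearization

/-! ### Weighted square sums of the terms of the remainder. -/

section Termwise
open SchwartzMap
variable {n : ℕ} {χ : Eu n → ℝ}

/-- The weighted square sum of a sequence of functions. -/
def tsq (σ : ℝ) (t : ℤ → Eu n → ℂ) : ℝ≥0∞ := ∑' k, (wt σ k * eLpNorm (t k) 2 volume) ^ 2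

variable {σ : ℝ} {t s : ℤ → Eu n → ℂ}

lemma tsq_le {c : ℝ≥0∞} {x : ℤ → ℝ≥0∞} (h : ∀ k, eLpNorm (t k) 2 volume ≤ c * x k) :
    tsq σ t ≤ c ^ 2 * ∑' k, (wt σ k * x k) ^ 2 := by
  rw [tsq, ← ENNReal.tsum_mul_left]
  refine ENNReal.tsum_le_tsum fun k => ?_
  rw [← mul_pow, mul_left_comm]
  gcongr
  exact h k

lemma tsq_add_le (ht : ∀ k, BM (t k)) (hs : ∀ k, BM (s k)) :
    tsq σ (t + s) ≤ 2 * (tsq σ t + tsq σ s) := by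
  rw [tsq, tsq, tsq, ← ENNReal.tsum_add, ← ENNReal.tsum_mul_left]
  refine ENNReal.tsum_le_tsum fun k => ?_
  refine le_trans ?_ (sq_add_le _ _)
  rw [← mul_add]
  gcongr
  exact eLpNorm_add_le (ht k).meas.aestronglyMeasurable (hs k).meas.aestronglyMeasurable one_le_two

lemma tsq_neg : tsq σ (-t) = tsq σ t := by simp [tsq]

lemma tsq_sub_le (ht : ∀ k, BM (t k)) (hs : ∀ k, BM (s k)) :
    tsq σ (t - s) ≤ 2 * (tsq σ t + tsq σ s) := by
  rw [sub_eq_add_neg, ← tsq_neg (t := s)]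
  refine tsq_add_le ht fun k => ?_
  have := (hs k).smul (-1)
  rwa [neg_one_smul] at this

lemma tsq_sum_le {ι : Type*} (A : Finset ι) {T : ι → ℤ → Eu n → ℂ} (hT : ∀ i ∈ A, ∀ k, BM (T i k))
    {D : ℝ≥0∞} (h : ∀ i ∈ A, tsq σ (T i) ≤ D) : tsq σ (∑ i ∈ A, T i) ≤ A.card ^ 2 * D := by
  have h1 (k : ℤ) : eLpNorm ((∑ i ∈ A, T i) k) 2 volume ≤ ∑ i : A, eLpNorm (T i k) 2 volume := by
    rw [Finset.sum_apply, ← Finset.sum_coe_sort]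
    exact eLpNorm_sum_le (fun i _ => (hT i i.2 k).meas.aestronglyMeasurable) one_le_two
  refine (tsq_le (c := 1) fun k => by simpa using h1 k).trans ?_
  rw [one_pow, one_mul]
  refine (lps_sum_le σ _).trans ?_
  calc (Fintype.card A : ℝ≥0∞) * ∑ i : A, tsq σ (T i) ≤ Fintype.card A * ∑ _i : A, D := by
        gcongr with i; exact h i i.2
    _ = _ := by simp; ring

lemma tsum_wt_shift (σ : ℝ) (d : ℤ) (x : ℤ → ℝ≥0∞) :
    ∑' k, (wt σ k * x (k + d)) ^ 2 = wt σ (-d) ^ 2 * ∑' k, (wt σ k * x k) ^ 2 := by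
  rw [← ENNReal.tsum_mul_left, ← (Equiv.addRight d).tsum_eq fun k => wt σ (-d) ^ 2 * (wt σ k * x k) ^ 2]
  refine tsum_congr fun k => ?_
  simp only [Equiv.coe_addRight]
  rw [← mul_pow, ← mul_assoc, ← wt_add]
  congr 3
  ring_nf

/-- The comparison goes through the homogeneous Sobolev norm, which dominates every annular square
function and is dominated by that of `phiS`. -/
lemma Annular.exists_le_lps (hχ : IsLPCutoff χ) {q : 𝓢(Eu n, ℂ)} (hq : Annular q) (hn : 0 < n)
    (hσ : 0 ≤ σ) : ∃ C : ℝ≥0, ∀ f : Eu n → ℂ, BM f → MemLp f 2 volume →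
    ∑' k, (wt σ k * eLpNorm (fm (dil k q) f) 2 volume) ^ 2 ≤ C * lps hχ σ f := by
  obtain ⟨C, hC⟩ := hq.square_function hn σ
  obtain ⟨D, hD⟩ : ∃ D : ℝ≥0, (D : ℝ≥0∞) = (2 * wt σ 1) ^ 2 :=
    ⟨_, ENNReal.coe_toNNReal (ENNReal.pow_ne_top (ENNReal.mul_ne_top (by simp) (wt_ne_top _ _)))⟩
  refine ⟨C * D, fun f hf hf2 => (hC f hf hf2).trans ?_⟩
  rw [ENNReal.coe_mul, hD, mul_assoc]
  exact mul_le_mul_right (hsq_le hχ hn hσ hf hf2) _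

/-- The decay `2 ^ (-k)` of the pieces of the Lipschitz factor cancels the `2 ^ k` of the
derivative, and the square sum falls on `w`. -/
lemma exists_tsq_tH_pdc (hχ : IsLPCutoff χ) (hn : 0 < n) (hσ : 0 ≤ σ) (d : ℤ) : ∃ C : ℝ≥0,
    ∀ (f w : Eu n → ℂ) (K L : ℝ≥0) (j : Fin n), BM f → BM w → MemLp w 2 volume → LipschitzWith K f →
    LipschitzWith L w →
    tsq σ (tH d (phiS hχ) (phiS hχ) f (pdc j w)) ≤ C * K ^ 2 * lps hχ σ w := by
  obtain ⟨C, hC⟩ := (ringS_phiS hχ).annular.norm_fm_le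
  choose D hD using fun j => ((ringS_phiS hχ).sd j).annular.exists_le_lps hχ hn hσ
  refine ⟨(C * 2 ^ (-d)) ^ 2 * ∑ j, D j, fun f w K L j hf hw hw2 hK hL => ?_⟩
  have h1 (k : ℤ) : eLpNorm (tH d (phiS hχ) (phiS hχ) f (pdc j w) k) 2 volume
      ≤ (C * 2 ^ (-d) * K : ℝ≥0) * eLpNorm (fm (dil k (sd j (phiS hχ))) w) 2 volume := by
    rw [tH, fm_dil_pdc k _ hw hL, mul_smul_comm, ← smul_mul_assoc]
    refine eLpNorm_mul_le_sup fun x => ?_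
    rw [Pi.smul_apply, norm_smul, Complex.norm_real, Real.norm_of_nonneg (by positivity)]
    have h2 := hC (k + d) K f hf hK x
    have e : (2 : ℝ) ^ k * 2 ^ (-(k + d)) = 2 ^ (-d) := by
      rw [← zpow_add₀ two_ne_zero]; congr 1; ring
    calc _ ≤ (2 : ℝ) ^ k * (C * 2 ^ (-(k + d)) * K) := by gcongr
      _ = C * (2 ^ k * 2 ^ (-(k + d))) * K := by ring
      _ = _ := by rw [e]; push_cast; ring
  refine (tsq_le h1).trans ((mul_le_mul_right (hD j w hw hw2) _).trans ?_)
  have h3 : (D j : ℝ≥0∞) ≤ ((∑ j, D j : ℝ≥0) : ℝ≥0∞) := by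
    exact_mod_cast Finset.single_le_sum (f := D) (fun _ _ => zero_le) (Finset.mem_univ j)
  calc _ ≤ ((C * 2 ^ (-d) * K : ℝ≥0) : ℝ≥0∞) ^ 2 * ((∑ j, D j : ℝ≥0) * lps hχ σ w) := by gcongr
    _ = _ := by push_cast; ring

lemma exists_tsq_tH (hχ : IsLPCutoff χ) (σ : ℝ) (d : ℤ) : ∃ C : ℝ≥0, ∀ (f g : Eu n → ℂ) (K : ℝ≥0),
    (∀ x, ‖g x‖ ≤ K) → tsq σ (tH d (phiS hχ) (phiS hχ) f g) ≤ C * K ^ 2 * lps hχ σ f := by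
  obtain ⟨D, hD⟩ : ∃ D : ℝ≥0, (D : ℝ≥0∞) = wt σ (-d) ^ 2 :=
    ⟨_, ENNReal.coe_toNNReal (ENNReal.pow_ne_top (wt_ne_top _ _))⟩
  refine ⟨nk (phiS hχ) ^ 2 * D, fun f g K hK => ?_⟩
  refine (tsq_le (c := (nk (phiS hχ) * K : ℝ≥0))
    (x := fun k => eLpNorm (fm (dil (k + d) (phiS hχ)) f) 2 volume) fun k =>
      eLpNorm_mul_le_sup' fun x => by exact_mod_cast norm_fm_dil_le hK k (phiS hχ) x).trans ?_
  rw [tsum_wt_shift σ d fun k => eLpNorm (fm (dil k (phiS hχ)) f) 2 volume, ← hD]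
  refine le_of_eq ?_
  rw [lps]
  push_cast
  ring

lemma tsq_tT_le (hχ : IsLPCutoff χ) (σ : ℝ) (f g : Eu n → ℂ) {K : ℝ≥0} (hK : ∀ x, ‖f x‖ ≤ K) :
    tsq σ (tT (chiS hχ) (phiS hχ) f g) ≤ nk (chiS hχ) ^ 2 * K ^ 2 * lps hχ σ g := by
  refine (tsq_le (c := (nk (chiS hχ) * K : ℝ≥0))
    (x := fun k => eLpNorm (fm (dil k (phiS hχ)) g) 2 volume) fun k =>
      eLpNorm_mul_le_sup fun x => by exact_mod_cast norm_fm_dil_le hK (k - 8) (chiS hχ) x).trans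
    (le_of_eq ?_)
  rw [lps]
  push_cast
  ring

variable {ι : Type*} [Fintype ι] [DecidableEq ι]

lemma norm_fm_low_pdc_le (q : 𝓢(Eu n, ℂ)) {w : Eu n → ℂ} {L θ : ℝ≥0} (hw : BM w)
    (hL : LipschitzWith L w) (hθ : ∀ x, ‖w x‖ ≤ θ) (k : ℤ) (j : Fin n) (x : Eu n) :
    ‖fm (dil k q) (pdc j w) x‖ ≤ 2 ^ k * (nk (sd j q) * θ) := by
  rw [fm_dil_pdc k q hw hL, Pi.smul_apply, norm_smul, Complex.norm_real, Real.norm_of_nonneg (by positivity)]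
  gcongr
  exact norm_fm_dil_le hθ k _ x

/-- The cancellation between `T_{∂_j w} a(U)` and `∑_γ T_{∂_γ a(U) ∂_j w} U_γ`. -/
lemma exists_tsq_tT_cancel (hχ : IsLPCutoff χ) (hn : 0 < n) (hσ : 0 < σ) {a : (ι → ℝ) → ℝ}
    (ha : ContDiff ℝ ∞ a) (M : ℝ≥0) : ∃ C : ℝ≥0, ∀ (L L' θ : ℝ≥0) (U : ι → Eu n → ℝ) (w : Eu n → ℂ)
    (j : Fin n), Fam L M U → BM w → LipschitzWith L' w → (∀ x, ‖w x‖ ≤ θ) →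
    tsq σ (tT (chiS hχ) (phiS hχ) (pdc j w) (cx fun x => a fun γ => U γ x)
      - ∑ γ, tT (chiS hχ) (phiS hχ) (cx (dcoef a U γ) * pdc j w) (cx (U γ)))
      ≤ C * (L * θ) ^ 2 * ∑ γ, lps hχ σ (cx (U γ)) := by
  obtain ⟨C, hC⟩ := paralinearization hχ hn hσ ha M
  choose Λ hΛ using fun γ => exists_lip_comp (n := n) (contDiff_partial ha γ) M
  set Q : ℝ≥0 := ∑ j : Fin n, nk (sd j (chiS hχ))
  set P : ℝ≥0 := ∑ j : Fin n, mk (sd j (chiS hχ))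
  have hQ (j : Fin n) : nk (sd j (chiS hχ)) ≤ Q :=
    Finset.single_le_sum (f := fun j => nk (sd j (chiS hχ))) (fun _ _ => zero_le) (Finset.mem_univ j)
  have hP (j : Fin n) : mk (sd j (chiS hχ)) ≤ P :=
    Finset.single_le_sum (f := fun j => mk (sd j (chiS hχ))) (fun _ _ => zero_le) (Finset.mem_univ j)
  set D : ι → ℝ≥0 := fun γ => mk (chiS hχ) * Λ γ * Q + (P + nk (chiS hχ)) * Λ γ
  refine ⟨2 * (Q ^ 2 * C + Fintype.card ι ^ 2 * (∑ γ, D γ) ^ 2), fun L L' θ U w j h hw hL hθ => ?_⟩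
  obtain ⟨y, hy1, hy2⟩ := hC L U h
  have hg (γ : ι) : BM (cx (dcoef a U γ)) := h.bm_comp (contDiff_partial ha γ)
  have hgL (γ : ι) : LipschitzWith (Λ γ * L) (cx (dcoef a U γ)) := hΛ γ L U h
  have bw := bm_pdc hL j
  -- The failure of the low frequency cutoff to be multiplicative on the product of the coefficient
  -- and `pdc j w`. The rest of the difference is the paralinearization remainder times the low
  -- frequencies of `pdc j w`.
  set b : ι → ℤ → Eu n → ℂ := fun γ k => fm (dil (k - 8) (chiS hχ)) (cx (dcoef a U γ))
    * fm (dil (k - 8) (chiS hχ)) (pdc j w) - fm (dil (k - 8) (chiS hχ)) (cx (dcoef a U γ) * pdc j w)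
  have bb (γ : ι) (k : ℤ) : BM (b γ k) := (((hg γ).fm _).mul (bw.fm _)).sub (((hg γ).mul bw).fm _)
  set t1 : ℤ → Eu n → ℂ := fun k => fm (dil (k - 8) (chiS hχ)) (pdc j w) * plin hχ a U k
  set t2 : ι → ℤ → Eu n → ℂ := fun γ k => b γ k * fm (dil k (phiS hχ)) (cx (U γ))
  have b2 (γ : ι) (k : ℤ) : BM (t2 γ k) := (bb γ k).mul ((h.bm γ).fm _)
  have b1 (k : ℤ) : BM (t1 k) := (bw.fm _).mul ((h.bm_comp ha |>.fm _).sub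
    (BM.sum _ fun γ _ => ((hg γ).fm _).mul ((h.bm γ).fm _)))
  have e : tT (chiS hχ) (phiS hχ) (pdc j w) (cx fun x => a fun γ => U γ x)
      - ∑ γ, tT (chiS hχ) (phiS hχ) (cx (dcoef a U γ) * pdc j w) (cx (U γ)) = t1 + ∑ γ, t2 γ := by
    ext k x
    simp only [t1, t2, b, tT, plin, Pi.sub_apply, Pi.add_apply, Finset.sum_apply, Pi.mul_apply, mul_sub,
      Finset.mul_sum, sub_mul, Finset.sum_sub_distrib]
    rw [sub_add_sub_comm, sub_eq_sub_iff_add_eq_add]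
    have : ∀ γ, fm (dil (k - 8) (chiS hχ)) (pdc j w) x * (fm (dil (k - 8) (chiS hχ)) (cx (dcoef a U γ)) x
        * fm (dil k (phiS hχ)) (cx (U γ)) x) = fm (dil (k - 8) (chiS hχ)) (cx (dcoef a U γ)) x
        * fm (dil (k - 8) (chiS hχ)) (pdc j w) x * fm (dil k (phiS hχ)) (cx (U γ)) x := fun γ => by ring
    simp only [this]
    ring
  -- Only the supremum of `w` is available, so its derivative costs `2 ^ k`: exactly the derivative
  -- gained by paralinearization.
  have sup1 (k : ℤ) (x : Eu n) : ‖fm (dil (k - 8) (chiS hχ)) (pdc j w) x‖ ≤ (2 ^ k * (Q * θ) : ℝ≥0) := by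
    refine (norm_fm_low_pdc_le _ hw hL hθ (k - 8) j x).trans ?_
    push_cast
    have := zpow_two_le (show k - 8 ≤ k by linarith)
    have := hQ j
    gcongr
  have n1 : tsq σ t1 ≤ (Q * θ * L : ℝ≥0) ^ 2 * (C * ∑ γ, lps hχ σ (cx (U γ))) := by
    refine (tsq_le fun k => ?_).trans (mul_le_mul_right hy2 _)
    refine (eLpNorm_mul_le_sup (sup1 k)).trans ((mul_le_mul_right (hy1 k) _).trans (le_of_eq ?_))
    have e2 : ((2 ^ k * (Q * θ) : ℝ≥0) : ℝ≥0∞) = wt 1 k * (Q * θ) := by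
      rw [wt_one]; push_cast; rw [ENNReal.coe_zpow (by norm_num)]; simp
    have e3 : wt 1 k * wt (-1) k = 1 := by rw [← wt_neg_neg, ← wt_add]; simp
    rw [e2]
    calc _ = (wt 1 k * wt (-1) k) * (Q * θ * L * y k) := by ring
      _ = _ := by rw [e3]; push_cast; ring
  -- Replacing the averaged coefficient by the coefficient itself gains `2 ^ (-k)` against the cost
  -- of `pdc j w`. The remaining commutator is bounded by the Lipschitz constant of the coefficient
  -- times `θ`.
  have sup2 (γ : ι) (k : ℤ) (x : Eu n) : ‖b γ k x‖ ≤ (D γ * (L * θ) : ℝ≥0) := by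
    have i1 := norm_fm_dil_sub_le (hg γ) (hgL γ) (k - 8) (chiS hχ) x
    rw [chiS_apply, hχ.eq_one 0 (by simp), Complex.ofReal_one, one_mul] at i1
    have i2 := norm_fm_low_pdc_le (chiS hχ) hw hL hθ (k - 8) j x
    have i3 := norm_commutator_pdc_le (hg γ) hw (hgL γ) hL hθ (k - 8) (chiS hχ) j x
    have e4 : b γ k x = (fm (dil (k - 8) (chiS hχ)) (cx (dcoef a U γ)) x - cx (dcoef a U γ) x)
        * fm (dil (k - 8) (chiS hχ)) (pdc j w) x
        - (fm (dil (k - 8) (chiS hχ)) (cx (dcoef a U γ) * pdc j w) x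
          - cx (dcoef a U γ) x * fm (dil (k - 8) (chiS hχ)) (pdc j w) x) := by
      simp only [b, Pi.sub_apply, Pi.mul_apply]; ring
    rw [e4]
    refine (norm_sub_le _ _).trans ?_
    rw [norm_mul]
    have e5 : (2 : ℝ) ^ (-(k - 8)) * 2 ^ (k - 8) = 1 := by rw [← zpow_add₀ two_ne_zero]; simp
    have hq := hQ j
    have hp := hP j
    calc _ ≤ ((2 : ℝ) ^ (-(k - 8)) * mk (chiS hχ) * (Λ γ * L : ℝ≥0)) * ((2 : ℝ) ^ (k - 8) * (nk (sd j (chiS hχ)) * θ))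
          + ((mk (sd j (chiS hχ)) + nk (chiS hχ) : ℝ)) * ((Λ γ * L : ℝ≥0) * θ) := by
          refine add_le_add (mul_le_mul i1 i2 (norm_nonneg _) (by positivity)) i3
      _ ≤ ((2 : ℝ) ^ (-(k - 8)) * mk (chiS hχ) * (Λ γ * L : ℝ≥0)) * ((2 : ℝ) ^ (k - 8) * (Q * θ))
          + (P + nk (chiS hχ)) * ((Λ γ * L : ℝ≥0) * θ) := by gcongr
      _ = ((2 : ℝ) ^ (-(k - 8)) * (2 : ℝ) ^ (k - 8)) * (mk (chiS hχ) * (Λ γ * L : ℝ≥0) * (Q * θ))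
          + (P + nk (chiS hχ)) * ((Λ γ * L : ℝ≥0) * θ) := by ring
      _ = _ := by rw [e5]; simp only [D]; push_cast; ring
  have n2 : tsq σ (∑ γ, t2 γ) ≤ Fintype.card ι ^ 2 * ((∑ γ, D γ : ℝ≥0) ^ 2 * (L * θ) ^ 2 *
      ∑ γ, lps hχ σ (cx (U γ))) := by
    refine tsq_sum_le _ (fun γ _ => b2 γ) fun γ _ => (tsq_le fun k => eLpNorm_mul_le_sup (sup2 γ k)).trans ?_
    have : (D γ : ℝ≥0∞) ≤ ((∑ γ, D γ : ℝ≥0) : ℝ≥0∞) := by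
      exact_mod_cast Finset.single_le_sum (f := D) (fun _ _ => zero_le) (Finset.mem_univ γ)
    rw [ENNReal.coe_mul, mul_pow, ENNReal.coe_mul]
    gcongr
    exact Finset.single_le_sum (f := fun γ => lps hχ σ (cx (U γ))) (fun _ _ => zero_le)
      (Finset.mem_univ γ)
  rw [e]
  refine (tsq_add_le b1 fun k => by rw [Finset.sum_apply]; exact BM.sum _ fun γ _ => b2 γ k).trans ?_
  refine (mul_le_mul_right (add_le_add n1 n2) _).trans (le_of_eq ?_)
  push_cast
  ring

end Termwise

/-! ### The square function bound for differences of scalar remainders. -/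

section SobolevDifference
open SchwartzMap
variable {n m : ℕ} {χ : Eu n → ℝ} {σ : ℝ} {L M : ℝ≥0} {U V : Fin m → Eu n → ℝ}

/-- The terms of the scalar remainder for the coefficient `a` and the component `β` of `U`. -/
def rterm (hχ : IsLPCutoff χ) (j : Fin n) (β : Fin m) (a : (Fin m → ℝ) → ℝ) (U : Fin m → Eu n → ℝ) :
    ℤ → Eu n → ℂ :=
  gterm hχ j (cx fun x => a fun γ => U γ x) (cx (U β)) (fun γ => cx (dcoef a U γ)) fun γ => cx (U γ)

lemma exists_data {a : (Fin m → ℝ) → ℝ} (ha : ContDiff ℝ ∞ a) (M : ℝ≥0) : ∃ A : ℝ≥0,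
    ∀ (L : ℝ≥0) (U : Fin m → Eu n → ℝ) (β : Fin m), Fam L M U →
      Data A L M (cx fun x => a fun γ => U γ x) (cx (U β)) (fun γ => cx (dcoef a U γ)) fun γ => cx (U γ) := by
  obtain ⟨A1, h1⟩ := exists_lip_comp (n := n) ha M
  choose A2 h2 using fun γ => exists_lip_comp (n := n) (contDiff_partial ha γ) M
  choose A3 h3 using fun γ => exists_bound_of_contDiff (contDiff_partial ha γ) M
  have s2 (γ : Fin m) : A2 γ ≤ ∑ γ, A2 γ :=
    Finset.single_le_sum (f := A2) (fun _ _ => zero_le) (Finset.mem_univ γ)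
  have s3 (γ : Fin m) : A3 γ ≤ ∑ γ, A3 γ :=
    Finset.single_le_sum (f := A3) (fun _ _ => zero_le) (Finset.mem_univ γ)
  refine ⟨A1 + ∑ γ, A2 γ + ∑ γ, A3 γ, fun L U β h => ⟨h.bm_comp ha, (h1 L U h).weaken ?_, h.bm β, h.lip β,
    fun γ => h.bm_comp (contDiff_partial ha γ), fun γ => (h2 γ L U h).weaken ?_, fun γ x => ?_, h.bm,
    h.lip, h.bdc⟩⟩
  · gcongr
    exact le_add_right le_self_add
  · gcongr
    exact le_add_right (le_add_left (s2 γ))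
  · rw [norm_cx]
    refine (h3 γ _ fun γ => h.bd γ x).trans ?_
    exact_mod_cast le_add_left (s3 γ)

/-- The square function bound for differences of remainders. -/
theorem exists_tsq_rterm_sub (hχ : IsLPCutoff χ) (hn : 0 < n) (hσ : 0 < σ) {a : (Fin m → ℝ) → ℝ}
    (ha : ContDiff ℝ ∞ a) (M : ℝ≥0) : ∃ C : ℝ≥0, ∀ (L θ : ℝ≥0) (U V : Fin m → Eu n → ℝ) (j : Fin n)
    (β : Fin m), Fam L M U → Fam L M V → (∀ γ x, |U γ x - V γ x| ≤ θ) →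
    tsq σ (rterm hχ j β a U - rterm hχ j β a V)
      ≤ C * L ^ 2 * (∑ γ, lps hχ σ (cx (U γ) - cx (V γ))
        + θ ^ 2 * ∑ γ, (lps hχ σ (cx (U γ)) + lps hχ σ (cx (V γ)))) := by
  obtain ⟨A, hA⟩ := exists_data (n := n) ha M
  obtain ⟨Cm, hCm⟩ := moser_sub hχ hn hσ ha M
  obtain ⟨Cc, hCc⟩ := exists_tsq_tT_cancel hχ hn hσ ha M
  choose Λ hΛ using fun γ => exists_lip_of_contDiff (contDiff_partial ha γ) M
  obtain ⟨C1, h1⟩ := exists_uniform (Finset.Icc (-8 : ℤ) 8) (P := fun d C => ∀ (f w : Eu n → ℂ)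
    (K L : ℝ≥0) (j : Fin n), BM f → BM w → MemLp w 2 volume → LipschitzWith K f → LipschitzWith L w →
    tsq σ (tH d (phiS hχ) (phiS hχ) f (pdc j w)) ≤ C * K ^ 2 * lps hχ σ w)
    (fun d a b hab h f g K L j h1 h2 h3 h4 h5 => (h f g K L j h1 h2 h3 h4 h5).trans (by gcongr))
    fun d _ => exists_tsq_tH_pdc hχ hn hσ.le d
  obtain ⟨C2, h2⟩ := exists_uniform (Finset.Icc (-8 : ℤ) 8) (P := fun d C => ∀ (f g : Eu n → ℂ)
    (K : ℝ≥0), (∀ x, ‖g x‖ ≤ K) → tsq σ (tH d (phiS hχ) (phiS hχ) f g) ≤ C * K ^ 2 * lps hχ σ f)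
    (fun d a b hab h f g K h1 => (h f g K h1).trans (by gcongr))
    fun d _ => exists_tsq_tH hχ σ d
  set ν := nk (chiS hχ)
  set Λs := ∑ γ, Λ γ
  have hΛs (γ : Fin m) : Λ γ ≤ Λs :=
    Finset.single_le_sum (f := Λ) (fun _ _ => zero_le) (Finset.mem_univ γ)
  refine ⟨2 * (2 * (2 * (17 ^ 2 * (2 * (C1 * A ^ 2 + C2 * Cm)) + Cc) + ν ^ 2 * Cm)
    + m ^ 2 * (2 * (ν ^ 2 * (Λs * m) ^ 2 + ν ^ 2 * A ^ 2))), fun L θ U V j β hU hV hθ => ?_⟩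
  set E := ∑ γ, lps hχ σ (cx (U γ) - cx (V γ))
        + θ ^ 2 * ∑ γ, (lps hχ σ (cx (U γ)) + lps hχ σ (cx (V γ))) with hE
  have dU := hA L U β hU
  have dV := hA L V β hV
  have E1 (γ : Fin m) : lps hχ σ (cx (U γ) - cx (V γ)) ≤ E :=
    le_add_right (Finset.single_le_sum (f := fun γ => lps hχ σ (cx (U γ) - cx (V γ)))
      (fun _ _ => zero_le) (Finset.mem_univ γ))
  have E2 : (θ : ℝ≥0∞) ^ 2 * ∑ γ, lps hχ σ (cx (U γ)) ≤ E := by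
    refine le_add_left (mul_le_mul_right (Finset.sum_le_sum fun γ _ => le_self_add) _)
  have E3 (γ : Fin m) : (θ : ℝ≥0∞) ^ 2 * lps hχ σ (cx (U γ)) ≤ E :=
    le_trans (mul_le_mul_right (Finset.single_le_sum (f := fun γ => lps hχ σ (cx (U γ)))
      (fun _ _ => zero_le) (Finset.mem_univ γ)) _) E2
  have E4 := hCm L θ U V hU hV hθ
  rw [← hE] at E4
  have lw := (hU.lip β).sub (hV.lip β)
  have bw := (hU.bm β).sub (hV.bm β)
  have mw := (hU.mem β).sub (hV.mem β)
  have sw (γ : Fin m) (x : Eu n) : ‖(cx (U γ) - cx (V γ)) x‖ ≤ θ := by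
    have := hθ γ x
    rwa [Pi.sub_apply, cx, cx, ← Complex.ofReal_sub, Complex.norm_real]
  have bdV := bm_pdc (hV.lip β) j
  have bdw : BM (pdc j (cx (U β) - cx (V β))) := bm_pdc lw j
  have bf := dU.bf.sub dV.bf
  have bp (γ : Fin m) := (dU.bfp γ).sub (dV.bfp γ)
  have bγ (γ : Fin m) := (hU.bm γ).sub (hV.bm γ)
  unfold rterm
  rw [gterm_sub hχ j dU dV]
  set f := cx fun x => a fun γ => U γ x
  set f' := cx fun x => a fun γ => V γ x
  set fp := fun γ => cx (dcoef a U γ)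
  set fp' := fun γ => cx (dcoef a V γ)
  set w := cx (U β) - cx (V β)
  set T1 := ∑ d ∈ Finset.Icc (-8 : ℤ) 8, (tH d (phiS hχ) (phiS hχ) f (pdc j w)
          + tH d (phiS hχ) (phiS hχ) (f - f') (pdc j (cx (V β))))
  -- The grouping isolates the only cancellation: the derivative of the difference on the low
  -- frequencies, against the high frequencies of `U`. All other pieces are estimated one by one.
  set T2 := tT (chiS hχ) (phiS hχ) (pdc j w) f - ∑ γ, tT (chiS hχ) (phiS hχ) (fp γ * pdc j w) (cx (U γ))
  set T3 := tT (chiS hχ) (phiS hχ) (pdc j (cx (V β))) (f - f')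
  set T4 := ∑ γ, (tT (chiS hχ) (phiS hχ) ((fp γ - fp' γ) * pdc j (cx (V β))) (cx (U γ))
        + tT (chiS hχ) (phiS hχ) (fp' γ * pdc j (cx (V β))) (cx (U γ) - cx (V γ)))
  have e : T1 + (tT (chiS hχ) (phiS hχ) (pdc j w) f + T3)
        - ∑ γ, ((tT (chiS hχ) (phiS hχ) (fp γ * pdc j w) (cx (U γ))
        + tT (chiS hχ) (phiS hχ) ((fp γ - fp' γ) * pdc j (cx (V β))) (cx (U γ)))
        + tT (chiS hχ) (phiS hχ) (fp' γ * pdc j (cx (V β))) (cx (U γ) - cx (V γ)))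
      = ((T1 + T2) + T3) - T4 := by
    simp only [T2, T4, Finset.sum_add_distrib]
    abel
  rw [e]
  have n1 : tsq σ T1 ≤ 17 ^ 2 * (2 * (C1 * (A * L) ^ 2 * E + C2 * L ^ 2 * (Cm * E))) := by
    refine (tsq_sum_le _ (fun d _ k => (bm_tH dU.bf bdw _ _ _ k).add (bm_tH bf bdV _ _ _ k))
      (D := 2 * (C1 * (A * L) ^ 2 * E + C2 * L ^ 2 * (Cm * E))) fun d hd => ?_).trans (le_of_eq (by simp))
    refine (tsq_add_le (bm_tH dU.bf bdw _ _ _) (bm_tH bf bdV _ _ _)).trans ?_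
    refine mul_le_mul_right (add_le_add ((h1 d hd _ _ _ _ j dU.bf bw mw dU.lf lw).trans ?_)
      ((h2 d hd _ _ _ (norm_pdc_le (hV.lip β) j)).trans (by gcongr))) _
    push_cast
    exact mul_le_mul_right (E1 β) _
  have n2 : tsq σ T2 ≤ Cc * L ^ 2 * E := by
    refine (hCc L _ θ U w j hU bw lw (sw β)).trans ?_
    calc _ = Cc * L ^ 2 * (θ ^ 2 * ∑ γ, lps hχ σ (cx (U γ))) := by ring
      _ ≤ _ := by gcongr
  have n3 : tsq σ T3 ≤ ν ^ 2 * L ^ 2 * (Cm * E) :=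
    (tsq_tT_le hχ σ _ _ (norm_pdc_le (hV.lip β) j)).trans (by gcongr)
  have n4 : tsq σ T4 ≤ m ^ 2 * (2 * (ν ^ 2 * (Λs * m * L) ^ 2 * E + ν ^ 2 * (A * L) ^ 2 * E)) := by
    have b1 (γ : Fin m) := bm_tT ((bp γ).mul bdV) (hU.bm γ) (chiS hχ) (phiS hχ)
    have b2 (γ : Fin m) := bm_tT ((dV.bfp γ).mul bdV) (bγ γ) (chiS hχ) (phiS hχ)
    refine (tsq_sum_le _ (fun γ _ k => (b1 γ k).add (b2 γ k))
      (D := 2 * (ν ^ 2 * (Λs * m * L) ^ 2 * E + ν ^ 2 * (A * L) ^ 2 * E)) fun γ _ => ?_).trans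
      (le_of_eq (by simp))
    refine (tsq_add_le (b1 γ) (b2 γ)).trans (mul_le_mul_right (add_le_add ?_ ?_) _)
    -- The coefficients of the two functions differ by at most `Λs * (m * θ)` in supremum, so here
    -- the smallness comes from `θ` and the Sobolev norm falls on `U`.
    · refine (tsq_tT_le hχ σ _ _ (K := Λs * (m * θ) * L) fun x => ?_).trans ?_
      · rw [Pi.mul_apply, norm_mul]
        push_cast
        refine mul_le_mul ?_ (norm_pdc_le (hV.lip β) j x) (norm_nonneg _) (by positivity)
        have := hΛ γ _ _ (fun γ => hU.bd γ x) fun γ => hV.bd γ x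
        simp only [Pi.sub_apply, cx, dcoef]
        rw [← Complex.ofReal_sub, Complex.norm_real]
        refine this.trans ?_
        have hs : ∑ γ, |U γ x - V γ x| ≤ m * θ := by
          refine (Finset.sum_le_sum fun γ _ => hθ γ x).trans (le_of_eq (by simp))
        have := hΛs γ
        gcongr
      · calc _ = ν ^ 2 * (Λs * m * L) ^ 2 * (θ ^ 2 * lps hχ σ (cx (U γ))) := by push_cast; ring
          _ ≤ _ := by gcongr; exact E3 γ
    · refine (tsq_tT_le hχ σ _ _ (K := A * L) fun x => ?_).trans ?_
      · rw [Pi.mul_apply, norm_mul]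
        push_cast
        exact mul_le_mul (dV.afp γ x) (norm_pdc_le (hV.lip β) j x) (norm_nonneg _) A.2
      · push_cast
        gcongr
        exact E1 γ
  have m1 (k : ℤ) : BM (T1 k) := by
    simp only [T1, Finset.sum_apply]
    exact BM.sum _ fun d _ => (bm_tH dU.bf bdw _ _ _ k).add (bm_tH bf bdV _ _ _ k)
  have m2 (k : ℤ) : BM (T2 k) := (bm_tT bdw dU.bf _ _ k).sub (by
    rw [Finset.sum_apply]
    exact BM.sum _ fun γ _ => bm_tT ((dU.bfp γ).mul bdw) (hU.bm γ) _ _ k)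
  have m3 (k : ℤ) : BM (T3 k) := bm_tT bdV bf _ _ k
  have m4 (k : ℤ) : BM (T4 k) := by
    simp only [T4, Finset.sum_apply]
    exact BM.sum _ fun γ _ => (bm_tT ((bp γ).mul bdV) (hU.bm γ) _ _ k).add
      (bm_tT ((dV.bfp γ).mul bdV) (bγ γ) _ _ k)
  calc _ ≤ 2 * (tsq σ (T1 + T2 + T3) + tsq σ T4) :=
        tsq_sub_le (fun k => ((m1 k).add (m2 k)).add (m3 k)) m4
    _ ≤ 2 * (2 * (2 * (tsq σ T1 + tsq σ T2) + tsq σ T3) + tsq σ T4) := by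
        gcongr
        refine (tsq_add_le (fun k => (m1 k).add (m2 k)) m3).trans ?_
        gcongr
        exact tsq_add_le m1 m2
    _ ≤ 2 * (2 * (2 * (17 ^ 2 * (2 * (C1 * (A * L) ^ 2 * E + C2 * L ^ 2 * (Cm * E))) + Cc * L ^ 2 * E)
        + ν ^ 2 * L ^ 2 * (Cm * E))
        + m ^ 2 * (2 * (ν ^ 2 * (Λs * m * L) ^ 2 * E + ν ^ 2 * (A * L) ^ 2 * E))) := by gcongr
    _ = _ := by push_cast; ring

end SobolevDifference

/-! ### Convergence and synthesis of the series in the remainder. -/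

section RemainderSeries
open SchwartzMap
variable {n m : ℕ} {χ : Eu n → ℝ}

lemma two_zpow_le_sqrt_zpow {k : ℤ} (hk : k ≤ 0) : (2 : ℝ) ^ k ≤ (√2) ^ k := by
  rw [← neg_neg k, zpow_neg, zpow_neg (√2)]
  have h1 : √2 ≤ 2 := by rw [Real.sqrt_le_left] <;> norm_num
  gcongr
  lift -k to ℕ using by omega with N
  rw [zpow_natCast, zpow_natCast]
  gcongr

/-- For `k → ∞` the Lipschitz factor decays, and for `k → -∞` the derivative does, as `w` is
bounded; square integrability plays no role. -/
lemma uConv_tH_pdc (hχ : IsLPCutoff χ) {f w : Eu n → ℂ} {K L : ℝ≥0} (hf : BM f) (hw : BM w)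
    (hK : LipschitzWith K f) (hL : LipschitzWith L w) (d : ℤ) (j : Fin n) :
    UConv (tH d (phiS hχ) (phiS hχ) f (pdc j w)) := by
  obtain ⟨C, hC⟩ := (ringS_phiS hχ).annular.norm_fm_le
  obtain ⟨Θ, hΘ⟩ := hf.exists_nnreal
  obtain ⟨θ, hθ⟩ := hw.exists_nnreal
  refine .of_bounds (C := C * 2 ^ (-d) * K * (nk (phiS hχ) * L))
    (D := nk (phiS hχ) * Θ * (nk (sd j (phiS hχ)) * θ)) (fun k x => ?_) fun k hk x => ?_
  · rw [tH, Pi.mul_apply, norm_mul]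
    refine (mul_le_mul (hC (k + d) K f hf hK x) (norm_fm_dil_le (norm_pdc_le hL j) k _ x)
      (norm_nonneg _) (by positivity)).trans (le_of_eq ?_)
    rw [neg_add, zpow_add₀ two_ne_zero]
    ring
  · rw [tH, Pi.mul_apply, norm_mul]
    refine (mul_le_mul (norm_fm_dil_le hΘ _ _ x) (norm_fm_low_pdc_le (phiS hχ) hw hL hθ k j x)
      (norm_nonneg _) (by positivity)).trans ?_
    have := two_zpow_le_sqrt_zpow hk
    calc _ ≤ nk (phiS hχ) * Θ * ((√2) ^ k * (nk (sd j (phiS hχ)) * θ)) := by gcongr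
      _ = _ := by ring

lemma uConv_tT_pdc (hχ : IsLPCutoff χ) {f w : Eu n → ℂ} {K L : ℝ≥0} (hf : BM f) (hw : BM w)
    (hK : LipschitzWith K f) (hL : LipschitzWith L w) (j : Fin n) :
    UConv (tT (chiS hχ) (phiS hχ) (pdc j w) f) := by
  obtain ⟨C, hC⟩ := (ringS_phiS hχ).annular.norm_fm_le
  obtain ⟨Θ, hΘ⟩ := hf.exists_nnreal
  obtain ⟨θ, hθ⟩ := hw.exists_nnreal
  refine .of_bounds (C := nk (chiS hχ) * L * (C * K))
    (D := nk (sd j (chiS hχ)) * θ * (nk (phiS hχ) * Θ)) (fun k x => ?_) fun k hk x => ?_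
  · rw [tT, Pi.mul_apply, norm_mul]
    refine (mul_le_mul (norm_fm_dil_le (norm_pdc_le hL j) _ _ x) (hC k K f hf hK x)
      (norm_nonneg _) (by positivity)).trans (le_of_eq ?_)
    ring
  · rw [tT, Pi.mul_apply, norm_mul]
    refine (mul_le_mul (norm_fm_low_pdc_le (chiS hχ) hw hL hθ (k - 8) j x) (norm_fm_dil_le hΘ _ _ x)
      (norm_nonneg _) (by positivity)).trans ?_
    have := (zpow_two_le (show k - 8 ≤ k by linarith)).trans (two_zpow_le_sqrt_zpow hk)
    calc _ ≤ (√2) ^ k * (nk (sd j (chiS hχ)) * θ) * (nk (phiS hχ) * Θ) := by gcongr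
      _ = _ := by ring

/-- Here the low frequency factor is no derivative, so convergence as `k → -∞` has to come from the
square integrability of `g`. -/
lemma uConv_tT (hχ : IsLPCutoff χ) (hn : 0 < n) {f g : Eu n → ℂ} {L : ℝ≥0} (hf : BM f) (hg : BM g)
    (hg2 : MemLp g 2 volume) (hL : LipschitzWith L g) : UConv (tT (chiS hχ) (phiS hχ) f g) := by
  obtain ⟨Θ, hΘ⟩ := hf.exists_nnreal
  refine (uConv_fm_phiS hχ hn hg hg2 hL).mono (C := nk (chiS hχ) * Θ) (fun k x => ?_) (by positivity)
  rw [tT, Pi.mul_apply, norm_mul]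
  gcongr
  exact norm_fm_dil_le hΘ _ _ x

variable {L M A : ℝ≥0} {f y : Eu n → ℂ} {fp V : Fin m → Eu n → ℂ}

lemma Data.uConv (hχ : IsLPCutoff χ) (hn : 0 < n) (h : Data A L M f y fp V)
    (hV : ∀ γ, MemLp (V γ) 2 volume) (j : Fin n) : UConv (gterm hχ j f y fp V) :=
  ((UConv.sum _ fun d _ => uConv_tH_pdc hχ h.bf h.by' h.lf h.ly d j).add
    (uConv_tT_pdc hχ h.bf h.by' h.lf h.ly j)).sub
      (UConv.sum _ fun γ _ => uConv_tT hχ hn ((h.bfp γ).mul (bm_pdc h.ly j)) (h.bU γ) (hV γ) (h.lU γ))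

lemma Data.bm (hχ : IsLPCutoff χ) (h : Data A L M f y fp V) (j : Fin n) (k : ℤ) :
    BM (gterm hχ j f y fp V k) := by
  have b := bm_pdc h.ly j
  simp only [gterm, Pi.sub_apply, Pi.add_apply, Finset.sum_apply]
  exact ((BM.sum _ fun d _ => bm_tH h.bf b _ _ _ k).add (bm_tT b h.bf _ _ k)).sub
    (BM.sum _ fun γ _ => bm_tT ((h.bfp γ).mul b) (h.bU γ) _ _ k)

lemma Data.fm_eq_zero (hχ : IsLPCutoff χ) (h : Data A L M f y fp V) (j : Fin n) {k l : ℤ}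
    (hkl : k + 12 ≤ l) : fm (dil l (phiS hχ)) (gterm hχ j f y fp V k) = 0 := by
  have b := bm_pdc h.ly j
  have hl : 3 ≤ |l - k| := by rw [abs_of_nonneg (by linarith)]; linarith
  simp only [gterm, Pi.sub_apply, Pi.add_apply, Finset.sum_apply]
  rw [fm_sub _ ((BM.sum _ fun d _ => bm_tH h.bf b _ _ _ k).add (bm_tT b h.bf _ _ k))
    (BM.sum _ fun γ _ => bm_tT ((h.bfp γ).mul b) (h.bU γ) _ _ k),
    fm_add _ (BM.sum _ fun d _ => bm_tH h.bf b _ _ _ k) (bm_tT b h.bf _ _ k),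
    fm_sum _ fun d _ => bm_tH h.bf b _ _ _ k,
    fm_sum _ fun γ _ => bm_tT ((h.bfp γ).mul b) (h.bU γ) _ _ k,
    tT_band hχ (lowS_chiS hχ) (ringS_phiS hχ) b h.bf l k hl, Finset.sum_eq_zero fun d hd =>
      tH_high hχ (ringS_phiS hχ) (ringS_phiS hχ) h.bf b (Finset.mem_Icc.1 hd).2 l k hkl,
    Finset.sum_eq_zero fun γ _ => tT_band hχ (lowS_chiS hχ) (ringS_phiS hχ) ((h.bfp γ).mul b)
      (h.bU γ) l k hl]
  simp

/-- High-high terms contribute to all frequencies below their own, that is to all `j < 12`. The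
weights are summable there only because `σ` is positive. -/
lemma tsum_wt_lt_ne_top {σ : ℝ} (hσ : 0 < σ) (c : ℝ≥0) :
    ∑' j : ℤ, wt σ j * (if j < 12 then (c : ℝ≥0∞) else 0) ≠ ⊤ := by
  refine ne_top_of_le_ne_top (b := c * wt σ 24 * ∑' k : ℤ, wt (-σ) |k|)
    (ENNReal.mul_ne_top (ENNReal.mul_ne_top (by simp) (wt_ne_top _ _)) (tsum_wt_natAbs_ne_top hσ)) ?_
  rw [← ENNReal.tsum_mul_left]
  refine ENNReal.tsum_le_tsum fun j => ?_
  split_ifs with h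
  · rw [mul_comm, mul_assoc]
    gcongr
    have e : wt (-σ) |j| = wt σ (-|j|) := by rw [wt_neg_neg]
    rw [e, ← wt_add]
    apply wt_le_wt
    gcongr
    -- For `j < 12` one has `j ≤ 24 - |j|`, which is the reason for the weight `wt σ 24`.
    exact_mod_cast (by cases abs_cases j <;> omega : j ≤ 24 + -|j|)
  · simp

/-- Square function bound for a series whose terms have bounded frequency relative to their index. -/
lemma exists_lps_su_le (hχ : IsLPCutoff χ) {σ : ℝ} (hσ : 0 < σ) : ∃ C : ℝ≥0, ∀ t : ℤ → Eu n → ℂ,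
    UConv t → (∀ k, Measurable (t k)) →
    (∀ l k, k + 12 ≤ l → fm (dil l (phiS hχ)) (t k) = 0) → lps hχ σ (su t) ≤ C * tsq σ t := by
  lift ∑' j : ℤ, wt σ j * (if j < 12 then (nk (phiS hχ) : ℝ≥0∞) else 0) to ℝ≥0 using
    tsum_wt_lt_ne_top hσ (nk (phiS hχ)) with C hC
  refine ⟨C ^ 2, fun t ht hm h0 => ?_⟩
  refine (tsum_wt_fm_su_le ht hm (phiS hχ) σ (c := fun j => if j < 12 then nk (phiS hχ) else 0)
    (x := fun k => eLpNorm (t k) 2 volume) fun l k => ?_).trans (le_of_eq ?_)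
  · split_ifs with h
    · exact eLpNorm_fm_dil_le (hm k) _ _
    · rw [h0 l k (by omega)]; simp
  · rw [← hC, tsq]; push_cast; rfl

end RemainderSeries

/-! ### Bounds for the summed scalar remainders. -/

section RemainderBounds
open SchwartzMap
variable {n m : ℕ} {χ : Eu n → ℝ} {σ : ℝ} {L M : ℝ≥0} {U V : Fin m → Eu n → ℝ}

lemma Fam.uConv_rterm (hχ : IsLPCutoff χ) (hn : 0 < n) {a : (Fin m → ℝ) → ℝ} (ha : ContDiff ℝ ∞ a)
    (h : Fam L M U) (j : Fin n) (β : Fin m) : UConv (rterm hχ j β a U) :=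
  ((exists_data ha M).choose_spec L U β h).uConv hχ hn h.mem j

lemma Fam.bm_rterm (hχ : IsLPCutoff χ) {a : (Fin m → ℝ) → ℝ} (ha : ContDiff ℝ ∞ a)
    (h : Fam L M U) (j : Fin n) (β : Fin m) (k : ℤ) : BM (rterm hχ j β a U k) :=
  ((exists_data ha M).choose_spec L U β h).bm hχ j k

lemma Fam.mem_sub (hU : Fam L M U) (hV : Fam L M V) (γ : Fin m) : MemLp (cx (U γ) - cx (V γ)) 2 volume :=
  (hU.mem γ).sub (hV.mem γ)

lemma Fam.eLpNorm_comp_sub_le (hU : Fam L M U) (hV : Fam L M V) {b : (Fin m → ℝ) → ℝ} {D R : ℝ≥0}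
    (hD : D ≤ R) (hb : ∀ x y : Fin m → ℝ, (∀ γ, |x γ| ≤ M) → (∀ γ, |y γ| ≤ M) →
      |b x - b y| ≤ D * ∑ γ, |x γ - y γ|) :
    eLpNorm ((cx fun x => b fun γ => U γ x) - cx fun x => b fun γ => V γ x) 2 volume
      ≤ R * ∑ γ, eLpNorm (cx (U γ) - cx (V γ)) 2 volume := by
  have h1 : eLpNorm ((cx fun x => b fun γ => U γ x) - cx fun x => b fun γ => V γ x) 2 volume
      ≤ D * eLpNorm (∑ γ, fun x => ‖(cx (U γ) - cx (V γ)) x‖) 2 volume := by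
    refine eLpNorm_le_nnreal_smul_eLpNorm_of_ae_le_mul (c := D) (.of_forall fun x => ?_) 2
    rw [← NNReal.coe_le_coe]
    simp only [Pi.sub_apply, cx, ← Complex.ofReal_sub, coe_nnnorm, Complex.norm_real, NNReal.coe_mul,
      Finset.sum_apply, Real.norm_eq_abs]
    refine (hb _ _ (fun γ => hU.bd γ x) fun γ => hV.bd γ x).trans ?_
    gcongr
    exact le_abs_self _
  refine h1.trans (mul_le_mul' (by exact_mod_cast hD) ?_)
  refine (eLpNorm_sum_le (fun γ _ => (hU.mem_sub hV γ).1.norm) one_le_two).trans ?_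
  simp only [eLpNorm_norm, le_refl]

/-- Square integrable bounds for differences of the scalar remainders. -/
theorem exists_eLpNorm_rterm_sub (hχ : IsLPCutoff χ) (hn : 0 < n) {a : (Fin m → ℝ) → ℝ}
    (ha : ContDiff ℝ ∞ a) (M : ℝ≥0) : ∃ C : ℝ≥0, ∀ (L : ℝ≥0) (U V : Fin m → Eu n → ℝ) (j : Fin n)
    (β : Fin m), Fam L M U → Fam L M V →
    eLpNorm (su (rterm hχ j β a U) - su (rterm hχ j β a V)) 2 volume
      ≤ C * L * ∑ γ, eLpNorm (cx (U γ) - cx (V γ)) 2 volume := by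
  obtain ⟨A, hA⟩ := exists_data (n := n) ha M
  obtain ⟨Λ, hΛ⟩ := exists_lip_of_contDiff ha M
  choose Λ' hΛ' using fun γ => exists_lip_of_contDiff (contDiff_partial ha γ) M
  -- A single constant has to serve as the parameter of `Data` and as the Lipschitz constant of `a`
  -- and of its partial derivatives.
  obtain ⟨R, hAR, hΛR, hΛR'⟩ : ∃ R : ℝ≥0, A ≤ R ∧ Λ ≤ R ∧ ∀ γ, Λ' γ ≤ R :=
    ⟨A + Λ + ∑ γ, Λ' γ, le_add_right le_self_add, le_add_right le_add_self, fun γ => le_add_left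
      (Finset.single_le_sum (f := Λ') (fun _ _ => zero_le) (Finset.mem_univ γ))⟩
  obtain ⟨C, hC⟩ := SB_gterm_sub hχ hn m R M
  refine ⟨C, fun L U V j β hU hV => ?_⟩
  have up {f y fp W} (h : Data (n := n) (m := m) A L M f y fp W) : Data R L M f y fp W :=
    ⟨h.bf, h.lf.weaken (by gcongr), h.by', h.ly, h.bfp, fun γ => (h.lfp γ).weaken (by gcongr),
      fun γ x => (h.afp γ x).trans (by exact_mod_cast hAR), h.bU, h.lU, h.aU⟩
  have hN (γ : Fin m) : eLpNorm (cx (U γ) - cx (V γ)) 2 volume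
      ≤ ∑ γ, eLpNorm (cx (U γ) - cx (V γ)) 2 volume :=
    Finset.single_le_sum (f := fun γ => eLpNorm (cx (U γ) - cx (V γ)) 2 volume)
      (fun _ _ => zero_le) (Finset.mem_univ γ)
  rw [← su_sub (hU.uConv_rterm hχ hn ha j β) (hV.uConv_rterm hχ hn ha j β)]
  have e (γ : Fin m) : eLpNorm (cx (dcoef a U γ) - cx (dcoef a V γ)) 2 volume
      ≤ R * ∑ γ, eLpNorm (cx (U γ) - cx (V γ)) 2 volume :=
    hU.eLpNorm_comp_sub_le (b := fun z => fderiv ℝ a z (Pi.single γ 1)) hV (hΛR' γ) (hΛ' γ)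
  have h : SB (rterm hχ j β a U - rterm hχ j β a V)
      (C * L * ∑ γ, eLpNorm (cx (U γ) - cx (V γ)) 2 volume) :=
    hC j L _ _ _ _ _ _ _ _ (up (hA L U β hU)) (up (hA L V β hV)) _
      (ENNReal.sum_ne_top.2 fun γ _ => (hU.mem_sub hV γ).eLpNorm_ne_top)
      (hU.eLpNorm_comp_sub_le hV hΛR hΛ) (hN β) e hN
  exact eLpNorm_le_of_hasSum (((hU.uConv_rterm hχ hn ha j β).sub (hV.uConv_rterm hχ hn ha j β)).hasSum)
    (fun k => ((hU.bm_rterm hχ ha j β k).sub (hV.bm_rterm hχ ha j β k)).meas) h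

lemma exists_lps_le_hsq (hχ : IsLPCutoff χ) (hn : 0 < n) (σ : ℝ) : ∃ C : ℝ≥0, ∀ f : Eu n → ℂ, BM f →
    MemLp f 2 volume → lps hχ σ f ≤ C * hsq σ f :=
  (ringS_phiS hχ).annular.square_function hn σ

/-- Homogeneous Sobolev bounds for differences of the scalar remainders. -/
theorem exists_hsq_rterm_sub (hχ : IsLPCutoff χ) (hn : 0 < n) (hσ : 0 < σ) {a : (Fin m → ℝ) → ℝ}
    (ha : ContDiff ℝ ∞ a) (M : ℝ≥0) : ∃ C : ℝ≥0, ∀ (L θ : ℝ≥0) (U V : Fin m → Eu n → ℝ) (j : Fin n)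
    (β : Fin m), Fam L M U → Fam L M V → (∀ γ x, |U γ x - V γ x| ≤ θ) →
    hsq σ (su (rterm hχ j β a U) - su (rterm hχ j β a V))
      ≤ C * L ^ 2 * (∑ γ, hsq σ (cx (U γ) - cx (V γ))
        + θ ^ 2 * ∑ γ, (hsq σ (cx (U γ)) + hsq σ (cx (V γ)))) := by
  obtain ⟨C0, h0⟩ := exists_eLpNorm_rterm_sub hχ hn ha M
  obtain ⟨C1, h1⟩ := exists_tsq_rterm_sub hχ hn hσ ha M
  obtain ⟨C2, h2⟩ := exists_lps_su_le (n := n) hχ hσ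
  obtain ⟨C3, h3⟩ := exists_lps_le_hsq (n := n) hχ hn σ
  obtain ⟨D, hD⟩ : ∃ D : ℝ≥0, (D : ℝ≥0∞) = (2 * wt σ 1) ^ 2 :=
    ⟨_, ENNReal.coe_toNNReal (ENNReal.pow_ne_top (ENNReal.mul_ne_top (by simp) (wt_ne_top _ _)))⟩
  refine ⟨D * (C2 * (C1 * C3)), fun L θ U V j β hU hV hθ => ?_⟩
  obtain ⟨A, hA⟩ := exists_data (n := n) ha M
  have uU := hU.uConv_rterm hχ hn ha j β
  have uV := hV.uConv_rterm hχ hn ha j β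
  have u := uU.sub uV
  have bU := hU.bm_rterm hχ ha j β
  have bV := hV.bm_rterm hχ ha j β
  have b (k : ℤ) := (bU k).sub (bV k)
  have mem : MemLp (su (rterm hχ j β a U - rterm hχ j β a V)) 2 volume := by
    refine ⟨(u.bm_su fun k => (b k).meas).meas.aestronglyMeasurable, ?_⟩
    rw [su_sub uU uV]
    exact (h0 L U V j β hU hV).trans_lt (ENNReal.mul_lt_top (by finiteness)
      (ENNReal.sum_lt_top.2 fun γ _ => (hU.mem_sub hV γ).2))
  have hz (l k : ℤ) (h : k + 12 ≤ l) :
      fm (dil l (phiS hχ)) ((rterm hχ j β a U - rterm hχ j β a V) k) = 0 := by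
    rw [Pi.sub_apply, fm_sub _ (bU k) (bV k), rterm, rterm, (hA L U β hU).fm_eq_zero hχ j h,
      (hA L V β hV).fm_eq_zero hχ j h, sub_zero]
  have e1 (γ : Fin m) : lps hχ σ (cx (U γ) - cx (V γ)) ≤ C3 * hsq σ (cx (U γ) - cx (V γ)) :=
    h3 _ ((hU.bm γ).sub (hV.bm γ)) (hU.mem_sub hV γ)
  rw [← su_sub uU uV]
  calc _ ≤ D * lps hχ σ (su (rterm hχ j β a U - rterm hχ j β a V)) := by
        rw [hD]; exact hsq_le hχ hn hσ.le (u.bm_su fun k => (b k).meas) mem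
    _ ≤ D * (C2 * (C1 * L ^ 2 * (∑ γ, C3 * hsq σ (cx (U γ) - cx (V γ))
        + θ ^ 2 * ∑ γ, (C3 * hsq σ (cx (U γ)) + C3 * hsq σ (cx (V γ)))))) := by
        gcongr
        refine (h2 _ u (fun k => (b k).meas) hz).trans (mul_le_mul_right ((h1 L θ U V j β hU hV hθ).trans ?_) _)
        gcongr with γ _ γ _
        · exact e1 γ
        · exact h3 _ (hU.bm γ) (hU.mem γ)
        · exact h3 _ (hV.bm γ) (hV.mem γ)
    _ = _ := by
        simp only [← mul_add, ← Finset.mul_sum]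
        push_cast
        ring

end RemainderBounds

/-! ### From the real, vector valued definitions to complex scalar pieces. -/

section RealRemainder
open SchwartzMap
variable {n m : ℕ} {χ : Eu n → ℝ} {u v : Eu n → EuclideanSpace ℝ (Fin m)}

lemma cx_paraTerm (hχ : IsLPCutoff χ) (f : Eu n → ℝ) {g : Eu n → ℝ} (hg : BM (cx g)) (k : ℤ) :
    cx (paraTerm χ f g k) = tT (chiS hχ) (phiS hχ) (cx f) (cx g) k := by
  rw [tT, ← lowFreq_eq hχ, ← dyadic_eq hχ k hg]
  ext x
  simp [cx, paraTerm]

lemma cx_highTerm (hχ : IsLPCutoff χ) {f g : Eu n → ℝ} (hf : BM (cx f)) (hg : BM (cx g)) (k : ℤ) :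
    cx (highTerm χ f g k)
      = (∑ d ∈ Finset.Icc (-8 : ℤ) 8, tH d (phiS hχ) (phiS hχ) (cx f) (cx g)) k := by
  ext x
  rw [Finset.sum_apply, Finset.sum_apply]
  simp only [tH, ← dyadic_eq hχ _ hf, ← dyadic_eq hχ _ hg]
  simp only [cx, highTerm, Complex.ofReal_sum, Pi.mul_apply, Complex.ofReal_mul]
  rw [show Finset.Icc (k - 8) (k + 8) = (Finset.Icc (-8 : ℤ) 8).image (k + ·) by
    rw [Finset.image_add_left_Icc]; rfl, Finset.sum_image fun a _ b _ h => by simpa using h]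

lemma ConvergesUniformly.of_uConv {t : ℤ → Eu n → ℝ} (h : UConv fun k => cx (t k)) :
    ConvergesUniformly t := by
  obtain ⟨b, hb, h⟩ := h
  exact ⟨b, hb, fun k x => by rw [← norm_cx]; exact h k x⟩

lemma cx_tsum (t : ℤ → Eu n → ℝ) : (cx fun x => ∑' k, t k x) = su fun k => cx (t k) := by
  ext x
  simp only [cx, su, Complex.ofReal_tsum]

lemma norm_sub_apply_le (u : Eu n → EuclideanSpace ℝ (Fin m)) (γ : Fin m) (x y : Eu n) :
    |u x γ - u y γ| ≤ ‖u x - u y‖ := PiLp.norm_apply_le (u x - u y) γ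

lemma lipschitzWith_cx_apply {K : ℝ≥0} (h : LipschitzWith K u) (γ : Fin m) :
    LipschitzWith K (cx fun x => u x γ) :=
  .of_dist_le_mul fun x y => by
    rw [dist_eq_norm, cx, cx, ← Complex.ofReal_sub, Complex.norm_real]
    exact (norm_sub_apply_le u γ x y).trans (by rw [← dist_eq_norm]; exact h.dist_le_mul x y)

lemma memLp_cx_apply (h : MemLp u 2 volume) (hc : Continuous u) (γ : Fin m) :
    MemLp (cx fun x => u x γ) 2 volume :=
  h.mono (Complex.continuous_ofReal.comp ((EuclideanSpace.proj γ).continuous.comp hc)).aestronglyMeasurable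
    (.of_forall fun x => by rw [norm_cx]; exact PiLp.norm_apply_le (u x) γ)

lemma IsLipschitzL2.exists_fam (h : IsLipschitzL2 u) : ∃ L M : ℝ≥0, Fam L M fun γ x => u x γ := by
  obtain ⟨⟨K, hK⟩, ⟨R, hR⟩, h2⟩ := h
  exact ⟨K, R.toNNReal, lipschitzWith_cx_apply hK,
    fun γ x => ((PiLp.norm_apply_le (u x) γ).trans (hR x)).trans (Real.le_coe_toNNReal R),
    memLp_cx_apply h2 hK.continuous⟩

lemma pdc_cx_apply {x : Eu n} (h : DifferentiableAt ℝ u x) (j : Fin n) (β : Fin m) :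
    pdc j (cx fun x => u x β) x = cx (pd u j β) x := by
  have := (Complex.ofRealCLM.hasFDerivAt.comp x
    ((EuclideanSpace.proj (𝕜 := ℝ) β).hasFDerivAt.comp x h.hasFDerivAt)).fderiv
  exact congrArg (fun L => L (ej j)) this

/-- Where `u` is not differentiable a single component still may be, so the two derivatives agree
only almost everywhere; multipliers do not see the difference. -/
lemma IsLipschitzL2.ae_pd (h : IsLipschitzL2 u) (j : Fin n) (β : Fin m) :
    cx (pd u j β) =ᵐ[volume] pdc j (cx fun x => u x β) := by
  obtain ⟨K, hK⟩ := h.1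
  filter_upwards [hK.ae_differentiableAt] with x hx
  exact (pdc_cx_apply hx j β).symm

lemma abs_pd_le (u : Eu n → EuclideanSpace ℝ (Fin m)) (j : Fin n) (β : Fin m) (x : Eu n) :
    |pd u j β x| ≤ ‖fderiv ℝ u x‖ := by
  refine (PiLp.norm_apply_le (fderiv ℝ u x (ej j)) β).trans ?_
  simpa [ej] using (fderiv ℝ u x).le_opNorm (ej j)

lemma IsLipschitzL2.bm_pd (h : IsLipschitzL2 u) (j : Fin n) (β : Fin m) : BM (cx (pd u j β)) := by
  obtain ⟨K, hK⟩ := h.1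
  refine ⟨Complex.measurable_ofReal.comp ((EuclideanSpace.proj (𝕜 := ℝ) β).continuous.measurable.comp
    (measurable_fderiv_apply_const ℝ u (ej j))), K, fun x => ?_⟩
  rw [norm_cx]
  exact (abs_pd_le u j β x).trans (norm_fderiv_le_of_lipschitz ℝ hK)

variable {A : Fin n → EuclideanSpace ℝ (Fin m) → Matrix (Fin m) (Fin m) ℝ}

/-- The entries of the coefficient matrices in coordinates. -/
def entry (A : Fin n → EuclideanSpace ℝ (Fin m) → Matrix (Fin m) (Fin m) ℝ) (j : Fin n) (α β : Fin m)
    (z : Fin m → ℝ) : ℝ := A j (WithLp.toLp 2 z) α β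

lemma contDiff_entry (hA : ∀ j α β, ContDiff ℝ ∞ fun z => A j z α β) (j : Fin n) (α β : Fin m) :
    ContDiff ℝ ∞ (entry A j α β) := (hA j α β).comp (PiLp.contDiff_toLp ..)

lemma dcoef_entry (A : Fin n → EuclideanSpace ℝ (Fin m) → Matrix (Fin m) (Fin m) ℝ)
    (u : Eu n → EuclideanSpace ℝ (Fin m)) (j : Fin n) (α β γ : Fin m) (x : Eu n) :
    dcoef (entry A j α β) (fun γ x => u x γ) γ x
      = fderiv ℝ (fun z => A j z α β) (u x) (EuclideanSpace.single γ 1) := by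
  have := ContinuousLinearEquiv.comp_right_fderiv (EuclideanSpace.equiv (Fin m) ℝ).symm
    (f := fun z => A j z α β) (x := fun γ => u x γ)
  exact congrArg (fun L => L (Pi.single γ 1)) this

lemma cx_coeff (A : Fin n → EuclideanSpace ℝ (Fin m) → Matrix (Fin m) (Fin m) ℝ)
    (u : Eu n → EuclideanSpace ℝ (Fin m)) (j : Fin n) (α β : Fin m) :
    cx (coeff A u j α β) = cx fun x => entry A j α β fun γ => u x γ := rfl

lemma cx_dCoeff (A : Fin n → EuclideanSpace ℝ (Fin m) → Matrix (Fin m) (Fin m) ℝ)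
    (u : Eu n → EuclideanSpace ℝ (Fin m)) (j : Fin n) (α γ : Fin m) : cx (dCoeff A u j α γ)
      = ∑ β, cx (dcoef (entry A j α β) (fun γ x => u x γ) γ) * cx (pd u j β) := by
  ext x
  simp only [cx, dCoeff, Finset.sum_apply, Pi.mul_apply, Complex.ofReal_sum, Complex.ofReal_mul,
    dcoef_entry]

end RealRemainder

/-! ### Convergence of the remainder and its decomposition into scalar remainders. -/

section RealRemainderSeries
open SchwartzMap Filter Topology
variable {n m : ℕ} {χ : Eu n → ℝ} {u : Eu n → EuclideanSpace ℝ (Fin m)}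
  {A : Fin n → EuclideanSpace ℝ (Fin m) → Matrix (Fin m) (Fin m) ℝ}

/-- The three series entering the remainder, in terms of `pdc j (cx (u · β))`. -/
structure TermsEq (hχ : IsLPCutoff χ) (A : Fin n → EuclideanSpace ℝ (Fin m) → Matrix (Fin m) (Fin m) ℝ)
    (u : Eu n → EuclideanSpace ℝ (Fin m)) (j : Fin n) (α β : Fin m) : Prop where
  high : (fun k => cx (highTerm χ (coeff A u j α β) (pd u j β) k)) =
    ∑ d ∈ Finset.Icc (-8 : ℤ) 8, tH d (phiS hχ) (phiS hχ) (cx fun x => entry A j α β fun γ => u x γ)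
      (pdc j (cx fun x => u x β))
  low : (fun k => cx (paraTerm χ (pd u j β) (coeff A u j α β) k)) =
    tT (chiS hχ) (phiS hχ) (pdc j (cx fun x => u x β)) (cx fun x => entry A j α β fun γ => u x γ)
  para : (fun k => cx (paraTerm χ (dCoeff A u j α β) (fun y => u y β) k)) =
    ∑ β', tT (chiS hχ) (phiS hχ) (cx (dcoef (entry A j α β') (fun γ x => u x γ) β)
      * pdc j (cx fun x => u x β')) (cx fun x => u x β)

variable (hA : ∀ j α β, ContDiff ℝ ∞ fun z => A j z α β)
include hA

lemma IsLipschitzL2.termsEq (hχ : IsLPCutoff χ) (h : IsLipschitzL2 u) (j : Fin n) (α β : Fin m) :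
    TermsEq hχ A u j α β := by
  obtain ⟨L, M, hU⟩ := h.exists_fam
  have bc := hU.bm_comp (contDiff_entry hA j α β)
  have b (β' : Fin m) : BM (cx (dcoef (entry A j α β') (fun γ x => u x γ) β)) :=
    hU.bm_comp (contDiff_partial (contDiff_entry hA j α β') β)
  refine ⟨funext fun k => ?_, funext fun k => ?_, funext fun k => ?_⟩
  · rw [cx_highTerm hχ (by rw [cx_coeff]; exact bc) (h.bm_pd j β), cx_coeff]
    simp only [Finset.sum_apply, tH_congr_right _ _ _ (h.ae_pd j β)]
  · rw [cx_paraTerm hχ _ (by rw [cx_coeff]; exact bc), cx_coeff, tT_congr_left _ _ (h.ae_pd j β)]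
  · rw [cx_paraTerm hχ _ (hU.bm β), cx_dCoeff, tT, fm_sum _ fun β' _ => (b β').mul (h.bm_pd j β'), Finset.sum_mul, Finset.sum_apply]
    refine Finset.sum_congr rfl fun β' _ => ?_
    rw [← tT_congr_left _ _ (EventuallyEq.rfl.mul (h.ae_pd j β'))]
    rfl

lemma IsLipschitzL2.uConv_high (hχ : IsLPCutoff χ) (h : IsLipschitzL2 u) (j : Fin n) (α β : Fin m) :
    UConv fun k => cx (highTerm χ (coeff A u j α β) (pd u j β) k) := by
  obtain ⟨L, M, hU⟩ := h.exists_fam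
  obtain ⟨R, hR⟩ := exists_data (n := n) (contDiff_entry hA j α β) M
  have d := hR L _ β hU
  rw [(h.termsEq hA hχ j α β).high]
  exact .sum _ fun i _ => uConv_tH_pdc hχ d.bf d.by' d.lf d.ly i j

lemma IsLipschitzL2.uConv_low (hχ : IsLPCutoff χ) (h : IsLipschitzL2 u) (j : Fin n) (α β : Fin m) :
    UConv fun k => cx (paraTerm χ (pd u j β) (coeff A u j α β) k) := by
  obtain ⟨L, M, hU⟩ := h.exists_fam
  obtain ⟨R, hR⟩ := exists_data (n := n) (contDiff_entry hA j α β) M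
  have d := hR L _ β hU
  rw [(h.termsEq hA hχ j α β).low]
  exact uConv_tT_pdc hχ d.bf d.by' d.lf d.ly j

lemma IsLipschitzL2.uConv_tT (hχ : IsLPCutoff χ) (h : IsLipschitzL2 u) (j : Fin n) (α β γ : Fin m) :
    UConv (tT (chiS hχ) (phiS hχ) (cx (dcoef (entry A j α β) (fun γ x => u x γ) γ)
      * pdc j (cx fun x => u x β)) (cx fun x => u x γ)) := by
  obtain ⟨L, M, hU⟩ := h.exists_fam
  exact Paradiff.uConv_tT hχ (Fin.pos j) ((hU.bm_comp (contDiff_partial (contDiff_entry hA j α β) γ)).mul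
    (bm_pdc (hU.lip β) j)) (hU.bm γ) (hU.mem γ) (hU.lip γ)

lemma IsLipschitzL2.remainderConverges (hχ : IsLPCutoff χ) (h : IsLipschitzL2 u) :
    RemainderConverges χ A u := fun j α β => by
  refine ⟨.of_uConv (h.uConv_high hA hχ j α β), .of_uConv (h.uConv_low hA hχ j α β), .of_uConv ?_⟩
  rw [(h.termsEq hA hχ j α β).para]
  exact .sum _ fun β' _ => h.uConv_tT hA hχ j α β' β

lemma IsLipschitzL2.cx_remainder (hχ : IsLPCutoff χ) (h : IsLipschitzL2 u) (α : Fin m) :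
    (cx fun x => remainder χ A u x α)
      = ∑ j, ∑ β, su (rterm hχ j β (entry A j α β) fun γ x => u x γ) := by
  have e1 (j : Fin n) (β : Fin m) := (cx_tsum _).trans (congrArg su (h.termsEq hA hχ j α β).high)
  have e2 (j : Fin n) (β : Fin m) := (cx_tsum _).trans (congrArg su (h.termsEq hA hχ j α β).low)
  have e3 (j : Fin n) (β : Fin m) := (cx_tsum _).trans (congrArg su (h.termsEq hA hχ j α β).para)
  have e4 (j : Fin n) (β : Fin m) : su (rterm hχ j β (entry A j α β) fun γ x => u x γ)
      = (cx fun x => highHigh χ (coeff A u j α β) (pd u j β) x)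
        + (cx fun x => para χ (pd u j β) (coeff A u j α β) x)
        - ∑ γ, su (tT (chiS hχ) (phiS hχ) (cx (dcoef (entry A j α β) (fun γ x => u x γ) γ)
          * pdc j (cx fun x => u x β)) (cx fun x => u x γ)) := by
    have c1 := h.uConv_high hA hχ j α β
    have c2 := h.uConv_low hA hχ j α β
    rw [(h.termsEq hA hχ j α β).high] at c1
    rw [(h.termsEq hA hχ j α β).low] at c2
    have c3 (γ : Fin m) := h.uConv_tT hA hχ j α β γ
    rw [rterm, gterm, su_sub (c1.add c2) (.sum _ fun γ _ => c3 γ), su_add c1 c2,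
      su_sum _ fun γ _ => c3 γ]
    exact congrArg₂ _ (congrArg₂ _ (e1 j β).symm (e2 j β).symm) rfl
  have e5 (j : Fin n) (γ : Fin m) : (cx fun x => para χ (dCoeff A u j α γ) (fun y => u y γ) x)
      = ∑ β, su (tT (chiS hχ) (phiS hχ) (cx (dcoef (entry A j α β) (fun γ x => u x γ) γ)
          * pdc j (cx fun x => u x β)) (cx fun x => u x γ)) :=
    (e3 j γ).trans (su_sum _ fun β _ => h.uConv_tT hA hχ j α β γ)
  simp only [e4, Finset.sum_sub_distrib, Finset.sum_add_distrib]
  -- The scalar remainders carry the sum over `γ` for fixed `β`, whereas the matrix `dCoeff` has the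
  -- sum over `β` inside for fixed `γ`; exchanging the two matches them.
  simp only [fun j => Finset.sum_comm (s := Finset.univ) (t := Finset.univ) (f := fun β γ =>
    su (tT (chiS hχ) (phiS hχ) (cx (dcoef (entry A j α β) (fun γ x => u x γ) γ)
          * pdc j (cx fun x => u x β)) (cx fun x => u x γ))), ← e5]
  ext x
  simp only [cx, remainder, Complex.ofReal_sum, Complex.ofReal_sub, Complex.ofReal_add, Pi.sub_apply,
    Pi.add_apply, Finset.sum_apply, Finset.sum_sub_distrib, Finset.sum_add_distrib]

end RealRemainderSeries

/-! ### Pointwise control from the essential suprema of `u` and its gradient. -/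

section Control
open SchwartzMap Filter Topology
variable {n m : ℕ} {χ : Eu n → ℝ} {u v : Eu n → EuclideanSpace ℝ (Fin m)}

/-- The bound holds almost everywhere, hence on a dense set, and extends by continuity. -/
lemma norm_le_of_eLpNorm_top_le {w : Eu n → EuclideanSpace ℝ (Fin m)} (hw : Continuous w) {M : ℝ≥0}
    (h : eLpNorm w ∞ volume ≤ M) (x : Eu n) : ‖w x‖ ≤ M := by
  have h1 : ∀ᵐ x, ‖w x‖ ≤ M := by
    filter_upwards [ae_le_eLpNormEssSup (f := w) (μ := volume)] with y hy
    rw [eLpNorm_exponent_top] at h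
    have := hy.trans h
    rwa [enorm_le_coe, ← NNReal.coe_le_coe, coe_nnnorm] at this
  have h2 : Dense {y | ‖w y‖ ≤ M} := Measure.dense_of_ae h1
  exact closure_minimal (fun _ h => h) (isClosed_le hw.norm continuous_const) (h2 x)

/-- The Lipschitz constant of a function is controlled by the supremum of its gradient. -/
lemma lipschitzWith_of_ae_pdc_le (hχ : IsLPCutoff χ) {f : Eu n → ℂ} (hf : BM f) {K B : ℝ≥0}
    (hK : LipschitzWith K f) (hB : ∀ i, ∀ᵐ x, ‖pdc i f x‖ ≤ B) :
    LipschitzWith (n * (nk (chiS hχ) * B)) f := by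
  -- The smooth low frequency parts have gradients bounded everywhere, uniformly in `N`, and
  -- converge pointwise to `f`.
  have h1 (N : ℕ) : LipschitzWith (n * (nk (chiS hχ) * B)) (fm (dil N (chiS hχ)) f) := by
    have := lipschitzWith_of_pdc_le (differentiable_fm (dil N (chiS hχ)) hf)
      (C := fun _ => nk (chiS hχ) * B) fun i x => ?_
    · simpa using this
    · classical
      -- The derivative is set to zero on a null set, so that the sup bound for multipliers, which
      -- requires a bound at every point, applies.
      have e : pdc i f =ᵐ[volume] fun x => if ‖pdc i f x‖ ≤ B then pdc i f x else 0 := by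
        filter_upwards [hB i] with x hx
        rw [if_pos hx]
      rw [pdc_fm _ hf, ← fm_pdc _ hf hK, fm_congr_ae _ e]
      refine norm_fm_dil_le (C := B) (fun y => ?_) N _ x
      split_ifs with h
      · exact h
      · simp
  have h2 (x : Eu n) : Tendsto (fun N : ℕ => fm (dil N (chiS hχ)) f x) atTop (𝓝 (f x)) := by
    rw [tendsto_iff_norm_sub_tendsto_zero]
    refine squeeze_zero (fun _ => norm_nonneg _) (g := fun N : ℕ => (1 / 2) ^ N * (mk (chiS hχ) * K : ℝ))
      (fun N => ?_) ?_
    · have := norm_fm_dil_sub_le hf hK N (chiS hχ) x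
      rw [chiS_apply, hχ.eq_one 0 (by simp), Complex.ofReal_one, one_mul] at this
      refine this.trans (le_of_eq ?_)
      simp [mul_assoc]
    · simpa using (tendsto_pow_atTop_nhds_zero_of_lt_one (r := (1 / 2 : ℝ)) (by norm_num)
        (by norm_num)).mul_const (mk (chiS hχ) * K : ℝ)
  exact .of_dist_le_mul fun x y => le_of_tendsto ((h2 x).dist (h2 y))
    (.of_forall fun N => (h1 N).dist_le_mul x y)

lemma IsLipschitzL2.fam (hχ : IsLPCutoff χ) (h : IsLipschitzL2 u) {M B : ℝ≥0} (hM : ctrlA u ≤ M)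
    (hB : ctrlB u ≤ B) : Fam (n * (nk (chiS hχ) * B)) M fun γ x => u x γ := by
  obtain ⟨K, R, hU⟩ := h.exists_fam
  obtain ⟨K', hK'⟩ := h.1
  refine ⟨fun γ => lipschitzWith_of_ae_pdc_le hχ (hU.bm γ) (hU.lip γ) fun i => ?_, fun γ x =>
    (PiLp.norm_apply_le (u x) γ).trans (norm_le_of_eLpNorm_top_le hK'.continuous hM x), hU.mem⟩
  filter_upwards [h.ae_pd i γ, ae_le_eLpNormEssSup (f := fderiv ℝ u) (μ := volume)] with x hx hy
  rw [ctrlB, eLpNorm_exponent_top] at hB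
  have := hy.trans hB
  rw [enorm_le_coe, ← NNReal.coe_le_coe, coe_nnnorm] at this
  rw [← hx, norm_cx]
  exact (abs_pd_le u i γ x).trans this

lemma ctrlB_le {K : ℝ≥0} (hK : LipschitzWith K u) : ctrlB u ≤ K := by
  rw [ctrlB, eLpNorm_exponent_top]
  refine eLpNormEssSup_le_of_ae_enorm_bound (.of_forall fun x => ?_)
  rw [enorm_le_coe, ← NNReal.coe_le_coe, coe_nnnorm]
  exact norm_fderiv_le_of_lipschitz ℝ hK

lemma IsLipschitzL2.ctrlB_ne_top (h : IsLipschitzL2 u) : ctrlB u ≠ ⊤ := by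
  obtain ⟨K, hK⟩ := h.1
  exact ne_top_of_le_ne_top (by simp) (ctrlB_le hK)

end Control

/-! ### The vector valued Sobolev norm in components. -/

section VectorFourier
open SchwartzMap
variable {n m : ℕ}

lemma fourier_postcompCLM {F G : Type*} [NormedAddCommGroup F] [NormedSpace ℂ F] [CompleteSpace F]
    [NormedAddCommGroup G] [NormedSpace ℂ G] [CompleteSpace G] (L : F →L[ℂ] G) (f : 𝓢(Eu n, F)) :
    𝓕 (f.postcompCLM L) = (𝓕 f).postcompCLM L := by
  ext ξ
  rw [postcompCLM_apply, SchwartzMap.fourier_coe, SchwartzMap.fourier_coe, Real.fourier_eq,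
    Real.fourier_eq, ← ContinuousLinearMap.integral_comp_comm]
  · refine integral_congr_ae (.of_forall fun x => ?_)
    simp only [postcompCLM_apply, Circle.smul_def, map_smul]
  · have := (Real.fourierIntegral_convergent_iff (f := f) ξ).2 (f.integrable (μ := volume))
    exact this

lemma compLp_toLp {F G : Type*} [NormedAddCommGroup F] [NormedSpace ℂ F]
    [NormedAddCommGroup G] [NormedSpace ℂ G] (L : F →L[ℂ] G) (f : 𝓢(Eu n, F)) :
    L.compLp (f.toLp 2 volume) = (f.postcompCLM L).toLp 2 volume := by
  refine Lp.ext ?_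
  filter_upwards [L.coeFn_compLp (f.toLp 2 volume), f.coeFn_toLp 2 volume,
    (f.postcompCLM L).coeFn_toLp 2 volume] with x h1 h2 h3
  rw [h1, h2, h3, postcompCLM_apply]

/-- The Fourier transform of square integrable functions commutes with linear maps. -/
lemma fourier_compLp {F G : Type*} [NormedAddCommGroup F] [InnerProductSpace ℂ F] [CompleteSpace F]
    [NormedAddCommGroup G] [InnerProductSpace ℂ G] [CompleteSpace G] (L : F →L[ℂ] G)
    (H : Lp F 2 (volume : Measure (Eu n))) : 𝓕 (L.compLp H) = L.compLp (𝓕 H) := by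
  -- Both sides are continuous in `H`, so Schwartz functions suffice; there the transform is an
  -- integral and commutes with `L`.
  refine DenseRange.induction_on (p := fun H : Lp F 2 (volume : Measure (Eu n)) =>
    𝓕 (L.compLp H) = L.compLp (𝓕 H))
    (SchwartzMap.denseRange_toLpCLM (p := 2) ENNReal.ofNat_ne_top) H ?_ fun f => ?_
  · apply isClosed_eq
    · exact ((fourierCLM ℂ (Lp G 2 (volume : Measure (Eu n)))) ∘L L.compLpL 2 volume).continuous
    · exact ((L.compLpL 2 volume) ∘L (fourierCLM ℂ (Lp F 2 (volume : Measure (Eu n))))).continuous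
  · rw [SchwartzMap.toLpCLM_apply, compLp_toLp, SchwartzMap.toLp_fourier_eq,
      SchwartzMap.toLp_fourier_eq, compLp_toLp, fourier_postcompCLM]

lemma enorm_sq_eq_sum {𝕜 : Type*} [RCLike 𝕜] (v : EuclideanSpace 𝕜 (Fin m)) :
    ‖v‖ₑ ^ 2 = ∑ α, ‖v α‖ₑ ^ 2 := by
  simp only [← ofReal_norm, ← ENNReal.ofReal_pow (norm_nonneg _)]
  rw [EuclideanSpace.norm_sq_eq, ENNReal.ofReal_sum_of_nonneg fun _ _ => by positivity]

variable {h : Eu n → EuclideanSpace ℝ (Fin m)}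

lemma memLp_complexify_apply (hh : MemLp (complexify h) 2 volume) (α : Fin m) :
    MemLp (cx fun x => h x α) 2 volume :=
  (EuclideanSpace.proj (𝕜 := ℂ) α).comp_memLp' hh

lemma memLp_complexify (hh : ∀ α, MemLp (cx fun x => h x α) 2 volume) :
    MemLp (complexify h) 2 volume :=
  MemLp.of_eval_piLp hh

lemma fourier_complexify_apply (hh : MemLp (complexify h) 2 volume) (α : Fin m) :
    (fun ξ => (𝓕 (hh.toLp (complexify h)) : Lp (EuclideanSpace ℂ (Fin m)) 2 volume) ξ α)
      =ᵐ[volume] fhat (cx fun x => h x α) := by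
  set L : EuclideanSpace ℂ (Fin m) →L[ℂ] ℂ := EuclideanSpace.proj α
  have h1 := fourier_compLp L (hh.toLp (complexify h))
  have h2 : L.compLp (hh.toLp (complexify h)) = (memLp_complexify_apply hh α).toLp _ := by
    refine Lp.ext ?_
    filter_upwards [L.coeFn_compLp (hh.toLp (complexify h)), hh.coeFn_toLp,
      (memLp_complexify_apply hh α).coeFn_toLp] with x h1 h2 h3
    rw [h1, h2, h3]; rfl
  rw [fhat_of_memLp (memLp_complexify_apply hh α), ← h2, h1]
  filter_upwards [L.coeFn_compLp (𝓕 (hh.toLp (complexify h)))] with x h3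
  rw [h3]; rfl

/-- The square of the inhomogeneous Sobolev norm. -/
def isq (σ : ℝ) (f : Eu n → ℂ) : ℝ≥0∞ :=
  ∫⁻ ξ, (‖((1 + ‖ξ‖ ^ 2) ^ (σ / 2) : ℝ)‖ₑ * ‖fhat f ξ‖ₑ) ^ 2

lemma measurable_bracket (σ : ℝ) : Measurable fun ξ : Eu n => ‖((1 + ‖ξ‖ ^ 2) ^ (σ / 2) : ℝ)‖ₑ := by
  fun_prop

lemma sobolevNorm_sq (hh : MemLp (complexify h) 2 volume) (σ : ℝ) :
    sobolevNorm σ h ^ 2 = ∑ α, isq σ (cx fun x => h x α) := by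
  rw [sobolevNorm, dif_pos hh, eLpNorm_two_sq]
  simp only [isq]
  rw [← lintegral_finsetSum']
  · refine lintegral_congr_ae ?_
    filter_upwards [Filter.eventually_all.2 fun α => fourier_complexify_apply hh α] with ξ hξ
    rw [enorm_smul, mul_pow, enorm_sq_eq_sum, Finset.mul_sum]
    refine Finset.sum_congr rfl fun α _ => ?_
    rw [mul_pow, ← hξ α]
  · exact fun α _ => ((measurable_bracket σ).aemeasurable.mul
      (memLp_fhat _).1.enorm).pow_const 2

end VectorFourier

/-! ### Comparison of inhomogeneous and homogeneous norms. -/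

section InhomogeneousNorm
open SchwartzMap
variable {n m : ℕ} {σ : ℝ} {f : Eu n → ℂ}

lemma bracket_le (hσ : 0 ≤ σ) (ξ : Eu n) :
    ‖((1 + ‖ξ‖ ^ 2) ^ (σ / 2) : ℝ)‖ₑ ≤ ((2 : ℝ≥0) ^ (σ / 2) : ℝ≥0) * (1 + ‖ξ‖ₑ ^ σ) := by
  have h : (1 + ‖ξ‖ ^ 2) ^ (σ / 2) ≤ 2 ^ (σ / 2) * (1 + ‖ξ‖ ^ σ) := by
    have e : (‖ξ‖ ^ 2) ^ (σ / 2) = ‖ξ‖ ^ σ := by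
      rw [← Real.rpow_natCast, ← Real.rpow_mul (norm_nonneg _)]; congr 1; push_cast; ring
    have hp : 0 ≤ ‖ξ‖ ^ σ := by positivity
    rcases le_total ‖ξ‖ 1 with h1 | h1
    · calc (1 + ‖ξ‖ ^ 2) ^ (σ / 2) ≤ (2 : ℝ) ^ (σ / 2) := by
            gcongr
            nlinarith [norm_nonneg ξ]
        _ ≤ _ := le_mul_of_one_le_right (by positivity) (by linarith)
    · calc (1 + ‖ξ‖ ^ 2) ^ (σ / 2) ≤ (2 * ‖ξ‖ ^ 2) ^ (σ / 2) := by
            gcongr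
            nlinarith
        _ = 2 ^ (σ / 2) * ‖ξ‖ ^ σ := by rw [Real.mul_rpow (by norm_num) (by positivity), e]
        _ ≤ _ := by gcongr; linarith
  rw [Real.enorm_of_nonneg (by positivity)]
  refine (ENNReal.ofReal_le_ofReal h).trans (le_of_eq ?_)
  rw [ENNReal.ofReal_mul (by positivity), ENNReal.ofReal_add zero_le_one (by positivity),
    ← ENNReal.ofReal_rpow_of_nonneg (norm_nonneg _) hσ, ofReal_norm, ENNReal.ofReal_one]
  congr 1
  rw [← NNReal.coe_two, ← NNReal.coe_rpow, ENNReal.ofReal_coe_nnreal]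

lemma one_le_bracket (hσ : 0 ≤ σ) (ξ : Eu n) : 1 ≤ ‖((1 + ‖ξ‖ ^ 2) ^ (σ / 2) : ℝ)‖ₑ := by
  rw [Real.enorm_of_nonneg (by positivity), ENNReal.one_le_ofReal]
  exact Real.one_le_rpow (by nlinarith [norm_nonneg ξ]) (by positivity)

lemma rpow_le_bracket (hσ : 0 ≤ σ) (ξ : Eu n) :
    ‖ξ‖ₑ ^ σ ≤ ‖((1 + ‖ξ‖ ^ 2) ^ (σ / 2) : ℝ)‖ₑ := by
  rw [Real.enorm_of_nonneg (by positivity), ← ofReal_norm,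
    ENNReal.ofReal_rpow_of_nonneg (norm_nonneg _) hσ]
  refine ENNReal.ofReal_le_ofReal ?_
  have e : (‖ξ‖ ^ 2) ^ (σ / 2) = ‖ξ‖ ^ σ := by
    rw [← Real.rpow_natCast, ← Real.rpow_mul (norm_nonneg _)]; congr 1; push_cast; ring
  rw [← e]
  gcongr
  linarith

lemma hsq_le_isq (hσ : 0 ≤ σ) (f : Eu n → ℂ) : hsq σ f ≤ isq σ f := by
  refine lintegral_mono fun ξ => ?_
  gcongr
  exact rpow_le_bracket hσ ξ

lemma eLpNorm_sq_le_isq (hσ : 0 ≤ σ) (hf : MemLp f 2 volume) : eLpNorm f 2 volume ^ 2 ≤ isq σ f := by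
  rw [← eLpNorm_fhat hf, eLpNorm_two_sq]
  refine lintegral_mono fun ξ => ?_
  gcongr
  exact le_mul_of_one_le_left zero_le (one_le_bracket hσ ξ)

lemma exists_isq_le (hσ : 0 ≤ σ) : ∃ C : ℝ≥0, ∀ f : Eu n → ℂ, MemLp f 2 volume →
    isq σ f ≤ C * (eLpNorm f 2 volume ^ 2 + hsq σ f) := by
  set D : ℝ≥0 := 2 ^ (σ / 2)
  refine ⟨D ^ 2 * 2, fun f hf => ?_⟩
  rw [← hsq_zero hf, hsq, hsq, ← lintegral_add_left',
    ← lintegral_const_mul' _ _ ENNReal.coe_ne_top]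
  · refine lintegral_mono fun ξ => ?_
    rw [ENNReal.rpow_zero]
    calc _ ≤ (D * (1 + ‖ξ‖ₑ ^ σ) * ‖fhat f ξ‖ₑ) ^ 2 := by gcongr; exact bracket_le hσ ξ
      _ = D ^ 2 * (1 * ‖fhat f ξ‖ₑ + ‖ξ‖ₑ ^ σ * ‖fhat f ξ‖ₑ) ^ 2 := by ring
      _ ≤ D ^ 2 * (2 * ((1 * ‖fhat f ξ‖ₑ) ^ 2 + (‖ξ‖ₑ ^ σ * ‖fhat f ξ‖ₑ) ^ 2)) := by
          gcongr; exact sq_add_le _ _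
      _ = _ := by push_cast; ring
  · exact ((measurable_enorm_rpow 0).aemeasurable.mul (memLp_fhat f).1.enorm).pow_const 2

lemma sum_sq_le {ι : Type*} (s : Finset ι) (x : ι → ℝ≥0∞) : (∑ i ∈ s, x i) ^ 2 ≤ s.card * ∑ i ∈ s, x i ^ 2 := by
  have := ENNReal.inner_le_Lp_mul_Lq s (fun _ => 1) x Real.HolderConjugate.two_two
  have := pow_le_pow_left' this 2
  rw [mul_pow, ← ENNReal.rpow_natCast, ← ENNReal.rpow_natCast, ← ENNReal.rpow_natCast,
    ← ENNReal.rpow_mul, ← ENNReal.rpow_mul] at this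
  simpa using this

lemma fhat_zero : fhat (0 : Eu n → ℂ) =ᵐ[volume] 0 := by
  have := fhat_smul (n := n) 0 (f := 0) MemLp.zero
  simpa using this

lemma fhat_sum {ι : Type*} (s : Finset ι) {F : ι → Eu n → ℂ} (hF : ∀ i ∈ s, MemLp (F i) 2 volume) :
    fhat (∑ i ∈ s, F i) =ᵐ[volume] ∑ i ∈ s, fhat (F i) := by
  classical
  induction s using Finset.induction_on with
  | empty => simpa using fhat_zero
  | insert a s ha ih =>
    have h1 := ih fun i hi => hF i (by simp [hi])
    rw [Finset.sum_insert ha, Finset.sum_insert ha]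
    refine (fhat_add (hF a (by simp)) ?_).trans (Filter.EventuallyEq.rfl.add h1)
    exact memLp_finsetSum' s fun i hi => hF i (by simp [hi])

lemma isq_sum_le {ι : Type*} (s : Finset ι) {F : ι → Eu n → ℂ} (hF : ∀ i ∈ s, MemLp (F i) 2 volume) :
    isq σ (∑ i ∈ s, F i) ≤ s.card * ∑ i ∈ s, isq σ (F i) := by
  simp only [isq]
  rw [← lintegral_finsetSum', ← lintegral_const_mul' _ _ (by simp)]
  · refine lintegral_mono_ae ?_
    filter_upwards [fhat_sum s hF] with ξ hξ
    refine le_trans ?_ (sum_sq_le s _)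
    rw [hξ, ← Finset.mul_sum, Finset.sum_apply]
    gcongr
    exact enorm_sum_le _ _
  · exact fun i _ => ((measurable_bracket σ).aemeasurable.mul (memLp_fhat _).1.enorm).pow_const 2

end InhomogeneousNorm

/-! ### Inhomogeneous Sobolev bounds for the scalar remainders. -/

section ScalarBounds
open SchwartzMap
variable {n m : ℕ} {χ : Eu n → ℝ} {σ : ℝ} {L M : ℝ≥0} {U V : Fin m → Eu n → ℝ}

lemma isq_zero_index {f : Eu n → ℂ} (hf : MemLp f 2 volume) : isq 0 f = eLpNorm f 2 volume ^ 2 := by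
  rw [← hsq_zero hf, isq, hsq]
  simp

lemma memLp_rterm_sub (hχ : IsLPCutoff χ) (hn : 0 < n) {a : (Fin m → ℝ) → ℝ} (ha : ContDiff ℝ ∞ a)
    (hU : Fam L M U) (hV : Fam L M V) (j : Fin n) (β : Fin m) :
    MemLp (su (rterm hχ j β a U) - su (rterm hχ j β a V)) 2 volume := by
  obtain ⟨C, hC⟩ := exists_eLpNorm_rterm_sub hχ hn ha M
  refine ⟨(((hU.uConv_rterm hχ hn ha j β).bm_su fun k => (hU.bm_rterm hχ ha j β k).meas).sub
    ((hV.uConv_rterm hχ hn ha j β).bm_su fun k => (hV.bm_rterm hχ ha j β k).meas)).meas.aestronglyMeasurable,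
    (hC L U V j β hU hV).trans_lt (ENNReal.mul_lt_top (by finiteness)
      (ENNReal.sum_lt_top.2 fun γ _ => (hU.mem_sub hV γ).2))⟩

lemma exists_isq_zero_rterm_sub (hχ : IsLPCutoff χ) (hn : 0 < n) {a : (Fin m → ℝ) → ℝ}
    (ha : ContDiff ℝ ∞ a) (M : ℝ≥0) : ∃ C : ℝ≥0, ∀ (L : ℝ≥0) (U V : Fin m → Eu n → ℝ) (j : Fin n)
    (β : Fin m), Fam L M U → Fam L M V →
    isq 0 (su (rterm hχ j β a U) - su (rterm hχ j β a V))
      ≤ C * L ^ 2 * ∑ γ, isq 0 (cx (U γ) - cx (V γ)) := by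
  obtain ⟨C, hC⟩ := exists_eLpNorm_rterm_sub hχ hn ha M
  refine ⟨C ^ 2 * m, fun L U V j β hU hV => ?_⟩
  simp only [isq_zero_index (memLp_rterm_sub hχ hn ha hU hV j β), fun γ => isq_zero_index (hU.mem_sub hV γ)]
  calc _ ≤ (C * L * ∑ γ, eLpNorm (cx (U γ) - cx (V γ)) 2 volume) ^ 2 := by
        gcongr; exact hC L U V j β hU hV
    _ = C ^ 2 * L ^ 2 * (∑ γ, eLpNorm (cx (U γ) - cx (V γ)) 2 volume) ^ 2 := by ring
    _ ≤ C ^ 2 * L ^ 2 * (m * ∑ γ, eLpNorm (cx (U γ) - cx (V γ)) 2 volume ^ 2) := by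
        gcongr
        simpa using sum_sq_le Finset.univ fun γ => eLpNorm (cx (U γ) - cx (V γ)) 2 volume
    _ = _ := by push_cast; ring

lemma exists_isq_rterm_sub (hχ : IsLPCutoff χ) (hn : 0 < n) (hσ : 0 ≤ σ) {a : (Fin m → ℝ) → ℝ}
    (ha : ContDiff ℝ ∞ a) (M : ℝ≥0) : ∃ C : ℝ≥0, ∀ (L θ : ℝ≥0) (U V : Fin m → Eu n → ℝ) (j : Fin n)
    (β : Fin m), Fam L M U → Fam L M V → (∀ γ x, |U γ x - V γ x| ≤ θ) →
    isq σ (su (rterm hχ j β a U) - su (rterm hχ j β a V))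
      ≤ C * L ^ 2 * (∑ γ, isq σ (cx (U γ) - cx (V γ))
        + θ ^ 2 * ∑ γ, (isq σ (cx (U γ)) + isq σ (cx (V γ)))) := by
  obtain ⟨C0, h0⟩ := exists_isq_zero_rterm_sub hχ hn ha M
  -- The square function argument requires `0 < σ`; for `σ = 0` the bound in L² is already stronger.
  rcases hσ.eq_or_lt with rfl | hσ'
  · refine ⟨C0, fun L θ U V j β hU hV _ => (h0 L U V j β hU hV).trans ?_⟩
    gcongr
    exact le_self_add
  obtain ⟨C1, h1⟩ := exists_hsq_rterm_sub hχ hn hσ' ha M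
  obtain ⟨C2, h2⟩ := exists_isq_le (n := n) hσ
  refine ⟨C2 * (C0 + C1), fun L θ U V j β hU hV hθ => ?_⟩
  have hW := memLp_rterm_sub hχ hn ha hU hV j β
  set E := ∑ γ, isq σ (cx (U γ) - cx (V γ)) + θ ^ 2 * ∑ γ, (isq σ (cx (U γ)) + isq σ (cx (V γ)))
  have b0 : eLpNorm (su (rterm hχ j β a U) - su (rterm hχ j β a V)) 2 volume ^ 2 ≤ C0 * L ^ 2 * E := by
    rw [← isq_zero_index hW]
    refine (h0 L U V j β hU hV).trans ?_
    gcongr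
    refine le_trans (Finset.sum_le_sum fun γ _ => ?_) le_self_add
    rw [isq_zero_index (hU.mem_sub hV γ)]
    exact eLpNorm_sq_le_isq hσ (hU.mem_sub hV γ)
  have b1 : hsq σ (su (rterm hχ j β a U) - su (rterm hχ j β a V)) ≤ C1 * L ^ 2 * E := by
    refine (h1 L θ U V j β hU hV hθ).trans ?_
    simp only [E]
    gcongr <;> exact hsq_le_isq hσ _
  calc _ ≤ C2 * (C0 * L ^ 2 * E + C1 * L ^ 2 * E) := (h2 _ hW).trans (by gcongr)
    _ = _ := by push_cast; ring

end ScalarBounds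

/-! ### Bounds for the vector valued remainder. -/

section VectorBounds
variable {n m : ℕ} {χ : Eu n → ℝ} {σ : ℝ} {u v : Eu n → EuclideanSpace ℝ (Fin m)}
  {A : Fin n → EuclideanSpace ℝ (Fin m) → Matrix (Fin m) (Fin m) ℝ}

lemma cx_sub_apply (u v : Eu n → EuclideanSpace ℝ (Fin m)) (γ : Fin m) :
    (cx fun x => (u - v) x γ) = (cx fun x => u x γ) - cx fun x => v x γ := by
  ext x
  simp [cx]

lemma IsLipschitzL2.memLp_complexify (h : IsLipschitzL2 u) : MemLp (complexify u) 2 volume := by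
  obtain ⟨L, M, hU⟩ := h.exists_fam
  exact Paradiff.memLp_complexify hU.mem

lemma memLp_complexify_sub (hu : MemLp (complexify u) 2 volume) (hv : MemLp (complexify v) 2 volume) :
    MemLp (complexify (u - v)) 2 volume :=
  Paradiff.memLp_complexify fun α => by
    rw [cx_sub_apply]
    exact (memLp_complexify_apply hu α).sub (memLp_complexify_apply hv α)

lemma sobolevNorm_zero_index (hu : MemLp (complexify u) 2 volume) :
    sobolevNorm 0 u = eLpNorm u 2 volume := by
  have h : sobolevNorm 0 u ^ 2 = eLpNorm u 2 volume ^ 2 := by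
    rw [sobolevNorm_sq hu, eLpNorm_two_sq]
    simp only [fun α => isq_zero_index (memLp_complexify_apply hu α), eLpNorm_two_sq]
    rw [← lintegral_finsetSum' _ fun α _ => (memLp_complexify_apply hu α).1.enorm.pow_const 2]
    refine lintegral_congr fun x => ?_
    rw [enorm_sq_eq_sum]
    refine Finset.sum_congr rfl fun α _ => ?_
    rw [← ofReal_norm, norm_cx, ← Real.norm_eq_abs, ofReal_norm]
  exact (ENNReal.pow_right_strictMono two_ne_zero).injective h

variable (hA : ∀ j α β, ContDiff ℝ ∞ fun z => A j z α β)
include hA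

lemma cx_remainder_sub (hχ : IsLPCutoff χ) (hu : IsLipschitzL2 u) (hv : IsLipschitzL2 v) (α : Fin m) :
    (cx fun x => (remainder χ A u - remainder χ A v) x α)
      = ∑ p : Fin n × Fin m, (su (rterm hχ p.1 p.2 (entry A p.1 α p.2) fun γ x => u x γ)
        - su (rterm hχ p.1 p.2 (entry A p.1 α p.2) fun γ x => v x γ)) := by
  rw [cx_sub_apply, hu.cx_remainder hA hχ, hv.cx_remainder hA hχ, Finset.sum_sub_distrib,
    Fintype.sum_prod_type, Fintype.sum_prod_type]

lemma memLp_remainder_sub (hχ : IsLPCutoff χ) (hu : IsLipschitzL2 u) (hv : IsLipschitzL2 v) {L M : ℝ≥0}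
    (hU : Fam L M fun γ x => u x γ) (hV : Fam L M fun γ x => v x γ) :
    MemLp (complexify (remainder χ A u - remainder χ A v)) 2 volume := by
  refine Paradiff.memLp_complexify fun α => ?_
  rw [cx_remainder_sub hA hχ hu hv]
  exact memLp_finsetSum' _ fun p _ => memLp_rterm_sub hχ (Fin.pos p.1) (contDiff_entry hA _ _ _) hU hV _ _

lemma sobolevNorm_remainder_sub_le (hχ : IsLPCutoff χ) (hu : IsLipschitzL2 u) (hv : IsLipschitzL2 v)
    {L M : ℝ≥0} (hU : Fam L M fun γ x => u x γ) (hV : Fam L M fun γ x => v x γ) {D : ℝ≥0∞}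
    (hD : ∀ j α β, isq σ (su (rterm hχ j β (entry A j α β) fun γ x => u x γ)
      - su (rterm hχ j β (entry A j α β) fun γ x => v x γ)) ≤ D) :
    sobolevNorm σ (remainder χ A u - remainder χ A v) ^ 2 ≤ m * (n * m) ^ 2 * D := by
  rw [sobolevNorm_sq (memLp_remainder_sub hA hχ hu hv hU hV)]
  calc _ ≤ ∑ _α : Fin m, (n * m : ℝ≥0∞) ^ 2 * D := by
        refine Finset.sum_le_sum fun α _ => ?_
        rw [cx_remainder_sub hA hχ hu hv]
        refine (isq_sum_le _ fun p _ => memLp_rterm_sub hχ (Fin.pos p.1) (contDiff_entry hA _ _ _)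
          hU hV _ _).trans ?_
        calc _ ≤ (Finset.univ : Finset (Fin n × Fin m)).card * ∑ _p : Fin n × Fin m, D := by
              gcongr with p; exact hD p.1 α p.2
          _ = _ := by simp; ring
    _ = _ := by simp; ring

lemma exists_sobolevNorm_remainder_sub_le (hχ : IsLPCutoff χ) (hσ : 0 ≤ σ) (M : ℝ≥0) : ∃ C : ℝ≥0,
    ∀ u v : Eu n → EuclideanSpace ℝ (Fin m), IsLipschitzL2 u → IsLipschitzL2 v → ctrlA u + ctrlA v ≤ M →
      sobolevNorm σ (remainder χ A u - remainder χ A v) ≤ C * (ctrlB u + ctrlB v) *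
        (sobolevNorm σ (u - v) + eLpNorm (u - v) ∞ volume * (sobolevNorm σ u + sobolevNorm σ v)) := by
  obtain ⟨C, hC⟩ := exists_uniform (Finset.univ : Finset (Fin n × Fin m × Fin m)) (P := fun p C =>
      ∀ (L θ : ℝ≥0) (U V : Fin m → Eu n → ℝ), Fam L M U → Fam L M V → (∀ γ x, |U γ x - V γ x| ≤ θ) →
        isq σ (su (rterm hχ p.1 p.2.2 (entry A p.1 p.2.1 p.2.2) U)
          - su (rterm hχ p.1 p.2.2 (entry A p.1 p.2.1 p.2.2) V))
        ≤ C * L ^ 2 * (∑ γ, isq σ (cx (U γ) - cx (V γ))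
          + θ ^ 2 * ∑ γ, (isq σ (cx (U γ)) + isq σ (cx (V γ)))))
    (fun p a b hab h L θ U V hU hV hθ => (h L θ U V hU hV hθ).trans (by gcongr)) fun p _ => by
      -- The index `p.1` itself shows that `n` is positive, so dimension zero needs no separate
      -- treatment: the family of scalar remainders is then empty.
      obtain ⟨C, hC⟩ := exists_isq_rterm_sub hχ (Fin.pos p.1) hσ (contDiff_entry hA p.1 p.2.1 p.2.2) M
      exact ⟨C, fun L θ U V => hC L θ U V p.1 p.2.2⟩
  refine ⟨NNReal.sqrt (m * (n * m) ^ 2 * C) * (n * nk (chiS hχ)), fun u v hu hv hM => ?_⟩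
  lift ctrlB u + ctrlB v to ℝ≥0 using by simp [hu.ctrlB_ne_top, hv.ctrlB_ne_top] with B hB
  have hU := hu.fam hχ (le_self_add.trans hM) (hB ▸ le_self_add : ctrlB u ≤ B)
  have hV := hv.fam hχ (le_add_self.trans hM) (hB ▸ le_add_self : ctrlB v ≤ B)
  have mu := hu.memLp_complexify
  have mv := hv.memLp_complexify
  obtain ⟨K, hK⟩ := hu.1
  obtain ⟨K', hK'⟩ := hv.1
  have hθM : eLpNorm (u - v) ∞ volume ≤ M :=
    (eLpNorm_sub_le hK.continuous.aestronglyMeasurable hK'.continuous.aestronglyMeasurable le_top).trans hM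
  lift eLpNorm (u - v) ∞ volume to ℝ≥0 using ne_top_of_le_ne_top (by simp) hθM with θ hθ
  have hθ' (γ : Fin m) (x : Eu n) : |u x γ - v x γ| ≤ θ :=
    (PiLp.norm_apply_le ((u - v) x) γ).trans
      (norm_le_of_eLpNorm_top_le (hK.continuous.sub hK'.continuous) hθ.symm.le x)
  have key := sobolevNorm_remainder_sub_le hA hχ hu hv hU hV fun j α β =>
    hC (j, α, β) (Finset.mem_univ _) _ θ _ _ hU hV hθ'
  simp only [← cx_sub_apply, Finset.sum_add_distrib, ← sobolevNorm_sq mu, ← sobolevNorm_sq mv,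
    ← sobolevNorm_sq (memLp_complexify_sub mu mv)] at key
  refine (le_sqrt_const (C := m * (n * m) ^ 2 * C) (y := (n * (nk (chiS hχ) * B) : ℝ≥0) *
    (sobolevNorm σ (u - v) + θ * (sobolevNorm σ u + sobolevNorm σ v))) (key.trans ?_)).trans
      (le_of_eq (by push_cast; ring))
  set x := sobolevNorm σ (u - v)
  set y := sobolevNorm σ u
  set z := sobolevNorm σ v
  have e : x ^ 2 + θ ^ 2 * (y ^ 2 + z ^ 2) ≤ (x + θ * (y + z)) ^ 2 :=
    le_of_le_of_eq (le_self_add (b := 2 * θ ^ 2 * y * z + 2 * x * (θ * (y + z)))) (by ring)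
  calc _ ≤ m * (n * m) ^ 2 * (C * (n * (nk (chiS hχ) * B) : ℝ≥0) ^ 2 * (x + θ * (y + z)) ^ 2) := by gcongr
    _ = _ := by push_cast; ring

lemma exists_eLpNorm_remainder_sub_le (hχ : IsLPCutoff χ) (M : ℝ≥0) : ∃ C : ℝ≥0,
    ∀ u v : Eu n → EuclideanSpace ℝ (Fin m), IsLipschitzL2 u → IsLipschitzL2 v → ctrlA u + ctrlA v ≤ M →
      eLpNorm (remainder χ A u - remainder χ A v) 2 volume
        ≤ C * (ctrlB u + ctrlB v) * eLpNorm (u - v) 2 volume := by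
  obtain ⟨C, hC⟩ := exists_uniform (Finset.univ : Finset (Fin n × Fin m × Fin m)) (P := fun p C =>
      ∀ (L : ℝ≥0) (U V : Fin m → Eu n → ℝ), Fam L M U → Fam L M V →
        isq 0 (su (rterm hχ p.1 p.2.2 (entry A p.1 p.2.1 p.2.2) U)
          - su (rterm hχ p.1 p.2.2 (entry A p.1 p.2.1 p.2.2) V))
        ≤ C * L ^ 2 * ∑ γ, isq 0 (cx (U γ) - cx (V γ)))
    (fun p a b hab h L U V hU hV => (h L U V hU hV).trans (by gcongr)) fun p _ => by
      obtain ⟨C, hC⟩ := exists_isq_zero_rterm_sub hχ (Fin.pos p.1) (contDiff_entry hA p.1 p.2.1 p.2.2) M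
      exact ⟨C, fun L U V => hC L U V p.1 p.2.2⟩
  refine ⟨NNReal.sqrt (m * (n * m) ^ 2 * C) * (n * nk (chiS hχ)), fun u v hu hv hM => ?_⟩
  lift ctrlB u + ctrlB v to ℝ≥0 using by simp [hu.ctrlB_ne_top, hv.ctrlB_ne_top] with B hB
  have hU := hu.fam hχ (le_self_add.trans hM) (hB ▸ le_self_add : ctrlB u ≤ B)
  have hV := hv.fam hχ (le_add_self.trans hM) (hB ▸ le_add_self : ctrlB v ≤ B)
  have mw := memLp_complexify_sub hu.memLp_complexify hv.memLp_complexify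
  have key := sobolevNorm_remainder_sub_le hA hχ hu hv hU hV fun j α β =>
    hC (j, α, β) (Finset.mem_univ _) _ _ _ hU hV
  simp only [← cx_sub_apply, ← sobolevNorm_sq mw] at key
  rw [sobolevNorm_zero_index mw, sobolevNorm_zero_index (memLp_remainder_sub hA hχ hu hv hU hV)] at key
  refine (le_sqrt_const (C := m * (n * m) ^ 2 * C) (y := (n * (nk (chiS hχ) * B) : ℝ≥0) *
    eLpNorm (u - v) 2 volume) (key.trans (le_of_eq ?_))).trans (le_of_eq (by push_cast; ring))
  push_cast
  ring

end VectorBounds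

/-! ### The remainder at zero. -/

section ZeroFunction
variable {n m : ℕ} {χ : Eu n → ℝ}

lemma isLipschitzL2_zero : IsLipschitzL2 (0 : Eu n → EuclideanSpace ℝ (Fin m)) :=
  ⟨⟨0, LipschitzWith.const 0⟩, ⟨0, by simp⟩, MemLp.zero⟩

lemma ctrlA_zero : ctrlA (0 : Eu n → EuclideanSpace ℝ (Fin m)) = 0 := by
  rw [ctrlA, eLpNorm_zero]

lemma ctrlB_zero : ctrlB (0 : Eu n → EuclideanSpace ℝ (Fin m)) = 0 := by
  have h := ctrlB_le (n := n) (LipschitzWith.const (0 : EuclideanSpace ℝ (Fin m)))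
  rwa [ENNReal.coe_zero, nonpos_iff_eq_zero] at h

lemma isq_zero {σ : ℝ} : isq σ (0 : Eu n → ℂ) = 0 := by
  simpa using isq_sum_le (n := n) (σ := σ) (∅ : Finset ℕ) (F := fun _ => 0) (by simp)

lemma sobolevNorm_zero (σ : ℝ) : sobolevNorm σ (0 : Eu n → EuclideanSpace ℝ (Fin m)) = 0 := by
  have h := sobolevNorm_sq (isLipschitzL2_zero (n := n) (m := m)).memLp_complexify σ
  have e : (cx fun _ : Eu n => (0 : ℝ)) = 0 := by
    ext x; simp [cx]
  simpa [e, isq_zero] using h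

lemma pd_zero (j : Fin n) (β : Fin m) : pd (0 : Eu n → EuclideanSpace ℝ (Fin m)) j β = 0 := by
  ext x
  simp [pd]

lemma lowFreq_zero (k : ℤ) : lowFreq χ k 0 = 0 := by
  ext x
  simp [lowFreq]

/-- The coefficients need not vanish at `0`, but each series contains `∂_j u`, as a factor or inside
the matrix `dCoeff`. -/
lemma remainder_zero (A : Fin n → EuclideanSpace ℝ (Fin m) → Matrix (Fin m) (Fin m) ℝ) :
    remainder χ A 0 = 0 := by
  have e (j : Fin n) (α γ : Fin m) : dCoeff A 0 j α γ = 0 := by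
    ext x
    simp [dCoeff, pd_zero]
  have h (f : Eu n → ℝ) (x : Eu n) : highHigh χ f 0 x = 0 := by
    simp [highHigh, highTerm, dyadic, lowFreq_zero]
  have p (f : Eu n → ℝ) (x : Eu n) : para χ 0 f x = 0 := by
    simp [para, paraTerm, lowFreq_zero]
  ext x α
  simp [remainder, pd_zero, e, h, p]

end ZeroFunction

end Paradiff

end


/-! ### Assembly of the four statements. -/

theorem propositionp {n m : ℕ} (χ : EuclideanSpace ℝ (Fin n) → ℝ) (hχ : Paradiff.IsLPCutoff χ)
    (A : Fin n → EuclideanSpace ℝ (Fin m) → Matrix (Fin m) (Fin m) ℝ)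
    (hA : ∀ j α β, ContDiff ℝ ∞ (fun z => A j z α β)) :
    -- the nonlinearity is well defined
    (∀ u : EuclideanSpace ℝ (Fin n) → EuclideanSpace ℝ (Fin m),
      Paradiff.IsLipschitzL2 u → Paradiff.RemainderConverges χ A u) ∧
    -- Sobolev bounds
    (∀ σ : ℝ, 0 ≤ σ → ∀ M : ℝ≥0, ∃ C : ℝ≥0,
      ∀ u : EuclideanSpace ℝ (Fin n) → EuclideanSpace ℝ (Fin m),
        Paradiff.IsLipschitzL2 u → Paradiff.ctrlA u ≤ M →
        Paradiff.sobolevNorm σ (Paradiff.remainder χ A u)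
          ≤ C * Paradiff.ctrlB u * Paradiff.sobolevNorm σ u) ∧
    -- difference bounds in Sobolev spaces
    (∀ σ : ℝ, 0 ≤ σ → ∀ M : ℝ≥0, ∃ C : ℝ≥0,
      ∀ u v : EuclideanSpace ℝ (Fin n) → EuclideanSpace ℝ (Fin m),
        Paradiff.IsLipschitzL2 u → Paradiff.IsLipschitzL2 v →
        Paradiff.ctrlA u + Paradiff.ctrlA v ≤ M →
        Paradiff.sobolevNorm σ (Paradiff.remainder χ A u - Paradiff.remainder χ A v)
          ≤ C * (Paradiff.ctrlB u + Paradiff.ctrlB v) *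
            (Paradiff.sobolevNorm σ (u - v) + eLpNorm (u - v) ∞ volume *
              (Paradiff.sobolevNorm σ u + Paradiff.sobolevNorm σ v))) ∧
    -- difference bound in the space of square integrable functions
    (∀ M : ℝ≥0, ∃ C : ℝ≥0,
      ∀ u v : EuclideanSpace ℝ (Fin n) → EuclideanSpace ℝ (Fin m),
        Paradiff.IsLipschitzL2 u → Paradiff.IsLipschitzL2 v →
        Paradiff.ctrlA u + Paradiff.ctrlA v ≤ M →
        eLpNorm (Paradiff.remainder χ A u - Paradiff.remainder χ A v) 2 volume
          ≤ C * (Paradiff.ctrlB u + Paradiff.ctrlB v) * eLpNorm (u - v) 2 volume) := by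
  refine ⟨fun u hu => hu.remainderConverges hA hχ, fun σ hσ M => ?_,
    fun σ hσ M => Paradiff.exists_sobolevNorm_remainder_sub_le hA hχ hσ M,
    fun M => Paradiff.exists_eLpNorm_remainder_sub_le hA hχ M⟩
  obtain ⟨C, hC⟩ := Paradiff.exists_sobolevNorm_remainder_sub_le hA hχ hσ M
  -- The Sobolev bound is the difference bound with `v = 0`. The bracket becomes the Sobolev norm of
  -- `u` times one plus the supremum of `u`, which is at most `1 + M`.
  refine ⟨C * (1 + M), fun u hu hM => ?_⟩
  have h := hC u 0 hu Paradiff.isLipschitzL2_zero (by rwa [Paradiff.ctrlA_zero, add_zero])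
  rw [Paradiff.remainder_zero, sub_zero, sub_zero, Paradiff.ctrlB_zero, Paradiff.sobolevNorm_zero,
    add_zero, add_zero] at h
  refine h.trans ?_
  calc _ ≤ C * Paradiff.ctrlB u * (Paradiff.sobolevNorm σ u + M * Paradiff.sobolevNorm σ u) := by
        gcongr; exact hM
    _ = _ := by push_cast; ring
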